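/- Let $d \ge 2$ be an integer and, for bounded, compactly supported (measurable) $f : \mathbb R \to \mathbb C$, let $$H_{*,d} f(x) = \sup_{\epsilon > 0} \Bigl| \int_{|y| > \epsilon} f(x-y) \frac{e^{2\pi i y^d}}{y}\, dy \Bigr| .$$ For a bounded interval $I$ and $1 \le r < \infty$ put $\langle f \rangle_{I,r} = \bigl( |I|^{-1} \int_I |f|^r\, dx \bigr)^{1/r}$. Call a collection $\mathcal S$ of bounded nondegenerate half-open intervals $[a,b) \subset \mathbb R$ sparse if there are pairwise disjoint measurable sets $E_I \subset I$, $I \in \mathcal S$, with $|E_I| > \tfrac14 |I|$ for all $I \in \mathcal S$. For an operator $T$ taking values in the $[0,\infty]$-valued functions, let $\| T : (r,s) \|$ be the infimum of the constants $C \ge 0$ such that for all bounded compactly supported $f, g : \mathbb R \to \mathbb C$ the function $Tf$ is finite almost everywhere, $(Tf)\,\bar g$ is integrable, and $$|\langle T f, g \rangle| = \Bigl| \int_{\mathbb R} Tf \; \bar g \, dx \Bigr| \le C \sup_{\mathcal S} \sum_{I \in \mathcal S} |I| \, \langle f \rangle_{I,r} \langle g \rangle_{I,s},$$ the supremum being over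 all sparse collections $\mathcal S$ (and $\|T : (r,s)\| = \infty$ if there is no such $C$). Theorem. There is an absolute constant $C > 0$ such that for all integers $d \ge 2$ and all $1 < r \le 2$, $$ \| H_{*,d} : (1,r) \| \le \frac{C}{r-1} . $$ -/

import Mathlib

open MeasureTheory Set
open scoped ENNReal NNReal ComplexConjugate

/-- A collection of (nondegenerate, bounded, half-open) intervals of the line is sparse if its
members `I` carry pairwise disjoint measurable subsets `E I ⊆ I` with `|E I| > |I| / 4`. -/
def IsSparse (S : Set (Set ℝ)) : Prop :=
  (∀ I ∈ S, ∃ a b : ℝ, a < b ∧ I = Ico a b) ∧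
  ∃ E : Set ℝ → Set ℝ,
    (∀ I ∈ S, MeasurableSet (E I) ∧ E I ⊆ I ∧ volume I / 4 < volume (E I)) ∧
    S.PairwiseDisjoint E

/-- The `r`-average `⟨f⟩_{I,r} = (|I|⁻¹ ∫_I |f|^r)^{1/r}`. -/
noncomputable def avg (f : ℝ → ℂ) (I : Set ℝ) (r : ℝ) : ℝ≥0∞ :=
  ((volume I)⁻¹ * ∫⁻ x in I, ‖f x‖ₑ ^ r) ^ (1 / r)

/-- The `(r,s)`-sparse form `Λ_{S,r,s}(f,g) = ∑_{I ∈ S} |I| ⟨f⟩_{I,r} ⟨g⟩_{I,s}`. -/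
noncomputable def sparseForm (S : Set (Set ℝ)) (r s : ℝ) (f g : ℝ → ℂ) : ℝ≥0∞ :=
  ∑' I : S, volume (I : Set ℝ) * avg f I r * avg g I s

/-- Bounded (measurable) functions of compact support. -/
def BddCompactlySupported (f : ℝ → ℂ) : Prop :=
  MemLp f ∞ volume ∧ HasCompactSupport f

/-- `T`, an operator whose values are functions into `[0,∞]`, satisfies the `(r,s)` sparse bound
with constant `C`: for all bounded compactly supported `f`, `g`, the pairing
`⟨T f, g⟩ = ∫ (T f) conj g` makes sense (`T f` is finite almost everywhere and the integral
converges absolutely), and `|⟨T f, g⟩| ≤ C sup_S Λ_{S,r,s}(f,g)`. -/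
def SparseBoundWith (T : (ℝ → ℂ) → ℝ → ℝ≥0∞) (r s : ℝ) (C : ℝ≥0) : Prop :=
  ∀ f g : ℝ → ℂ, BddCompactlySupported f → BddCompactlySupported g →
    (∀ᵐ x, T f x < ∞) ∧
    Integrable (fun x : ℝ => ((T f x).toReal : ℂ) * conj (g x)) ∧
    ‖∫ x : ℝ, ((T f x).toReal : ℂ) * conj (g x)‖ₑ ≤
      C * ⨆ (S : Set (Set ℝ)) (_ : IsSparse S), sparseForm S r s f g

/-- `‖T : (r,s)‖`, the infimum of the constants in the `(r,s)` sparse bound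
(`∞` if there are none). -/
noncomputable def sparseNorm (T : (ℝ → ℂ) → ℝ → ℝ≥0∞) (r s : ℝ) : ℝ≥0∞ :=
  ⨅ (C : ℝ≥0) (_ : SparseBoundWith T r s C), (C : ℝ≥0∞)

/-- The maximally truncated oscillatory Hilbert transform
`H_{*,d} f (x) = sup_{ε > 0} |∫_{|y| > ε} f (x - y) e^{2 π i y^d} / y dy|`. -/
noncomputable def maxOscHilbert (d : ℕ) (f : ℝ → ℂ) (x : ℝ) : ℝ≥0∞ :=
  ⨆ (ε : ℝ) (_ : 0 < ε),
    ‖∫ y in {y : ℝ | ε < |y|},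
      f (x - y) * (Complex.exp (2 * (Real.pi : ℂ) * Complex.I * (y : ℂ) ^ d) / (y : ℂ))‖ₑ

/-!
The kernel `e ^ (2 π i u ^ d) / u` is split into pieces at dyadic scales. For `|u| ≤ 1` it differs
from `1 / u` by a bounded amount, and the pieces of `1 / u` are treated as those of the Hilbert
transform. For `|u| > 1` it is a sum of oscillating pieces on the two half-lines. A truncation of
the kernel at `ε` differs from a sum of pieces by averages of `|f|` and by the part beyond the
largest scale considered (`enorm_truncInt_le`), so that it suffices to bound maximal partial sums
of the pieces; these are the terms of `truncTerm` and `truncSup`.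

The Hilbert pieces satisfy a maximal weak type `(1,1)` inequality (`mul_volume_iSup_hilOp_le`). It
follows from an `L²` inequality by a Calderón–Zygmund decomposition. Both `L²` maximal inequalities
in the file come from `lintegral_sq_iSup_partialSum_le`, which compares the partial sums of almost
orthogonal functions, each living at its own scale, with averages of the full sum and leaves these
to Doob's inequality.

For the oscillating pieces, `f` is decomposed by its stopping scales: the part of `f` at distance
`s` is the one whose averages are controlled from `s` scales below the scale of the operator on.
The autocorrelation of the kernel decays by van der Corput's test, and the `T*T` method gives an
`L²` bound with a gain `decayRate ^ (2 s)` (`lintegral_sq_iSup_oscOp_le`). The scales at which the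
outputs are averaged depend on `d` in such a way that all constants are independent of `d`. In the
pairing with `g`, the values of `g` below the height `decayRate ^ (-s) ⟨g⟩_r` are left to this
bound, the larger ones to the trivial `L¹` bound. The result is a gain `ρ ^ s` with
`ρ = decayRate ^ ((r - 1) / 2)`, and the sum over `s` is `O(1 / (r - 1))`
(`lintegral_iSup_active_oscOp_le`).

Together this yields a local estimate (`exists_exceptional_set`): on a dyadic interval `I`, and
outside an exceptional set `E` with `|E| ≤ |I| / 16`, the maximal partial sums up to the scale of `I`,
paired with `g`, are at most `(C / (r - 1)) |3 I| ⟨f⟩_{3I,1} ⟨g⟩_{3I,r}`. More precisely, at each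
point only the scales whose dyadic interval is not contained in `E` are considered. Repeating the
argument on the maximal dyadic intervals contained in `E` produces a family of dyadic intervals
with small overlap (`exists_dyFamily_le`). After removal of the smaller members, each member `I`
retains more than `3 |I| / 4 = |3 I| / 4` of its measure, so that the triples form a sparse
collection (`lintegral_truncSup_le_sparse`). Two adjacent dyadic intervals of a large scale cover
the supports of `f` and `g` (`sparseBoundWith_maxOscHilbert`).
-/

/-! ### Dyadic intervals and averages -/

/-- The index of the dyadic interval of length `2 ^ k` containing `x`. -/
noncomputable def dyIdx (k : ℤ) (x : ℝ) : ℤ := ⌊x / (2 : ℝ) ^ k⌋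

/-- The dyadic interval `[i 2^k, (i+1) 2^k)`, as a level set of `dyIdx k`. -/
def dyIv (k i : ℤ) : Set ℝ := {y | dyIdx k y = i}

/-- The concentric triple `[(i-1) 2^k, (i+2) 2^k)` of the dyadic interval `dyIv k i`. -/
def dyTriple (k i : ℤ) : Set ℝ := Ico ((i - 1) * (2 : ℝ) ^ k) ((i + 2) * (2 : ℝ) ^ k)

lemma two_zpow_pos (k : ℤ) : (0 : ℝ) < (2 : ℝ) ^ k := by positivity

lemma two_zpow_mono {j k : ℤ} (h : j ≤ k) : (2 : ℝ) ^ j ≤ (2 : ℝ) ^ k :=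
  zpow_le_zpow_right₀ (by norm_num) h

lemma le_dyIdx_iff {k i : ℤ} {x : ℝ} : i ≤ dyIdx k x ↔ i * (2 : ℝ) ^ k ≤ x := by
  rw [dyIdx, Int.le_floor, le_div_iff₀ (two_zpow_pos k)]

lemma dyIdx_eq_iff {k i : ℤ} {x : ℝ} :
    dyIdx k x = i ↔ i * (2 : ℝ) ^ k ≤ x ∧ x < (i + 1) * (2 : ℝ) ^ k := by
  rw [dyIdx, Int.floor_eq_iff, le_div_iff₀ (two_zpow_pos k), div_lt_iff₀ (two_zpow_pos k)]

lemma dyIdx_bounds (k : ℤ) (x : ℝ) :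
    dyIdx k x * (2 : ℝ) ^ k ≤ x ∧ x < (dyIdx k x + 1) * (2 : ℝ) ^ k :=
  dyIdx_eq_iff.1 rfl

lemma mem_dyIv {k i : ℤ} {x : ℝ} : x ∈ dyIv k i ↔ dyIdx k x = i := Iff.rfl

lemma dyIv_eq_Ico (k i : ℤ) : dyIv k i = Ico (i * (2 : ℝ) ^ k) ((i + 1) * (2 : ℝ) ^ k) := by
  ext x; exact dyIdx_eq_iff

lemma measurable_dyIdx (k : ℤ) : Measurable (dyIdx k) :=
  Int.measurable_floor.comp (measurable_id.div_const _)

lemma measurableSet_dyIv (k i : ℤ) : MeasurableSet (dyIv k i) := by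
  rw [dyIv_eq_Ico]; exact measurableSet_Ico

lemma volume_dyIv (k i : ℤ) : volume (dyIv k i) = ENNReal.ofReal ((2 : ℝ) ^ k) := by
  rw [dyIv_eq_Ico, Real.volume_Ico]; congr 1; ring

lemma volume_dyTriple (k i : ℤ) : volume (dyTriple k i) = ENNReal.ofReal (3 * (2 : ℝ) ^ k) := by
  rw [dyTriple, Real.volume_Ico]; congr 1; ring

lemma dyIdx_eq_of_le {j k : ℤ} (h : j ≤ k) {x y : ℝ} (hxy : dyIdx j x = dyIdx j y) :
    dyIdx k x = dyIdx k y := by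
  have key : ∀ i z, i ≤ dyIdx k z ↔ i * 2 ^ (k - j).toNat ≤ dyIdx j z := by
    intro i z
    rw [le_dyIdx_iff, le_dyIdx_iff]
    have : (2 : ℝ) ^ k = 2 ^ (k - j).toNat * 2 ^ j := by
      rw [← zpow_natCast, ← zpow_add₀ (by norm_num)]; congr 1; omega
    push_cast
    rw [this, mul_assoc]
  apply le_antisymm
  · rw [key, ← hxy, ← key]
  · rw [key, hxy, ← key]

lemma dyIv_subset_of_le {j k : ℤ} (h : j ≤ k) (x : ℝ) :
    dyIv j (dyIdx j x) ⊆ dyIv k (dyIdx k x) := fun _ hy => dyIdx_eq_of_le h hy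

lemma abs_sub_lt_of_dyIdx_eq {k : ℤ} {x y : ℝ} (h : dyIdx k x = dyIdx k y) :
    |x - y| < (2 : ℝ) ^ k := by
  have h1 := dyIdx_bounds k x
  have h2 := dyIdx_bounds k y
  rw [h] at h1
  rw [abs_lt]; constructor <;> nlinarith

lemma dyIdx_near {k : ℤ} {x y : ℝ} (h : |x - y| ≤ (2 : ℝ) ^ k) :
    dyIdx k x - 1 ≤ dyIdx k y ∧ dyIdx k y ≤ dyIdx k x + 1 := by
  have hp := two_zpow_pos k
  have h1 := dyIdx_bounds k x
  have h2 := dyIdx_bounds k y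
  rw [abs_le] at h
  constructor
  · rw [le_dyIdx_iff]; push_cast; nlinarith
  · have : dyIdx k y - 1 ≤ dyIdx k x := by
      rw [le_dyIdx_iff]; push_cast; nlinarith
    omega

lemma mem_dyTriple_iff {k i : ℤ} {y : ℝ} :
    y ∈ dyTriple k i ↔ i - 1 ≤ dyIdx k y ∧ dyIdx k y ≤ i + 1 := by
  have h1 : (i - 1 ≤ dyIdx k y) ↔ (i - 1 : ℝ) * 2 ^ k ≤ y := by
    rw [le_dyIdx_iff]; push_cast; rfl
  have h2 : (dyIdx k y ≤ i + 1) ↔ y < (i + 2 : ℝ) * 2 ^ k := by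
    rw [← Int.lt_add_one_iff, ← not_le, le_dyIdx_iff, not_le]; push_cast; ring_nf
  rw [h1, h2]; rfl

lemma mem_dyTriple_of_abs_le {k : ℤ} {x y : ℝ} (h : |x - y| ≤ (2 : ℝ) ^ k) :
    y ∈ dyTriple k (dyIdx k x) := mem_dyTriple_iff.2 (dyIdx_near h)

lemma abs_le_of_mem_dyTriple {k : ℤ} {x y : ℝ} (h : y ∈ dyTriple k (dyIdx k x)) :
    |x - y| ≤ 2 * (2 : ℝ) ^ k := by
  have h1 := dyIdx_bounds k x
  obtain ⟨h2, h3⟩ := h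
  rw [abs_le]; constructor <;> nlinarith

lemma measurableSet_dyTriple (k i : ℤ) : MeasurableSet (dyTriple k i) := measurableSet_Ico

lemma dyIv_subset_dyTriple (k i : ℤ) : dyIv k i ⊆ dyTriple k i := by
  intro y hy
  rw [mem_dyTriple_iff, mem_dyIv.1 hy]; omega

lemma dyTriple_eq_union (k i : ℤ) :
    dyTriple k i = dyIv k (i - 1) ∪ dyIv k i ∪ dyIv k (i + 1) := by
  ext y
  simp only [mem_dyTriple_iff, mem_union, mem_dyIv]
  omega

lemma dyTriple_subset_of_le {j k : ℤ} (h : j ≤ k) (x : ℝ) :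
    dyTriple j (dyIdx j x) ⊆ dyTriple k (dyIdx k x) := by
  have h2 : ∀ n : ℕ, dyTriple (k - n) (dyIdx (k - n) x) ⊆ dyTriple k (dyIdx k x) := by
    intro n
    induction n with
    | zero => simp
    | succ n ih =>
      refine subset_trans ?_ ih
      intro y hy
      have hp := two_zpow_pos (k - (n + 1 : ℕ))
      have h0 : (2 : ℝ) ^ (k - (n : ℤ)) = 2 * 2 ^ (k - (n + 1 : ℕ)) := by
        rw [show k - (n : ℤ) = 1 + (k - (n + 1 : ℕ)) by push_cast; ring, zpow_add₀ (by norm_num)]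
        simp
      exact mem_dyTriple_of_abs_le ((abs_le_of_mem_dyTriple hy).trans h0.ge)
  have := h2 (k - j).toNat
  rwa [show k - ((k - j).toNat : ℤ) = j by omega] at this

/-- The average of `F` over the dyadic interval of length `2 ^ k` containing `x`. -/
noncomputable def dyAvg (k : ℤ) (F : ℝ → ℝ≥0∞) (x : ℝ) : ℝ≥0∞ :=
  (ENNReal.ofReal ((2 : ℝ) ^ k))⁻¹ * ∫⁻ y in dyIv k (dyIdx k x), F y

lemma ofReal_two_zpow_ne_zero (k : ℤ) : ENNReal.ofReal ((2 : ℝ) ^ k) ≠ 0 := by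
  simp [two_zpow_pos k]

lemma dyAvg_congr {k : ℤ} {F : ℝ → ℝ≥0∞} {x y : ℝ} (h : dyIdx k x = dyIdx k y) :
    dyAvg k F x = dyAvg k F y := by simp [dyAvg, h]

lemma measurable_of_dyIdx {α : Type*} [MeasurableSpace α] {k : ℤ} {F : ℝ → α}
    (h : ∀ x y, dyIdx k x = dyIdx k y → F x = F y) : Measurable F := by
  have : F = (fun i : ℤ => F (i * (2 : ℝ) ^ k)) ∘ dyIdx k := by
    funext x
    refine h _ _ ?_
    symm
    rw [dyIdx_eq_iff]
    have := two_zpow_pos k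
    constructor <;> nlinarith
  rw [this]
  exact (measurable_from_top).comp (measurable_dyIdx k)

lemma measurable_dyAvg (k : ℤ) (F : ℝ → ℝ≥0∞) : Measurable (dyAvg k F) :=
  measurable_of_dyIdx (k := k) fun _ _ h => dyAvg_congr h

lemma setLIntegral_dyIv_eq (k : ℤ) (F : ℝ → ℝ≥0∞) (x : ℝ) :
    ∫⁻ y in dyIv k (dyIdx k x), F y = ENNReal.ofReal ((2 : ℝ) ^ k) * dyAvg k F x := by
  rw [dyAvg, ← mul_assoc, ENNReal.mul_inv_cancel (ofReal_two_zpow_ne_zero k) ENNReal.ofReal_ne_top,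
    one_mul]

lemma dyAvg_mono {k : ℤ} {F G : ℝ → ℝ≥0∞} (h : F ≤ G) : dyAvg k F ≤ dyAvg k G :=
  fun _ => mul_le_mul_right (lintegral_mono h) _

lemma dyAvg_eq_lintegral (k : ℤ) (F : ℝ → ℝ≥0∞) (x : ℝ) :
    dyAvg k F x =
      ∫⁻ y, (if dyIdx k x = dyIdx k y then (ENNReal.ofReal ((2 : ℝ) ^ k))⁻¹ else 0) * F y := by
  rw [dyAvg, ← lintegral_const_mul' _ _ (by simp [two_zpow_pos k]),
    ← lintegral_indicator (measurableSet_dyIv _ _)]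
  congr 1; funext y
  by_cases h : dyIdx k x = dyIdx k y
  · rw [indicator_of_mem (show y ∈ dyIv k (dyIdx k x) from h.symm), if_pos h]
  · rw [indicator_of_notMem (show y ∉ dyIv k (dyIdx k x) from fun h' => h h'.symm), if_neg h,
        zero_mul]

lemma measurableSet_dyIdx_eq (k : ℤ) : MeasurableSet {p : ℝ × ℝ | dyIdx k p.1 = dyIdx k p.2} :=
  measurableSet_eq_fun ((measurable_dyIdx k).comp measurable_fst)
    ((measurable_dyIdx k).comp measurable_snd)

/-- Dyadic averaging is self-adjoint. -/
lemma lintegral_dyAvg_mul (k : ℤ) {F G : ℝ → ℝ≥0∞} (hF : Measurable F) (hG : Measurable G) :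
    ∫⁻ x, dyAvg k F x * G x = ∫⁻ x, F x * dyAvg k G x := by
  have hm : Measurable fun p : ℝ × ℝ =>
      (if dyIdx k p.1 = dyIdx k p.2 then (ENNReal.ofReal ((2 : ℝ) ^ k))⁻¹ else 0) :=
    Measurable.ite (measurableSet_dyIdx_eq k) measurable_const measurable_const
  have e1 : ∀ x, dyAvg k F x * G x = ∫⁻ y,
      (if dyIdx k x = dyIdx k y then (ENNReal.ofReal ((2 : ℝ) ^ k))⁻¹ else 0) * F y * G x := by
    intro x
    rw [dyAvg_eq_lintegral, lintegral_mul_const]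
    exact (hm.comp measurable_prodMk_left).mul hF
  have e2 : ∀ y, F y * dyAvg k G y = ∫⁻ x,
      (if dyIdx k x = dyIdx k y then (ENNReal.ofReal ((2 : ℝ) ^ k))⁻¹ else 0) * F y * G x := by
    intro y
    rw [dyAvg_eq_lintegral, ← lintegral_const_mul]
    · congr 1; funext x
      simp only [eq_comm (a := dyIdx k y)]; ring
    · exact (hm.comp measurable_prodMk_left).mul hG
  simp_rw [e1, e2]
  rw [lintegral_lintegral_swap]
  exact ((hm.mul (hF.comp measurable_snd)).mul (hG.comp measurable_fst)).aemeasurable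

lemma dyAvg_of_const {k : ℤ} {G : ℝ → ℝ≥0∞} (h : ∀ x y, dyIdx k x = dyIdx k y → G x = G y)
    (x : ℝ) : dyAvg k G x = G x := by
  have : ∫⁻ y in dyIv k (dyIdx k x), G y = ∫⁻ y in dyIv k (dyIdx k x), G x :=
    setLIntegral_congr_fun (measurableSet_dyIv _ _) fun y hy => h _ _ hy
  rw [dyAvg, this, setLIntegral_const, volume_dyIv, mul_comm, mul_assoc,
    ENNReal.mul_inv_cancel (ofReal_two_zpow_ne_zero k) ENNReal.ofReal_ne_top, mul_one]

lemma lintegral_dyAvg_mul_of_const {k : ℤ} {F G : ℝ → ℝ≥0∞} (hF : Measurable F)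
    (h : ∀ x y, dyIdx k x = dyIdx k y → G x = G y) :
    ∫⁻ x, dyAvg k F x * G x = ∫⁻ x, F x * G x := by
  rw [lintegral_dyAvg_mul k hF (measurable_of_dyIdx h)]
  simp_rw [dyAvg_of_const h]

lemma lintegral_dyAvg (k : ℤ) {F : ℝ → ℝ≥0∞} (hF : Measurable F) :
    ∫⁻ x, dyAvg k F x = ∫⁻ x, F x := by
  simpa using lintegral_dyAvg_mul_of_const (G := fun _ => 1) (k := k) hF (fun _ _ _ => rfl)

/-- Cauchy–Schwarz for the Lebesgue integral. -/
lemma sq_lintegral_mul_le {α : Type*} [MeasurableSpace α] (μ : Measure α) {F G : α → ℝ≥0∞}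
    (hF : AEMeasurable F μ) (hG : AEMeasurable G μ) :
    (∫⁻ x, F x * G x ∂μ) ^ 2 ≤ (∫⁻ x, F x ^ 2 ∂μ) * ∫⁻ x, G x ^ 2 ∂μ := by
  have h := ENNReal.lintegral_mul_le_Lp_mul_Lq μ Real.HolderConjugate.two_two hF hG
  have e : ∀ H : α → ℝ≥0∞, ∫⁻ x, H x ^ (2 : ℝ) ∂μ = ∫⁻ x, H x ^ 2 ∂μ := fun H => by
    simp only [ENNReal.rpow_two]
  rw [e, e] at h
  have e2 : ∀ a : ℝ≥0∞, (a ^ (1 / 2 : ℝ)) ^ 2 = a := fun a => by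
    rw [← ENNReal.rpow_natCast, ← ENNReal.rpow_mul]; norm_num
  calc _ ≤ _ := pow_le_pow_left' h 2
    _ = _ := by rw [mul_pow, e2, e2]

lemma sq_dyAvg_le (k : ℤ) {F : ℝ → ℝ≥0∞} (hF : Measurable F) (x : ℝ) :
    dyAvg k F x ^ 2 ≤ dyAvg k (fun y => F y ^ 2) x := by
  have h := sq_lintegral_mul_le (volume.restrict (dyIv k (dyIdx k x))) hF.aemeasurable
    (aemeasurable_const (b := 1))
  simp only [mul_one, one_pow, lintegral_one, Measure.restrict_apply_univ, volume_dyIv] at h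
  rw [dyAvg, dyAvg, mul_pow]
  calc _ ≤ (ENNReal.ofReal ((2 : ℝ) ^ k))⁻¹ ^ 2 * _ := mul_le_mul_right h _
    _ = (ENNReal.ofReal ((2 : ℝ) ^ k))⁻¹ * (∫⁻ y in dyIv k (dyIdx k x), F y ^ 2)
        * (ENNReal.ofReal ((2 : ℝ) ^ k) * (ENNReal.ofReal ((2 : ℝ) ^ k))⁻¹) := by ring
    _ = _ := by
      rw [ENNReal.mul_inv_cancel (ofReal_two_zpow_ne_zero k) ENNReal.ofReal_ne_top, mul_one]

lemma lintegral_sq_dyAvg_le (k : ℤ) {F : ℝ → ℝ≥0∞} (hF : Measurable F) :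
    ∫⁻ x, dyAvg k F x ^ 2 ≤ ∫⁻ x, F x ^ 2 :=
  (lintegral_mono fun x => sq_dyAvg_le k hF x).trans (lintegral_dyAvg k (hF.pow_const 2)).le

lemma ennreal_max_sq_ineq (a m : ℝ≥0∞) :
    max m a ^ 2 + 2 * (a * m) ≤ m ^ 2 + 2 * (a * max m a) := by
  rcases le_total a m with h | h
  · rw [max_eq_left h]
  · rw [max_eq_right h]
    obtain ⟨c, rfl⟩ := exists_add_of_le h
    calc (m + c) ^ 2 + 2 * ((m + c) * m) = m ^ 2 + 2 * m ^ 2 + 4 * (m * c) + c ^ 2 := by ring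
      _ ≤ m ^ 2 + 2 * m ^ 2 + 4 * (m * c) + (c ^ 2 + c ^ 2) := by gcongr; exact le_self_add
      _ = _ := by ring

lemma le_four_mul_of_le_mul_sqrt {A B : ℝ≥0∞} (hA : A ≠ ∞) {I : ℝ≥0∞} (h : A ≤ 2 * I)
    (h2 : I ^ 2 ≤ B * A) : A ≤ 4 * B := by
  rcases eq_or_ne A 0 with rfl | h0
  · simp
  have : A * A ≤ (4 * B) * A := by
    calc A * A ≤ (2 * I) * (2 * I) := mul_le_mul' h h
      _ = 4 * I ^ 2 := by ring
      _ ≤ 4 * (B * A) := by gcongr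
      _ = _ := by ring
  rwa [ENNReal.mul_le_mul_iff_left h0 hA] at this

/-- Doob's `L²` maximal inequality for dyadic averages along decreasing scales. -/
lemma lintegral_sq_iSup_dyAvg_le {n : ℕ → ℤ} (hn : Antitone n) {F : ℝ → ℝ≥0∞} (hF : Measurable F)
    (N : ℕ) : ∫⁻ x, (⨆ j ∈ Finset.range (N + 1), dyAvg (n j) F x) ^ 2 ≤ 4 * ∫⁻ x, F x ^ 2 := by
  rcases eq_or_ne (∫⁻ x, F x ^ 2) ∞ with h | hfin
  · rw [h]; simp
  set M : ℕ → ℝ → ℝ≥0∞ := fun N x => ⨆ j ∈ Finset.range (N + 1), dyAvg (n j) F x with hM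
  have hMsucc : ∀ N x, M (N + 1) x = max (M N x) (dyAvg (n (N + 1)) F x) := by
    intro N x
    simp only [hM]
    rw [Finset.range_add_one, Finset.iSup_insert, max_comm]
  have hMzero : ∀ x, M 0 x = dyAvg (n 0) F x := by intro x; simp [hM]
  -- The running maximum is constant on the intervals of the current, smallest scale, so that
  -- `lintegral_dyAvg_mul_of_const` applies to it.
  have hMc : ∀ N, ∀ x y, dyIdx (n N) x = dyIdx (n N) y → M N x = M N y := by
    intro N x y h
    simp only [hM]
    refine iSup_congr fun j => iSup_congr fun hj => dyAvg_congr (dyIdx_eq_of_le (hn ?_) h)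
    have := Finset.mem_range.1 hj; omega
  have hMm : ∀ N, Measurable (M N) := fun N => measurable_of_dyIdx (hMc N)
  have hMfin : ∀ N, ∫⁻ x, M N x ^ 2 ≠ ∞ := by
    intro N
    induction N with
    | zero =>
      simp_rw [hMzero]
      exact ((lintegral_sq_dyAvg_le _ hF).trans_lt (lt_top_iff_ne_top.2 hfin)).ne
    | succ N ih =>
      refine ne_top_of_le_ne_top (b := ∫⁻ x, (M N x ^ 2 + dyAvg (n (N + 1)) F x ^ 2)) ?_ ?_
      · rw [lintegral_add_left ((hMm N).pow_const 2)]
        exact ENNReal.add_ne_top.2 ⟨ih, ne_top_of_le_ne_top hfin (lintegral_sq_dyAvg_le _ hF)⟩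
      · refine lintegral_mono fun x => ?_
        rw [hMsucc]
        rcases le_total (M N x) (dyAvg (n (N + 1)) F x) with h | h
        · rw [max_eq_right h]; exact le_add_self
        · rw [max_eq_left h]; exact le_self_add
  have hCS : ∀ N, (∫⁻ x, F x * M N x) ^ 2 ≤ (∫⁻ x, F x ^ 2) * ∫⁻ x, M N x ^ 2 := fun N =>
    sq_lintegral_mul_le _ hF.aemeasurable (hMm N).aemeasurable
  have hFM : ∀ N, ∫⁻ x, F x * M N x ≠ ∞ := by
    intro N h
    have := hCS N
    rw [h] at this
    simp only [ne_eq, OfNat.ofNat_ne_zero, not_false_eq_true, ENNReal.top_pow, top_le_iff] at this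
    exact ENNReal.mul_ne_top hfin (hMfin N) this
  -- By induction on the number of scales, without subtraction: with `a` the new average and `m` the
  -- old maximum, `max m a ^ 2 + 2 a m ≤ m ^ 2 + 2 a max m a`, and `a` may be replaced by `F`
  -- against both maxima.
  have main : ∀ N, ∫⁻ x, M N x ^ 2 ≤ 2 * ∫⁻ x, F x * M N x := by
    intro N
    induction N with
    | zero =>
      have : ∫⁻ x, M 0 x ^ 2 = ∫⁻ x, F x * M 0 x := by
        rw [← lintegral_dyAvg_mul_of_const hF (hMc 0)]
        congr 1; funext x; rw [hMzero]; ring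
      rw [this, two_mul]; exact le_self_add
    | succ N ih =>
      have h1 : ∫⁻ x, (M (N + 1) x ^ 2 + 2 * (dyAvg (n (N + 1)) F x * M N x)) ≤
          ∫⁻ x, (M N x ^ 2 + 2 * (dyAvg (n (N + 1)) F x * M (N + 1) x)) := by
        refine lintegral_mono fun x => ?_
        rw [hMsucc]; exact ennreal_max_sq_ineq _ _
      have m1 : ∀ L, ∫⁻ x, 2 * (dyAvg (n (N + 1)) F x * M L x) =
          2 * ∫⁻ x, dyAvg (n (N + 1)) F x * M L x := fun L =>
        lintegral_const_mul _ ((measurable_dyAvg _ F).mul (hMm L))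
      rw [lintegral_add_left ((hMm _).pow_const 2), lintegral_add_left ((hMm _).pow_const 2),
        m1, m1,
        lintegral_dyAvg_mul_of_const hF (hMc (N + 1)),
        lintegral_dyAvg_mul_of_const hF fun x y h =>
            hMc N x y (dyIdx_eq_of_le (hn N.le_succ) h)] at h1
      have h2 := h1.trans (add_le_add_left ih _)
      rw [add_comm] at h2
      exact (ENNReal.add_le_add_iff_left (ENNReal.mul_ne_top (by simp) (hFM N))).1 h2
  exact le_four_mul_of_le_mul_sqrt (hMfin N) (main N) (hCS N)

/-- A set is covered by three translates of a union of dyadic intervals if all its points are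
within one interval length of that union. -/
lemma volume_near_le (m : ℤ) {S : Set ℝ} (hS : ∀ x y, dyIdx m x = dyIdx m y → x ∈ S → y ∈ S) :
    volume {x : ℝ | ∃ y ∈ S, |x - y| ≤ (2 : ℝ) ^ m} ≤ 3 * volume S := by
  have hsub : {x : ℝ | ∃ y ∈ S, |x - y| ≤ (2 : ℝ) ^ m} ⊆
      S ∪ (fun x => x + (2 : ℝ) ^ m) ⁻¹' S ∪ (fun x => x + -(2 : ℝ) ^ m) ⁻¹' S := by
    rintro x ⟨y, hy, hxy⟩
    obtain ⟨h1, h2⟩ := dyIdx_near hxy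
    have hb := dyIdx_bounds m x
    have hc : dyIdx m y = dyIdx m x ∨ dyIdx m y = dyIdx m x + 1 ∨ dyIdx m y = dyIdx m x - 1 := by
      omega
    rcases hc with h | h | h
    · exact Or.inl (Or.inl (hS _ _ h hy))
    · refine Or.inl (Or.inr (hS y _ ?_ hy))
      rw [h]; symm; rw [dyIdx_eq_iff]; push_cast; constructor <;> nlinarith
    · refine Or.inr (hS y _ ?_ hy)
      rw [h]; symm; rw [dyIdx_eq_iff]; push_cast; constructor <;> nlinarith
  refine (measure_mono hsub).trans ((measure_union_le _ _).trans ?_)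
  refine (add_le_add_left (measure_union_le _ _) _).trans ?_
  rw [measure_preimage_add_right, measure_preimage_add_right]
  apply le_of_eq; ring

/-! ### Integral operators with local kernels -/

/-- Bounded measurable functions with bounded support. Unlike for `BddCompactlySupported`, all
requirements are pointwise rather than almost everywhere. -/
structure TestFun (f : ℝ → ℂ) : Prop where
  meas : Measurable f
  bdd : ∃ C : ℝ, ∀ x, ‖f x‖ ≤ C
  supp : ∃ R : ℝ, ∀ x, R < |x| → f x = 0

/-- Bounded measurable kernels that vanish away from the diagonal. -/
structure LocalKernel (κ : ℝ → ℝ → ℂ) : Prop where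
  meas : Measurable fun p : ℝ × ℝ => κ p.1 p.2
  bdd : ∃ C : ℝ, ∀ x y, ‖κ x y‖ ≤ C
  near : ∃ R : ℝ, ∀ x y, R < |x - y| → κ x y = 0

/-- The integral operator with kernel `κ`. -/
noncomputable def kOp (κ : ℝ → ℝ → ℂ) (f : ℝ → ℂ) (x : ℝ) : ℂ := ∫ y, κ x y * f y

/-- The kernel of the composition of two integral operators. -/
noncomputable def kComp (κ₁ κ₂ : ℝ → ℝ → ℂ) (x y : ℝ) : ℂ := ∫ z, κ₁ x z * κ₂ z y

/-- The squared `L²` norm. -/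
noncomputable def l2sq (f : ℝ → ℂ) : ℝ≥0∞ := ∫⁻ x, ‖f x‖ₑ ^ 2

namespace TestFun

variable {f g : ℝ → ℂ}

lemma integrable (hf : TestFun f) : Integrable f := by
  obtain ⟨C, hC⟩ := hf.bdd
  obtain ⟨R, hR⟩ := hf.supp
  have : IntegrableOn f (Icc (-R) R) :=
    Measure.integrableOn_of_bounded (M := C) (by simp) hf.meas.aestronglyMeasurable
      (Filter.Eventually.of_forall hC)
  refine (integrableOn_iff_integrable_of_support_subset ?_).1 this
  intro x hx
  by_contra h
  exact hx (hR x (by rw [mem_Icc, ← abs_le, not_le] at h; exact h))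

lemma zero : TestFun fun _ => 0 :=
  ⟨measurable_const, ⟨0, by simp⟩, ⟨0, by simp⟩⟩

lemma add (hf : TestFun f) (hg : TestFun g) : TestFun fun x => f x + g x := by
  obtain ⟨C, hC⟩ := hf.bdd
  obtain ⟨R, hR⟩ := hf.supp
  obtain ⟨C', hC'⟩ := hg.bdd
  obtain ⟨R', hR'⟩ := hg.supp
  refine ⟨hf.meas.add hg.meas, ⟨C + C', fun x => (norm_add_le _ _).trans (add_le_add (hC x) (hC' x))⟩,
    ⟨max R R', fun x hx => ?_⟩⟩
  rw [hR x ((le_max_left _ _).trans_lt hx), hR' x ((le_max_right _ _).trans_lt hx), add_zero]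

lemma mul_bdd (hf : TestFun f) (hg : Measurable g) {C' : ℝ} (hC' : ∀ x, ‖g x‖ ≤ C') :
    TestFun fun x => g x * f x := by
  obtain ⟨C, hC⟩ := hf.bdd
  obtain ⟨R, hR⟩ := hf.supp
  refine ⟨hg.mul hf.meas, ⟨C' * C, fun x => ?_⟩, ⟨R, fun x hx => by rw [hR x hx, mul_zero]⟩⟩
  rw [norm_mul]
  exact mul_le_mul (hC' x) (hC x) (norm_nonneg _) ((norm_nonneg _).trans (hC' x))

lemma mul (hf : TestFun f) (hg : TestFun g) : TestFun fun x => g x * f x :=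
  hf.mul_bdd hg.meas hg.bdd.choose_spec

lemma conjugate (hf : TestFun f) : TestFun fun x => conj (f x) := by
  obtain ⟨C, hC⟩ := hf.bdd
  obtain ⟨R, hR⟩ := hf.supp
  refine ⟨Complex.continuous_conj.measurable.comp hf.meas, ⟨C, fun x => by simpa using hC x⟩,
    ⟨R, fun x hx => by simp [hR x hx]⟩⟩

lemma neg (hf : TestFun f) : TestFun fun x => -f x := by
  simpa using hf.mul_bdd (g := fun _ => -1) measurable_const (C' := 1) (by simp)

lemma sub (hf : TestFun f) (hg : TestFun g) : TestFun fun x => f x - g x := by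
  simpa [sub_eq_add_neg] using hf.add hg.neg

lemma sum {ι : Type*} {s : Finset ι} {φ : ι → ℝ → ℂ} (h : ∀ i ∈ s, TestFun (φ i)) :
    TestFun fun x => ∑ i ∈ s, φ i x := by
  classical
  induction s using Finset.induction_on with
  | empty => simpa using zero
  | insert a s ha ih =>
    simp_rw [Finset.sum_insert ha]
    exact (h a (Finset.mem_insert_self _ _)).add (ih fun i hi => h i (Finset.mem_insert_of_mem hi))

lemma indicator (hf : TestFun f) {s : Set ℝ} (hs : MeasurableSet s) : TestFun (s.indicator f) := by
  obtain ⟨C, hC⟩ := hf.bdd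
  obtain ⟨R, hR⟩ := hf.supp
  refine ⟨hf.meas.indicator hs, ⟨C, fun x => (norm_indicator_le_norm_self f x).trans (hC x)⟩,
    ⟨R, fun x hx => ?_⟩⟩
  by_cases h : x ∈ s <;> simp [h, hR x hx]

lemma enorm_meas (hf : TestFun f) : Measurable fun x => ‖f x‖ₑ := hf.meas.enorm

lemma lintegral_lt_top (hf : TestFun f) : ∫⁻ x, ‖f x‖ₑ < ∞ := hf.integrable.2

lemma l2sq_lt_top (hf : TestFun f) : l2sq f < ∞ := by
  have := (hf.mul hf).lintegral_lt_top
  simpa [l2sq, enorm_mul, sq] using this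

end TestFun

lemma integrable_prod_of_bdd {F : ℝ × ℝ → ℂ} (hF : Measurable F) {C a b c d : ℝ}
    (hC : ∀ p, ‖F p‖ ≤ C) (h : ∀ p, p ∉ Icc a b ×ˢ Icc c d → F p = 0) : Integrable F := by
  have : IntegrableOn F (Icc a b ×ˢ Icc c d) := by
    refine Measure.integrableOn_of_bounded (M := C) ?_ hF.aestronglyMeasurable
      (Filter.Eventually.of_forall hC)
    rw [Measure.volume_eq_prod, Measure.prod_prod]
    exact ENNReal.mul_ne_top (by simp) (by simp)
  refine (integrableOn_iff_integrable_of_support_subset ?_).1 this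
  intro p hp
  by_contra h'
  exact hp (h p h')

lemma mem_Icc_of_abs_sub {x y R : ℝ} (h : ¬ R < |x - y|) : y ∈ Icc (x - R) (x + R) := by
  rw [not_lt, abs_le] at h
  constructor <;> linarith

namespace LocalKernel

variable {κ κ₁ κ₂ : ℝ → ℝ → ℂ} {f g : ℝ → ℂ}

lemma right (h : LocalKernel κ) (x : ℝ) : TestFun fun y => κ x y := by
  obtain ⟨C, hC⟩ := h.bdd
  obtain ⟨R, hR⟩ := h.near
  refine ⟨h.meas.comp measurable_prodMk_left, ⟨C, hC x⟩, ⟨|x| + R, fun y hy => hR x y ?_⟩⟩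
  have := abs_sub_abs_le_abs_sub y x
  rw [abs_sub_comm] at this; linarith

lemma swap (h : LocalKernel κ) : LocalKernel fun x y => κ y x := by
  obtain ⟨C, hC⟩ := h.bdd
  obtain ⟨R, hR⟩ := h.near
  exact ⟨h.meas.comp measurable_swap, ⟨C, fun x y => hC y x⟩,
    ⟨R, fun x y hxy => hR y x (by rwa [abs_sub_comm])⟩⟩

lemma left (h : LocalKernel κ) (y : ℝ) : TestFun fun x => κ x y := h.swap.right y

lemma neg (h : LocalKernel κ) : LocalKernel fun x y => -κ x y := by
  obtain ⟨C, hC⟩ := h.bdd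
  obtain ⟨R, hR⟩ := h.near
  exact ⟨h.meas.neg, ⟨C, fun x y => by simpa using hC x y⟩,
      ⟨R, fun x y hxy => by simp [hR x y hxy]⟩⟩

lemma add (h₁ : LocalKernel κ₁) (h₂ : LocalKernel κ₂) : LocalKernel fun x y => κ₁ x y + κ₂ x y := by
  obtain ⟨C, hC⟩ := h₁.bdd
  obtain ⟨R, hR⟩ := h₁.near
  obtain ⟨C', hC'⟩ := h₂.bdd
  obtain ⟨R', hR'⟩ := h₂.near
  refine ⟨h₁.meas.add h₂.meas, ⟨C + C', fun x y => (norm_add_le _ _).trans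
    (add_le_add (hC x y) (hC' x y))⟩, ⟨max R R', fun x y hx => ?_⟩⟩
  rw [hR x y ((le_max_left _ _).trans_lt hx), hR' x y ((le_max_right _ _).trans_lt hx), add_zero]

lemma sub (h₁ : LocalKernel κ₁) (h₂ : LocalKernel κ₂) : LocalKernel fun x y => κ₁ x y - κ₂ x y := by
  simpa [sub_eq_add_neg] using h₁.add h₂.neg

lemma integrable_mul (h : LocalKernel κ) (hf : TestFun f) (x : ℝ) :
    Integrable fun y => κ x y * f y := (hf.mul (h.right x)).integrable

lemma norm_kOp_le {C R D : ℝ} (hR : ∀ x y, R < |x - y| → κ x y = 0) (hR0 : 0 ≤ R)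
    (hC : ∀ x y, ‖κ x y‖ ≤ C) (hD : ∀ x, ‖f x‖ ≤ D) (x : ℝ) :
    ‖kOp κ f x‖ ≤ C * D * (2 * R) := by
  have h0 : 0 ≤ C := (norm_nonneg _).trans (hC 0 0)
  have : kOp κ f x = ∫ y in Icc (x - R) (x + R), κ x y * f y := by
    refine (setIntegral_eq_integral_of_forall_compl_eq_zero fun y hy => ?_).symm
    by_cases h : R < |x - y|
    · rw [hR x y h, zero_mul]
    · exact absurd (mem_Icc_of_abs_sub h) hy
  rw [this]
  refine (norm_setIntegral_le_of_norm_le_const (C := C * D) (by simp) fun y _ => ?_).trans ?_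
  · rw [norm_mul]
    exact mul_le_mul (hC x y) (hD y) (norm_nonneg _) h0
  · rw [measureReal_def, Real.volume_Icc, ENNReal.toReal_ofReal (by linarith)]
    apply le_of_eq; ring

lemma nearBound (h : LocalKernel κ) : ∃ R : ℝ, 0 ≤ R ∧ ∀ x y, R < |x - y| → κ x y = 0 := by
  obtain ⟨R, hR⟩ := h.near
  exact ⟨max R 0, le_max_right _ _, fun x y hxy => hR x y ((le_max_left _ _).trans_lt hxy)⟩

lemma kOp_testFun (h : LocalKernel κ) (hf : TestFun f) : TestFun (kOp κ f) := by
  obtain ⟨C, hC⟩ := h.bdd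
  obtain ⟨R, hR0, hR⟩ := h.nearBound
  obtain ⟨D, hD⟩ := hf.bdd
  obtain ⟨S, hS⟩ := hf.supp
  refine ⟨?_, ⟨_, norm_kOp_le hR hR0 hC hD⟩, ⟨R + S, fun x hx => ?_⟩⟩
  · exact (StronglyMeasurable.integral_prod_right'
      (f := fun p : ℝ × ℝ => κ p.1 p.2 * f p.2) (ν := volume)
      (h.meas.mul (hf.meas.comp measurable_snd)).stronglyMeasurable).measurable
  · rw [kOp, ← integral_zero ℝ ℂ (μ := volume)]
    congr 1; funext y
    by_cases hy : S < |y|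
    · rw [hS y hy, mul_zero]
    · rw [hR x y, zero_mul]
      have := abs_sub_abs_le_abs_sub x y
      linarith

lemma comp (h₁ : LocalKernel κ₁) (h₂ : LocalKernel κ₂) : LocalKernel (kComp κ₁ κ₂) := by
  obtain ⟨C, hC⟩ := h₁.bdd
  obtain ⟨R, hR0, hR⟩ := h₁.nearBound
  obtain ⟨D, hD⟩ := h₂.bdd
  obtain ⟨S, hS0, hS⟩ := h₂.nearBound
  refine ⟨?_, ⟨_, fun x y => norm_kOp_le (f := fun z => κ₂ z y) hR hR0 hC (fun z => hD z y) x⟩,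
    ⟨R + S, fun x y hxy => ?_⟩⟩
  · exact (StronglyMeasurable.integral_prod_right'
      (f := fun p : (ℝ × ℝ) × ℝ => κ₁ p.1.1 p.2 * κ₂ p.2 p.1.2) (ν := volume)
      ((h₁.meas.comp ((measurable_fst.comp measurable_fst).prodMk measurable_snd)).mul
        (h₂.meas.comp (measurable_snd.prodMk
          (measurable_snd.comp measurable_fst)))).stronglyMeasurable).measurable
  · rw [kComp, ← integral_zero ℝ ℂ (μ := volume)]
    congr 1; funext z
    by_cases hz : R < |x - z|
    · rw [hR x z hz, zero_mul]
    · rw [hS z y, mul_zero]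
      have := abs_sub_le x z y
      linarith

lemma kOp_kOp (h₁ : LocalKernel κ₁) (h₂ : LocalKernel κ₂) (hf : TestFun f) (x : ℝ) :
    kOp κ₁ (kOp κ₂ f) x = kOp (kComp κ₁ κ₂) f x := by
  obtain ⟨C, hC⟩ := h₁.bdd
  obtain ⟨R, hR0, hR⟩ := h₁.nearBound
  obtain ⟨D, hD⟩ := h₂.bdd
  obtain ⟨B, hB⟩ := hf.bdd
  obtain ⟨S, hS⟩ := hf.supp
  have e1 : ∀ z, κ₁ x z * kOp κ₂ f z = ∫ y, κ₁ x z * κ₂ z y * f y := by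
    intro z
    rw [kOp, ← integral_const_mul]
    simp_rw [mul_assoc]
  have e2 : ∀ y, kComp κ₁ κ₂ x y * f y = ∫ z, κ₁ x z * κ₂ z y * f y := by
    intro y
    rw [kComp, ← integral_mul_const]
  rw [kOp, kOp]
  simp_rw [e1, e2]
  refine integral_integral_swap (f := fun z y => κ₁ x z * κ₂ z y * f y) ?_
  have h0 : 0 ≤ C := (norm_nonneg _).trans (hC 0 0)
  have h0' : 0 ≤ D := (norm_nonneg _).trans (hD 0 0)
  refine integrable_prod_of_bdd (C := C * D * B) (a := x - R) (b := x + R) (c := -S) (d := S)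
    ?_ ?_ ?_
  · exact (((h₁.right x).meas.comp measurable_fst).mul h₂.meas).mul (hf.meas.comp measurable_snd)
  · rintro ⟨z, y⟩
    simp only [Function.uncurry, norm_mul]
    exact mul_le_mul (mul_le_mul (hC x z) (hD z y) (norm_nonneg _) h0) (hB y) (norm_nonneg _)
      (by positivity)
  · rintro ⟨z, y⟩ hp
    by_cases hz : R < |x - z|
    · simp [hR x z hz]
    · by_cases hy : S < |y|
      · simp [hS y hy]
      · refine absurd ⟨mem_Icc_of_abs_sub hz, ?_⟩ hp
        rw [not_lt] at hy
        exact abs_le.1 hy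

/-- The transposed kernel gives the transposed operator. -/
lemma integral_kOp_mul (h : LocalKernel κ) (hf : TestFun f) (hg : TestFun g) :
    ∫ x, kOp κ f x * g x = ∫ x, f x * kOp (fun x y => κ y x) g x := by
  obtain ⟨D, hD⟩ := h.bdd
  obtain ⟨B, hB⟩ := hf.bdd
  obtain ⟨S, hS⟩ := hf.supp
  obtain ⟨B', hB'⟩ := hg.bdd
  obtain ⟨S', hS'⟩ := hg.supp
  have e1 : ∀ x, kOp κ f x * g x = ∫ y, κ x y * f y * g x := by
    intro x; rw [kOp, ← integral_mul_const]
  have e2 : ∀ y, f y * kOp (fun x y => κ y x) g y = ∫ x, κ x y * f y * g x := by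
    intro y
    rw [kOp, ← integral_const_mul]
    congr 1; funext x; ring
  simp_rw [e1, e2]
  refine integral_integral_swap (f := fun x y => κ x y * f y * g x) ?_
  have h0' : 0 ≤ D := (norm_nonneg _).trans (hD 0 0)
  have h0 : 0 ≤ B := (norm_nonneg _).trans (hB 0)
  refine integrable_prod_of_bdd (C := D * B * B') (a := -S') (b := S') (c := -S) (d := S)
    ?_ ?_ ?_
  · exact (h.meas.mul (hf.meas.comp measurable_snd)).mul (hg.meas.comp measurable_fst)
  · rintro ⟨z, y⟩
    simp only [Function.uncurry, norm_mul]
    exact mul_le_mul (mul_le_mul (hD z y) (hB y) (norm_nonneg _) h0') (hB' z) (norm_nonneg _)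
      (by positivity)
  · rintro ⟨x, y⟩ hp
    by_cases hx : S' < |x|
    · simp [hS' x hx]
    · by_cases hy : S < |y|
      · simp [hS y hy]
      · rw [not_lt] at hx hy
        exact absurd ⟨abs_le.1 hx, abs_le.1 hy⟩ hp

lemma kOp_sub_kernel (h₁ : LocalKernel κ₁) (h₂ : LocalKernel κ₂) (hf : TestFun f) (x : ℝ) :
    kOp κ₁ f x - kOp κ₂ f x = kOp (fun x y => κ₁ x y - κ₂ x y) f x := by
  simp only [kOp, sub_mul]
  rw [integral_sub (h₁.integrable_mul hf x) (h₂.integrable_mul hf x)]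

lemma kOp_sub (h : LocalKernel κ) (hf : TestFun f) (hg : TestFun g) (x : ℝ) :
    kOp κ (fun y => f y - g y) x = kOp κ f x - kOp κ g x := by
  simp only [kOp, mul_sub]
  rw [integral_sub (h.integrable_mul hf x) (h.integrable_mul hg x)]

lemma kOp_sum {ι : Type*} {s : Finset ι} {φ : ι → ℝ → ℂ} (h : LocalKernel κ)
    (hφ : ∀ i ∈ s, TestFun (φ i)) (x : ℝ) :
    kOp κ (fun y => ∑ i ∈ s, φ i y) x = ∑ i ∈ s, kOp κ (φ i) x := by
  simp only [kOp, Finset.mul_sum]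
  rw [integral_finsetSum _ fun i hi => h.integrable_mul (hφ i hi) x]

end LocalKernel

lemma enorm_kOp_le (κ : ℝ → ℝ → ℂ) (f : ℝ → ℂ) (x : ℝ) :
    ‖kOp κ f x‖ₑ ≤ ∫⁻ y, ‖κ x y‖ₑ * ‖f y‖ₑ := by
  refine (enorm_integral_le_lintegral_enorm _).trans (le_of_eq ?_)
  simp_rw [enorm_mul]

section Schur

variable {κ : ℝ → ℝ → ℂ} {f : ℝ → ℂ}

lemma lintegral_lintegral_kernel_le (h : LocalKernel κ) {F : ℝ → ℝ≥0∞} (hF : Measurable F)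
    {B : ℝ≥0∞} (hB : ∀ y, ∫⁻ x, ‖κ x y‖ₑ ≤ B) :
    ∫⁻ x, ∫⁻ y, ‖κ x y‖ₑ * F y ≤ B * ∫⁻ y, F y := by
  rw [lintegral_lintegral_swap (h.meas.enorm.mul (hF.comp measurable_snd)).aemeasurable]
  rw [← lintegral_const_mul _ hF]
  refine lintegral_mono fun y => ?_
  rw [lintegral_mul_const _ (h.left y).enorm_meas]
  exact mul_le_mul_left (hB y) _

lemma lintegral_kOp_le (h : LocalKernel κ) (hf : TestFun f)
    {B : ℝ≥0∞} (hB : ∀ y, ∫⁻ x, ‖κ x y‖ₑ ≤ B) :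
    ∫⁻ x, ‖kOp κ f x‖ₑ ≤ B * ∫⁻ y, ‖f y‖ₑ :=
  (lintegral_mono fun x => enorm_kOp_le κ f x).trans
    (lintegral_lintegral_kernel_le h hf.enorm_meas hB)

/-- Schur's test. -/
lemma l2sq_kOp_le (h : LocalKernel κ) (hf : TestFun f) {A B : ℝ≥0∞}
    (hA : ∀ x, ∫⁻ y, ‖κ x y‖ₑ ≤ A) (hB : ∀ y, ∫⁻ x, ‖κ x y‖ₑ ≤ B) :
    l2sq (kOp κ f) ≤ A * B * l2sq f := by
  have h1 : ∀ x, ‖kOp κ f x‖ₑ ^ 2 ≤ A * ∫⁻ y, ‖κ x y‖ₑ * ‖f y‖ₑ ^ 2 := by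
    intro x
    have e : ∀ y, ‖κ x y‖ₑ * ‖f y‖ₑ = ‖κ x y‖ₑ ^ (1 / 2 : ℝ) * (‖κ x y‖ₑ ^ (1 / 2 : ℝ) * ‖f y‖ₑ) := by
      intro y
      rw [← mul_assoc, ← ENNReal.rpow_add_of_nonneg _ _ (by norm_num) (by norm_num)]; norm_num
    have e2 : ∀ a : ℝ≥0∞, (a ^ (1 / 2 : ℝ)) ^ 2 = a := fun a => by
      rw [← ENNReal.rpow_natCast, ← ENNReal.rpow_mul]; norm_num
    have hm := (h.right x).enorm_meas
    have := sq_lintegral_mul_le volume (F := fun y => ‖κ x y‖ₑ ^ (1 / 2 : ℝ))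
      (G := fun y => ‖κ x y‖ₑ ^ (1 / 2 : ℝ) * ‖f y‖ₑ) (hm.pow_const _).aemeasurable
      ((hm.pow_const _).mul hf.enorm_meas).aemeasurable
    simp_rw [← e, mul_pow, e2] at this
    exact (pow_le_pow_left' (enorm_kOp_le κ f x) 2).trans (this.trans (mul_le_mul_left (hA x) _))
  calc l2sq (kOp κ f) ≤ ∫⁻ x, A * ∫⁻ y, ‖κ x y‖ₑ * ‖f y‖ₑ ^ 2 := lintegral_mono h1
    _ = A * ∫⁻ x, ∫⁻ y, ‖κ x y‖ₑ * ‖f y‖ₑ ^ 2 := by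
      refine lintegral_const_mul _ ?_
      exact (h.meas.enorm.mul ((hf.enorm_meas.pow_const 2).comp measurable_snd)).lintegral_prod_right'
    _ ≤ A * (B * l2sq f) :=
      mul_le_mul_right (lintegral_lintegral_kernel_le h (hf.enorm_meas.pow_const 2) hB) _
    _ = _ := by ring

/-- A variant of Schur's test in which one factor of `f` is absorbed into an `L^∞` bound. -/
lemma l2sq_kOp_le_of_bound (h : LocalKernel κ) (hf : TestFun f) {A B : ℝ≥0∞}
    (hA : ∀ x, ∫⁻ y, ‖κ x y‖ₑ * ‖f y‖ₑ ≤ A) (hB : ∀ y, ∫⁻ x, ‖κ x y‖ₑ ≤ B) :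
    l2sq (kOp κ f) ≤ A * B * ∫⁻ y, ‖f y‖ₑ := by
  calc l2sq (kOp κ f) ≤ ∫⁻ x, A * ‖kOp κ f x‖ₑ := by
        refine lintegral_mono fun x => ?_
        rw [sq]
        exact mul_le_mul_left ((enorm_kOp_le κ f x).trans (hA x)) _
    _ = A * ∫⁻ x, ‖kOp κ f x‖ₑ := lintegral_const_mul _ (h.kOp_testFun hf).enorm_meas
    _ ≤ A * (B * ∫⁻ y, ‖f y‖ₑ) := mul_le_mul_right (lintegral_kOp_le h hf hB) _
    _ = _ := by ring

end Schur

/-- The kernel of dyadic averaging at scale `2 ^ n`. -/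
noncomputable def dyKer (n : ℤ) (x y : ℝ) : ℂ :=
  if dyIdx n x = dyIdx n y then (((2 : ℝ) ^ n)⁻¹ : ℝ) else 0

/-- The conditional expectation onto functions constant on dyadic intervals of length `2 ^ n`. -/
noncomputable def dyExp (n : ℤ) (f : ℝ → ℂ) : ℝ → ℂ := kOp (dyKer n) f

lemma localKernel_dyKer (n : ℤ) : LocalKernel (dyKer n) := by
  refine ⟨Measurable.ite (measurableSet_dyIdx_eq n) measurable_const measurable_const,
    ⟨((2 : ℝ) ^ n)⁻¹, fun x y => ?_⟩, ⟨(2 : ℝ) ^ n, fun x y h => ?_⟩⟩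
  · unfold dyKer
    have := two_zpow_pos n
    split_ifs
    · rw [Complex.norm_real, Real.norm_of_nonneg (by positivity)]
    · simp only [norm_zero]; positivity
  · unfold dyKer
    rw [if_neg]
    intro h'
    exact absurd (abs_sub_lt_of_dyIdx_eq h') (not_lt.2 h.le)

lemma dyKer_symm (n : ℤ) (x y : ℝ) : dyKer n x y = dyKer n y x := by
  simp only [dyKer, eq_comm]

lemma enorm_dyKer (n : ℤ) (x y : ℝ) :
    ‖dyKer n x y‖ₑ = if dyIdx n x = dyIdx n y then (ENNReal.ofReal ((2 : ℝ) ^ n))⁻¹ else 0 := by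
  unfold dyKer
  split_ifs
  · have := two_zpow_pos n
    rw [← ENNReal.ofReal_inv_of_pos this, ← ofReal_norm, Complex.norm_real,
      Real.norm_of_nonneg (by positivity)]
  · simp

lemma TestFun.dyExp {f : ℝ → ℂ} (hf : TestFun f) (n : ℤ) : TestFun (dyExp n f) :=
  (localKernel_dyKer n).kOp_testFun hf

lemma enorm_dyExp_le (n : ℤ) (f : ℝ → ℂ) (x : ℝ) :
    ‖dyExp n f x‖ₑ ≤ dyAvg n (fun y => ‖f y‖ₑ) x := by
  refine (enorm_kOp_le _ _ _).trans (le_of_eq ?_)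
  rw [dyAvg_eq_lintegral]
  simp_rw [enorm_dyKer]

lemma dyExp_congr {n : ℤ} {f : ℝ → ℂ} {x y : ℝ} (h : dyIdx n x = dyIdx n y) :
    dyExp n f x = dyExp n f y := by
  simp only [dyExp, kOp, dyKer, h]

lemma dyExp_of_const {n : ℤ} {f : ℝ → ℂ} {x : ℝ} (h : ∀ y, dyIdx n x = dyIdx n y → f y = f x) :
    dyExp n f x = f x := by
  have e : ∀ y, dyKer n x y * f y = (dyIv n (dyIdx n x)).indicator
      (fun _ => (((2 : ℝ) ^ n)⁻¹ : ℝ) * f x) y := by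
    intro y
    unfold dyKer
    by_cases hxy : dyIdx n x = dyIdx n y
    · rw [indicator_of_mem (show y ∈ dyIv n (dyIdx n x) from hxy.symm), if_pos hxy, h y hxy]
    · rw [indicator_of_notMem (show y ∉ dyIv n (dyIdx n x) from fun h' => hxy h'.symm), if_neg hxy,
        zero_mul]
  have hp := two_zpow_pos n
  rw [dyExp, kOp]
  simp_rw [e]
  rw [integral_indicator (measurableSet_dyIv _ _), setIntegral_const, measureReal_def, volume_dyIv,
    ENNReal.toReal_ofReal hp.le, Complex.real_smul, ← mul_assoc, ← Complex.ofReal_mul,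
    mul_inv_cancel₀ hp.ne', Complex.ofReal_one, one_mul]

lemma integral_dyExp_mul (n : ℤ) {f g : ℝ → ℂ} (hf : TestFun f) (hg : TestFun g) :
    ∫ x, dyExp n f x * g x = ∫ x, f x * dyExp n g x := by
  have := (localKernel_dyKer n).integral_kOp_mul hf hg
  simp only [dyKer_symm n] at this
  rw [dyExp, this, dyExp]

lemma dyExp_dyExp_of_le {m n : ℤ} (h : m ≤ n) {f : ℝ → ℂ} (hf : TestFun f) (x : ℝ) :
    dyExp n (dyExp m f) x = dyExp n f x := by
  have h1 : dyExp n (dyExp m f) x = ∫ y, dyExp m f y * dyKer n x y := by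
    rw [dyExp, kOp]; simp_rw [mul_comm]
  rw [h1, integral_dyExp_mul m hf ((localKernel_dyKer n).right x)]
  have h2 : ∀ y, dyExp m (fun y => dyKer n x y) y = dyKer n x y := by
    intro y
    refine dyExp_of_const fun z hz => ?_
    simp only [dyKer, dyIdx_eq_of_le h hz]
  simp_rw [h2]
  rw [dyExp, kOp]
  simp_rw [mul_comm]

lemma dyExp_dyExp_of_ge {m n : ℤ} (h : n ≤ m) (f : ℝ → ℂ) (x : ℝ) :
    dyExp n (dyExp m f) x = dyExp m f x :=
  dyExp_of_const fun _ hy => (dyExp_congr (dyIdx_eq_of_le h hy)).symm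

lemma l2sq_dyExp_le (n : ℤ) {f : ℝ → ℂ} (hf : TestFun f) : l2sq (dyExp n f) ≤ l2sq f :=
  (lintegral_mono fun x => pow_le_pow_left' (enorm_dyExp_le n f x) 2).trans
    (lintegral_sq_dyAvg_le n hf.enorm_meas)

lemma dyExp_conj (n : ℤ) (f : ℝ → ℂ) (x : ℝ) :
    dyExp n (fun y => conj (f y)) x = conj (dyExp n f x) := by
  rw [dyExp, kOp, dyExp, kOp, ← integral_conj]
  congr 1; funext y
  rw [map_mul]
  congr 1
  unfold dyKer
  split_ifs
  · exact (Complex.conj_ofReal _).symm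
  · simp

/-! ### A maximal inequality for partial sums -/

lemma enorm_sq_integral_conj_mul_le {f g : ℝ → ℂ} (hf : TestFun f) (hg : TestFun g) :
    ‖∫ x, conj (f x) * g x‖ₑ ^ 2 ≤ l2sq f * l2sq g := by
  have h := sq_lintegral_mul_le volume hf.enorm_meas.aemeasurable hg.enorm_meas.aemeasurable
  refine (pow_le_pow_left' (enorm_integral_le_lintegral_enorm _) 2).trans ?_
  simpa [enorm_mul, l2sq, ← ofReal_norm] using h

lemma ennreal_two_mul_le_of_sq_le {x t a b : ℝ≥0∞} (h : x ^ 2 ≤ t ^ 2 * (a * b)) :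
    2 * x ≤ t * (a + b) := by
  by_contra! hlt
  have h1 : (t * (a + b)) ^ 2 < (2 * x) ^ 2 := by
    exact ENNReal.pow_lt_pow_left (by norm_num) hlt
  have h2 : 4 * (a * b) ≤ (a + b) ^ 2 := by
    rcases le_total a b with hab | hab
    · obtain ⟨c, rfl⟩ := exists_add_of_le hab
      calc 4 * (a * (a + c)) ≤ 4 * (a * (a + c)) + c ^ 2 := le_self_add
        _ = _ := by ring
    · obtain ⟨c, rfl⟩ := exists_add_of_le hab
      calc 4 * ((b + c) * b) ≤ 4 * ((b + c) * b) + c ^ 2 := le_self_add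
        _ = _ := by ring
  have h3 : (2 * x) ^ 2 ≤ (t * (a + b)) ^ 2 := by
    calc (2 * x) ^ 2 = 4 * x ^ 2 := by ring
      _ ≤ 4 * (t ^ 2 * (a * b)) := by gcongr
      _ = t ^ 2 * (4 * (a * b)) := by ring
      _ ≤ t ^ 2 * (a + b) ^ 2 := by gcongr
      _ = _ := by ring
  exact absurd h1 (not_lt.2 h3)

lemma ennreal_sq_sum_mul_le {ι : Type*} (s : Finset ι) (f g : ι → ℝ≥0∞) :
    (∑ i ∈ s, f i * g i) ^ 2 ≤ (∑ i ∈ s, f i ^ 2) * ∑ i ∈ s, g i ^ 2 := by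
  have h := ENNReal.inner_le_Lp_mul_Lq s f g Real.HolderConjugate.two_two
  simp only [ENNReal.rpow_two] at h
  have e2 : ∀ a : ℝ≥0∞, (a ^ (1 / 2 : ℝ)) ^ 2 = a := fun a => by
    rw [← ENNReal.rpow_natCast, ← ENNReal.rpow_mul]; norm_num
  calc _ ≤ _ := pow_le_pow_left' h 2
    _ = _ := by rw [mul_pow, e2, e2]

lemma sum_range_dist_le (g : ℕ → ℝ≥0∞) (i N : ℕ) :
    ∑ j ∈ Finset.range N, g ((i - j) + (j - i)) ≤ 2 * ∑' n, g n := by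
  have key : ∀ (s : Finset ℕ) (u : ℕ → ℕ), (∀ x ∈ s, ∀ y ∈ s, u x = u y → x = y) →
      ∑ j ∈ s, g (u j) ≤ ∑' n, g n := by
    intro s u hu
    rw [← Finset.sum_image (f := g) hu]
    exact ENNReal.sum_le_tsum _
  rw [← Finset.sum_filter_add_sum_filter_not (Finset.range N) (fun j => j ≤ i), two_mul]
  refine add_le_add (key _ _ ?_) (key _ _ ?_)
  · intro x hx y hy h
    simp only [Finset.mem_filter] at hx hy
    omega
  · intro x hx y hy h
    simp only [Finset.mem_filter] at hx hy
    omega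

lemma l2sq_eq_enorm_integral {f : ℝ → ℂ} (hf : TestFun f) :
    l2sq f = ‖∫ x, conj (f x) * f x‖ₑ := by
  have h1 : ∀ x, conj (f x) * f x = ((‖f x‖ ^ 2 : ℝ) : ℂ) := by
    intro x
    rw [mul_comm, Complex.mul_conj, Complex.normSq_eq_norm_sq]
  have h2 : Integrable fun x => ‖f x‖ ^ 2 := by
    have := (hf.conjugate.mul hf).integrable.norm
    simpa [sq] using this
  simp_rw [h1]
  rw [integral_complex_ofReal, ← ofReal_norm, Complex.norm_real, Real.norm_of_nonneg
    (integral_nonneg fun x => by positivity), ofReal_integral_eq_lintegral_ofReal h2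
    (Filter.Eventually.of_forall fun x => by positivity)]
  refine lintegral_congr fun x => ?_
  rw [ENNReal.ofReal_pow (norm_nonneg _), ofReal_norm]

/-- Almost orthogonality: inner products that are summable off the diagonal give an `L²` bound for
the sum. -/
lemma l2sq_sum_le {φ : ℕ → ℝ → ℂ} (hφ : ∀ i, TestFun (φ i)) {N : ℕ} {a g : ℕ → ℝ≥0∞}
    (h : ∀ i < N, ∀ j < N, ‖∫ x, conj (φ i x) * φ j x‖ₑ ≤ g ((i - j) + (j - i)) * (a i + a j)) :
    l2sq (fun x => ∑ i ∈ Finset.range N, φ i x) ≤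
      4 * (∑' n, g n) * ∑ i ∈ Finset.range N, a i := by
  rw [l2sq_eq_enorm_integral (TestFun.sum fun i _ => hφ i)]
  have e : ∫ x, conj (∑ i ∈ Finset.range N, φ i x) * ∑ i ∈ Finset.range N, φ i x =
      ∑ i ∈ Finset.range N, ∑ j ∈ Finset.range N, ∫ x, conj (φ i x) * φ j x := by
    simp_rw [map_sum, Finset.sum_mul_sum]
    rw [integral_finsetSum]
    · refine Finset.sum_congr rfl fun i _ => ?_
      rw [integral_finsetSum]
      intro j _
      exact ((hφ j).mul (hφ i).conjugate).integrable
    · intro i _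
      exact (TestFun.sum fun j _ => (hφ j).mul (hφ i).conjugate).integrable
  rw [e]
  have hs : ∀ i ∈ Finset.range N, ∑ j ∈ Finset.range N, g ((i - j) + (j - i)) * a i ≤
      2 * (∑' n, g n) * a i := by
    intro i _
    rw [← Finset.sum_mul]
    exact mul_le_mul_left (sum_range_dist_le g i N) _
  calc _ ≤ ∑ i ∈ Finset.range N, ∑ j ∈ Finset.range N, ‖∫ x, conj (φ i x) * φ j x‖ₑ :=
        (enorm_sum_le _ _).trans (Finset.sum_le_sum fun i _ => enorm_sum_le _ _)
    _ ≤ ∑ i ∈ Finset.range N, ∑ j ∈ Finset.range N,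
        (g ((i - j) + (j - i)) * a i + g ((i - j) + (j - i)) * a j) := by
        refine Finset.sum_le_sum fun i hi => Finset.sum_le_sum fun j hj => ?_
        rw [← mul_add]
        exact h i (Finset.mem_range.1 hi) j (Finset.mem_range.1 hj)
    _ = ∑ i ∈ Finset.range N, ∑ j ∈ Finset.range N, g ((i - j) + (j - i)) * a i +
        ∑ i ∈ Finset.range N, ∑ j ∈ Finset.range N, g ((i - j) + (j - i)) * a i := by
        simp_rw [Finset.sum_add_distrib]
        congr 1
        rw [Finset.sum_comm]
        simp_rw [add_comm]
    _ ≤ ∑ i ∈ Finset.range N, 2 * (∑' n, g n) * a i + ∑ i ∈ Finset.range N, 2 * (∑' n, g n) * a i :=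
        add_le_add (Finset.sum_le_sum hs) (Finset.sum_le_sum hs)
    _ = _ := by
        rw [← Finset.mul_sum]; ring

/-- The constant in `lintegral_sq_iSup_partialSum_le`. -/
noncomputable def partialSumConst (q : ℝ≥0∞) : ℝ≥0∞ := 32 * (1 + (1 - q)⁻¹) + 8 * (1 - q)⁻¹ ^ 2

lemma partialSumConst_ne_top {q : ℝ≥0∞} (hq : q < 1) : partialSumConst q ≠ ∞ := by
  have : (1 - q)⁻¹ ≠ ∞ := by
    rw [ENNReal.inv_ne_top]
    exact (tsub_pos_of_lt hq).ne'
  unfold partialSumConst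
  finiteness

lemma tsum_pow_two_mul_le (q : ℝ≥0∞) (hq : q < 1) : ∑' n : ℕ, q ^ (2 * n) ≤ (1 - q)⁻¹ := by
  rw [← ENNReal.tsum_geometric]
  exact ENNReal.tsum_le_tsum fun n => pow_le_pow_right_of_le_one' hq.le (by omega)

/-- A maximal inequality for partial sums of functions `φ i` that are localized at decreasing
scales `2 ^ n i`: if averaging at scale `2 ^ n j` nearly annihilates `φ i` for `i > j` and nearly
preserves it for `i < j`, then the maximal partial sum is controlled in `L²` by the square
function. The partial sums up to `j` are compared with the average of the full sum at scale
`2 ^ n j`, to which Doob's inequality applies. -/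
theorem lintegral_sq_iSup_partialSum_le {q : ℝ≥0∞} (hq0 : q ≠ 0) (hq : q < 1) {n : ℕ → ℤ}
    (hn : Antitone n) {φ : ℕ → ℝ → ℂ} (hφ : ∀ i, TestFun (φ i)) {N : ℕ} {a : ℕ → ℝ≥0∞}
    (h0 : ∀ i < N, l2sq (φ i) ≤ a i)
    (h1 : ∀ i < N, ∀ j < i, l2sq (dyExp (n j) (φ i)) ≤ q ^ (4 * (i - j)) * a i)
    (h2 : ∀ j < N, ∀ i ≤ j, l2sq (fun x => φ i x - dyExp (n j) (φ i) x) ≤ q ^ (4 * (j - i)) * a i) :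
    ∫⁻ x, (⨆ j ∈ Finset.range N, ‖∑ i ∈ Finset.range (j + 1), φ i x‖ₑ) ^ 2 ≤
      partialSumConst q * ∑ i ∈ Finset.range N, a i := by
  rcases N with _ | M
  · simp
  set N := M + 1 with hN
  set Φ : ℝ → ℂ := fun x => ∑ i ∈ Finset.range N, φ i x with hΦ
  have hΦt : TestFun Φ := TestFun.sum fun i _ => hφ i
  -- The contribution of `φ i` to the difference between the partial sum up to `j` and the average
  -- of the full sum at scale `2 ^ n j`.
  set X : ℕ → ℕ → ℝ → ℂ := fun j i x =>
    if i ≤ j then φ i x - dyExp (n j) (φ i) x else -dyExp (n j) (φ i) x with hX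
  have hXt : ∀ j i, TestFun (X j i) := by
    intro j i
    by_cases hij : i ≤ j
    · simpa only [hX, if_pos hij] using (hφ i).sub ((hφ i).dyExp _)
    · simpa only [hX, if_neg hij] using ((hφ i).dyExp (n j)).neg
  have hXb : ∀ j < N, ∀ i < N, l2sq (X j i) ≤ q ^ (4 * ((j - i) + (i - j))) * a i := by
    intro j hj i hi
    by_cases hij : i ≤ j
    · have : j - i + (i - j) = j - i := by omega
      simpa only [hX, if_pos hij, this] using h2 j hj i hij
    · have : j - i + (i - j) = i - j := by omega
      simp only [hX, if_neg hij, this]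
      simpa [l2sq] using h1 i hi j (by omega)
  have hqt : ∀ m : ℕ, q ^ m ≠ ∞ := fun m => ENNReal.pow_ne_top (hq.trans ENNReal.one_lt_top).ne
  have hqz : ∀ m : ℕ, q ^ m ≠ 0 := fun m => pow_ne_zero m hq0
  -- The full sum is almost orthogonal: for `i < j`, averaging at the middle scale `m` nearly
  -- preserves `φ i` and nearly annihilates `φ j`.
  have hfull : l2sq Φ ≤ 4 * (1 + (1 - q)⁻¹) * ∑ i ∈ Finset.range N, a i := by
    have hg : ∑' m : ℕ, q ^ (m - 1) = 1 + (1 - q)⁻¹ := by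
      rw [tsum_eq_zero_add' ENNReal.summable]
      simp [ENNReal.tsum_geometric]
    rw [← hg]
    refine l2sq_sum_le hφ ?_
    have hlt : ∀ i j, i < j → j < N →
        ‖∫ x, conj (φ i x) * φ j x‖ₑ ≤ q ^ (j - i - 1) * (a i + a j) := by
      intro i j hij hj
      set m := (i + j) / 2 with hm
      have e : ∫ x, conj (φ i x) * φ j x =
          (∫ x, conj (φ i x - dyExp (n m) (φ i) x) * φ j x) +
          ∫ x, conj (φ i x) * dyExp (n m) (φ j) x := by
        rw [← integral_dyExp_mul (n m) (hφ i).conjugate (hφ j), ← integral_add]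
        · congr 1; funext x
          rw [dyExp_conj, map_sub]; ring
        · exact ((hφ j).mul ((hφ i).sub ((hφ i).dyExp _)).conjugate).integrable
        · exact ((hφ j).mul ((hφ i).conjugate.dyExp _)).integrable
      have b1 : 2 * ‖∫ x, conj (φ i x - dyExp (n m) (φ i) x) * φ j x‖ₑ ≤
          q ^ (j - i - 1) * (a i + a j) := by
        refine ennreal_two_mul_le_of_sq_le ((enorm_sq_integral_conj_mul_le
          ((hφ i).sub ((hφ i).dyExp _)) (hφ j)).trans ?_)
        rw [← mul_assoc, ← pow_mul]
        refine mul_le_mul' ((h2 m (by omega) i (by omega)).trans ?_) (h0 j hj)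
        exact mul_le_mul_left (pow_le_pow_right_of_le_one' hq.le (by omega)) _
      have b2 : 2 * ‖∫ x, conj (φ i x) * dyExp (n m) (φ j) x‖ₑ ≤
          q ^ (j - i - 1) * (a i + a j) := by
        refine ennreal_two_mul_le_of_sq_le ((enorm_sq_integral_conj_mul_le
          (hφ i) ((hφ j).dyExp _)).trans ?_)
        rw [← mul_assoc, ← pow_mul, mul_comm (q ^ _) (a i), mul_assoc]
        refine mul_le_mul' (h0 i (by omega)) ((h1 j hj m (by omega)).trans ?_)
        exact mul_le_mul_left (pow_le_pow_right_of_le_one' hq.le (by omega)) _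
      have : 2 * ‖∫ x, conj (φ i x) * φ j x‖ₑ ≤ 2 * (q ^ (j - i - 1) * (a i + a j)) := by
        rw [e, two_mul (q ^ (j - i - 1) * (a i + a j))]
        refine (mul_le_mul_right (enorm_add_le _ _) 2).trans ?_
        rw [mul_add]
        exact add_le_add b1 b2
      exact (ENNReal.mul_le_mul_iff_right (by simp) (by simp)).1 this
    intro i hi j hj
    rcases lt_trichotomy i j with h | rfl | h
    · have : i - j + (j - i) - 1 = j - i - 1 := by omega
      rw [this]; exact hlt i j h hj
    · simp only [tsub_self, add_zero, zero_tsub, pow_zero, one_mul]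
      rw [← l2sq_eq_enorm_integral (hφ i)]
      exact (h0 i hi).trans le_self_add
    · have h3 : i - j + (j - i) - 1 = i - j - 1 := by omega
      have h4 : ∫ x, conj (φ i x) * φ j x = conj (∫ x, conj (φ j x) * φ i x) := by
        rw [← integral_conj]
        congr 1; funext x
        rw [map_mul, Complex.conj_conj, mul_comm]
      have h5 : ∀ z : ℂ, ‖conj z‖ₑ = ‖z‖ₑ := fun z => by simp [← ofReal_norm]
      rw [h3, h4, h5, add_comm (a i)]
      exact hlt j i h hi
  -- The partial sum up to `j` is the average of the full sum at scale `2 ^ n j` plus errors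
  -- `X j i`, which decay geometrically in `|i - j|`.
  have hpt : ∀ j ∈ Finset.range N, ∀ x,
      ∑ i ∈ Finset.range (j + 1), φ i x = dyExp (n j) Φ x + ∑ i ∈ Finset.range N, X j i x := by
    intro j hj x
    have hj' := Finset.mem_range.1 hj
    have e1 : dyExp (n j) Φ x = ∑ i ∈ Finset.range N, dyExp (n j) (φ i) x :=
      (localKernel_dyKer _).kOp_sum (fun i _ => hφ i) x
    rw [e1, ← Finset.sum_add_distrib]
    have e2 : ∀ i ∈ Finset.range N, dyExp (n j) (φ i) x + X j i x =
        if i ∈ Finset.range (j + 1) then φ i x else 0 := by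
      intro i _
      simp only [hX, Finset.mem_range, Nat.lt_succ_iff]
      split_ifs <;> ring
    rw [Finset.sum_congr rfl e2, ← Finset.sum_filter]
    congr 1
    ext i
    simp only [Finset.mem_filter, Finset.mem_range]
    omega
  have hdev : ∀ j ∈ Finset.range N, l2sq (fun x => ∑ i ∈ Finset.range N, X j i x) ≤
      2 * (1 - q)⁻¹ * ∑ i ∈ Finset.range N, q ^ (2 * ((j - i) + (i - j))) * a i := by
    intro j hj
    set d : ℕ → ℕ := fun i => (j - i) + (i - j) with hd
    -- Cauchy–Schwarz with weights `q ^ d i`; the squares lose `q ^ (2 d i)` of the available decay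
    -- `q ^ (4 d i)`.
    have p1 : ∀ x, ‖∑ i ∈ Finset.range N, X j i x‖ₑ ^ 2 ≤
        2 * (1 - q)⁻¹ * ∑ i ∈ Finset.range N, (q ^ (2 * d i))⁻¹ * ‖X j i x‖ₑ ^ 2 := by
      intro x
      have e1 : ∑ i ∈ Finset.range N, ‖X j i x‖ₑ =
          ∑ i ∈ Finset.range N, q ^ (d i) * ((q ^ (d i))⁻¹ * ‖X j i x‖ₑ) := by
        refine Finset.sum_congr rfl fun i _ => ?_
        rw [← mul_assoc, ENNReal.mul_inv_cancel (hqz _) (hqt _), one_mul]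
      refine (pow_le_pow_left' (enorm_sum_le _ _) 2).trans ?_
      rw [e1]
      refine (ennreal_sq_sum_mul_le _ _ _).trans (mul_le_mul' ?_ (le_of_eq ?_))
      · simp_rw [← pow_mul, mul_comm _ 2]
        refine (sum_range_dist_le (fun m => q ^ (2 * m)) j N).trans ?_
        exact mul_le_mul_right (tsum_pow_two_mul_le q hq) _
      · refine Finset.sum_congr rfl fun i _ => ?_
        rw [mul_pow, ← ENNReal.inv_pow, ← pow_mul, mul_comm (d i) 2]
    have hm : ∀ i ∈ Finset.range N, Measurable fun x => (q ^ (2 * d i))⁻¹ * ‖X j i x‖ₑ ^ 2 :=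
      fun i _ => ((hXt j i).enorm_meas.pow_const 2).const_mul _
    refine (lintegral_mono p1).trans ?_
    rw [lintegral_const_mul _ (Finset.measurable_fun_sum _ hm), lintegral_finsetSum _ hm]
    refine mul_le_mul_right (Finset.sum_le_sum fun i hi => ?_) _
    rw [lintegral_const_mul _ ((hXt j i).enorm_meas.pow_const 2)]
    refine (mul_le_mul_right (hXb j (Finset.mem_range.1 hj) i (Finset.mem_range.1 hi)) _).trans ?_
    rw [← mul_assoc, show 4 * (j - i + (i - j)) = 2 * d i + 2 * d i by simp only [hd]; ring,
        pow_add,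
      ← mul_assoc, ENNReal.inv_mul_cancel (hqz _) (hqt _), one_mul]
  -- The averages of the full sum are left to Doob's inequality; the supremum of the errors is
  -- replaced by their square function.
  have hsup : ∀ x, (⨆ j ∈ Finset.range N, ‖∑ i ∈ Finset.range (j + 1), φ i x‖ₑ) ^ 2 ≤
      2 * (⨆ j ∈ Finset.range N, dyAvg (n j) (fun y => ‖Φ y‖ₑ) x) ^ 2 +
      2 * ∑ j ∈ Finset.range N, ‖∑ i ∈ Finset.range N, X j i x‖ₑ ^ 2 := by
    intro x
    set A := ⨆ j ∈ Finset.range N, dyAvg (n j) (fun y => ‖Φ y‖ₑ) x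
    obtain ⟨j, hj, hje⟩ := Finset.exists_mem_eq_sup (Finset.range N) ⟨0, by simp [hN]⟩
      (fun j => ‖∑ i ∈ Finset.range (j + 1), φ i x‖ₑ)
    rw [Finset.sup_eq_iSup] at hje
    rw [hje, hpt j hj x]
    have t1 : ‖dyExp (n j) Φ x + ∑ i ∈ Finset.range N, X j i x‖ₑ ≤
        A + ‖∑ i ∈ Finset.range N, X j i x‖ₑ :=
      (enorm_add_le _ _).trans (add_le_add_left ((enorm_dyExp_le _ _ _).trans
        (le_iSup₂ (f := fun j _ => dyAvg (n j) (fun y => ‖Φ y‖ₑ) x) j hj)) _)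
    have t2 : ∀ u v : ℝ≥0∞, (u + v) ^ 2 ≤ 2 * u ^ 2 + 2 * v ^ 2 := by
      intro u v
      have := ennreal_sq_sum_mul_le (Finset.univ : Finset (Fin 2)) (fun _ => 1) ![u, v]
      simpa [Fin.sum_univ_two, mul_add, one_add_one_eq_two] using this
    refine (pow_le_pow_left' t1 2).trans ((t2 _ _).trans ?_)
    gcongr
    exact Finset.single_le_sum (f := fun j => ‖∑ i ∈ Finset.range N, X j i x‖ₑ ^ 2)
      (fun _ _ => zero_le) hj
  have hXs : ∀ j, TestFun fun x => ∑ i ∈ Finset.range N, X j i x := fun j =>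
    TestFun.sum fun i _ => hXt j i
  have hmsum : Measurable fun x => ∑ j ∈ Finset.range N, ‖∑ i ∈ Finset.range N, X j i x‖ₑ ^ 2 :=
    Finset.measurable_fun_sum _ fun j _ => (hXs j).enorm_meas.pow_const 2
  refine (lintegral_mono hsup).trans ?_
  rw [lintegral_add_right _ (hmsum.const_mul _), lintegral_const_mul _ hmsum,
    lintegral_const_mul' _ _ (by simp), lintegral_finsetSum _ fun j _ =>
      (hXs j).enorm_meas.pow_const 2]
  have b1 := (lintegral_sq_iSup_dyAvg_le hn hΦt.enorm_meas M).trans (mul_le_mul_right hfull 4)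
  have b2 : ∑ j ∈ Finset.range N, ∫⁻ x, ‖∑ i ∈ Finset.range N, X j i x‖ₑ ^ 2 ≤
      (2 * (1 - q)⁻¹) ^ 2 * ∑ i ∈ Finset.range N, a i := by
    refine (Finset.sum_le_sum hdev).trans ?_
    rw [← Finset.mul_sum, Finset.sum_comm, sq, mul_assoc (2 * (1 - q)⁻¹) (2 * (1 - q)⁻¹)]
    refine mul_le_mul_right ?_ _
    rw [Finset.mul_sum]
    refine Finset.sum_le_sum fun i _ => ?_
    rw [← Finset.sum_mul]
    refine mul_le_mul_left ?_ _
    have := sum_range_dist_le (fun m => q ^ (2 * m)) i N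
    simp_rw [add_comm (i - _)] at this
    exact this.trans (mul_le_mul_right (tsum_pow_two_mul_le q hq) _)
  refine (add_le_add (mul_le_mul_right b1 2) (mul_le_mul_right b2 2)).trans (le_of_eq ?_)
  unfold partialSumConst
  ring

/-! ### Stopping scales -/

lemma dyIdx_mul_zpow (k i : ℤ) : dyIdx k (i * (2 : ℝ) ^ k) = i := by
  rw [dyIdx_eq_iff]
  have := two_zpow_pos k
  constructor <;> nlinarith

lemma setLIntegral_dyTriple_le {n : ℤ} {F : ℝ → ℝ≥0∞} {B : ℝ≥0∞} (h : ∀ x, dyAvg n F x ≤ B)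
    (i : ℤ) : ∫⁻ y in dyTriple n i, F y ≤ 3 * ENNReal.ofReal ((2 : ℝ) ^ n) * B := by
  have h1 : ∀ j, ∫⁻ y in dyIv n j, F y ≤ ENNReal.ofReal ((2 : ℝ) ^ n) * B := by
    intro j
    rw [← dyIdx_mul_zpow n j, setLIntegral_dyIv_eq]
    exact mul_le_mul_right (h _) _
  rw [dyTriple_eq_union]
  refine (lintegral_union_le _ _ _).trans ?_
  refine (add_le_add ((lintegral_union_le _ _ _).trans (add_le_add (h1 _) (h1 _))) (h1 _)).trans ?_
  apply le_of_eq; ring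

lemma setLIntegral_ball_le {n : ℤ} {F : ℝ → ℝ≥0∞} {B : ℝ≥0∞} (h : ∀ x, dyAvg n F x ≤ B)
    (x : ℝ) : ∫⁻ y in {y | |x - y| ≤ (2 : ℝ) ^ n}, F y ≤ 3 * ENNReal.ofReal ((2 : ℝ) ^ n) * B :=
  (lintegral_mono_set fun _ hy => mem_dyTriple_of_abs_le hy).trans (setLIntegral_dyTriple_le h _)

lemma ofReal_two_zpow_succ (m : ℤ) :
    ENNReal.ofReal ((2 : ℝ) ^ (m + 1)) = 2 * ENNReal.ofReal ((2 : ℝ) ^ m) := by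
  rw [zpow_add₀ (by norm_num), zpow_one, mul_comm, ENNReal.ofReal_mul (by norm_num)]; norm_num

lemma dyAvg_le_two_mul (m : ℤ) (F : ℝ → ℝ≥0∞) (x : ℝ) : dyAvg m F x ≤ 2 * dyAvg (m + 1) F x := by
  have h : ∫⁻ y in dyIv m (dyIdx m x), F y ≤ ∫⁻ y in dyIv (m + 1) (dyIdx (m + 1) x), F y :=
    lintegral_mono_set (dyIv_subset_of_le (by omega) x)
  rw [dyAvg, dyAvg, ofReal_two_zpow_succ, ENNReal.mul_inv (by simp) (by simp), ← mul_assoc,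
    ← mul_assoc, ENNReal.mul_inv_cancel (by simp) (by simp), one_mul]
  exact mul_le_mul_right h _

lemma dyAvg_le_of_lintegral_le {M n : ℤ} (h : M ≤ n) {F : ℝ → ℝ≥0∞} {t : ℝ≥0∞}
    (hF : ∫⁻ x, F x ≤ t * ENNReal.ofReal ((2 : ℝ) ^ M)) (x : ℝ) : dyAvg n F x ≤ t := by
  rw [dyAvg, mul_comm, ← div_eq_mul_inv]
  refine ENNReal.div_le_of_le_mul ?_
  refine (setLIntegral_le_lintegral _ _).trans (hF.trans ?_)
  gcongr
  norm_num

/-- The scale of the largest dyadic interval around `x`, among those of scales in `[a, M]`, on which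
the average of `F` exceeds `t`; it is `a` if there is none. -/
noncomputable def stopScale (F : ℝ → ℝ≥0∞) (t : ℝ≥0∞) (a M : ℤ) (x : ℝ) : ℤ := by
  classical
  exact (insert a ((Finset.Icc a M).filter fun m =>
      t < dyAvg m F x)).max' (Finset.insert_nonempty _ _)

section StopScale

variable {F : ℝ → ℝ≥0∞} {t : ℝ≥0∞} {a M : ℤ}

lemma stopScale_spec (F : ℝ → ℝ≥0∞) (t : ℝ≥0∞) (a M : ℤ) (x : ℝ) :
    stopScale F t a M x = a ∨
      (stopScale F t a M x ∈ Icc a M ∧ t < dyAvg (stopScale F t a M x) F x) := by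
  classical
  have := Finset.max'_mem (insert a ((Finset.Icc a M).filter fun m => t < dyAvg m F x))
    (Finset.insert_nonempty _ _)
  rw [Finset.mem_insert, Finset.mem_filter, Finset.mem_Icc] at this
  exact this

lemma le_stopScale {m : ℤ} {x : ℝ} (h1 : a ≤ m) (h2 : m ≤ M) (h : t < dyAvg m F x) :
    m ≤ stopScale F t a M x := by
  classical
  refine Finset.le_max' _ _ ?_
  rw [Finset.mem_insert, Finset.mem_filter, Finset.mem_Icc]
  exact Or.inr ⟨⟨h1, h2⟩, h⟩

lemma left_le_stopScale (x : ℝ) : a ≤ stopScale F t a M x := by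
  classical
  exact Finset.le_max' _ _ (Finset.mem_insert_self _ _)

lemma stopScale_le (haM : a ≤ M) (x : ℝ) : stopScale F t a M x ≤ M := by
  rcases stopScale_spec F t a M x with h | h
  · rw [h]; exact haM
  · exact h.1.2

lemma lt_dyAvg_stopScale {x : ℝ} (h : a < stopScale F t a M x) :
    t < dyAvg (stopScale F t a M x) F x := by
  rcases stopScale_spec F t a M x with h' | h'
  · omega
  · exact h'.2

lemma dyAvg_le_of_stopScale_lt {n : ℤ} {x : ℝ} (h : stopScale F t a M x < n) (hn : n ≤ M) :
    dyAvg n F x ≤ t := by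
  by_contra! h'
  have := le_stopScale (a := a) ((left_le_stopScale x).trans h.le) hn h'
  omega

lemma stopScale_congr {x y : ℝ} (h : dyIdx (stopScale F t a M x) x =
    dyIdx (stopScale F t a M x) y) :
    stopScale F t a M y = stopScale F t a M x := by
  apply le_antisymm
  · rcases stopScale_spec F t a M y with hy | hy
    · rw [hy]; exact left_le_stopScale x
    · by_contra! hlt
      have : t < dyAvg (stopScale F t a M y) F x := by
        rw [dyAvg_congr (dyIdx_eq_of_le hlt.le h)]; exact hy.2
      have := le_stopScale hy.1.1 hy.1.2 this
      omega
  · rcases stopScale_spec F t a M x with hx | hx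
    · conv_lhs => rw [hx]
      exact left_le_stopScale y
    · refine le_stopScale hx.1.1 hx.1.2 ?_
      rw [← dyAvg_congr h]; exact hx.2

lemma stopScale_level_congr {m : ℤ} {x y : ℝ} (h : dyIdx m x = dyIdx m y) :
    stopScale F t a M x = m ↔ stopScale F t a M y = m := by
  constructor
  · intro hx; rw [← hx] at h ⊢; exact stopScale_congr h
  · intro hy; rw [← hy] at h ⊢; exact stopScale_congr h.symm

lemma measurableSet_stopScale (m : ℤ) : MeasurableSet {x | stopScale F t a M x = m} := by
  have : Measurable fun x => (stopScale F t a M x = m : Prop) :=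
    measurable_of_dyIdx (k := m) fun x y h => propext (stopScale_level_congr h)
  exact measurableSet_setOfPred.2 this

/-- The weak type estimate for the maximal function over all dyadic intervals with scales in
`[a, M]` that are near the given point. -/
lemma mul_volume_dyAvg_near_le (hF : Measurable F) :
    t * volume {x : ℝ | ∃ m ∈ Icc a M, ∃ y, |x - y| ≤ (2 : ℝ) ^ m ∧ t < dyAvg m F y} ≤
      3 * ∫⁻ x, F x := by
  -- The disjoint sets on which `2 ^ m` is the largest scale with a large average.
  set S : ℤ → Set ℝ := fun m => {y | stopScale F t a M y = m ∧ t < dyAvg m F y} with hS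
  have hSc : ∀ m x y, dyIdx m x = dyIdx m y → x ∈ S m → y ∈ S m := by
    rintro m x y h ⟨h1, h2⟩
    exact ⟨(stopScale_level_congr h).1 h1, by rwa [← dyAvg_congr h]⟩
  have hSm : ∀ m, MeasurableSet (S m) := fun m =>
    (measurableSet_stopScale m).inter (measurableSet_lt measurable_const (measurable_dyAvg m F))
  have hsub : {x : ℝ | ∃ m ∈ Icc a M, ∃ y, |x - y| ≤ (2 : ℝ) ^ m ∧ t < dyAvg m F y} ⊆
      ⋃ m ∈ Finset.Icc a M, {x | ∃ y ∈ S m, |x - y| ≤ (2 : ℝ) ^ m} := by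
    rintro x ⟨m, hm, y, hxy, hy⟩
    have h1 := le_stopScale hm.1 hm.2 hy
    have h2 : t < dyAvg (stopScale F t a M y) F y := by
      rcases h1.lt_or_eq with h | h
      · exact lt_dyAvg_stopScale (hm.1.trans_lt h)
      · rwa [← h]
    rw [mem_iUnion₂]
    refine ⟨stopScale F t a M y, Finset.mem_Icc.2 ⟨left_le_stopScale y,
      stopScale_le (hm.1.trans hm.2) y⟩, y, ⟨rfl, h2⟩, hxy.trans (two_zpow_mono h1)⟩
  have hvol : ∀ m, t * volume (S m) ≤ ∫⁻ x in S m, F x := by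
    intro m
    have e1 : ∫⁻ x in S m, F x = ∫⁻ x, F x * (S m).indicator 1 x := by
      rw [← lintegral_indicator (hSm m)]
      congr 1; funext x; by_cases hx : x ∈ S m <;> simp [hx]
    have e2 : ∀ x y, dyIdx m x = dyIdx m y →
        (S m).indicator (1 : ℝ → ℝ≥0∞) x = (S m).indicator 1 y := by
      intro x y h
      by_cases hx : x ∈ S m
      · simp [hx, hSc m x y h hx]
      · rw [indicator_of_notMem hx, indicator_of_notMem fun hy => hx (hSc m y x h.symm hy)]
    rw [e1, ← lintegral_dyAvg_mul_of_const hF e2, ← setLIntegral_const,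
        ← lintegral_indicator (hSm m)]
    refine lintegral_mono fun x => ?_
    by_cases hx : x ∈ S m
    · simpa [hx] using hx.2.le
    · simp [hx]
  calc _ ≤ t * ∑ m ∈ Finset.Icc a M, volume {x | ∃ y ∈ S m, |x - y| ≤ (2 : ℝ) ^ m} :=
        mul_le_mul_right ((measure_mono hsub).trans (measure_biUnion_finset_le _ _)) _
    _ ≤ t * ∑ m ∈ Finset.Icc a M, 3 * volume (S m) :=
        mul_le_mul_right (Finset.sum_le_sum fun m _ => volume_near_le m (hSc m)) _
    _ = 3 * ∑ m ∈ Finset.Icc a M, t * volume (S m) := by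
        rw [← Finset.mul_sum, ← Finset.mul_sum]; ring
    _ ≤ 3 * ∑ m ∈ Finset.Icc a M, ∫⁻ x in S m, F x :=
        mul_le_mul_right (Finset.sum_le_sum fun m _ => hvol m) _
    _ ≤ 3 * ∫⁻ x, F x := by
        rw [← lintegral_biUnion_finset]
        · exact mul_le_mul_right (setLIntegral_le_lintegral _ _) _
        · intro i _ j _ hij
          refine Set.disjoint_left.2 fun x hx hx' => hij ?_
          exact hx.1.symm.trans hx'.1
        · exact fun m _ => hSm m

/-- The part of `F` with stopping scale `m` has averages `O(t)` at all scales at least `m`. -/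
lemma dyAvg_indicator_stopScale_le
    (hF : ∫⁻ x, F x ≤ t * ENNReal.ofReal ((2 : ℝ) ^ M)) {m n : ℤ} (hmn : m ≤ n) (x : ℝ) :
    dyAvg n ({y | stopScale F t a M y = m}.indicator F) x ≤ 2 * t := by
  by_cases h : ∃ y, dyIdx n x = dyIdx n y ∧ stopScale F t a M y = m
  · obtain ⟨y, hy, hym⟩ := h
    refine (dyAvg_mono (indicator_le_self _ _) x).trans ?_
    rw [dyAvg_congr hy]
    have hbig : ∀ k, m < k → dyAvg k F y ≤ t := by
      intro k hk
      rcases le_total k M with hkM | hkM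
      · exact dyAvg_le_of_stopScale_lt (a := a) (by omega) hkM
      · exact dyAvg_le_of_lintegral_le hkM hF y
    rcases hmn.lt_or_eq with h | rfl
    · exact (hbig n h).trans (le_mul_of_one_le_left' (by norm_num))
    · exact (dyAvg_le_two_mul m F y).trans (mul_le_mul_right (hbig _ (by omega)) _)
  · have : ∀ y ∈ dyIv n (dyIdx n x), {y | stopScale F t a M y = m}.indicator F y = 0 := by
      intro y hy
      rw [indicator_of_notMem]
      exact fun hym => h ⟨y, hy.symm, hym⟩
    rw [dyAvg, setLIntegral_congr_fun (measurableSet_dyIv _ _) this]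
    simp

lemma sum_indicator_stopScale (haM : a ≤ M) {α : Type*} [AddCommMonoid α] (f : ℝ → α) (x : ℝ) :
    ∑ m ∈ Finset.Icc a M, {y | stopScale F t a M y = m}.indicator f x = f x := by
  rw [Finset.sum_eq_single (stopScale F t a M x)]
  · simp
  · intro m _ hm
    rw [indicator_of_notMem]
    exact fun h => hm h.symm
  · intro h
    exact absurd (Finset.mem_Icc.2 ⟨left_le_stopScale x, stopScale_le haM x⟩) h

end StopScale

/-! ### The pieces of the Hilbert transform -/

/-- The function `1 / y`, regularized to be Lipschitz at scale `2 ^ j`. -/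
noncomputable def regInv (j : ℤ) (y : ℝ) : ℝ := y / max |y| ((2 : ℝ) ^ j) ^ 2

/-- The piece of `1 / y` at scale `2 ^ k`: an odd Lipschitz function supported in `|y| ≤ 2 ^ k`. -/
noncomputable def invPiece (k : ℤ) (y : ℝ) : ℝ := regInv (k - 1) y - regInv k y

lemma abs_regInv_le (j : ℤ) (y : ℝ) : |regInv j y| ≤ ((2 : ℝ) ^ j)⁻¹ := by
  have hp := two_zpow_pos j
  have h1 : (2 : ℝ) ^ j ≤ max |y| ((2 : ℝ) ^ j) := le_max_right _ _
  have h2 : |y| ≤ max |y| ((2 : ℝ) ^ j) := le_max_left _ _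
  rw [regInv, abs_div, abs_of_nonneg (by positivity : (0 : ℝ) ≤ max |y| ((2 : ℝ) ^ j) ^ 2)]
  set M := max |y| ((2 : ℝ) ^ j)
  have hM : 0 < M := hp.trans_le h1
  calc |y| / M ^ 2 ≤ M / M ^ 2 := by gcongr
    _ = M⁻¹ := by field_simp
    _ ≤ _ := by gcongr

lemma regInv_of_le {j : ℤ} {y : ℝ} (h : (2 : ℝ) ^ j ≤ |y|) : regInv j y = 1 / y := by
  rw [regInv, max_eq_left h, sq_abs]
  have : y ≠ 0 := by
    rintro rfl
    have := two_zpow_pos j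
    simp at h; linarith
  field_simp

lemma regInv_neg (j : ℤ) (y : ℝ) : regInv j (-y) = -regInv j y := by
  simp [regInv, neg_div]

lemma measurable_regInv (j : ℤ) : Measurable (regInv j) := by
  unfold regInv
  fun_prop

lemma abs_regInv_sub_le (j : ℤ) (y z : ℝ) :
    |regInv j y - regInv j z| ≤ 3 * ((2 : ℝ) ^ j)⁻¹ ^ 2 * |y - z| := by
  have hp := two_zpow_pos j
  unfold regInv
  set c := (2 : ℝ) ^ j
  set a := max |y| c with ha
  set b := max |z| c with hb
  have ha1 : c ≤ a := le_max_right _ _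
  have hb1 : c ≤ b := le_max_right _ _
  have hb2 : |z| ≤ b := le_max_left _ _
  have ha0 : 0 < a := hp.trans_le ha1
  have hb0 : 0 < b := hp.trans_le hb1
  have hab : |b - a| ≤ |y - z| := by
    rw [abs_sub_comm y z]
    exact (abs_max_sub_max_le_abs _ _ _).trans (abs_abs_sub_abs_le_abs_sub z y)
  have e : y / a ^ 2 - z / b ^ 2 = ((y - z) * b ^ 2 + z * ((b - a) * (a + b))) / (a ^ 2 * b ^ 2) := by
    field_simp; ring
  rw [e, abs_div, abs_of_pos (by positivity : 0 < a ^ 2 * b ^ 2)]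
  have h1 : |(y - z) * b ^ 2 + z * ((b - a) * (a + b))| ≤ |y - z| * (2 * b ^ 2 + a * b) := by
    refine (abs_add_le _ _).trans ?_
    rw [abs_mul, abs_mul, abs_mul, abs_of_pos (by positivity : 0 < b ^ 2),
      abs_of_pos (by positivity : 0 < a + b)]
    have : |z| * (|b - a| * (a + b)) ≤ b * (|y - z| * (a + b)) := by gcongr
    nlinarith
  have h2 : (2 * b ^ 2 + a * b) / (a ^ 2 * b ^ 2) ≤ 3 * c⁻¹ ^ 2 := by
    have : (2 * b ^ 2 + a * b) / (a ^ 2 * b ^ 2) = 2 * a⁻¹ ^ 2 + a⁻¹ * b⁻¹ := by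
      field_simp
    rw [this]
    have h3 : a⁻¹ ≤ c⁻¹ := by gcongr
    have h4 : b⁻¹ ≤ c⁻¹ := by gcongr
    have h5 : 0 < a⁻¹ := by positivity
    have h6 : 0 < b⁻¹ := by positivity
    nlinarith [mul_le_mul h3 h4 h6.le (h5.le.trans h3), mul_le_mul h3 h3 h5.le (h5.le.trans h3)]
  calc _ ≤ |y - z| * (2 * b ^ 2 + a * b) / (a ^ 2 * b ^ 2) := by gcongr
    _ = |y - z| * ((2 * b ^ 2 + a * b) / (a ^ 2 * b ^ 2)) := by ring
    _ ≤ |y - z| * (3 * c⁻¹ ^ 2) := by gcongr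
    _ = _ := by ring

lemma inv_two_zpow_sub_one (k : ℤ) : ((2 : ℝ) ^ (k - 1))⁻¹ = 2 * ((2 : ℝ) ^ k)⁻¹ := by
  rw [zpow_sub₀ (by norm_num), zpow_one]; field_simp

lemma abs_invPiece_le (k : ℤ) (y : ℝ) : |invPiece k y| ≤ 3 * ((2 : ℝ) ^ k)⁻¹ := by
  have h1 := abs_regInv_le (k - 1) y
  have h2 := abs_regInv_le k y
  rw [inv_two_zpow_sub_one] at h1
  calc _ ≤ |regInv (k - 1) y| + |regInv k y| := abs_sub _ _
    _ ≤ _ := by linarith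

lemma invPiece_of_le {k : ℤ} {y : ℝ} (h : (2 : ℝ) ^ k ≤ |y|) : invPiece k y = 0 := by
  rw [invPiece, regInv_of_le h, regInv_of_le ((two_zpow_mono (by omega)).trans h), sub_self]

lemma invPiece_neg (k : ℤ) (y : ℝ) : invPiece k (-y) = -invPiece k y := by
  simp only [invPiece, regInv_neg]; ring

lemma measurable_invPiece (k : ℤ) : Measurable (invPiece k) :=
  (measurable_regInv _).sub (measurable_regInv _)

lemma abs_invPiece_sub_le (k : ℤ) (y z : ℝ) :
    |invPiece k y - invPiece k z| ≤ 15 * ((2 : ℝ) ^ k)⁻¹ ^ 2 * |y - z| := by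
  have h1 := abs_regInv_sub_le (k - 1) y z
  have h2 := abs_regInv_sub_le k y z
  rw [inv_two_zpow_sub_one] at h1
  have e : invPiece k y - invPiece k z = (regInv (k - 1) y - regInv (k - 1) z) -
      (regInv k y - regInv k z) := by unfold invPiece; ring
  rw [e]
  refine (abs_sub _ _).trans ((add_le_add h1 h2).trans (le_of_eq ?_))
  ring

/-- The kernel of the piece of the Hilbert transform at scale `2 ^ k`. -/
noncomputable def hilKer (k : ℤ) (x y : ℝ) : ℂ := (invPiece k (x - y) : ℝ)

lemma norm_hilKer (k : ℤ) (x y : ℝ) : ‖hilKer k x y‖ = |invPiece k (x - y)| := by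
  rw [hilKer, Complex.norm_real, Real.norm_eq_abs]

lemma norm_hilKer_le (k : ℤ) (x y : ℝ) : ‖hilKer k x y‖ ≤ 3 * ((2 : ℝ) ^ k)⁻¹ := by
  rw [norm_hilKer]; exact abs_invPiece_le _ _

lemma hilKer_of_le {k : ℤ} {x y : ℝ} (h : (2 : ℝ) ^ k ≤ |x - y|) : hilKer k x y = 0 := by
  rw [hilKer, invPiece_of_le h]; simp

lemma localKernel_hilKer (k : ℤ) : LocalKernel (hilKer k) :=
  ⟨Complex.measurable_ofReal.comp ((measurable_invPiece k).comp (measurable_fst.sub measurable_snd)),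
    ⟨_, norm_hilKer_le k⟩, ⟨(2 : ℝ) ^ k, fun _ _ h => hilKer_of_le h.le⟩⟩

lemma hilKer_swap (k : ℤ) (x y : ℝ) : hilKer k y x = -hilKer k x y := by
  rw [hilKer, hilKer, ← neg_sub, invPiece_neg]; simp

lemma norm_hilKer_sub_le (k : ℤ) (x z y : ℝ) :
    ‖hilKer k x y - hilKer k z y‖ ≤ 15 * ((2 : ℝ) ^ k)⁻¹ ^ 2 * |x - z| := by
  rw [hilKer, hilKer, ← Complex.ofReal_sub, Complex.norm_real, Real.norm_eq_abs]
  refine (abs_invPiece_sub_le _ _ _).trans (le_of_eq ?_)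
  ring_nf

lemma enorm_le_ofReal {z : ℂ} {C : ℝ} (h : ‖z‖ ≤ C) : ‖z‖ₑ ≤ ENNReal.ofReal C := by
  rw [← ofReal_norm]; exact ENNReal.ofReal_le_ofReal h

/-- The integral of a function that is bounded by `C` and supported in a set of measure `V`. -/
lemma lintegral_enorm_le_of_bound {f : ℝ → ℂ} {S : Set ℝ} {C V : ℝ} (hC0 : 0 ≤ C)
    (hC : ∀ y, ‖f y‖ ≤ C) (hS : ∀ y, y ∉ S → f y = 0) (hV : volume S ≤ ENNReal.ofReal V) :
    ∫⁻ y, ‖f y‖ₑ ≤ ENNReal.ofReal (C * V) := by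
  rw [ENNReal.ofReal_mul hC0]
  calc ∫⁻ y, ‖f y‖ₑ ≤ ∫⁻ y, (toMeasurable volume S).indicator (fun _ => ENNReal.ofReal C) y := by
        refine lintegral_mono fun y => ?_
        by_cases hy : y ∈ toMeasurable volume S
        · rw [indicator_of_mem hy]; exact enorm_le_ofReal (hC y)
        · rw [hS y fun h => hy (subset_toMeasurable _ _ h)]; simp
    _ = ENNReal.ofReal C * volume S := by
        rw [lintegral_indicator (measurableSet_toMeasurable _ _), setLIntegral_const,
          measure_toMeasurable]
    _ ≤ _ := mul_le_mul_right hV _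

lemma lintegral_enorm_le_of_ball {f : ℝ → ℂ} {x C R : ℝ} (hC0 : 0 ≤ C)
    (hC : ∀ y, ‖f y‖ ≤ C) (hS : ∀ y, R < |x - y| → f y = 0) :
    ∫⁻ y, ‖f y‖ₑ ≤ ENNReal.ofReal (C * (2 * R)) := by
  refine lintegral_enorm_le_of_bound (S := Icc (x - R) (x + R)) hC0 hC (fun y hy => hS y ?_) ?_
  · by_contra h; exact hy (mem_Icc_of_abs_sub h)
  · rw [Real.volume_Icc]; apply le_of_eq; congr 1; ring

lemma lintegral_hilKer_right_le (k : ℤ) (x : ℝ) : ∫⁻ y, ‖hilKer k x y‖ₑ ≤ 6 := by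
  have hp := two_zpow_pos k
  refine (lintegral_enorm_le_of_ball (x := x) (by positivity) (norm_hilKer_le k x)
    fun y hy => hilKer_of_le hy.le).trans ?_
  rw [show 3 * ((2 : ℝ) ^ k)⁻¹ * (2 * 2 ^ k) = 6 by field_simp; norm_num]; simp

lemma lintegral_hilKer_left_le (k : ℤ) (y : ℝ) : ∫⁻ x, ‖hilKer k x y‖ₑ ≤ 6 := by
  simp_rw [hilKer_swap k y, enorm_neg]
  exact lintegral_hilKer_right_le k y

lemma norm_sub_dyExp_le {m : ℤ} {f : ℝ → ℂ} (hf : TestFun f) {x δ : ℝ}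
    (h : ∀ z, dyIdx m x = dyIdx m z → ‖f x - f z‖ ≤ δ) : ‖f x - dyExp m f x‖ ≤ δ := by
  have hδ : 0 ≤ δ := (norm_nonneg _).trans (h x rfl)
  set g : ℝ → ℂ := (dyIv m (dyIdx m x)).indicator fun _ => f x with hg
  have hgz : ∀ z, dyIdx m x = dyIdx m z → g z = f x := fun z hz =>
    indicator_of_mem (show z ∈ dyIv m (dyIdx m x) from hz.symm) _
  have hgt : TestFun g := by
    refine ⟨measurable_const.indicator (measurableSet_dyIv _ _), ⟨‖f x‖, fun z => ?_⟩,
      ⟨|x| + 2 ^ m, fun z hz => ?_⟩⟩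
    · exact norm_indicator_le_norm_self (fun _ => f x) z
    · refine indicator_of_notMem (fun hz' => ?_) _
      have h1 := abs_sub_lt_of_dyIdx_eq (mem_dyIv.1 hz')
      have h2 := abs_sub_abs_le_abs_sub z x
      linarith
  have e1 : dyExp m g x = f x := by
    rw [dyExp_of_const fun y hy => by rw [hgz y hy, hgz x rfl], hgz x rfl]
  have e2 : f x - dyExp m f x = dyExp m (fun z => g z - f z) x := by
    have := (localKernel_dyKer m).kOp_sub hgt hf x
    rw [← dyExp, ← dyExp, ← dyExp, e1] at this
    exact this.symm
  rw [e2]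
  have h3 : ‖dyExp m (fun z => g z - f z) x‖ₑ ≤ ENNReal.ofReal δ := by
    refine (enorm_dyExp_le _ _ _).trans ?_
    rw [dyAvg, mul_comm, ← div_eq_mul_inv]
    refine ENNReal.div_le_of_le_mul ?_
    rw [← volume_dyIv m (dyIdx m x), ← setLIntegral_const]
    refine setLIntegral_mono measurable_const fun z hz => ?_
    rw [hgz z (mem_dyIv.1 hz).symm]
    exact enorm_le_ofReal (h z (mem_dyIv.1 hz).symm)
  rw [← ofReal_norm] at h3
  exact (ENNReal.ofReal_le_ofReal_iff hδ).1 h3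

/-- The kernel of `(1 - E_m) T_k`. -/
noncomputable def hilFineKer (m k : ℤ) (x y : ℝ) : ℂ :=
    hilKer k x y - kComp (dyKer m) (hilKer k) x y

lemma localKernel_hilFineKer (m k : ℤ) : LocalKernel (hilFineKer m k) :=
  (localKernel_hilKer k).sub ((localKernel_dyKer m).comp (localKernel_hilKer k))

lemma kComp_dyKer (m : ℤ) (κ : ℝ → ℝ → ℂ) (x y : ℝ) :
    kComp (dyKer m) κ x y = dyExp m (fun z => κ z y) x := rfl

lemma dyExp_eq_zero {m : ℤ} {f : ℝ → ℂ} {x : ℝ} (h : ∀ z, dyIdx m x = dyIdx m z → f z = 0) :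
    dyExp m f x = 0 := by
  rw [dyExp_of_const fun y hy => by rw [h y hy, h x rfl], h x rfl]

lemma norm_hilFineKer_le {m k : ℤ} (x y : ℝ) :
    ‖hilFineKer m k x y‖ ≤ 15 * ((2 : ℝ) ^ k)⁻¹ ^ 2 * 2 ^ m := by
  refine norm_sub_dyExp_le ((localKernel_hilKer k).left y) fun z hz => ?_
  refine (norm_hilKer_sub_le k x z y).trans ?_
  gcongr
  exact (abs_sub_lt_of_dyIdx_eq hz).le

lemma hilFineKer_of_lt {m k : ℤ} (h : m ≤ k) {x y : ℝ} (hxy : 2 * (2 : ℝ) ^ k < |x - y|) :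
    hilFineKer m k x y = 0 := by
  have h1 := two_zpow_mono h
  have hp := two_zpow_pos k
  rw [hilFineKer, hilKer_of_le (by linarith), kComp_dyKer, dyExp_eq_zero, sub_zero]
  intro z hz
  apply hilKer_of_le
  have h2 := abs_sub_lt_of_dyIdx_eq hz
  have h3 := abs_sub_le x z y
  linarith

lemma hilFineKer_const (m k : ℤ) :
    15 * ((2 : ℝ) ^ k)⁻¹ ^ 2 * 2 ^ m * (2 * (2 * 2 ^ k)) = 60 * 2 ^ (m - k) := by
  have hp := two_zpow_pos k
  rw [zpow_sub₀ (by norm_num)]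
  field_simp; norm_num

lemma lintegral_hilFineKer_right_le {m k : ℤ} (h : m ≤ k) (x : ℝ) :
    ∫⁻ y, ‖hilFineKer m k x y‖ₑ ≤ ENNReal.ofReal (60 * 2 ^ (m - k)) := by
  rw [← hilFineKer_const]
  exact lintegral_enorm_le_of_ball (by positivity) (norm_hilFineKer_le x)
    fun y hy => hilFineKer_of_lt h hy

lemma lintegral_hilFineKer_left_le {m k : ℤ} (h : m ≤ k) (y : ℝ) :
    ∫⁻ x, ‖hilFineKer m k x y‖ₑ ≤ ENNReal.ofReal (60 * 2 ^ (m - k)) := by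
  rw [← hilFineKer_const]
  exact lintegral_enorm_le_of_ball (x := y) (by positivity) (fun x => norm_hilFineKer_le x y)
    fun x hx => hilFineKer_of_lt h (by rwa [abs_sub_comm])

/-- The kernel of `E_m T_k`. -/
noncomputable def hilCoarseKer (m k : ℤ) (x y : ℝ) : ℂ := kComp (dyKer m) (hilKer k) x y

lemma localKernel_hilCoarseKer (m k : ℤ) : LocalKernel (hilCoarseKer m k) :=
  (localKernel_dyKer m).comp (localKernel_hilKer k)

lemma norm_hilCoarseKer_le (m k : ℤ) (x y : ℝ) : ‖hilCoarseKer m k x y‖ ≤ 6 * ((2 : ℝ) ^ m)⁻¹ := by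
  have hp := two_zpow_pos m
  have h3 : ‖hilCoarseKer m k x y‖ₑ ≤ ENNReal.ofReal (6 * ((2 : ℝ) ^ m)⁻¹) := by
    rw [hilCoarseKer, kComp_dyKer]
    refine (enorm_dyExp_le _ _ _).trans ?_
    rw [dyAvg, ENNReal.ofReal_mul (by norm_num), ENNReal.ofReal_inv_of_pos hp, mul_comm]
    refine mul_le_mul_left ((setLIntegral_le_lintegral _ _).trans ?_) _
    simpa using lintegral_hilKer_left_le k y
  rw [← ofReal_norm] at h3
  exact (ENNReal.ofReal_le_ofReal_iff (by positivity)).1 h3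

lemma integral_hilKer_left (k : ℤ) (y : ℝ) : ∫ z, hilKer k z y = 0 := by
  have h1 : ∫ z, hilKer k z y = ∫ z, hilKer k z 0 := by
    have := integral_sub_right_eq_self (μ := volume) (fun z => hilKer k z 0) y
    rw [← this]
    simp [hilKer]
  have h2 : ∫ z, hilKer k z 0 = ∫ z, hilKer k (-z) 0 := (integral_neg_eq_self _ _).symm
  have h3 : ∀ z, hilKer k (-z) 0 = -hilKer k z 0 := by
    intro z; rw [hilKer, sub_zero, invPiece_neg, hilKer, sub_zero]; simp
  simp_rw [h3, integral_neg] at h2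
  rw [h1]
  exact self_eq_neg.1 h2

/-- The kernel of `E_m T_k` is concentrated near the endpoints of the intervals of length `2 ^ m`,
because the kernel of `T_k` has mean zero. -/
lemma hilCoarseKer_eq_zero {m k : ℤ} {x y : ℝ}
    (h1 : (2 : ℝ) ^ k < |dyIdx m x * (2 : ℝ) ^ m - y|)
    (h2 : (2 : ℝ) ^ k < |(dyIdx m x + 1) * (2 : ℝ) ^ m - y|) : hilCoarseKer m k x y = 0 := by
  have hp := two_zpow_pos k
  have hm := two_zpow_pos m
  rw [hilCoarseKer, kComp_dyKer]
  by_cases hin : dyIdx m x * (2 : ℝ) ^ m < y ∧ y < (dyIdx m x + 1) * (2 : ℝ) ^ m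
  · rw [abs_of_neg (by linarith)] at h1
    rw [abs_of_pos (by linarith)] at h2
    have e : ∀ z, dyKer m x z * hilKer k z y = (((2 : ℝ) ^ m)⁻¹ : ℝ) * hilKer k z y := by
      intro z
      by_cases hz : dyIdx m x = dyIdx m z
      · rw [dyKer, if_pos hz]
      · rw [hilKer_of_le, mul_zero, mul_zero]
        by_contra! hlt
        rw [abs_lt] at hlt
        apply hz
        symm
        rw [dyIdx_eq_iff]
        constructor <;> linarith
    rw [dyExp, kOp]
    simp_rw [e]
    rw [integral_const_mul, integral_hilKer_left, mul_zero]
  · refine dyExp_eq_zero fun z hz => hilKer_of_le ?_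
    have hb := dyIdx_bounds m z
    rw [← hz] at hb
    by_contra! hlt
    rw [abs_lt] at hlt
    apply hin
    rw [lt_abs] at h1 h2
    constructor
    · rcases h1 with h | h <;> linarith
    · rcases h2 with h | h <;> linarith

lemma lintegral_hilCoarseKer_right_le (m k : ℤ) (x : ℝ) :
    ∫⁻ y, ‖hilCoarseKer m k x y‖ₑ ≤ ENNReal.ofReal (24 * 2 ^ (k - m)) := by
  have hp := two_zpow_pos k
  have hm := two_zpow_pos m
  rw [show 24 * (2 : ℝ) ^ (k - m) = 6 * ((2 : ℝ) ^ m)⁻¹ * (4 * 2 ^ k) by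
    rw [zpow_sub₀ (by norm_num)]; field_simp; norm_num]
  set e₁ := dyIdx m x * (2 : ℝ) ^ m
  set e₂ := (dyIdx m x + 1) * (2 : ℝ) ^ m
  refine lintegral_enorm_le_of_bound
    (S := Icc (e₁ - 2 ^ k) (e₁ + 2 ^ k) ∪ Icc (e₂ - 2 ^ k) (e₂ + 2 ^ k)) (by positivity)
    (norm_hilCoarseKer_le m k x) (fun y hy => ?_) ?_
  · rw [mem_union, not_or] at hy
    apply hilCoarseKer_eq_zero
    · by_contra h; exact hy.1 (mem_Icc_of_abs_sub h)
    · by_contra h; exact hy.2 (mem_Icc_of_abs_sub h)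
  · refine (measure_union_le _ _).trans ?_
    rw [Real.volume_Icc, Real.volume_Icc, ← ENNReal.ofReal_add (by linarith) (by linarith)]
    apply le_of_eq; congr 1; ring

lemma lintegral_hilCoarseKer_left_le {m k : ℤ} (h : k ≤ m) (y : ℝ) :
    ∫⁻ x, ‖hilCoarseKer m k x y‖ₑ ≤ 24 := by
  have hp := two_zpow_pos k
  have hm := two_zpow_pos m
  have h1 := two_zpow_mono h
  refine (lintegral_enorm_le_of_ball (x := y) (R := 2 * 2 ^ m) (by positivity)
    (fun x => norm_hilCoarseKer_le m k x y) fun x hx => ?_).trans ?_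
  · rw [hilCoarseKer, kComp_dyKer]
    refine dyExp_eq_zero fun z hz => hilKer_of_le ?_
    have h2 := abs_sub_lt_of_dyIdx_eq hz
    have h3 := abs_sub_le y z x
    rw [abs_sub_comm z x, abs_sub_comm y z] at h3
    linarith
  · rw [show 6 * ((2 : ℝ) ^ m)⁻¹ * (2 * (2 * 2 ^ m)) = 24 by field_simp; norm_num]; simp

/-- The piece of the Hilbert transform at scale `2 ^ k`. -/
noncomputable def hilOp (k : ℤ) (f : ℝ → ℂ) : ℝ → ℂ := kOp (hilKer k) f

lemma TestFun.hilOp {f : ℝ → ℂ} (hf : TestFun f) (k : ℤ) : TestFun (hilOp k f) :=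
  (localKernel_hilKer k).kOp_testFun hf

/-- The decay rate used throughout: `decayRate ^ 8 = 1 / 2`. -/
noncomputable def decayRate : ℝ≥0∞ := 2⁻¹ ^ (1 / 8 : ℝ)

lemma decayRate_pow_eight : decayRate ^ 8 = 2⁻¹ := by
  rw [decayRate, ← ENNReal.rpow_natCast, ← ENNReal.rpow_mul]; norm_num

lemma decayRate_ne_zero : decayRate ≠ 0 := by
  intro h
  have := decayRate_pow_eight
  rw [h, zero_pow (by norm_num)] at this
  exact ENNReal.inv_ne_zero.2 (by simp) this.symm

lemma decayRate_lt_one : decayRate < 1 := by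
  refine ENNReal.rpow_lt_one ?_ (by norm_num)
  rw [ENNReal.inv_lt_one]; norm_num

lemma ofReal_two_zpow_neg (n : ℕ) : ENNReal.ofReal ((2 : ℝ) ^ (-(n : ℤ))) = decayRate ^ (8 * n) := by
  rw [pow_mul, decayRate_pow_eight, zpow_neg, zpow_natCast,
    ENNReal.ofReal_inv_of_pos (by positivity), ENNReal.ofReal_pow (by norm_num), ENNReal.inv_pow]
  norm_num

lemma dyExp_hilOp {f : ℝ → ℂ} (hf : TestFun f) (m k : ℤ) (x : ℝ) : dyExp m (hilOp k f) x =
    kOp (hilCoarseKer m k) f x :=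
  (localKernel_dyKer m).kOp_kOp (localKernel_hilKer k) hf x

lemma hilOp_dyExp {f : ℝ → ℂ} (hf : TestFun f) (m k : ℤ) (x : ℝ) :
    hilOp k (dyExp m f) x = kOp (fun x y => -hilCoarseKer m k y x) f x := by
  rw [hilOp, dyExp, (localKernel_hilKer k).kOp_kOp (localKernel_dyKer m) hf]
  congr 1
  funext x y
  rw [hilCoarseKer, kComp, kComp, ← integral_neg]
  congr 1; funext z
  rw [hilKer_swap k x z, dyKer_symm m y z]; ring

lemma l2sq_dyExp_hilOp_le {f : ℝ → ℂ} (hf : TestFun f) (k : ℤ) (n : ℕ) :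
    l2sq (dyExp (k + n) (hilOp k f)) ≤ 3600 * decayRate ^ (8 * n) * l2sq f := by
  have := l2sq_kOp_le (localKernel_hilCoarseKer (k + n) k) hf
    (lintegral_hilCoarseKer_right_le (k + n) k)
    (lintegral_hilCoarseKer_left_le (m := k + n) (k := k) (by omega))
  rw [l2sq]
  simp_rw [dyExp_hilOp hf]
  refine this.trans (mul_le_mul_left ?_ _)
  rw [show k - (k + n : ℤ) = -n by ring, ENNReal.ofReal_mul (by norm_num), ofReal_two_zpow_neg,
    mul_right_comm]
  refine mul_le_mul_left ?_ _
  norm_num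

lemma l2sq_hilOp_dyExp_le {f : ℝ → ℂ} (hf : TestFun f) (k : ℤ) (n : ℕ) :
    l2sq (hilOp k (dyExp (k + n) f)) ≤ 3600 * decayRate ^ (8 * n) * l2sq f := by
  have := l2sq_kOp_le (localKernel_hilCoarseKer (k + n) k).swap.neg hf (A := 24)
    (B := ENNReal.ofReal (24 * 2 ^ (k - (k + n : ℤ)))) ?_ ?_
  · rw [l2sq]
    simp_rw [hilOp_dyExp hf]
    refine this.trans (mul_le_mul_left ?_ _)
    rw [show k - (k + n : ℤ) = -n by ring, ENNReal.ofReal_mul (by norm_num), ofReal_two_zpow_neg,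
      ← mul_assoc]
    refine mul_le_mul_left ?_ _
    norm_num
  · intro x
    simp_rw [enorm_neg]
    exact lintegral_hilCoarseKer_left_le (by omega) x
  · intro y
    simp_rw [enorm_neg]
    exact lintegral_hilCoarseKer_right_le _ _ y

lemma hilOp_sub_dyExp {f : ℝ → ℂ} (hf : TestFun f) (m k : ℤ) (x : ℝ) :
    hilOp k f x - dyExp m (hilOp k f) x = kOp (hilFineKer m k) f x := by
  rw [dyExp_hilOp hf, hilOp, (localKernel_hilKer k).kOp_sub_kernel (localKernel_hilCoarseKer m k) hf]
  rfl

lemma hilOp_sub_hilOp_dyExp {f : ℝ → ℂ} (hf : TestFun f) (m k : ℤ) (x : ℝ) :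
    hilOp k f x - hilOp k (dyExp m f) x = kOp (fun x y => -hilFineKer m k y x) f x := by
  rw [hilOp_dyExp hf, hilOp, (localKernel_hilKer k).kOp_sub_kernel
    (localKernel_hilCoarseKer m k).swap.neg hf]
  congr 1
  funext x y
  rw [hilFineKer, hilKer_swap k x y, hilCoarseKer]; ring

lemma sq_ofReal_le (n : ℕ) :
    ENNReal.ofReal (60 * 2 ^ (-(n : ℤ))) * ENNReal.ofReal (60 * 2 ^ (-(n : ℤ)))
    ≤ 3600 * decayRate ^ (8 * n) := by
  rw [ENNReal.ofReal_mul (by norm_num), ofReal_two_zpow_neg]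
  calc _ = ENNReal.ofReal 60 * ENNReal.ofReal 60 * decayRate ^ (8 * n) * decayRate ^ (8 * n) :=
      by ring
    _ ≤ 3600 * decayRate ^ (8 * n) * 1 := by
      gcongr
      · norm_num
      · exact pow_le_one₀ zero_le decayRate_lt_one.le
    _ = _ := mul_one _

lemma l2sq_hilOp_sub_dyExp_le {f : ℝ → ℂ} (hf : TestFun f) (m : ℤ) (n : ℕ) :
    l2sq (fun x => hilOp (m + n) f x - dyExp m (hilOp (m + n) f) x) ≤
      3600 * decayRate ^ (8 * n) * l2sq f := by
  have := l2sq_kOp_le (localKernel_hilFineKer m (m + n)) hf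
    (lintegral_hilFineKer_right_le (m := m) (k := m + n) (by omega))
    (lintegral_hilFineKer_left_le (m := m) (k := m + n) (by omega))
  simp_rw [hilOp_sub_dyExp hf]
  refine this.trans (mul_le_mul_left ?_ _)
  rw [show m - (m + n : ℤ) = -n by ring]
  exact sq_ofReal_le n

lemma l2sq_hilOp_sub_hilOp_dyExp_le {f : ℝ → ℂ} (hf : TestFun f) (m : ℤ) (n : ℕ) :
    l2sq (fun x => hilOp (m + n) f x - hilOp (m + n) (dyExp m f) x) ≤
      3600 * decayRate ^ (8 * n) * l2sq f := by
  have := l2sq_kOp_le (localKernel_hilFineKer m (m + n)).swap.neg hf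
    (fun x => by
      simp_rw [enorm_neg]
      exact lintegral_hilFineKer_left_le (m := m) (k := m + n) (by omega) x)
    (fun x => by
      simp_rw [enorm_neg]
      exact lintegral_hilFineKer_right_le (m := m) (k := m + n) (by omega) x)
  simp_rw [hilOp_sub_hilOp_dyExp hf]
  refine this.trans (mul_le_mul_left ?_ _)
  rw [show m - (m + n : ℤ) = -n by ring]
  exact sq_ofReal_le n

/-- Pieces of the Hilbert transform at scales larger than `2 ^ m` decay on functions with mean zero
on dyadic intervals of length `2 ^ m`. -/
lemma lintegral_hilOp_sub_hilOp_dyExp_le {f : ℝ → ℂ} (hf : TestFun f) (m : ℤ) (n : ℕ) :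
    ∫⁻ x, ‖hilOp (m + n) f x - hilOp (m + n) (dyExp m f) x‖ₑ ≤ 60 * 2⁻¹ ^ n * ∫⁻ x, ‖f x‖ₑ := by
  have := lintegral_kOp_le (localKernel_hilFineKer m (m + n)).swap.neg hf
    (fun x => by
      simp_rw [enorm_neg]
      exact lintegral_hilFineKer_right_le (m := m) (k := m + n) (by omega) x)
  simp_rw [hilOp_sub_hilOp_dyExp hf]
  refine this.trans (mul_le_mul_left ?_ _)
  rw [show m - (m + n : ℤ) = -n by ring, ENNReal.ofReal_mul (by norm_num), ofReal_two_zpow_neg,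
    pow_mul, decayRate_pow_eight]
  norm_num

/-! ### Maximal truncations of the Hilbert transform on `L²` -/

lemma decayRate_ne_top : decayRate ≠ ∞ := (decayRate_lt_one.trans ENNReal.one_lt_top).ne

/-- Summation in `L²` of a family with geometrically decaying norms. -/
lemma lintegral_sq_sum_le {ι : Type*} {s : Finset ι} {d : ι → ℕ} {F : ι → ℝ → ℝ≥0∞}
    (hF : ∀ i ∈ s, Measurable (F i)) {q S B : ℝ≥0∞} (hq0 : q ≠ 0) (hq : q ≠ ∞)
    (h : ∀ i ∈ s, ∫⁻ x, F i x ^ 2 ≤ q ^ (4 * d i) * B) (hS : ∑ i ∈ s, q ^ (2 * d i) ≤ S) :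
    ∫⁻ x, (∑ i ∈ s, F i x) ^ 2 ≤ S ^ 2 * B := by
  have hqt : ∀ m : ℕ, q ^ m ≠ ∞ := fun m => ENNReal.pow_ne_top hq
  have hqz : ∀ m : ℕ, q ^ m ≠ 0 := fun m => pow_ne_zero m hq0
  have p1 : ∀ x, (∑ i ∈ s, F i x) ^ 2 ≤ S * ∑ i ∈ s, (q ^ (2 * d i))⁻¹ * F i x ^ 2 := by
    intro x
    have e1 : ∑ i ∈ s, F i x = ∑ i ∈ s, q ^ (d i) * ((q ^ (d i))⁻¹ * F i x) := by
      refine Finset.sum_congr rfl fun i _ => ?_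
      rw [← mul_assoc, ENNReal.mul_inv_cancel (hqz _) (hqt _), one_mul]
    rw [e1]
    refine (ennreal_sq_sum_mul_le _ _ _).trans (mul_le_mul' ?_ (le_of_eq ?_))
    · simp_rw [← pow_mul, mul_comm _ 2]
      exact hS
    · refine Finset.sum_congr rfl fun i _ => ?_
      rw [mul_pow, ← ENNReal.inv_pow, ← pow_mul, mul_comm (d i) 2]
  have hm : ∀ i ∈ s, Measurable fun x => (q ^ (2 * d i))⁻¹ * F i x ^ 2 :=
    fun i hi => ((hF i hi).pow_const 2).const_mul _
  refine (lintegral_mono p1).trans ?_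
  rw [lintegral_const_mul _ (Finset.measurable_fun_sum _ hm), lintegral_finsetSum _ hm, sq,
      mul_assoc]
  refine mul_le_mul_right ?_ _
  calc _ ≤ ∑ i ∈ s, q ^ (2 * d i) * B := by
        refine Finset.sum_le_sum fun i hi => ?_
        rw [lintegral_const_mul _ ((hF i hi).pow_const 2)]
        refine (mul_le_mul_right (h i hi) _).trans (le_of_eq ?_)
        rw [show 4 * d i = 2 * d i + 2 * d i by ring, pow_add, ← mul_assoc, ← mul_assoc,
          ENNReal.inv_mul_cancel (hqz _) (hqt _), one_mul]
    _ ≤ S * B := by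
        rw [← Finset.sum_mul]; exact mul_le_mul_left hS _

lemma sum_natAbs_le (g : ℕ → ℝ≥0∞) (t : Finset ℤ) : ∑ s ∈ t, g s.natAbs ≤ 2 * ∑' n, g n := by
  have key : ∀ (s : Finset ℤ), (∀ x ∈ s, ∀ y ∈ s, x.natAbs = y.natAbs → x = y) →
      ∑ j ∈ s, g j.natAbs ≤ ∑' n, g n := by
    intro s hu
    rw [← Finset.sum_image (f := g) hu]
    exact ENNReal.sum_le_tsum _
  rw [← Finset.sum_filter_add_sum_filter_not t (fun j => 0 ≤ j), two_mul]
  refine add_le_add (key _ ?_) (key _ ?_)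
  · intro x hx y hy h
    simp only [Finset.mem_filter] at hx hy
    omega
  · intro x hx y hy h
    simp only [Finset.mem_filter] at hx hy
    omega

lemma le_mul_pow_of_two_bounds {q A v : ℝ≥0∞} (hq : q ≤ 1) {m n : ℕ} (h1 : v ≤ q ^ (8 * m) * A)
    (h2 : v ≤ q ^ (8 * n) * A) : v ≤ q ^ (4 * m) * (q ^ (4 * n) * A) := by
  rw [← mul_assoc, ← pow_add]
  rcases le_total m n with h | h
  · exact h2.trans (mul_le_mul_left (pow_le_pow_right_of_le_one' hq (by omega)) _)
  · exact h1.trans (mul_le_mul_left (pow_le_pow_right_of_le_one' hq (by omega)) _)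

lemma l2sq_eq_ofReal_integral {f : ℝ → ℂ} (hf : TestFun f) :
    (∫ x, conj (f x) * f x) = ((l2sq f).toReal : ℂ) := by
  have h1 : ∀ x, conj (f x) * f x = ((‖f x‖ ^ 2 : ℝ) : ℂ) := by
    intro x
    rw [mul_comm, Complex.mul_conj, Complex.normSq_eq_norm_sq]
  simp_rw [h1]
  rw [integral_complex_ofReal, integral_eq_lintegral_of_nonneg_ae
    (Filter.Eventually.of_forall fun x => by positivity)
    (hf.meas.norm.pow_const 2).aestronglyMeasurable]
  congr 2
  refine lintegral_congr fun x => ?_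
  rw [ENNReal.ofReal_pow (norm_nonneg _), ofReal_norm]

/-- Pythagoras for the orthogonal projection `dyExp n`. -/
lemma l2sq_eq_add (n : ℤ) {f : ℝ → ℂ} (hf : TestFun f) :
    l2sq f = l2sq (dyExp n f) + l2sq (fun x => f x - dyExp n f x) := by
  have hE := hf.dyExp n
  have hd := hf.sub hE
  have e1 : ∫ x, conj (f x) * f x = (∫ x, conj (dyExp n f x) * dyExp n f x) +
      ∫ x, conj (f x - dyExp n f x) * (f x - dyExp n f x) := by
    have a1 : ∫ x, conj (dyExp n f x) * f x = ∫ x, conj (f x) * dyExp n f x := by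
      simp_rw [← dyExp_conj]
      exact integral_dyExp_mul n hf.conjugate hf
    have a2 : ∫ x, conj (dyExp n f x) * dyExp n f x = ∫ x, conj (f x) * dyExp n f x := by
      simp_rw [← dyExp_conj]
      rw [integral_dyExp_mul n hf.conjugate hE]
      simp_rw [dyExp_dyExp_of_ge le_rfl f]
    have i1 := (hf.mul hf.conjugate).integrable
    have i2 := (hf.mul hE.conjugate).integrable
    have i3 := (hE.mul hf.conjugate).integrable
    have i4 := (hE.mul hE.conjugate).integrable
    have : ∀ x, conj (f x - dyExp n f x) * (f x - dyExp n f x) = (conj (f x) * f x -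
        conj (dyExp n f x) * f x) - (conj (f x) * dyExp n f x - conj (dyExp n f x) * dyExp n f x) := by
      intro x; rw [map_sub]; ring
    simp_rw [this]
    have e := integral_sub (i1.sub i2) (i3.sub i4)
    simp only [Pi.sub_apply] at e
    rw [e, integral_sub i1 i2, integral_sub i3 i4, a1, a2]
    ring
  rw [l2sq_eq_ofReal_integral hf, l2sq_eq_ofReal_integral hE, l2sq_eq_ofReal_integral hd,
    ← Complex.ofReal_add, Complex.ofReal_inj,
    ← ENNReal.toReal_add hE.l2sq_lt_top.ne hd.l2sq_lt_top.ne] at e1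
  exact (ENNReal.toReal_eq_toReal_iff' hf.l2sq_lt_top.ne
    (ENNReal.add_ne_top.2 ⟨hE.l2sq_lt_top.ne, hd.l2sq_lt_top.ne⟩)).1 e1

lemma l2sq_sub_dyExp_le (n : ℤ) {f : ℝ → ℂ} (hf : TestFun f) :
    l2sq (fun x => f x - dyExp n f x) ≤ l2sq f := by
  rw [l2sq_eq_add n hf]; exact le_add_self

/-- The dyadic martingale differences of `g`, going down from scale `2 ^ b`; the zeroth one is the
average at scale `2 ^ b` itself. -/
noncomputable def dyDiff (b : ℤ) (g : ℝ → ℂ) : ℕ → ℝ → ℂ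
  | 0 => dyExp b g
  | l + 1 => fun x => dyExp (b - (l + 1 : ℕ)) g x - dyExp (b - l) g x

lemma TestFun.dyDiff {g : ℝ → ℂ} (hg : TestFun g) (b : ℤ) (l : ℕ) : TestFun (dyDiff b g l) := by
  cases l with
  | zero => exact hg.dyExp b
  | succ l => exact (hg.dyExp _).sub (hg.dyExp _)

lemma sum_dyDiff (b : ℤ) (g : ℝ → ℂ) (M : ℕ) (x : ℝ) :
    ∑ l ∈ Finset.range (M + 1), dyDiff b g l x = dyExp (b - M) g x := by
  induction M with
  | zero => simp [dyDiff]
  | succ M ih => rw [Finset.sum_range_succ, ih, dyDiff]; ring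

lemma dyExp_dyDiff (b : ℤ) {g : ℝ → ℂ} (hg : TestFun g) (l : ℕ) :
    dyExp (b - l) (dyDiff b g l) = dyDiff b g l := by
  funext x
  cases l with
  | zero => simpa [dyDiff] using dyExp_dyExp_of_ge le_rfl g x
  | succ l =>
    have := (localKernel_dyKer (b - (l + 1 : ℕ))).kOp_sub (hg.dyExp (b - (l + 1 : ℕ))) (hg.dyExp (b - l)) x
    refine this.trans ?_
    rw [← dyExp, ← dyExp, dyExp_dyExp_of_ge le_rfl, dyExp_dyExp_of_ge (by push_cast; omega)]
    rfl

lemma dyExp_dyDiff_succ (b : ℤ) {g : ℝ → ℂ} (hg : TestFun g) (l : ℕ) :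
    dyExp (b - l) (dyDiff b g (l + 1)) = fun _ => 0 := by
  funext x
  have := (localKernel_dyKer (b - l)).kOp_sub (hg.dyExp (b - (l + 1 : ℕ))) (hg.dyExp (b - l)) x
  refine this.trans ?_
  rw [← dyExp, ← dyExp, dyExp_dyExp_of_ge le_rfl, dyExp_dyExp_of_le (by push_cast; omega) hg,
      sub_self]

lemma sum_l2sq_dyDiff_le (b : ℤ) {g : ℝ → ℂ} (hg : TestFun g) (M : ℕ) :
    ∑ l ∈ Finset.range (M + 1), l2sq (dyDiff b g l) ≤ l2sq g := by
  refine le_trans (le_of_eq ?_) (l2sq_dyExp_le (b - M) hg)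
  induction M with
  | zero => simp [dyDiff]
  | succ M ih =>
    rw [Finset.sum_range_succ, ih, l2sq_eq_add (b - M) (hg.dyExp (b - (M + 1 : ℕ)))]
    have : dyExp (b - M) (dyExp (b - (M + 1 : ℕ)) g) = dyExp (b - M) g :=
      funext fun x => dyExp_dyExp_of_le (by push_cast; omega) hg x
    rw [this]
    rfl

lemma hilOp_zero (k : ℤ) : hilOp k (fun _ => 0) = fun _ => 0 := by
  funext x; simp [hilOp, kOp]

lemma l2sq_hilOp_dyDiff_le (b : ℤ) {g : ℝ → ℂ} (hg : TestFun g) (i l : ℕ) :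
    l2sq (hilOp (b - i) (dyDiff b g l)) ≤
      decayRate ^ (8 * ((i - l) + (l - i))) * (7200 * l2sq (dyDiff b g l)) := by
  rcases le_or_gt l i with h | h
  · have := l2sq_hilOp_dyExp_le (hg.dyDiff b l) (b - i) (i - l)
    rw [show b - (i : ℤ) + (i - l : ℕ) = b - l by omega, dyExp_dyDiff b hg] at this
    rw [show i - l + (l - i) = i - l by omega]
    refine this.trans ?_
    calc _ = decayRate ^ (8 * (i - l)) * (3600 * l2sq (dyDiff b g l)) := by ring
      _ ≤ _ := by gcongr; norm_num
  · obtain ⟨l, rfl⟩ : ∃ l', l = l' + 1 := ⟨l - 1, by omega⟩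
    have := l2sq_hilOp_sub_hilOp_dyExp_le (hg.dyDiff b (l + 1)) (b - l) (l - i)
    rw [dyExp_dyDiff_succ b hg, show b - (l : ℤ) + (l - i : ℕ) = b - i by omega, hilOp_zero] at this
    simp only [sub_zero] at this
    refine this.trans (le_of_eq ?_)
    rw [show i - (l + 1) + (l + 1 - i) = (l - i) + 1 by omega, mul_add, pow_add, mul_one,
      decayRate_pow_eight]
    calc _ = decayRate ^ (8 * (l - i)) * (3600 * l2sq (dyDiff b g (l + 1))) := by ring
      _ = decayRate ^ (8 * (l - i)) * ((2⁻¹ * 2) * 3600 * l2sq (dyDiff b g (l + 1))) := by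
        rw [ENNReal.inv_mul_cancel (by simp) (by simp), one_mul]
      _ = _ := by ring

/-- The constant in `lintegral_sq_iSup_hilOp_le`. -/
noncomputable def hilConst : ℝ≥0∞ :=
  (2 * (1 - decayRate)⁻¹) ^ 2 * (partialSumConst decayRate * 7200)

lemma inv_one_sub_decayRate_ne_top : (1 - decayRate)⁻¹ ≠ ∞ := by
  rw [ENNReal.inv_ne_top]
  exact (tsub_pos_of_lt decayRate_lt_one).ne'

lemma hilConst_ne_top : hilConst ≠ ∞ := by
  have h1 := inv_one_sub_decayRate_ne_top
  have h2 := partialSumConst_ne_top decayRate_lt_one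
  unfold hilConst
  finiteness

lemma measurable_iSup_partialSum {φ : ℕ → ℝ → ℂ} (hφ : ∀ i, TestFun (φ i)) (s : Finset ℕ)
    (t : ℕ → Finset ℕ) : Measurable fun x => ⨆ j ∈ s, ‖∑ i ∈ t j, φ i x‖ₑ :=
  .biSup _ (Finset.countable_toSet s) fun _ _ => (TestFun.sum fun i _ => hφ i).enorm_meas

/-- The maximal truncations of the Hilbert transform are bounded on `L²`, uniformly in the range of
scales. The function is expanded in martingale differences, and the pieces with a fixed ratio
between the scales of the kernel and of the martingale difference are summed by
`lintegral_sq_iSup_partialSum_le`. -/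
theorem lintegral_sq_iSup_hilOp_le (b : ℤ) (M : ℕ) {g : ℝ → ℂ} (hg : TestFun g) :
    ∫⁻ x, (⨆ j ∈ Finset.range (M + 1), ‖∑ i ∈ Finset.range (j + 1),
      hilOp (b - i) (dyExp (b - M) g) x‖ₑ) ^ 2 ≤ hilConst * l2sq g := by
  classical
  set N := M + 1 with hN
  set D := dyDiff b g
  have hD : ∀ l, TestFun (D l) := fun l => hg.dyDiff b l
  -- The family with the kernel at scale `2 ^ (b - i)` and the martingale difference at scale
  -- `2 ^ (b - (i + s))`.
  set φ : ℤ → ℕ → ℝ → ℂ := fun s i =>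
    if 0 ≤ i + s ∧ i + s < N then hilOp (b - i) (D (i + s).toNat) else fun _ => 0 with hφ
  have hφt : ∀ s i, TestFun (φ s i) := by
    intro s i
    simp only [hφ]
    split_ifs
    · exact (hD _).hilOp _
    · exact TestFun.zero
  -- The bound for the squared norms of this family, up to the factor decaying in `s`.
  set A : ℤ → ℕ → ℝ≥0∞ := fun s i =>
    if 0 ≤ i + s ∧ i + s < N then 7200 * l2sq (D (i + s).toNat) else 0 with hA
  have hq1 := decayRate_lt_one
  have hzero : l2sq (fun _ => 0) = 0 := by simp [l2sq]
  have hEzero : ∀ n, dyExp n (fun _ => 0) = fun _ => 0 := fun n => by funext x; simp [dyExp, kOp]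
  have hb0 : ∀ s i, l2sq (φ s i) ≤ decayRate ^ (8 * s.natAbs) * A s i := by
    intro s i
    simp only [hφ, hA]
    split_ifs with h
    · have := l2sq_hilOp_dyDiff_le b hg i (i + s).toNat
      rwa [show i - (i + s).toNat + ((i + s).toNat - i) = s.natAbs by omega] at this
    · simp [hzero]
  have hAD : ∀ (s : ℤ) (i : ℕ), 3600 * l2sq (D (i + s).toNat) ≤ 7200 * l2sq (D (i + s).toNat) := by
    intro s i; gcongr; norm_num
  have main : ∀ s : ℤ, ∫⁻ x, (⨆ j ∈ Finset.range N, ‖∑ i ∈ Finset.range (j + 1), φ s i x‖ₑ) ^ 2 ≤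
      decayRate ^ (4 * s.natAbs) * (partialSumConst decayRate * 7200 * l2sq g) := by
    intro s
    have am := lintegral_sq_iSup_partialSum_le decayRate_ne_zero decayRate_lt_one
      (n := fun j => b - (j : ℤ)) (fun i j hij => by dsimp only; omega) (hφt s) (N := N)
      (a := fun i => decayRate ^ (4 * s.natAbs) * A s i) ?_ ?_ ?_
    · refine am.trans ?_
      rw [← Finset.mul_sum]
      have : ∑ i ∈ Finset.range N, A s i ≤ 7200 * l2sq g := by
        refine le_trans ?_ (mul_le_mul_right (sum_l2sq_dyDiff_le b hg M) _)
        simp only [hA]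
        rw [← Finset.sum_filter, ← Finset.mul_sum]
        refine mul_le_mul_right ?_ _
        rw [← Finset.sum_image (f := fun l => l2sq (D l)) (g := fun i : ℕ => ((i : ℤ) + s).toNat)]
        · refine Finset.sum_le_sum_of_subset fun l hl => ?_
          simp only [Finset.mem_image, Finset.mem_filter] at hl
          obtain ⟨i, ⟨_, h1, h2⟩, rfl⟩ := hl
          rw [Finset.mem_range]; omega
        · intro i hi j hj hij
          simp only [Finset.coe_filter, Set.mem_ofPred_eq] at hi hj
          dsimp only at hij
          omega
      calc _ ≤ partialSumConst decayRate * (decayRate ^ (4 * s.natAbs) * (7200 * l2sq g)) :=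
          by gcongr
        _ = _ := by ring
    · intro i _
      refine (hb0 s i).trans (mul_le_mul_left (pow_le_pow_right_of_le_one' hq1.le ?_) _)
      omega
    · intro i _ j hji
      -- Two bounds are available, one decaying in the distance of the averaging scale and one in
      -- `s`; their geometric mean decays in both.
      refine le_mul_pow_of_two_bounds hq1.le ?_ ((l2sq_dyExp_le _ (hφt s i)).trans (hb0 s i))
      simp only [hφ, hA]
      split_ifs with h
      · have := l2sq_dyExp_hilOp_le (hD (i + s).toNat) (b - i) (i - j)
        rw [show b - (i : ℤ) + (i - j : ℕ) = b - j by omega] at this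
        refine this.trans ?_
        rw [mul_comm 3600, mul_assoc]
        exact mul_le_mul_right (hAD s i) _
      · simp [hEzero, hzero]
    · intro j _ i hij
      refine le_mul_pow_of_two_bounds hq1.le ?_ ((l2sq_sub_dyExp_le _ (hφt s i)).trans (hb0 s i))
      simp only [hφ, hA]
      split_ifs with h
      · have := l2sq_hilOp_sub_dyExp_le (hD (i + s).toNat) (b - j) (j - i)
        rw [show b - (j : ℤ) + (j - i : ℕ) = b - i by omega] at this
        refine this.trans ?_
        rw [mul_comm 3600, mul_assoc]
        exact mul_le_mul_right (hAD s i) _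
      · simp [hEzero, hzero]
  -- Expanding `dyExp (b - M) g` in martingale differences and sorting by the ratio `s` of the
  -- scales.
  have hpt : ∀ x, (⨆ j ∈ Finset.range N, ‖∑ i ∈ Finset.range (j + 1),
      hilOp (b - i) (dyExp (b - M) g) x‖ₑ) ≤
      ∑ s ∈ Finset.Icc (-N : ℤ) N, ⨆ j ∈ Finset.range N, ‖∑ i ∈ Finset.range (j + 1), φ s i x‖ₑ := by
    intro x
    refine iSup₂_le fun j hj => ?_
    have e : ∑ i ∈ Finset.range (j + 1), hilOp (b - i) (dyExp (b - M) g) x =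
        ∑ s ∈ Finset.Icc (-N : ℤ) N, ∑ i ∈ Finset.range (j + 1), φ s i x := by
      rw [Finset.sum_comm]
      refine Finset.sum_congr rfl fun i hi => ?_
      have hiN : i < N := by
        rw [Finset.mem_range] at hi hj; omega
      have e1 : dyExp (b - M) g = fun x => ∑ l ∈ Finset.range N, D l x :=
        funext fun x => (sum_dyDiff b g M x).symm
      rw [e1, hilOp, (localKernel_hilKer _).kOp_sum fun l _ => hD l]
      have e2 : ∀ s, φ s i x = if 0 ≤ i + s ∧ i + s < N then
          kOp (hilKer (b - i)) (D (i + s).toNat) x else 0 := by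
        intro s; simp only [hφ]; split_ifs <;> rfl
      simp_rw [e2]
      rw [← Finset.sum_filter]
      refine Finset.sum_nbij' (fun l => (l : ℤ) - i) (fun s => (i + s).toNat) ?_ ?_ ?_ ?_ ?_
      · intro l hl
        simp only [Finset.mem_range] at hl
        simp only [Finset.mem_filter, Finset.mem_Icc]
        omega
      · intro s hs
        simp only [Finset.mem_filter, Finset.mem_Icc] at hs
        simp only [Finset.mem_range]
        omega
      · intro l _; omega
      · intro s hs
        simp only [Finset.mem_filter, Finset.mem_Icc] at hs
        omega
      · intro l _
        rw [show ((i : ℤ) + (l - i)).toNat = l by omega]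
    rw [e]
    refine (enorm_sum_le _ _).trans (Finset.sum_le_sum fun s _ => ?_)
    exact le_iSup₂ (f := fun j _ => ‖∑ i ∈ Finset.range (j + 1), φ s i x‖ₑ) j hj
  refine (lintegral_mono fun x => pow_le_pow_left' (hpt x) 2).trans ?_
  refine (lintegral_sq_sum_le (d := Int.natAbs) (S := 2 * (1 - decayRate)⁻¹)
    (F := fun s x => ⨆ j ∈ Finset.range N, ‖∑ i ∈ Finset.range (j + 1), φ s i x‖ₑ)
    (fun s _ => measurable_iSup_partialSum (hφt s) _ _)
    decayRate_ne_zero decayRate_ne_top (fun s _ => main s) ?_).trans (le_of_eq ?_)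
  · refine (sum_natAbs_le (fun m => decayRate ^ (2 * m)) _).trans ?_
    exact mul_le_mul_right (tsum_pow_two_mul_le _ hq1) _
  · rw [hilConst]; ring

/-! ### The weak type inequality -/

lemma exists_scale_ge {I t : ℝ≥0∞} (hI : I ≠ ∞) (ht : t ≠ 0) (htt : t ≠ ∞) (b : ℤ) :
    ∃ M : ℤ, b ≤ M ∧ I ≤ t * ENNReal.ofReal ((2 : ℝ) ^ M) := by
  obtain ⟨n, hn⟩ := pow_unbounded_of_one_lt (I / t).toReal (one_lt_two (α := ℝ))
  refine ⟨max b n, le_max_left _ _, ?_⟩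
  have h1 : I / t ≤ ENNReal.ofReal ((2 : ℝ) ^ (max b n)) := by
    rw [← ENNReal.ofReal_toReal (ENNReal.div_ne_top hI ht)]
    refine ENNReal.ofReal_le_ofReal (hn.le.trans ?_)
    rw [← zpow_natCast]
    exact two_zpow_mono (le_max_right _ _)
  calc I ≤ t * (I / t) := by
        rw [ENNReal.mul_div_cancel ht htt]
    _ ≤ _ := mul_le_mul_right h1 _

lemma lintegral_dyExp_le (n : ℤ) {f : ℝ → ℂ} (hf : TestFun f) :
    ∫⁻ x, ‖dyExp n f x‖ₑ ≤ ∫⁻ x, ‖f x‖ₑ :=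
  (lintegral_mono fun x => enorm_dyExp_le n f x).trans (lintegral_dyAvg n hf.enorm_meas).le

/-- The constant in the weak type `(1,1)` inequality for the maximally truncated Hilbert
transform. -/
noncomputable def hilWeakConst : ℝ≥0∞ := 8 * hilConst + 243

/-- The weak type `(1,1)` inequality for the maximally truncated Hilbert transform, by a
Calderón–Zygmund decomposition. -/
theorem mul_volume_iSup_hilOp_le (b : ℤ) (M : ℕ) {f : ℝ → ℂ} (hf : TestFun f) (t : ℝ≥0∞) :
    t * volume {x | t < ⨆ j ∈ Finset.range (M + 1), ‖∑ i ∈ Finset.range (j + 1),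
      hilOp (b - i) f x‖ₑ} ≤ hilWeakConst * ∫⁻ x, ‖f x‖ₑ := by
  classical
  rcases eq_or_ne t 0 with rfl | ht0
  · simp
  rcases eq_or_ne t ∞ with rfl | htt
  · simp
  set a : ℤ := b - M with ha
  set F : ℝ → ℝ≥0∞ := fun x => ‖f x‖ₑ with hF
  have hFm : Measurable F := hf.enorm_meas
  -- At scale `2 ^ L` all averages of `|f|` are at most `t`, so that no stopping interval is larger.
  obtain ⟨L, hbL, hL⟩ := exists_scale_ge hf.lintegral_lt_top.ne ht0 htt b
  have haL : a ≤ L := by omega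
  -- The part of `f` on the stopping intervals of scale `2 ^ m`; for `m = a` this includes the
  -- points at which no average is large.
  set h : ℤ → ℝ → ℂ := fun m => {x | stopScale F t a L x = m}.indicator f with hh
  have hht : ∀ m, TestFun (h m) := fun m => hf.indicator (measurableSet_stopScale m)
  have hhe : ∀ m, (fun x => ‖h m x‖ₑ) = {x | stopScale F t a L x = m}.indicator F := fun m => by
    funext x; exact enorm_indicator_eq_indicator_enorm _ _
  have hhsum : ∑ m ∈ Finset.Icc a L, ∫⁻ x, ‖h m x‖ₑ = ∫⁻ x, F x := by
    rw [← lintegral_finsetSum _ fun m _ => (hht m).enorm_meas]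
    refine lintegral_congr fun x => ?_
    rw [← sum_indicator_stopScale haL F x]
    exact Finset.sum_congr rfl fun m _ => congr_fun (hhe m) x
  have hhc : ∀ m x, h m x ≠ 0 → stopScale F t a L x = m := fun m x hx => by
    by_contra h'
    exact hx (indicator_of_notMem (s := {x | stopScale F t a L x = m}) h' f)
  have hEc : ∀ m x, dyExp m (h m) x ≠ 0 → stopScale F t a L x = m := fun m x hx => by
    by_contra h'
    refine hx (dyExp_eq_zero fun z hz => ?_)
    by_contra hz'
    exact h' ((stopScale_level_congr hz).2 (hhc m z hz'))
  -- The good function replaces each `h m` by its averages over the stopping intervals.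
  set g : ℝ → ℂ := fun x => ∑ m ∈ Finset.Icc a L, dyExp m (h m) x with hg
  have hgt : TestFun g := TestFun.sum fun m _ => (hht m).dyExp m
  have hgb : ∀ x, ‖g x‖ₑ ≤ 2 * t := by
    intro x
    have e : g x = dyExp (stopScale F t a L x) (h (stopScale F t a L x)) x := by
      refine Finset.sum_eq_single _ (fun m _ hm => ?_) fun hm => ?_
      · by_contra h'; exact hm (hEc m x h').symm
      · exact absurd (Finset.mem_Icc.2 ⟨left_le_stopScale x, stopScale_le haL x⟩) hm
    rw [e]
    refine (enorm_dyExp_le _ _ _).trans ?_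
    rw [hhe]
    exact dyAvg_indicator_stopScale_le hL le_rfl x
  have hg1 : ∫⁻ x, ‖g x‖ₑ ≤ ∫⁻ x, F x := by
    rw [← hhsum]
    refine (lintegral_mono fun x => enorm_sum_le _ _).trans ?_
    rw [lintegral_finsetSum _ fun m _ => ((hht m).dyExp m).enorm_meas]
    exact Finset.sum_le_sum fun m _ => lintegral_dyExp_le m (hht m)
  have hg2 : l2sq g ≤ 2 * t * ∫⁻ x, F x := by
    refine le_trans ?_ (mul_le_mul_right hg1 _)
    rw [← lintegral_const_mul _ hgt.enorm_meas]
    refine lintegral_mono fun x => ?_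
    rw [sq]; exact mul_le_mul_left (hgb x) _
  have hgE : dyExp a g = g := by
    funext x
    refine dyExp_of_const fun y hy => ?_
    refine Finset.sum_congr rfl fun m hm => dyExp_congr ?_
    exact dyIdx_eq_of_le (Finset.mem_Icc.1 hm).1 hy.symm
  -- The bad functions `h m - dyExp m (h m)` have mean zero on the stopping intervals of scale `m`.
  set bad : ℕ → ℤ → ℝ → ℂ := fun i m x => hilOp (b - i) (h m) x - hilOp (b - i) (dyExp m (h m)) x
    with hbad
  have hbadt : ∀ i m, TestFun (bad i m) := fun i m =>
    ((hht m).hilOp _).sub (((hht m).dyExp m).hilOp _)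
  have hdec : ∀ (i : ℕ) x, hilOp (b - i) f x = hilOp (b - i) g x +
      ∑ m ∈ Finset.Icc a L, bad i m x := by
    intro i x
    have e1 : f = fun x => ∑ m ∈ Finset.Icc a L, h m x :=
      funext fun x => (sum_indicator_stopScale haL f x).symm
    have e2 : hilOp (b - i) f x = ∑ m ∈ Finset.Icc a L, hilOp (b - i) (h m) x := by
      conv_lhs => rw [e1]
      exact (localKernel_hilKer _).kOp_sum (fun m _ => hht m) x
    have e3 : hilOp (b - i) g x = ∑ m ∈ Finset.Icc a L, hilOp (b - i) (dyExp m (h m)) x :=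
      (localKernel_hilKer _).kOp_sum (fun m _ => (hht m).dyExp m) x
    rw [e2, e3, ← Finset.sum_add_distrib]
    exact Finset.sum_congr rfl fun m _ => by simp only [hbad]; ring
  -- The exceptional set of points near a stopping interval.
  set Ω := {x : ℝ | ∃ m ∈ Icc a L, ∃ y, |x - y| ≤ (2 : ℝ) ^ m ∧ t < dyAvg m F y} with hΩ
  have hΩv : t * volume Ω ≤ 3 * ∫⁻ x, F x := mul_volume_dyAvg_near_le hFm
  -- Away from the exceptional set, a piece of the kernel does not reach the stopping intervals
  -- longer than its own scale.
  have hloc : ∀ i ∈ Finset.range (M + 1), ∀ m ∈ Finset.Icc a L, ¬ m ≤ b - i → ∀ x ∉ Ω,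
      bad i m x = 0 := by
    intro i hi m hm hmi x hx
    rw [Finset.mem_range] at hi
    rw [Finset.mem_Icc] at hm
    have key : ∀ u : ℝ → ℂ, (∀ y, u y ≠ 0 → stopScale F t a L y = m) → hilOp (b - i) u x = 0 := by
      intro u hu
      rw [hilOp, kOp, ← integral_zero ℝ ℂ (μ := volume)]
      congr 1; funext y
      by_cases hy : u y = 0
      · rw [hy, mul_zero]
      · rw [hilKer_of_le, zero_mul]
        by_contra! hlt
        have hs := hu y hy
        refine hx ⟨m, hm, y, hlt.le.trans (two_zpow_mono (by omega)), ?_⟩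
        rw [← hs]
        exact lt_dyAvg_stopScale (by omega)
    simp only [hbad]
    rw [key _ (hhc m), key _ (hEc m), sub_zero]
  set A : ℝ → ℝ≥0∞ := fun x => ⨆ j ∈ Finset.range (M + 1), ‖∑ i ∈ Finset.range (j + 1),
    hilOp (b - i) g x‖ₑ with hA
  set B : ℝ → ℝ≥0∞ := fun x => ∑ i ∈ Finset.range (M + 1), ∑ m ∈ Finset.Icc a L,
    if m ≤ b - i then ‖bad i m x‖ₑ else 0 with hB
  have hBm1 : ∀ (i : ℕ) (m : ℤ), Measurable fun x => if m ≤ b - (i : ℤ) then ‖bad i m x‖ₑ else 0 := by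
    intro i m
    split_ifs
    · exact (hbadt i m).enorm_meas
    · exact measurable_const
  have hBm2 : ∀ i : ℕ, Measurable fun x => ∑ m ∈ Finset.Icc a L,
      if m ≤ b - (i : ℤ) then ‖bad i m x‖ₑ else 0 :=
    fun i => Finset.measurable_fun_sum _ fun m _ => hBm1 i m
  have hBm : Measurable B := Finset.measurable_fun_sum _ fun i _ => hBm2 i
  have hpt : ∀ x ∉ Ω, (⨆ j ∈ Finset.range (M + 1), ‖∑ i ∈ Finset.range (j + 1),
      hilOp (b - i) f x‖ₑ) ≤ A x + B x := by
    intro x hx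
    refine iSup₂_le fun j hj => ?_
    simp_rw [hdec, Finset.sum_add_distrib]
    refine (enorm_add_le _ _).trans (add_le_add ?_ ?_)
    · exact le_iSup₂ (f := fun j _ => ‖∑ i ∈ Finset.range (j + 1), hilOp (b - i) g x‖ₑ) j hj
    · refine (enorm_sum_le _ _).trans ?_
      have hsub : Finset.range (j + 1) ⊆ Finset.range (M + 1) := by
        intro i; simp only [Finset.mem_range] at hj ⊢; omega
      refine (Finset.sum_le_sum_of_subset hsub).trans (Finset.sum_le_sum fun i hi => ?_)
      refine (enorm_sum_le _ _).trans (Finset.sum_le_sum fun m hm => ?_)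
      split_ifs with hmi
      · exact le_rfl
      · rw [hloc i hi m hm hmi x hx]; simp
  -- At scales above the stopping scale, the cancellation of the bad functions makes the sum over
  -- all scales converge in `L¹`, so that no maximal inequality is needed.
  have hBint : ∫⁻ x, B x ≤ 120 * ∫⁻ x, F x := by
    simp only [hB]
    rw [lintegral_finsetSum _ fun i _ => hBm2 i]
    simp_rw [lintegral_finsetSum _ fun m _ => hBm1 _ m]
    rw [Finset.sum_comm, ← hhsum, Finset.mul_sum]
    refine Finset.sum_le_sum fun m _ => ?_
    have h1 : ∀ i ∈ Finset.range (M + 1), (∫⁻ x, if m ≤ b - (i : ℤ) then ‖bad i m x‖ₑ else 0) ≤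
        if m ≤ b - (i : ℤ) then 60 * (2 : ℝ≥0∞)⁻¹ ^ (b - i - m).toNat * ∫⁻ x, ‖h m x‖ₑ else 0 := by
      intro i _
      split_ifs with hmi
      · have := lintegral_hilOp_sub_hilOp_dyExp_le (hht m) m (b - i - m).toNat
        rwa [show m + ((b - i - m).toNat : ℤ) = b - i by omega] at this
      · simp
    refine (Finset.sum_le_sum h1).trans ?_
    rw [← Finset.sum_filter, ← Finset.sum_mul, ← Finset.mul_sum]
    refine mul_le_mul_left ?_ _
    have h2 : ∑ i ∈ (Finset.range (M + 1)).filter (fun i : ℕ => m ≤ b - (i : ℤ)),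
        (2 : ℝ≥0∞)⁻¹ ^ (b - i - m).toNat ≤ 2 := by
      rw [← Finset.sum_image (f := fun n : ℕ => (2 : ℝ≥0∞)⁻¹ ^ n)
        (g := fun i : ℕ => (b - (i : ℤ) - m).toNat)]
      · refine (ENNReal.sum_le_tsum _).trans ?_
        rw [ENNReal.tsum_geometric, ENNReal.one_sub_inv_two, inv_inv]
      · intro i hi j hj hij
        simp only [Finset.coe_filter, Set.mem_ofPred_eq] at hi hj
        dsimp only at hij
        omega
    calc _ ≤ (60 : ℝ≥0∞) * 2 := mul_le_mul_right h2 _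
      _ = 120 := by norm_num
  -- The good part is treated by Chebyshev's inequality in `L²`.
  have hAv : t * volume {x | t / 2 ≤ A x} ≤ 8 * hilConst * ∫⁻ x, F x := by
    have h1 := mul_meas_ge_le_lintegral₀ (μ := volume) (f := fun x => A x ^ 2)
      ((measurable_iSup_partialSum (fun i => hgt.hilOp (b - i)) _ _).pow_const 2).aemeasurable
      ((t / 2) ^ 2)
    have h2 := lintegral_sq_iSup_hilOp_le b M hgt
    rw [← ha, hgE] at h2
    have h3 : {x | t / 2 ≤ A x} ⊆ {x | (t / 2) ^ 2 ≤ A x ^ 2} := fun x hx =>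
      show (t / 2) ^ 2 ≤ A x ^ 2 from pow_le_pow_left' hx 2
    have h4 : (t / 2) ^ 2 * volume {x | t / 2 ≤ A x} ≤ hilConst * (2 * t * ∫⁻ x, F x) :=
      (mul_le_mul_right (measure_mono h3) _).trans (h1.trans (h2.trans (mul_le_mul_right hg2 _)))
    have h5 : t * (t * volume {x | t / 2 ≤ A x}) ≤ t * (8 * hilConst * ∫⁻ x, F x) := by
      have h6 : t = 2 * (t / 2) := (ENNReal.mul_div_cancel (by simp) (by simp)).symm
      calc _ = 4 * ((t / 2) ^ 2 * volume {x | t / 2 ≤ A x}) := by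
            generalize volume {x | t / 2 ≤ A x} = V
            calc t * (t * V) = (2 * (t / 2)) * ((2 * (t / 2)) * V) := by rw [← h6]
              _ = _ := by ring
        _ ≤ 4 * (hilConst * (2 * t * ∫⁻ x, F x)) := mul_le_mul_right h4 _
        _ = _ := by ring
    exact (ENNReal.mul_le_mul_iff_right ht0 htt).1 h5
  have hBv : t * volume {x | t / 2 ≤ B x} ≤ 240 * ∫⁻ x, F x := by
    have h1 := mul_meas_ge_le_lintegral₀ (μ := volume) hBm.aemeasurable (t / 2)
    calc _ = 2 * (t / 2 * volume {x | t / 2 ≤ B x}) := by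
          rw [← mul_assoc, ENNReal.mul_div_cancel (by simp) (by simp)]
      _ ≤ 2 * (120 * ∫⁻ x, F x) := mul_le_mul_right (h1.trans hBint) _
      _ = _ := by rw [← mul_assoc]; norm_num
  have hsub : {x | t < ⨆ j ∈ Finset.range (M + 1), ‖∑ i ∈ Finset.range (j + 1),
      hilOp (b - i) f x‖ₑ} ⊆ {x | t / 2 ≤ A x} ∪ {x | t / 2 ≤ B x} ∪ Ω := by
    intro x hx
    by_cases hxΩ : x ∈ Ω
    · exact Or.inr hxΩ
    · left
      by_contra hcon
      rw [mem_union, not_or] at hcon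
      have h1 : A x < t / 2 := not_le.1 hcon.1
      have h2 : B x < t / 2 := not_le.1 hcon.2
      have := (lt_of_lt_of_le hx (hpt x hxΩ)).trans (ENNReal.add_lt_add h1 h2)
      rw [ENNReal.add_halves] at this
      exact lt_irrefl _ this
  calc _ ≤ t * (volume {x | t / 2 ≤ A x} + volume {x | t / 2 ≤ B x} + volume Ω) :=
        mul_le_mul_right ((measure_mono hsub).trans ((measure_union_le _ _).trans
          (add_le_add_left (measure_union_le _ _) _))) _
    _ = t * volume {x | t / 2 ≤ A x} + t * volume {x | t / 2 ≤ B x} + t * volume Ω := by ring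
    _ ≤ 8 * hilConst * (∫⁻ x, F x) + 240 * (∫⁻ x, F x) + 3 * ∫⁻ x, F x := by gcongr
    _ = _ := by rw [hilWeakConst]; ring

lemma hilWeakConst_ne_top : hilWeakConst ≠ ∞ := by
  have := hilConst_ne_top
  unfold hilWeakConst
  finiteness

/-! ### Oscillatory integrals -/

/-- Van der Corput's first derivative test, in the form obtained from one integration by parts. -/
lemma norm_integral_exp_le {a b : ℝ} (hab : a ≤ b) {θ θ' P P' : ℝ → ℝ} {τ : ℝ} (hτ : |τ| = 1)
    (hθ : ∀ u ∈ Icc a b, HasDerivAt θ (θ' u) u) (hP : ∀ u ∈ Icc a b, HasDerivAt P (P' u) u)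
    (hP0 : ∀ u ∈ Icc a b, 0 < P u) (hP' : ∀ u ∈ Icc a b, 0 ≤ P' u)
    (hθc : ContinuousOn θ' (Icc a b)) (hPc : ContinuousOn P' (Icc a b)) :
    ‖∫ u in a..b, ((θ' u / P u : ℝ) : ℂ) * Complex.exp (Complex.I * τ * θ u)‖ ≤ 2 / P a := by
  have hτ0 : (τ : ℂ) ≠ 0 := by
    intro h
    rw [Complex.ofReal_eq_zero] at h
    rw [h] at hτ; simp at hτ
  set v : ℝ → ℂ := fun u => Complex.exp (Complex.I * τ * θ u) / (Complex.I * τ) with hv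
  set v' : ℝ → ℂ := fun u => (θ' u : ℂ) * Complex.exp (Complex.I * τ * θ u) with hv'
  set w : ℝ → ℂ := fun u => ((P u)⁻¹ : ℝ) with hw
  set w' : ℝ → ℂ := fun u => (-(P' u) / P u ^ 2 : ℝ) with hw'
  have hI : uIcc a b = Icc a b := uIcc_of_le hab
  have dv : ∀ u ∈ uIcc a b, HasDerivAt v (v' u) u := by
    intro u hu
    rw [hI] at hu
    have h1 := (((hθ u hu).ofReal_comp.const_mul (Complex.I * τ)).cexp).div_const (Complex.I * τ)
    refine h1.congr_deriv ?_
    simp only [hv']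
    have := Complex.I_ne_zero
    field_simp
  have dwr : ∀ u ∈ uIcc a b, HasDerivAt (fun u => (P u)⁻¹) (-(P' u) / P u ^ 2) u := by
    intro u hu
    rw [hI] at hu
    exact (hP u hu).inv (hP0 u hu).ne'
  have dw : ∀ u ∈ uIcc a b, HasDerivAt w (w' u) u := fun u hu => (dwr u hu).ofReal_comp
  have hθcont : ContinuousOn θ (Icc a b) := fun u hu => (hθ u hu).continuousAt.continuousWithinAt
  have hPcont : ContinuousOn P (Icc a b) := fun u hu => (hP u hu).continuousAt.continuousWithinAt
  have cv' : ContinuousOn v' (Icc a b) := by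
    refine ContinuousOn.mul (Complex.continuous_ofReal.comp_continuousOn hθc) ?_
    exact Complex.continuous_exp.comp_continuousOn
      (continuousOn_const.mul (Complex.continuous_ofReal.comp_continuousOn hθcont))
  have cwr : ContinuousOn (fun u => -(P' u) / P u ^ 2) (Icc a b) :=
    hPc.neg.div (hPcont.pow 2) fun u hu => (pow_pos (hP0 u hu) 2).ne'
  have cw' : ContinuousOn w' (Icc a b) := Complex.continuous_ofReal.comp_continuousOn cwr
  have iw' : IntervalIntegrable w' volume a b := (hI ▸ cw').intervalIntegrable
  have iwr : IntervalIntegrable (fun u => -(P' u) / P u ^ 2) volume a b :=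
      (hI ▸ cwr).intervalIntegrable
  have iv' : IntervalIntegrable v' volume a b := (hI ▸ cv').intervalIntegrable
  -- Integration by parts, with `exp (i τ θ)` as the antiderivative of `θ' exp (i τ θ)` up to a
  -- constant factor and `1 / P` as the other factor, which is monotone.
  have key := intervalIntegral.integral_mul_deriv_eq_deriv_mul dw dv iw' iv'
  have e : ∀ u, ((θ' u / P u : ℝ) : ℂ) * Complex.exp (Complex.I * τ * θ u) = w u * v' u := by
    intro u
    simp only [hw, hv']
    push_cast
    rw [div_eq_mul_inv]; ring
  have nv : ∀ u, ‖v u‖ = 1 := by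
    intro u
    simp only [hv]
    rw [norm_div, norm_mul, Complex.norm_I, Complex.norm_real, Real.norm_eq_abs, hτ,
      show Complex.I * τ * θ u = ((τ * θ u : ℝ) : ℂ) * Complex.I by push_cast; ring,
      Complex.norm_exp_ofReal_mul_I]
    norm_num
  have nw : ∀ u ∈ Icc a b, ‖w u‖ = (P u)⁻¹ := by
    intro u hu
    simp only [hw]
    rw [Complex.norm_real, Real.norm_of_nonneg (inv_nonneg.2 (hP0 u hu).le)]
  have hint : ‖∫ u in a..b, w' u * v u‖ ≤ (P a)⁻¹ - (P b)⁻¹ := by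
    have h1 : ∀ u ∈ Ioc a b, ‖w' u * v u‖ ≤ -(-(P' u) / P u ^ 2) := by
      intro u hu
      have hu' := Ioc_subset_Icc_self hu
      rw [norm_mul, nv, mul_one]
      simp only [hw']
      rw [Complex.norm_real, Real.norm_eq_abs, abs_of_nonpos]
      rw [neg_div]
      exact neg_nonpos.2 (div_nonneg (hP' u hu') (sq_nonneg _))
    refine (intervalIntegral.norm_integral_le_of_norm_le hab
      (Filter.Eventually.of_forall h1) iwr.neg).trans (le_of_eq ?_)
    rw [intervalIntegral.integral_neg, intervalIntegral.integral_eq_sub_of_hasDerivAt dwr iwr]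
    ring
  simp_rw [e]
  rw [key]
  have ha := nw a (left_mem_Icc.2 hab)
  have hb := nw b (right_mem_Icc.2 hab)
  calc _ ≤ ‖w b * v b‖ + ‖w a * v a‖ + ‖∫ u in a..b, w' u * v u‖ :=
        (norm_sub_le _ _).trans (add_le_add_left (norm_sub_le _ _) _)
    _ ≤ (P b)⁻¹ + (P a)⁻¹ + ((P a)⁻¹ - (P b)⁻¹) := by
        rw [norm_mul, norm_mul, nv, nv, ha, hb]; linarith
    _ = _ := by ring

/-- The piece `exp (2 π i τ u ^ d) / u` of the oscillating kernel, restricted to `A < u ≤ 2 A`. -/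
noncomputable def oscPiece (d : ℕ) (τ A u : ℝ) : ℂ :=
  (Ioc A (2 * A)).indicator
    (fun u : ℝ => Complex.exp (Complex.I * τ * (2 * Real.pi * u ^ d : ℝ)) / u) u

lemma norm_exp_I_mul (τ t : ℝ) : ‖Complex.exp (Complex.I * τ * (t : ℂ))‖ = 1 := by
  rw [show Complex.I * τ * (t : ℂ) = ((τ * t : ℝ) : ℂ) * Complex.I by push_cast; ring,
    Complex.norm_exp_ofReal_mul_I]

lemma oscPiece_of_mem {d : ℕ} {τ A u : ℝ} (h : u ∈ Ioc A (2 * A)) :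
    oscPiece d τ A u = Complex.exp (Complex.I * τ * (2 * Real.pi * u ^ d : ℝ)) / u :=
  indicator_of_mem h _

lemma oscPiece_of_notMem {d : ℕ} {τ A u : ℝ} (h : u ∉ Ioc A (2 * A)) : oscPiece d τ A u = 0 :=
  indicator_of_notMem h _

lemma measurable_oscPiece (d : ℕ) (τ A : ℝ) : Measurable (oscPiece d τ A) := by
  refine Measurable.indicator ?_ measurableSet_Ioc
  refine Measurable.div ?_ Complex.measurable_ofReal
  fun_prop

lemma norm_oscPiece_le {d : ℕ} {τ A : ℝ} (hA : 0 < A) (u : ℝ) : ‖oscPiece d τ A u‖ ≤ A⁻¹ := by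
  by_cases h : u ∈ Ioc A (2 * A)
  · rw [oscPiece_of_mem h, norm_div, norm_exp_I_mul, Complex.norm_real,
      Real.norm_of_nonneg (hA.trans h.1).le, one_div]
    exact inv_anti₀ hA h.1.le
  · rw [oscPiece_of_notMem h, norm_zero]; positivity

/-- The oscillation makes all integrals of the kernel over intervals small. -/
lemma norm_integral_oscPiece_le {d : ℕ} (hd : 1 ≤ d) {τ A : ℝ} (hτ : |τ| = 1) (hA : 0 < A)
    {p q : ℝ} (hpq : p ≤ q) : ‖∫ u in p..q, oscPiece d τ A u‖ ≤ (d * A ^ d)⁻¹ := by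
  have hd0 : (0 : ℝ) < d := by exact_mod_cast hd
  rw [intervalIntegral.integral_of_le hpq]
  unfold oscPiece
  rw [setIntegral_indicator measurableSet_Ioc, Ioc_inter_Ioc]
  rcases le_total (p ⊔ A) (q ⊓ (2 * A)) with h | h
  · rw [← intervalIntegral.integral_of_le h]
    set a := p ⊔ A with ha
    set b := q ⊓ (2 * A)
    have haA : A ≤ a := le_sup_right
    -- Here `θ' / P = 1 / u`, and `P` is increasing.
    have key := norm_integral_exp_le h hτ (θ := fun u => 2 * Real.pi * u ^ d)
      (θ' := fun u => 2 * Real.pi * (d * u ^ (d - 1))) (P := fun u => 2 * Real.pi * d * u ^ d)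
      (P' := fun u => 2 * Real.pi * d * (d * u ^ (d - 1))) ?_ ?_ ?_ ?_ ?_ ?_
    · have e : ∫ u in a..b, Complex.exp (Complex.I * τ * (2 * Real.pi * u ^ d : ℝ)) / u =
          ∫ u in a..b, (((2 * Real.pi * (d * u ^ (d - 1))) / (2 * Real.pi * d * u ^ d) : ℝ) : ℂ) *
            Complex.exp (Complex.I * τ * (2 * Real.pi * u ^ d : ℝ)) := by
        refine intervalIntegral.integral_congr fun u hu => ?_
        rw [uIcc_of_le h] at hu
        have hu0 : 0 < u := hA.trans_le (haA.trans hu.1)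
        have : (2 * Real.pi * (d * u ^ (d - 1))) / (2 * Real.pi * d * u ^ d) = u⁻¹ := by
          have := Real.pi_pos
          obtain ⟨n, rfl⟩ : ∃ n, d = n + 1 := ⟨d - 1, by omega⟩
          rw [Nat.add_sub_cancel, pow_succ]
          field_simp
        simp only [this]
        push_cast
        rw [div_eq_mul_inv, mul_comm]
      rw [e]
      refine key.trans ?_
      have h1 : A ^ d ≤ a ^ d := pow_le_pow_left₀ hA.le haA d
      rw [div_le_iff₀ (by have := hA.trans_le haA; have := Real.pi_pos; positivity),
        ← div_eq_inv_mul, le_div_iff₀ (by positivity)]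
      have h2 : d * A ^ d ≤ d * a ^ d := by gcongr
      have h3 : (3 : ℝ) < Real.pi := Real.pi_gt_three
      have h4 : 0 < d * A ^ d := by positivity
      nlinarith
    · intro u _
      exact (hasDerivAt_pow d u).const_mul _
    · intro u _
      exact (hasDerivAt_pow d u).const_mul _
    · intro u hu
      have := hA.trans_le (haA.trans hu.1)
      have := Real.pi_pos
      positivity
    · intro u hu
      have := hA.trans_le (haA.trans hu.1)
      have := Real.pi_pos
      positivity
    · fun_prop
    · fun_prop
  · rw [Ioc_eq_empty (not_lt.2 h)]
    simp only [Measure.restrict_empty, integral_zero_measure, norm_zero]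
    positivity

lemma le_add_pow_sub_pow {u h : ℝ} (hu : 1 ≤ u) (hh : 0 ≤ h) {n : ℕ} (hn : 1 ≤ n) :
    h ≤ (u + h) ^ n - u ^ n := by
  obtain ⟨m, rfl⟩ : ∃ m, n = m + 1 := ⟨n - 1, by omega⟩
  have h1 : u ^ m ≤ (u + h) ^ m := pow_le_pow_left₀ (by linarith) (by linarith) m
  have h2 : 1 ≤ (u + h) ^ m := one_le_pow₀ (by linarith)
  rw [pow_succ, pow_succ]
  nlinarith

/-- The autocorrelation of the oscillating kernel decays. -/
lemma norm_integral_conj_oscPiece_mul_le {d : ℕ} (hd : 2 ≤ d) {τ A h : ℝ} (hτ : |τ| = 1)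
    (hA : 1 ≤ A) (hh : 0 < h) :
    ‖∫ v, conj (oscPiece d τ A v) * oscPiece d τ A (v + h)‖ ≤ (A ^ 2 * h)⁻¹ := by
  have hA0 : 0 < A := by linarith
  have hd0 : (0 : ℝ) < d := by positivity
  have hpi := Real.pi_gt_three
  set F : ℝ → ℂ := fun v => ((1 / (v * (v + h)) : ℝ) : ℂ) *
    Complex.exp (Complex.I * τ * (2 * Real.pi * ((v + h) ^ d - v ^ d) : ℝ)) with hF
  have e1 : (fun v => conj (oscPiece d τ A v) * oscPiece d τ A (v + h)) =
      (Ioc A (2 * A - h)).indicator F := by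
    funext v
    by_cases hv : v ∈ Ioc A (2 * A - h)
    · have m1 : v ∈ Ioc A (2 * A) := ⟨hv.1, by linarith [hv.2]⟩
      have m2 : v + h ∈ Ioc A (2 * A) := ⟨by linarith [hv.1], by linarith [hv.2]⟩
      rw [indicator_of_mem hv, oscPiece_of_mem m1, oscPiece_of_mem m2]
      simp only [hF]
      rw [map_div₀, ← Complex.exp_conj, map_mul, map_mul, Complex.conj_I, Complex.conj_ofReal,
        Complex.conj_ofReal, Complex.conj_ofReal, div_mul_div_comm, ← Complex.exp_add]
      push_cast
      rw [one_div, div_eq_inv_mul]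
      congr 2
      ring
    · rw [indicator_of_notMem hv]
      by_cases m1 : v ∈ Ioc A (2 * A)
      · rw [oscPiece_of_notMem (u := v + h), mul_zero]
        intro m2
        exact hv ⟨m1.1, by linarith [m2.2]⟩
      · rw [oscPiece_of_notMem m1, map_zero, zero_mul]
  rw [e1, integral_indicator measurableSet_Ioc]
  rcases le_total A (2 * A - h) with hle | hle
  · rw [← intervalIntegral.integral_of_le hle]
    -- `D` is the derivative of the difference of the phases. It is at least `2 h` and increasing,
    -- so that `P v = v (v + h) D v` is increasing and `D / P` is the amplitude.
    set D : ℝ → ℝ := fun v => 2 * Real.pi * (d * (v + h) ^ (d - 1) - d * v ^ (d - 1)) with hD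
    set D' : ℝ → ℝ := fun v => 2 * Real.pi * (d * (((d - 1 : ℕ) : ℝ) * (v + h) ^ (d - 1 - 1)) -
      d * (((d - 1 : ℕ) : ℝ) * v ^ (d - 1 - 1))) with hD'
    have dD : ∀ v, HasDerivAt (fun v => 2 * Real.pi * ((v + h) ^ d - v ^ d)) (D v) v := by
      intro v
      have h1 : HasDerivAt (fun v => (v + h) ^ d) (d * (v + h) ^ (d - 1)) v := by
        simpa using ((hasDerivAt_id v).add_const h).fun_pow d
      exact ((h1.sub (hasDerivAt_pow d v)).const_mul _)
    have dD' : ∀ v, HasDerivAt D (D' v) v := by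
      intro v
      have h1 : HasDerivAt (fun v => (v + h) ^ (d - 1))
          (((d - 1 : ℕ) : ℝ) * (v + h) ^ (d - 1 - 1)) v := by
        simpa using ((hasDerivAt_id v).add_const h).fun_pow (d - 1)
      exact (((h1.const_mul _).sub ((hasDerivAt_pow (d - 1) v).const_mul _)).const_mul _)
    have hDlow : ∀ v, A ≤ v → 2 * h ≤ D v := by
      intro v hv
      have h1 := le_add_pow_sub_pow (u := v) (by linarith) hh.le (n := d - 1) (by omega)
      have h2 : (1 : ℝ) ≤ d := by exact_mod_cast (by omega : 1 ≤ d)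
      have h3 : D v = 2 * (Real.pi * (d * ((v + h) ^ (d - 1) - v ^ (d - 1)))) := by
        simp only [hD]; ring
      have h5 : h ≤ d * ((v + h) ^ (d - 1) - v ^ (d - 1)) := by nlinarith
      rw [h3]; nlinarith
    have hD'0 : ∀ v, A ≤ v → 0 ≤ D' v := by
      intro v hv
      have h1 : v ^ (d - 1 - 1) ≤ (v + h) ^ (d - 1 - 1) :=
        pow_le_pow_left₀ (by linarith) (by linarith) _
      have : D' v =
          2 * Real.pi * d * ((d - 1 : ℕ) : ℝ) * ((v + h) ^ (d - 1 - 1) - v ^ (d - 1 - 1)) := by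
        simp only [hD']; ring
      rw [this]
      have := sub_nonneg.2 h1
      positivity
    have key := norm_integral_exp_le hle hτ (θ := fun v => 2 * Real.pi * ((v + h) ^ d - v ^ d))
      (θ' := D) (P := fun v => v * (v + h) * D v)
      (P' := fun v => (1 * (v + h) + v * 1) * D v + v * (v + h) * D' v) ?_ ?_ ?_ ?_ ?_ ?_
    · have e2 : ∫ v in A..(2 * A - h), F v = ∫ v in A..(2 * A - h),
          ((D v / (v * (v + h) * D v) : ℝ) : ℂ) *
            Complex.exp (Complex.I * τ * (2 * Real.pi * ((v + h) ^ d - v ^ d) : ℝ)) := by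
        refine intervalIntegral.integral_congr fun v hv => ?_
        rw [uIcc_of_le hle] at hv
        have h1 : 0 < v := by linarith [hv.1]
        have h2 : 0 < D v := by linarith [hDlow v hv.1]
        have h3 : D v / (v * (v + h) * D v) = 1 / (v * (v + h)) := by field_simp
        simp only [hF, h3]
      rw [e2]
      refine key.trans ?_
      have h1 := hDlow A le_rfl
      have h2 : 2 * (A ^ 2 * h) ≤ A * (A + h) * D A := by
        calc 2 * (A ^ 2 * h) = A * A * (2 * h) := by ring
          _ ≤ A * (A + h) * D A := by gcongr; linarith
      rw [div_le_iff₀ (lt_of_lt_of_le (by positivity) h2), ← div_eq_inv_mul,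
        le_div_iff₀ (by positivity)]
      exact h2
    · exact fun v _ => dD v
    · intro v _
      have h1 : HasDerivAt (fun v => v * (v + h)) (1 * (v + h) + v * 1) v :=
        (hasDerivAt_id v).mul ((hasDerivAt_id v).add_const h)
      exact h1.mul (dD' v)
    · intro v hv
      have h1 : 0 < v := by linarith [hv.1]
      have h2 : 0 < D v := by linarith [hDlow v hv.1]
      positivity
    · intro v hv
      have h1 : 0 < v := by linarith [hv.1]
      have h2 : 0 < D v := by linarith [hDlow v hv.1]
      have h3 := hD'0 v hv.1
      positivity
    · simp only [hD]; fun_prop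
    · simp only [hD, hD']; fun_prop
  · rw [Ioc_eq_empty (not_lt.2 hle)]
    simp only [Measure.restrict_empty, integral_zero_measure, norm_zero]
    positivity

/-- The `L¹` modulus of continuity of the oscillating kernel. -/
lemma lintegral_oscPiece_sub_le {d : ℕ} (hd : 1 ≤ d) {τ A h : ℝ} (hτ : |τ| = 1)
    (hA : 1 ≤ A) (hh : 0 ≤ h) :
    ∫⁻ u, ‖oscPiece d τ A u - oscPiece d τ A (u + h)‖ₑ ≤
      ENNReal.ofReal (10 * (h * (d * (2 * A) ^ (d - 1)))) := by
  have hA0 : 0 < A := by linarith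
  have hd1 : (1 : ℝ) ≤ d := by exact_mod_cast hd
  have hpi := Real.pi_pos
  set L : ℝ := 2 * Real.pi * d * (2 * A) ^ (d - 1) / A + 1 / A ^ 2 with hL
  have hL0 : 0 ≤ L := by positivity
  set F : ℝ → ℂ := fun u : ℝ => Complex.exp (Complex.I * τ * (2 * Real.pi * u ^ d : ℝ)) / u with hF
  set F' : ℝ → ℂ := fun u => (Complex.exp (Complex.I * τ * (2 * Real.pi * u ^ d : ℝ)) *
    (Complex.I * τ * (2 * Real.pi * (d * u ^ (d - 1)) : ℝ)) * u -
      Complex.exp (Complex.I * τ * (2 * Real.pi * u ^ d : ℝ)) * 1) / (u : ℂ) ^ 2 with hF'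
  have hder : ∀ u ∈ Icc A (2 * A), HasDerivWithinAt F (F' u) (Icc A (2 * A)) u := by
    intro u hu
    have hu0 : (u : ℂ) ≠ 0 := by
      have : 0 < u := hA0.trans_le hu.1
      exact_mod_cast this.ne'
    have h1 : HasDerivAt (fun u : ℝ => 2 * Real.pi * u ^ d) (2 * Real.pi * (d * u ^ (d - 1))) u :=
      (hasDerivAt_pow d u).const_mul _
    have h2 := (h1.ofReal_comp.const_mul (Complex.I * τ)).cexp
    have h3 : HasDerivAt (fun u : ℝ => (u : ℂ)) 1 u := (hasDerivAt_id u).ofReal_comp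
    exact (h2.div h3 hu0).hasDerivWithinAt
  have hbd : ∀ u ∈ Icc A (2 * A), ‖F' u‖ ≤ L := by
    intro u hu
    have hu0 : 0 < u := hA0.trans_le hu.1
    simp only [hF']
    rw [norm_div, norm_pow, Complex.norm_real, Real.norm_of_nonneg hu0.le]
    have h1 : ‖Complex.exp (Complex.I * τ * (2 * Real.pi * u ^ d : ℝ)) *
        (Complex.I * τ * (2 * Real.pi * (d * u ^ (d - 1)) : ℝ)) * u -
        Complex.exp (Complex.I * τ * (2 * Real.pi * u ^ d : ℝ)) * 1‖ ≤
        2 * Real.pi * (d * u ^ (d - 1)) * u + 1 := by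
      refine (norm_sub_le _ _).trans ?_
      have h4 : ‖Complex.I * τ * (2 * Real.pi * (d * u ^ (d - 1)) : ℝ)‖ =
          2 * Real.pi * (d * u ^ (d - 1)) := by
        rw [norm_mul, norm_mul, Complex.norm_I, Complex.norm_real, Complex.norm_real,
          Real.norm_eq_abs, hτ, Real.norm_of_nonneg (by positivity)]
        ring
      rw [mul_one, norm_exp_I_mul, norm_mul, norm_mul, norm_exp_I_mul, h4, Complex.norm_real,
        Real.norm_of_nonneg hu0.le, one_mul]
    calc _ ≤ (2 * Real.pi * (d * u ^ (d - 1)) * u + 1) / u ^ 2 := by gcongr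
      _ = 2 * Real.pi * d * u ^ (d - 1) / u + 1 / u ^ 2 := by field_simp
      _ ≤ L := by
        rw [hL]
        have h2 := hu.1
        have h3 := hu.2
        gcongr
  have hlip : ∀ u ∈ Icc A (2 * A), ∀ v ∈ Icc A (2 * A), ‖F v - F u‖ ≤ L * ‖v - u‖ :=
    fun u hu v hv => (convex_Icc A (2 * A)).norm_image_sub_le_of_norm_hasDerivWithin_le hder hbd hu hv
  -- The mean value inequality applies if `u` and `u + h` both lie in `(A, 2 A]`. The other points
  -- form two intervals of length `h`, on which the difference is at most `1 / A`.
  have hpt : ∀ u, ‖oscPiece d τ A u - oscPiece d τ A (u + h)‖ₑ ≤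
      (Ioc A (2 * A)).indicator (fun _ => ENNReal.ofReal (L * h)) u +
      ((Ioc (A - h) A).indicator (fun _ => ENNReal.ofReal A⁻¹) u +
      (Ioc (2 * A - h) (2 * A)).indicator (fun _ => ENNReal.ofReal A⁻¹) u) := by
    intro u
    by_cases m1 : u ∈ Ioc A (2 * A)
    · by_cases m2 : u + h ∈ Ioc A (2 * A)
      · refine le_trans ?_ le_self_add
        rw [indicator_of_mem m1, oscPiece_of_mem m1, oscPiece_of_mem m2]
        refine enorm_le_ofReal ((hlip _ (Ioc_subset_Icc_self m2) _ (Ioc_subset_Icc_self m1)).trans ?_)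
        rw [Real.norm_eq_abs, sub_add_cancel_left, abs_neg, abs_of_nonneg hh]
      · refine le_trans ?_ (le_add_self.trans le_add_self)
        rw [oscPiece_of_notMem m2, sub_zero, indicator_of_mem]
        · exact enorm_le_ofReal (norm_oscPiece_le hA0 u)
        · refine ⟨?_, m1.2⟩
          by_contra! hc
          exact m2 ⟨by linarith [m1.1], by linarith⟩
    · by_cases m2 : u + h ∈ Ioc A (2 * A)
      · refine le_trans ?_ (le_self_add.trans le_add_self)
        rw [oscPiece_of_notMem m1, zero_sub, enorm_neg, indicator_of_mem]
        · exact enorm_le_ofReal (norm_oscPiece_le hA0 _)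
        · refine ⟨by linarith [m2.1], ?_⟩
          by_contra! hc
          exact m1 ⟨hc, by linarith [m2.2]⟩
      · rw [oscPiece_of_notMem m1, oscPiece_of_notMem m2]; simp
  refine (lintegral_mono hpt).trans ?_
  have mi : ∀ (a b : ℝ) (c : ℝ≥0∞), Measurable ((Ioc a b).indicator fun _ => c) := fun a b c =>
    measurable_const.indicator measurableSet_Ioc
  have ii : ∀ (a b c : ℝ), 0 ≤ c → ∫⁻ x, (Ioc a b).indicator (fun _ => ENNReal.ofReal c) x =
      ENNReal.ofReal (c * (b - a)) := fun a b c hc => by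
    rw [lintegral_indicator measurableSet_Ioc, setLIntegral_const, Real.volume_Ioc,
      ENNReal.ofReal_mul hc]
  have hAi : 0 ≤ A⁻¹ := by positivity
  rw [lintegral_add_left (mi _ _ _), lintegral_add_left (mi _ _ _), ii _ _ _ (by positivity),
    ii _ _ _ hAi, ii _ _ _ hAi, ← ENNReal.ofReal_add (by simp; positivity) (by simp; positivity),
    ← ENNReal.ofReal_add (by have : 0 ≤ 2 * A - A := by linarith
                             positivity) (by ring_nf; positivity)]
  refine ENNReal.ofReal_le_ofReal ?_
  have hX : 1 ≤ d * (2 * A) ^ (d - 1) := by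
    have : 1 ≤ (2 * A) ^ (d - 1) := one_le_pow₀ (by linarith)
    nlinarith
  have e : L * h * (2 * A - A) + (A⁻¹ * (A - (A - h)) + A⁻¹ * (2 * A - (2 * A - h))) =
      h * (2 * Real.pi * (d * (2 * A) ^ (d - 1)) + 3 * A⁻¹) := by
    rw [hL]; field_simp; ring
  rw [e]
  have h1 : A⁻¹ ≤ 1 := inv_le_one_of_one_le₀ hA
  have h2 : Real.pi < 3.15 := Real.pi_lt_d2
  have : 2 * Real.pi * (d * (2 * A) ^ (d - 1)) + 3 * A⁻¹ ≤ 10 * (d * (2 * A) ^ (d - 1)) := by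
    nlinarith
  nlinarith

/-! ### The oscillating kernels: estimates at one scale -/

/-- The part `2 ^ i < σ (x - y) ≤ 2 ^ (i + 1)` of the oscillating kernel on one half-line. -/
noncomputable def oscKer (d : ℕ) (σ τ : ℝ) (i : ℕ) (x y : ℝ) : ℂ :=
  oscPiece d τ ((2 : ℝ) ^ i) (σ * (x - y))

/-- The integral operator with kernel `oscKer`. -/
noncomputable def oscOp (d : ℕ) (σ τ : ℝ) (i : ℕ) (f : ℝ → ℂ) : ℝ → ℂ := kOp (oscKer d σ τ i) f

lemma lintegral_mul_le_of_near {K F : ℝ → ℝ≥0∞} (hF : Measurable F) {x : ℝ} {n : ℤ}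
    {C B : ℝ≥0∞} (hC : ∀ y, K y ≤ C) (hK : ∀ y, (2 : ℝ) ^ n < |x - y| → K y = 0)
    (hB : ∀ x, dyAvg n F x ≤ B) : ∫⁻ y, K y * F y ≤ C * (3 * ENNReal.ofReal ((2 : ℝ) ^ n) * B) := by
  have hm : MeasurableSet {y : ℝ | |x - y| ≤ (2 : ℝ) ^ n} :=
    measurableSet_le (by fun_prop) measurable_const
  calc ∫⁻ y, K y * F y ≤ ∫⁻ y, C * {y : ℝ | |x - y| ≤ (2 : ℝ) ^ n}.indicator F y := by
        refine lintegral_mono fun y => ?_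
        by_cases hy : |x - y| ≤ (2 : ℝ) ^ n
        · rw [indicator_of_mem (show y ∈ {y : ℝ | |x - y| ≤ (2 : ℝ) ^ n} from hy)]
          exact mul_le_mul_left (hC y) _
        · rw [hK y (not_le.1 hy), zero_mul]; exact zero_le
    _ = C * ∫⁻ y in {y : ℝ | |x - y| ≤ (2 : ℝ) ^ n}, F y := by
        rw [lintegral_const_mul _ (hF.indicator hm), lintegral_indicator hm]
    _ ≤ _ := mul_le_mul_right (setLIntegral_ball_le hB x) _

section

variable {d : ℕ} {σ τ : ℝ}

lemma norm_oscKer_le (d : ℕ) (σ τ : ℝ) (i : ℕ) (x y : ℝ) :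
    ‖oscKer d σ τ i x y‖ ≤ ((2 : ℝ) ^ i)⁻¹ := norm_oscPiece_le (by positivity) _

lemma oscKer_of_lt (hσ : |σ| = 1) {i : ℕ} {x y : ℝ} (h : (2 : ℝ) ^ (i + 1) < |x - y|) :
    oscKer d σ τ i x y = 0 := by
  refine oscPiece_of_notMem fun hm => ?_
  have h1 : |σ * (x - y)| = |x - y| := by rw [abs_mul, hσ, one_mul]
  have hp : (0 : ℝ) < 2 ^ i := by positivity
  rw [abs_of_pos (hp.trans hm.1)] at h1
  have := hm.2
  rw [pow_succ] at h
  linarith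

lemma localKernel_oscKer (hσ : |σ| = 1) (i : ℕ) : LocalKernel (oscKer d σ τ i) :=
  ⟨(measurable_oscPiece d τ _).comp (measurable_const.mul (measurable_fst.sub measurable_snd)),
    ⟨_, norm_oscKer_le d σ τ i⟩, ⟨(2 : ℝ) ^ (i + 1), fun _ _ h => oscKer_of_lt hσ h⟩⟩

lemma TestFun.oscOp {f : ℝ → ℂ} (hf : TestFun f) (hσ : |σ| = 1) (i : ℕ) :
    TestFun (oscOp d σ τ i f) := (localKernel_oscKer hσ i).kOp_testFun hf

/-- The autocorrelation of one piece of the oscillating kernel. -/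
noncomputable def oscCorr (d : ℕ) (τ A h : ℝ) : ℂ :=
  ∫ v, conj (oscPiece d τ A v) * oscPiece d τ A (v + h)

lemma oscCorr_neg (d : ℕ) (τ A h : ℝ) : oscCorr d τ A (-h) = conj (oscCorr d τ A h) := by
  rw [oscCorr, oscCorr, ← integral_conj,
    ← integral_add_right_eq_self (fun v => conj (oscPiece d τ A v) * oscPiece d τ A (v + -h)) h]
  congr 1; funext v
  rw [map_mul, Complex.conj_conj, add_neg_cancel_right, mul_comm]

lemma norm_oscCorr_le (hd : 2 ≤ d) {A h : ℝ} (hτ : |τ| = 1) (hA : 1 ≤ A) (hh : h ≠ 0) :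
    ‖oscCorr d τ A h‖ ≤ (A ^ 2 * |h|)⁻¹ := by
  rcases lt_or_gt_of_ne hh with h0 | h0
  · have := norm_integral_conj_oscPiece_mul_le hd hτ hA (h := -h) (by linarith)
    rw [← oscCorr, oscCorr_neg, RCLike.norm_conj] at this
    rwa [abs_of_neg h0]
  · rw [abs_of_pos h0]
    exact norm_integral_conj_oscPiece_mul_le hd hτ hA h0

lemma enorm_oscCorr_le (d : ℕ) (τ : ℝ) {A : ℝ} (hA : 0 < A) (h : ℝ) :
    ‖oscCorr d τ A h‖ₑ ≤ ENNReal.ofReal A⁻¹ := by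
  refine (enorm_integral_le_lintegral_enorm _).trans ?_
  refine (lintegral_enorm_le_of_bound (C := A⁻¹ * A⁻¹) (S := Ioc A (2 * A)) (V := A) (by positivity)
    (fun v => ?_) (fun v hv => ?_) ?_).trans ?_
  · rw [norm_mul, RCLike.norm_conj]
    exact mul_le_mul (norm_oscPiece_le hA _) (norm_oscPiece_le hA _) (norm_nonneg _) (by positivity)
  · rw [oscPiece_of_notMem hv, map_zero, zero_mul]
  · rw [Real.volume_Ioc]; apply ENNReal.ofReal_le_ofReal; linarith
  · apply ENNReal.ofReal_le_ofReal; field_simp; exact le_rfl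

lemma oscCorr_of_le {A h : ℝ} (hh : A ≤ |h|) : oscCorr d τ A h = 0 := by
  rw [oscCorr]
  refine integral_eq_zero_of_ae (Filter.Eventually.of_forall fun v => ?_)
  by_cases h1 : v ∈ Ioc A (2 * A)
  · by_cases h2 : v + h ∈ Ioc A (2 * A)
    · exfalso
      have : |h| < A := by
        rw [abs_lt]; constructor <;> linarith [h1.1, h1.2, h2.1, h2.2]
      linarith
    · simp [oscPiece_of_notMem h2]
  · simp [oscPiece_of_notMem h1]

lemma eq_or_eq_neg_of_abs_eq_one (hσ : |σ| = 1) : σ = 1 ∨ σ = -1 := by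
  rcases abs_eq (zero_le_one (α := ℝ)) |>.1 hσ with h | h
  · exact Or.inl h
  · exact Or.inr h

lemma integral_conj_oscKer_mul (hσ : |σ| = 1) (i : ℕ) (y z : ℝ) :
    ∫ x, conj (oscKer d σ τ i x y) * oscKer d σ τ i x z = oscCorr d τ ((2 : ℝ) ^ i) (σ * (y - z)) := by
  rcases eq_or_eq_neg_of_abs_eq_one hσ with rfl | rfl
  · rw [oscCorr, ← integral_sub_right_eq_self (fun v => conj (oscPiece d τ ((2 : ℝ) ^ i) v) *
      oscPiece d τ ((2 : ℝ) ^ i) (v + 1 * (y - z))) y]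
    congr 1; funext x
    rw [oscKer, oscKer, one_mul, one_mul, one_mul, sub_add_sub_cancel]
  · rw [oscCorr, ← integral_sub_left_eq_self _ _ y]
    congr 1; funext x
    rw [oscKer, oscKer]
    congr 3 <;> ring

/-- The `T*T` method: `‖T u‖² = ⟨u, T*T u⟩`, where the kernel of `T*T` is the autocorrelation of the
kernel of `T`. -/
lemma l2sq_oscOp_le_of_corr {u : ℝ → ℂ} (hu : TestFun u) (hσ : |σ| = 1) (i : ℕ) {D : ℝ≥0∞}
    (hD : ∀ y, ∫⁻ z, ‖oscCorr d τ ((2 : ℝ) ^ i) (σ * (y - z))‖ₑ * ‖u z‖ₑ ≤ D) :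
    l2sq (oscOp d σ τ i u) ≤ D * ∫⁻ y, ‖u y‖ₑ := by
  have hκ := localKernel_oscKer (d := d) (τ := τ) hσ i
  have hκc : LocalKernel fun x y => conj (oscKer d σ τ i x y) := by
    obtain ⟨C, hC⟩ := hκ.bdd
    obtain ⟨R, hR⟩ := hκ.near
    exact ⟨Complex.continuous_conj.measurable.comp hκ.meas, ⟨C, fun x y => by
      rw [RCLike.norm_conj]; exact hC x y⟩, ⟨R, fun x y h => by rw [hR x y h, map_zero]⟩⟩
  have e1 : ∀ x, conj (oscOp d σ τ i u x) =
      kOp (fun x y => conj (oscKer d σ τ i x y)) (fun y => conj (u y)) x := by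
    intro x
    rw [oscOp, kOp, kOp, ← integral_conj]
    congr 1; funext y
    rw [map_mul]
  rw [l2sq_eq_enorm_integral (hu.oscOp hσ i)]
  simp_rw [e1]
  rw [hκc.integral_kOp_mul hu.conjugate (hu.oscOp hσ i)]
  refine (enorm_integral_le_lintegral_enorm _).trans ?_
  rw [← lintegral_const_mul _ hu.enorm_meas]
  refine lintegral_mono fun y => ?_
  rw [enorm_mul, RCLike.enorm_conj, mul_comm]
  refine mul_le_mul_left ?_ _
  rw [oscOp, hκc.swap.kOp_kOp hκ hu]
  refine (enorm_kOp_le _ _ _).trans (le_trans (le_of_eq ?_) (hD y))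
  congr 1; funext z
  rw [kComp, integral_conj_oscKer_mul hσ]

lemma decayRate_pow_half_le (s : ℕ) : decayRate ^ (8 * (s / 2)) ≤ 2 * decayRate ^ (4 * s) := by
  have h : decayRate ^ (8 * (s / 2)) = 2 * decayRate ^ (8 * (s / 2) + 8) := by
    rw [pow_add, decayRate_pow_eight, mul_left_comm, ENNReal.mul_inv_cancel (by norm_num)
      (by norm_num), mul_one]
  rw [h]
  refine mul_le_mul_right (pow_le_pow_right_of_le_one' decayRate_lt_one.le ?_) _
  omega

/-- If `u` has averages at most `B` over intervals longer than `2 ^ (i + 1 - s)`, the oscillation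
yields a gain that is geometric in `s`. -/
lemma l2sq_oscOp_le {u : ℝ → ℂ} (hu : TestFun u) (hd : 2 ≤ d) (hσ : |σ| = 1) (hτ : |τ| = 1)
    {i s : ℕ} (hs : 1 ≤ s) (hsi : s ≤ i + 1) {B : ℝ≥0∞}
    (hB : ∀ n : ℤ, (i : ℤ) + 1 - s ≤ n → ∀ x, dyAvg n (fun y => ‖u y‖ₑ) x ≤ B) :
    l2sq (oscOp d σ τ i u) ≤ 18 * decayRate ^ (4 * s) * B * ∫⁻ y, ‖u y‖ₑ := by
  refine l2sq_oscOp_le_of_corr hu hσ i fun y => ?_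
  set h : ℕ := s / 2 with hh
  have hhi : h ≤ i := by omega
  set A : ℝ := (2 : ℝ) ^ i with hA
  have hA1 : 1 ≤ A := one_le_pow₀ (by norm_num)
  have hA0 : 0 < A := by linarith
  set p : ℤ := (i : ℤ) - h with hp
  have hpp := two_zpow_pos p
  have hAz : (2 : ℝ) ^ (i : ℤ) = A := by rw [zpow_natCast]
  -- Near the diagonal the autocorrelation is estimated by its size, elsewhere by its decay. The
  -- threshold `2 ^ p` is long enough for the averages of `u` to be controlled, and both
  -- contributions are `O(2 ^ (-s / 2))` because `s ≤ i + 1`.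
  have hsplit : ∀ z, ‖oscCorr d τ A (σ * (y - z))‖ₑ ≤
      {z | |y - z| ≤ (2 : ℝ) ^ p}.indicator (fun _ => ENNReal.ofReal A⁻¹) z +
      {z | |y - z| ≤ (2 : ℝ) ^ (i : ℤ)}.indicator (fun _ => ENNReal.ofReal (A ^ 2 * 2 ^ p)⁻¹) z := by
    intro z
    have hab : |σ * (y - z)| = |y - z| := by rw [abs_mul, hσ, one_mul]
    by_cases h1 : |y - z| ≤ (2 : ℝ) ^ p
    · rw [indicator_of_mem (show z ∈ {z | |y - z| ≤ (2 : ℝ) ^ p} from h1)]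
      exact (enorm_oscCorr_le d τ hA0 _).trans le_self_add
    · by_cases h2 : |y - z| ≤ (2 : ℝ) ^ (i : ℤ)
      · rw [indicator_of_mem (show z ∈ {z | |y - z| ≤ (2 : ℝ) ^ (i : ℤ)} from h2)]
        refine le_trans (enorm_le_ofReal ?_) le_add_self
        refine (norm_oscCorr_le hd hτ hA1 ?_).trans ?_
        · rw [← abs_pos, hab]; linarith
        · rw [hab]
          refine inv_anti₀ (by positivity) ?_
          gcongr
          exact (not_le.1 h1).le
      · rw [oscCorr_of_le]
        · simp
        · rw [hab, ← hAz]; exact (not_le.1 h2).le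
  have hm : ∀ n : ℤ, MeasurableSet {z : ℝ | |y - z| ≤ (2 : ℝ) ^ n} := fun n =>
    measurableSet_le (by fun_prop) measurable_const
  calc ∫⁻ z, ‖oscCorr d τ A (σ * (y - z))‖ₑ * ‖u z‖ₑ
      ≤ ∫⁻ z, ({z | |y - z| ≤ (2 : ℝ) ^ p}.indicator (fun _ => ENNReal.ofReal A⁻¹) z * ‖u z‖ₑ +
        {z | |y - z| ≤ (2 : ℝ) ^ (i : ℤ)}.indicator
          (fun _ => ENNReal.ofReal (A ^ 2 * 2 ^ p)⁻¹) z * ‖u z‖ₑ) := by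
        refine lintegral_mono fun z => ?_
        rw [← add_mul]
        exact mul_le_mul_left (hsplit z) _
    _ ≤ ENNReal.ofReal A⁻¹ * (3 * ENNReal.ofReal ((2 : ℝ) ^ p) * B) +
        ENNReal.ofReal (A ^ 2 * 2 ^ p)⁻¹ * (3 * ENNReal.ofReal ((2 : ℝ) ^ (i : ℤ)) * B) := by
        have hm1 : Measurable fun z => {z | |y - z| ≤ (2 : ℝ) ^ p}.indicator
            (fun _ => ENNReal.ofReal A⁻¹) z * ‖u z‖ₑ :=
          (measurable_const.indicator (hm p)).mul hu.enorm_meas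
        rw [lintegral_add_left hm1]
        refine add_le_add ?_ ?_
        · refine lintegral_mul_le_of_near hu.enorm_meas (x := y)
            (fun z => indicator_le_self' (fun _ _ => zero_le) z) (fun z hz => ?_)
            (hB p (by omega))
          exact indicator_of_notMem (s := {z : ℝ | |y - z| ≤ (2 : ℝ) ^ p})
            (fun hz' => absurd hz (not_lt.2 hz')) _
        · refine lintegral_mul_le_of_near hu.enorm_meas (x := y)
            (fun z => indicator_le_self' (fun _ _ => zero_le) z) (fun z hz => ?_)
            (hB i (by omega))
          exact indicator_of_notMem (s := {z : ℝ | |y - z| ≤ (2 : ℝ) ^ (i : ℤ)})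
            (fun hz' => absurd hz (not_lt.2 hz')) _
    _ = (ENNReal.ofReal (A⁻¹ * 2 ^ p) + ENNReal.ofReal ((A ^ 2 * 2 ^ p)⁻¹ * A)) * (3 * B) := by
        rw [ENNReal.ofReal_mul (by positivity), ENNReal.ofReal_mul (by positivity), hAz]
        ring
    _ ≤ (decayRate ^ (8 * h) + 2 * decayRate ^ (8 * h)) * (3 * B) := by
        have e1 : A⁻¹ * 2 ^ p = (2 : ℝ) ^ (-(h : ℤ)) := by
          rw [← hAz, ← zpow_neg, ← zpow_add₀ (by norm_num)]; congr 1; omega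
        have e2 : (A ^ 2 * 2 ^ p)⁻¹ * A = (2 : ℝ) ^ (-(3 * i - h : ℤ) + i) := by
          have e4 : A ^ 2 * 2 ^ p = (2 : ℝ) ^ (3 * i - h : ℤ) := by
            have e5 : (i : ℤ) + i + p = 3 * i - h := by omega
            rw [sq, ← hAz, ← zpow_add₀ (by norm_num), ← zpow_add₀ (by norm_num), e5]
          rw [zpow_add₀ (by norm_num), hAz, zpow_neg, e4]
        have e3 : (2 : ℝ) ^ (-(3 * i - h : ℤ) + i) ≤ 2 * (2 : ℝ) ^ (-(h : ℤ)) := by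
          rw [← zpow_one_add₀ (by norm_num)]
          exact two_zpow_mono (by omega)
        refine mul_le_mul_left (add_le_add ?_ ?_) _
        · rw [e1, ofReal_two_zpow_neg]
        · rw [e2]
          refine (ENNReal.ofReal_le_ofReal e3).trans ?_
          rw [ENNReal.ofReal_mul (by norm_num), ofReal_two_zpow_neg]
          simp
    _ ≤ 18 * decayRate ^ (4 * s) * B := by
        have := decayRate_pow_half_le s
        calc (decayRate ^ (8 * h) + 2 * decayRate ^ (8 * h)) * (3 * B)
            = 9 * decayRate ^ (8 * h) * B := by ring
          _ ≤ 9 * (2 * decayRate ^ (4 * s)) * B := by gcongr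
          _ = _ := by ring

end

/-! ### The oscillating kernels: maximal partial sums in `L²` -/

lemma sub_dyExp_eq (m : ℤ) {f : ℝ → ℂ} (hf : TestFun f) (x : ℝ) :
    f x - dyExp m f x = dyExp m (fun z => (dyIv m (dyIdx m x)).indicator
        (fun _ => f x) z - f z) x := by
  set g : ℝ → ℂ := (dyIv m (dyIdx m x)).indicator fun _ => f x with hg
  have hgz : ∀ z, dyIdx m x = dyIdx m z → g z = f x := fun z hz =>
    indicator_of_mem (show z ∈ dyIv m (dyIdx m x) from hz.symm) _
  have hgt : TestFun g := by
    refine ⟨measurable_const.indicator (measurableSet_dyIv _ _), ⟨‖f x‖, fun z => ?_⟩,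
      ⟨|x| + 2 ^ m, fun z hz => ?_⟩⟩
    · exact norm_indicator_le_norm_self (fun _ => f x) z
    · refine indicator_of_notMem (fun hz' => ?_) _
      have h1 := abs_sub_lt_of_dyIdx_eq (mem_dyIv.1 hz')
      have h2 := abs_sub_abs_le_abs_sub z x
      linarith
  have e1 : dyExp m g x = f x := by
    rw [dyExp_of_const fun y hy => by rw [hgz y hy, hgz x rfl], hgz x rfl]
  have := (localKernel_dyKer m).kOp_sub hgt hf x
  rw [← dyExp, ← dyExp, ← dyExp, e1] at this
  exact this.symm

lemma enorm_sub_dyExp_le (m : ℤ) {f : ℝ → ℂ} (hf : TestFun f) (x : ℝ) :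
    ‖f x - dyExp m f x‖ₑ ≤ (ENNReal.ofReal ((2 : ℝ) ^ m))⁻¹ *
      ∫⁻ t in Icc (-(2 : ℝ) ^ m) (2 ^ m), ‖f x - f (x + t)‖ₑ := by
  rw [sub_dyExp_eq m hf]
  refine (enorm_dyExp_le _ _ _).trans ?_
  rw [dyAvg]
  refine mul_le_mul_right ?_ _
  rw [← lintegral_indicator (measurableSet_dyIv _ _), ← lintegral_indicator measurableSet_Icc,
    ← lintegral_add_left_eq_self _ x]
  refine lintegral_mono fun t => ?_
  by_cases hm : x + t ∈ dyIv m (dyIdx m x)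
  · have h1 := abs_sub_lt_of_dyIdx_eq (mem_dyIv.1 hm)
    rw [add_sub_cancel_left, abs_lt] at h1
    have h2 : t ∈ Icc (-(2 : ℝ) ^ m) (2 ^ m) := ⟨h1.1.le, h1.2.le⟩
    rw [indicator_of_mem hm, indicator_of_mem h2, indicator_of_mem hm]
  · rw [indicator_of_notMem hm]; exact zero_le

section

variable {d : ℕ} {σ τ : ℝ}

lemma lintegral_oscPiece_sub_le_of_abs (hd : 1 ≤ d) {A h t : ℝ} (hτ : |τ| = 1) (hA : 1 ≤ A)
    (ht : |t| ≤ h) : ∫⁻ u, ‖oscPiece d τ A u - oscPiece d τ A (u + t)‖ₑ ≤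
      ENNReal.ofReal (10 * (h * (d * (2 * A) ^ (d - 1)))) := by
  have key : ∫⁻ u, ‖oscPiece d τ A u - oscPiece d τ A (u + t)‖ₑ ≤
      ENNReal.ofReal (10 * (|t| * (d * (2 * A) ^ (d - 1)))) := by
    rcases le_total 0 t with h0 | h0
    · rw [abs_of_nonneg h0]
      exact lintegral_oscPiece_sub_le hd hτ hA h0
    · rw [abs_of_nonpos h0]
      have := lintegral_oscPiece_sub_le hd hτ hA (h := -t) (by linarith)
      refine le_trans (le_of_eq ?_) this
      rw [← lintegral_add_right_eq_self _ (-t)]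
      refine lintegral_congr fun u => ?_
      rw [neg_add_cancel_right, ← enorm_neg, neg_sub]
  refine key.trans (ENNReal.ofReal_le_ofReal ?_)
  gcongr

lemma lintegral_oscKer_sub_le (hd : 1 ≤ d) (hσ : |σ| = 1) (hτ : |τ| = 1) (i : ℕ) {h t : ℝ}
    (ht : |t| ≤ h) (y : ℝ) : ∫⁻ x, ‖oscKer d σ τ i x y - oscKer d σ τ i (x + t) y‖ₑ ≤
      ENNReal.ofReal (10 * (h * (d * (2 * 2 ^ i) ^ (d - 1)))) := by
  have hA : (1 : ℝ) ≤ 2 ^ i := one_le_pow₀ (by norm_num)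
  have hst : |σ * t| ≤ h := by rwa [abs_mul, hσ, one_mul]
  refine le_trans (le_of_eq ?_) (lintegral_oscPiece_sub_le_of_abs hd hτ hA hst)
  rcases eq_or_eq_neg_of_abs_eq_one hσ with rfl | rfl
  · rw [← lintegral_sub_right_eq_self (fun u => ‖oscPiece d τ (2 ^ i) u -
      oscPiece d τ (2 ^ i) (u + 1 * t)‖ₑ) y]
    refine lintegral_congr fun x => ?_
    rw [oscKer, oscKer]
    congr 3 <;> ring
  · rw [← lintegral_sub_left_eq_self _ y]
    refine lintegral_congr fun x => ?_
    rw [oscKer, oscKer]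
    congr 3 <;> ring

/-- The kernel of `E_n T_i`. -/
noncomputable def oscCoarseKer (d : ℕ) (σ τ : ℝ) (n : ℤ) (i : ℕ) (x y : ℝ) : ℂ :=
  kComp (dyKer n) (oscKer d σ τ i) x y

lemma localKernel_oscCoarseKer (hσ : |σ| = 1) (n : ℤ) (i : ℕ) :
    LocalKernel (oscCoarseKer d σ τ n i) :=
  (localKernel_dyKer n).comp (localKernel_oscKer hσ i)

lemma oscCoarseKer_of_lt (hσ : |σ| = 1) {n : ℤ} (hn : n ≤ 0) {i : ℕ} {x y : ℝ}
    (h : (2 : ℝ) ^ ((i : ℤ) + 2) < |x - y|) : oscCoarseKer d σ τ n i x y = 0 := by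
  rw [oscCoarseKer, kComp_dyKer]
  refine dyExp_eq_zero fun z hz => oscKer_of_lt hσ ?_
  have h1 := abs_sub_lt_of_dyIdx_eq hz
  have h2 := abs_sub_le x z y
  have h3 : (2 : ℝ) ^ n ≤ 1 := by simpa using two_zpow_mono hn
  have h4 : (1 : ℝ) ≤ 2 ^ (i + 1) := one_le_pow₀ (by norm_num)
  have h5 : (2 : ℝ) ^ ((i : ℤ) + 2) = 2 * 2 ^ (i + 1) := by
    rw [show (i : ℤ) + 2 = ((i + 1 + 1 : ℕ) : ℤ) by push_cast; ring, zpow_natCast,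
        pow_succ _ (i + 1)]
    ring
  linarith

lemma norm_le_of_enorm_le {z : ℂ} {C : ℝ} (hC : 0 ≤ C) (h : ‖z‖ₑ ≤ ENNReal.ofReal C) : ‖z‖ ≤ C := by
  rw [← ofReal_norm] at h
  exact (ENNReal.ofReal_le_ofReal_iff hC).1 h

lemma norm_oscCoarseKer_le (d : ℕ) (σ τ : ℝ) (n : ℤ) (i : ℕ) (x y : ℝ) :
    ‖oscCoarseKer d σ τ n i x y‖ ≤ ((2 : ℝ) ^ i)⁻¹ := by
  refine norm_le_of_enorm_le (by positivity) ?_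
  rw [oscCoarseKer, kComp_dyKer]
  refine (enorm_dyExp_le _ _ _).trans ?_
  rw [dyAvg, mul_comm, ← div_eq_mul_inv]
  refine ENNReal.div_le_of_le_mul ?_
  rw [← volume_dyIv n (dyIdx n x), ← setLIntegral_const]
  exact setLIntegral_mono measurable_const fun z _ => enorm_le_ofReal (norm_oscKer_le d σ τ i z y)

/-- Averaging the kernel integrates its oscillation over an interval. -/
lemma norm_oscCoarseKer_le_of_osc (hd : 1 ≤ d) (hσ : |σ| = 1) (hτ : |τ| = 1) (n : ℤ) (i : ℕ)
    (x y : ℝ) : ‖oscCoarseKer d σ τ n i x y‖ ≤ ((2 : ℝ) ^ n)⁻¹ * (d * ((2 : ℝ) ^ i) ^ d)⁻¹ := by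
  have hp := two_zpow_pos n
  set p : ℝ := dyIdx n x * (2 : ℝ) ^ n with hpdef
  set q : ℝ := (dyIdx n x + 1) * (2 : ℝ) ^ n with hqdef
  have hpq : p ≤ q := by rw [hpdef, hqdef]; nlinarith
  have e1 : oscCoarseKer d σ τ n i x y = (((2 : ℝ) ^ n)⁻¹ : ℝ) * ∫ z in p..q, oscKer d σ τ i z y := by
    rw [intervalIntegral.integral_of_le hpq, ← integral_Ico_eq_integral_Ioc, hpdef, hqdef,
      ← dyIv_eq_Ico, ← integral_indicator (measurableSet_dyIv _ _), ← integral_const_mul]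
    rw [oscCoarseKer, kComp]
    congr 1; funext z
    by_cases hz : dyIdx n x = dyIdx n z
    · rw [dyKer, if_pos hz, indicator_of_mem (show z ∈ dyIv n (dyIdx n x) from hz.symm)]
    · rw [dyKer, if_neg hz, indicator_of_notMem (fun h : z ∈ dyIv n (dyIdx n x) =>
        hz (mem_dyIv.1 h).symm), zero_mul, mul_zero]
  rw [e1, norm_mul, Complex.norm_real, Real.norm_of_nonneg (by positivity)]
  refine mul_le_mul_of_nonneg_left ?_ (by positivity)
  rcases eq_or_eq_neg_of_abs_eq_one hσ with rfl | rfl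
  · have : ∫ z in p..q, oscKer d 1 τ i z y = ∫ u in (p - y)..(q - y), oscPiece d τ (2 ^ i) u := by
      rw [← intervalIntegral.integral_comp_sub_right]
      simp only [oscKer, one_mul]
    rw [this]
    exact norm_integral_oscPiece_le hd hτ (by positivity) (by linarith)
  · have : ∫ z in p..q, oscKer d (-1) τ i z y = ∫ u in (y - q)..(y - p), oscPiece d τ (2 ^ i) u := by
      rw [← intervalIntegral.integral_comp_sub_left]
      simp only [oscKer, neg_one_mul, neg_sub]
    rw [this]
    exact norm_integral_oscPiece_le hd hτ (by positivity) (by linarith)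

/-- The scales at which the outputs of the oscillating operators are averaged: `T_i f` oscillates
at scales much longer than `2 ^ oscScale d i` and is smooth at much shorter ones. The shift by
`Nat.clog 2 d` accounts for the factor `d` in the derivative of the phase and makes all bounds
uniform in `d`. -/
def oscScale (d : ℕ) (j : ℕ) : ℤ := -(Nat.clog 2 d : ℤ) - j * ((d : ℤ) - 1)

lemma antitone_oscScale (hd : 1 ≤ d) : Antitone (oscScale d) := by
  intro i j hij
  have h1 : (i : ℤ) ≤ j := by exact_mod_cast hij
  have h2 : (0 : ℤ) ≤ (d : ℤ) - 1 := by have : (1 : ℤ) ≤ d := by exact_mod_cast hd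
                                        linarith
  simp only [oscScale]
  nlinarith

lemma oscScale_nonpos (hd : 1 ≤ d) (j : ℕ) : oscScale d j ≤ 0 := by
  have h2 : (0 : ℤ) ≤ (d : ℤ) - 1 := by have : (1 : ℤ) ≤ d := by exact_mod_cast hd
                                        linarith
  have h3 : (0 : ℤ) ≤ j * ((d : ℤ) - 1) := by positivity
  simp only [oscScale]
  omega

lemma two_zpow_oscScale (hd : 1 ≤ d) (j : ℕ) :
    (2 : ℝ) ^ oscScale d j = ((2 : ℝ) ^ Nat.clog 2 d)⁻¹ * (((2 : ℝ) ^ j) ^ (d - 1))⁻¹ := by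
  have : oscScale d j = -((Nat.clog 2 d : ℕ) : ℤ) + -((j * (d - 1) : ℕ) : ℤ) := by
    rw [oscScale]; push_cast [Nat.cast_sub hd]; ring
  rw [this, zpow_add₀ (by norm_num), zpow_neg, zpow_neg, zpow_natCast, zpow_natCast, pow_mul]

lemma le_two_pow_clog (d : ℕ) : (d : ℝ) ≤ 2 ^ Nat.clog 2 d := by
  exact_mod_cast Nat.le_pow_clog (by norm_num) d

lemma two_pow_clog_le (hd : 2 ≤ d) : (2 : ℝ) ^ Nat.clog 2 d ≤ 2 * d := by
  have h1 := Nat.pow_pred_clog_lt_self (b := 2) (by norm_num) (x := d) (by omega)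
  have h2 : 0 < Nat.clog 2 d := Nat.clog_pos (by norm_num) (by omega)
  have h3 : 2 ^ Nat.clog 2 d = 2 * 2 ^ (Nat.clog 2 d).pred := by
    rw [← pow_succ']; congr 1; simp; omega
  have : 2 ^ Nat.clog 2 d ≤ 2 * d := by omega
  exact_mod_cast this

/-- For `j ≤ i` the oscillation of `T_i` is fast compared to `2 ^ oscScale d j`, and averaging at
this scale gains a factor `2 ^ (j - i)`. -/
lemma lintegral_oscCoarseKer_left_le (hd : 2 ≤ d) (hσ : |σ| = 1) (hτ : |τ| = 1) {i j : ℕ}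
    (hji : j ≤ i) (y : ℝ) :
    ∫⁻ x, ‖oscCoarseKer d σ τ (oscScale d j) i x y‖ₑ ≤ 16 * decayRate ^ (8 * (i - j)) := by
  refine (lintegral_enorm_le_of_ball (x := y) (R := (2 : ℝ) ^ ((i : ℤ) + 2)) (by positivity)
    (fun x => norm_oscCoarseKer_le_of_osc (by omega) hσ hτ _ i x y) fun x hx =>
    oscCoarseKer_of_lt hσ (oscScale_nonpos (by omega) j) (by rwa [abs_sub_comm])).trans ?_
  rw [← ofReal_two_zpow_neg, show (16 : ℝ≥0∞) = ENNReal.ofReal 16 by norm_num,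
    ← ENNReal.ofReal_mul (by norm_num)]
  refine ENNReal.ofReal_le_ofReal ?_
  have hd0 : (0 : ℝ) < d := by exact_mod_cast (by omega : 0 < d)
  obtain ⟨l, rfl⟩ := Nat.exists_eq_add_of_le hji
  obtain ⟨e, rfl⟩ := Nat.exists_eq_add_of_le hd
  have hc := two_pow_clog_le hd
  rw [two_zpow_oscScale (by omega)]
  have e1 : (2 : ℝ) ^ (((j + l : ℕ) : ℤ) + 2) = 4 * 2 ^ (j + l) := by
    rw [zpow_add₀ (by norm_num), zpow_natCast]; norm_num; ring
  rw [e1, add_tsub_cancel_left, zpow_neg, zpow_natCast, show 2 + e - 1 = e + 1 by omega]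
  have hl : (2 : ℝ) ^ l ≤ (2 ^ l) ^ (e + 1) := by
    refine le_self_pow₀ (one_le_pow₀ (by norm_num)) (by omega)
  set c : ℝ := 2 ^ Nat.clog 2 (2 + e) with hcdef
  have hc0 : 0 < c := by positivity
  calc (c⁻¹ * ((2 ^ j) ^ (e + 1))⁻¹)⁻¹ * (((2 + e : ℕ) : ℝ) * (2 ^ (j + l)) ^ (2 + e))⁻¹ *
        (2 * (4 * 2 ^ (j + l)))
      = 8 * (c / ((2 + e : ℕ) : ℝ)) * ((2 ^ l) ^ (e + 1))⁻¹ := by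
        have hab : ((2 : ℝ) ^ (j + l)) ^ (2 + e) =
            (2 ^ j) ^ (e + 1) * (2 ^ l) ^ (e + 1) * 2 ^ (j + l) := by
          rw [pow_add (2 : ℝ) j l]; ring
        rw [hab]
        field_simp
        norm_num
    _ ≤ 8 * 2 * (2 ^ l)⁻¹ := by
        gcongr
        rw [div_le_iff₀ hd0]; exact hc
    _ = 16 * (2 ^ l)⁻¹ := by ring

/-- The kernel of `(1 - E_n) T_i`. -/
noncomputable def oscFineKer (d : ℕ) (σ τ : ℝ) (n : ℤ) (i : ℕ) (x y : ℝ) : ℂ :=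
  oscKer d σ τ i x y - oscCoarseKer d σ τ n i x y

/-- For `i < j` the kernel of `T_i` is smooth at the scale `2 ^ oscScale d j`, and removing its
averages gains a factor `2 ^ (i - j)` by the modulus of continuity. -/
lemma lintegral_oscFineKer_left_le (hd : 2 ≤ d) (hσ : |σ| = 1) (hτ : |τ| = 1) {i j : ℕ}
    (hij : i < j) (y : ℝ) :
    ∫⁻ x, ‖oscFineKer d σ τ (oscScale d j) i x y‖ₑ ≤ 40 * decayRate ^ (8 * (j - i)) := by
  set n := oscScale d j with hn
  have hp := two_zpow_pos n
  have hm : Measurable (Function.uncurry fun x t : ℝ =>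
      ‖oscKer d σ τ i x y - oscKer d σ τ i (x + t) y‖ₑ) := by
    have h1 := (measurable_oscPiece d τ ((2 : ℝ) ^ i))
    unfold Function.uncurry oscKer
    exact ((h1.comp (by fun_prop)).sub (h1.comp (by fun_prop))).enorm
  set V : ℝ≥0∞ := ENNReal.ofReal (10 * (2 ^ n * (d * (2 * 2 ^ i) ^ (d - 1)))) with hV
  calc ∫⁻ x, ‖oscFineKer d σ τ n i x y‖ₑ
      ≤ ∫⁻ x, (ENNReal.ofReal ((2 : ℝ) ^ n))⁻¹ * ∫⁻ t in Icc (-(2 : ℝ) ^ n) (2 ^ n),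
          ‖oscKer d σ τ i x y - oscKer d σ τ i (x + t) y‖ₑ := by
        refine lintegral_mono fun x => ?_
        exact enorm_sub_dyExp_le n ((localKernel_oscKer hσ i).left y) x
    _ = (ENNReal.ofReal ((2 : ℝ) ^ n))⁻¹ * ∫⁻ t in Icc (-(2 : ℝ) ^ n) (2 ^ n), ∫⁻ x,
          ‖oscKer d σ τ i x y - oscKer d σ τ i (x + t) y‖ₑ := by
        rw [lintegral_const_mul' _ _ (by simpa using hp), lintegral_lintegral_swap hm.aemeasurable]
    _ ≤ (ENNReal.ofReal ((2 : ℝ) ^ n))⁻¹ * ∫⁻ t in Icc (-(2 : ℝ) ^ n) (2 ^ n), V := by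
        refine mul_le_mul_right (setLIntegral_mono measurable_const fun t ht => ?_) _
        exact lintegral_oscKer_sub_le (by omega) hσ hτ i (abs_le.2 ht) y
    _ = 2 * V := by
        rw [setLIntegral_const, Real.volume_Icc, show (2 : ℝ) ^ n - -2 ^ n = 2 * 2 ^ n by ring,
          ENNReal.ofReal_mul (by norm_num), mul_comm V, ← mul_assoc, mul_left_comm,
          ENNReal.inv_mul_cancel (ofReal_two_zpow_ne_zero n) ENNReal.ofReal_ne_top]
        simp
    _ ≤ _ := by
        rw [← ofReal_two_zpow_neg, show (40 : ℝ≥0∞) = 2 * ENNReal.ofReal 20 by norm_num, mul_assoc,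
          ← ENNReal.ofReal_mul (by norm_num)]
        refine mul_le_mul_right (ENNReal.ofReal_le_ofReal ?_) _
        have hc := le_two_pow_clog d
        have hd0 : (0 : ℝ) < d := by exact_mod_cast (by omega : 0 < d)
        obtain ⟨l, rfl⟩ := Nat.exists_eq_add_of_lt hij
        obtain ⟨e, rfl⟩ := Nat.exists_eq_add_of_le hd
        rw [hn, two_zpow_oscScale (by omega), show i + l + 1 - i = l + 1 by omega, zpow_neg,
          zpow_natCast, show 2 + e - 1 = e + 1 by omega]
        have hl : (2 : ℝ) ^ l ≤ (2 ^ l) ^ (e + 1) :=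
          le_self_pow₀ (one_le_pow₀ (by norm_num)) (by omega)
        set c : ℝ := 2 ^ Nat.clog 2 (2 + e) with hcdef
        have hc0 : 0 < c := by positivity
        calc 10 * (c⁻¹ * ((2 ^ (i + l + 1)) ^ (e + 1))⁻¹ *
              (((2 + e : ℕ) : ℝ) * (2 * 2 ^ i) ^ (e + 1)))
            = 10 * (((2 + e : ℕ) : ℝ) / c) * ((2 ^ l) ^ (e + 1))⁻¹ := by
              rw [show (2 : ℝ) ^ (i + l + 1) = (2 * 2 ^ i) * 2 ^ l by ring, mul_pow _ ((2 : ℝ) ^ l)]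
              field_simp
          _ ≤ 10 * 1 * (2 ^ l)⁻¹ := by
              gcongr
              rw [div_le_one₀ hc0]; exact hc
          _ = 20 * (2 ^ (l + 1))⁻¹ := by rw [pow_succ]; field_simp; norm_num

end

lemma le_pow_mul_of_two_bounds {q A v : ℝ≥0∞} {m n : ℕ} (h1 : v ≤ q ^ (8 * m) * A)
    (h2 : v ≤ q ^ (4 * n) * A) : v ≤ q ^ (4 * m) * (q ^ (2 * n) * A) := by
  have e1 : q ^ (8 * m) = q ^ (4 * m) * q ^ (4 * m) := by rw [← pow_add]; congr 1; ring
  have e2 : q ^ (4 * n) = q ^ (2 * n) * q ^ (2 * n) := by rw [← pow_add]; congr 1; ring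
  rw [← mul_assoc]
  rcases le_total (q ^ (4 * m)) (q ^ (2 * n)) with h | h
  · rw [e1] at h1
    exact h1.trans (mul_le_mul_left (mul_le_mul_right h _) _)
  · rw [e2] at h2
    exact h2.trans (mul_le_mul_left (mul_le_mul_left h _) _)

section

variable {d : ℕ} {σ τ : ℝ}

lemma two_pow_ofReal_inv_mul (i : ℕ) (c : ℕ) (B : ℝ≥0∞) :
    ENNReal.ofReal ((2 : ℝ) ^ i)⁻¹ * (3 * ENNReal.ofReal ((2 : ℝ) ^ ((i : ℤ) + c)) * B) =
      3 * 2 ^ c * B := by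
  have h1 : (2 : ℝ) ^ ((i : ℤ) + c) = 2 ^ i * 2 ^ c := by
    rw [zpow_add₀ (by norm_num), zpow_natCast, zpow_natCast]
  have h2 : ENNReal.ofReal ((2 : ℝ) ^ i)⁻¹ * ENNReal.ofReal ((2 : ℝ) ^ i) = 1 := by
    rw [← ENNReal.ofReal_mul (by positivity), inv_mul_cancel₀ (by positivity)]; simp
  have h3 : ENNReal.ofReal ((2 : ℝ) ^ c) = 2 ^ c := by
    rw [ENNReal.ofReal_pow (by norm_num)]; simp
  calc _ = 3 * (ENNReal.ofReal ((2 : ℝ) ^ i)⁻¹ * ENNReal.ofReal ((2 : ℝ) ^ i)) *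
        ENNReal.ofReal ((2 : ℝ) ^ c) * B := by
        rw [h1, ENNReal.ofReal_mul (by positivity)]; ring
    _ = _ := by rw [h2, h3, mul_one]

lemma dyExp_oscOp {f : ℝ → ℂ} (hf : TestFun f) (hσ : |σ| = 1) (n : ℤ) (i : ℕ) (x : ℝ) :
    dyExp n (oscOp d σ τ i f) x = kOp (oscCoarseKer d σ τ n i) f x :=
  (localKernel_dyKer n).kOp_kOp (localKernel_oscKer hσ i) hf x

lemma oscOp_sub_dyExp {f : ℝ → ℂ} (hf : TestFun f) (hσ : |σ| = 1) (n : ℤ) (i : ℕ) (x : ℝ) :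
    oscOp d σ τ i f x - dyExp n (oscOp d σ τ i f) x = kOp (oscFineKer d σ τ n i) f x := by
  rw [dyExp_oscOp hf hσ, oscOp,
    (localKernel_oscKer hσ i).kOp_sub_kernel (localKernel_oscCoarseKer hσ n i) hf]
  rfl

lemma l2sq_dyExp_oscOp_le {u : ℝ → ℂ} (hu : TestFun u) (hd : 2 ≤ d) (hσ : |σ| = 1)
    (hτ : |τ| = 1) {i j : ℕ} (hji : j ≤ i) {B : ℝ≥0∞}
    (hB : ∀ x, dyAvg ((i : ℤ) + 2) (fun y => ‖u y‖ₑ) x ≤ B) :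
    l2sq (dyExp (oscScale d j) (oscOp d σ τ i u)) ≤
      decayRate ^ (8 * (i - j)) * (960 * B * ∫⁻ y, ‖u y‖ₑ) := by
  have := l2sq_kOp_le_of_bound (localKernel_oscCoarseKer (τ := τ) hσ (oscScale d j) i) hu
    (A := 12 * B) (fun x => ?_) (lintegral_oscCoarseKer_left_le hd hσ hτ hji)
  · rw [l2sq]
    simp_rw [dyExp_oscOp hu hσ]
    refine this.trans ?_
    calc 12 * B * (16 * decayRate ^ (8 * (i - j))) * ∫⁻ y, ‖u y‖ₑ
        = 192 * (decayRate ^ (8 * (i - j)) * (B * ∫⁻ y, ‖u y‖ₑ)) := by ring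
      _ ≤ 960 * (decayRate ^ (8 * (i - j)) * (B * ∫⁻ y, ‖u y‖ₑ)) := by gcongr; norm_num
      _ = _ := by ring
  · have h1 := two_pow_ofReal_inv_mul i 2 B
    rw [show (3 : ℝ≥0∞) * 2 ^ 2 = 12 by norm_num] at h1
    rw [← h1]
    refine lintegral_mul_le_of_near hu.enorm_meas (x := x)
      (fun y => enorm_le_ofReal (norm_oscCoarseKer_le d σ τ _ i x y)) (fun y hy => ?_) hB
    rw [oscCoarseKer_of_lt hσ (oscScale_nonpos (by omega) j) hy, enorm_zero]

lemma l2sq_oscOp_sub_dyExp_le {u : ℝ → ℂ} (hu : TestFun u) (hd : 2 ≤ d) (hσ : |σ| = 1)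
    (hτ : |τ| = 1) {i j : ℕ} (hij : i < j) {B : ℝ≥0∞}
    (hB : ∀ x, dyAvg ((i : ℤ) + 2) (fun y => ‖u y‖ₑ) x ≤ B) :
    l2sq (fun x => oscOp d σ τ i u x - dyExp (oscScale d j) (oscOp d σ τ i u) x) ≤
      decayRate ^ (8 * (j - i)) * (960 * B * ∫⁻ y, ‖u y‖ₑ) := by
  have := l2sq_kOp_le_of_bound (κ := oscFineKer d σ τ (oscScale d j) i)
    ((localKernel_oscKer hσ i).sub (localKernel_oscCoarseKer (τ := τ) hσ (oscScale d j) i)) hu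
    (A := 24 * B) (fun x => ?_) (lintegral_oscFineKer_left_le hd hσ hτ hij)
  · rw [l2sq]
    simp_rw [oscOp_sub_dyExp hu hσ]
    refine this.trans (le_of_eq ?_)
    ring
  · have h1 := two_pow_ofReal_inv_mul i 2 (2 * B)
    rw [show (3 : ℝ≥0∞) * 2 ^ 2 * (2 * B) = 24 * B by ring] at h1
    have h2 : ∀ y, ‖oscFineKer d σ τ (oscScale d j) i x y‖ₑ ≤ 2 * ENNReal.ofReal ((2 : ℝ) ^ i)⁻¹ := by
      intro y
      refine enorm_sub_le.trans ?_
      rw [two_mul]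
      exact add_le_add (enorm_le_ofReal (norm_oscKer_le d σ τ i x y))
        (enorm_le_ofReal (norm_oscCoarseKer_le d σ τ _ i x y))
    refine (lintegral_mul_le_of_near hu.enorm_meas (x := x) h2 (fun y hy => ?_) hB).trans
      (le_of_eq ?_)
    · have h3 : (2 : ℝ) ^ (i + 1) < |x - y| := by
        refine lt_of_le_of_lt ?_ hy
        rw [← zpow_natCast]
        exact two_zpow_mono (by push_cast; omega)
      rw [oscFineKer, oscCoarseKer_of_lt hσ (oscScale_nonpos (by omega) j) hy, oscKer_of_lt hσ h3,
        sub_zero, enorm_zero]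
    · rw [← h1]; push_cast; ring

/-- The constant in the maximal inequality `lintegral_sq_iSup_oscOp_le`. -/
noncomputable def oscConst : ℝ≥0∞ := partialSumConst decayRate * 3840

lemma oscConst_ne_top : oscConst ≠ ∞ :=
  ENNReal.mul_ne_top (partialSumConst_ne_top decayRate_lt_one) (by norm_num)

/-- The initial partial sums form the situation of `lintegral_sq_iSup_partialSum_le`. For each pair
of scales there are two bounds, one decaying in `|i - j|` and one, from the oscillation, in `s`;
their geometric mean decays in both. -/
lemma lintegral_sq_iSup_oscOp_head_le (hd : 2 ≤ d) (hσ : |σ| = 1) (hτ : |τ| = 1)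
    {u : ℕ → ℝ → ℂ} (hu : ∀ i, TestFun (u i)) {s : ℕ} (hs : 1 ≤ s) {B : ℝ≥0∞}
    (hB : ∀ i : ℕ, ∀ n : ℤ, (i : ℤ) + 1 - s ≤ n → ∀ x, dyAvg n (fun y => ‖u i y‖ₑ) x ≤ B)
    (h0 : ∀ i, i + 1 < s → u i = fun _ => 0) (N : ℕ) :
    ∫⁻ x, (⨆ j ∈ Finset.range N, ‖∑ i ∈ Finset.range (j + 1), oscOp d σ τ i (u i) x‖ₑ) ^ 2 ≤
      partialSumConst decayRate * 960 *
        (decayRate ^ (2 * s) * B * ∑ i ∈ Finset.range N, ∫⁻ y, ‖u i y‖ₑ) := by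
  set a : ℕ → ℝ≥0∞ := fun i => decayRate ^ (2 * s) * (960 * B * ∫⁻ y, ‖u i y‖ₑ) with ha
  have hφ : ∀ i, TestFun (oscOp d σ τ i (u i)) := fun i => (hu i).oscOp hσ i
  have hdiag : ∀ i, l2sq (oscOp d σ τ i (u i)) ≤ decayRate ^ (4 * s) *
      (960 * B * ∫⁻ y, ‖u i y‖ₑ) := by
    intro i
    by_cases his : i + 1 < s
    · have : l2sq (oscOp d σ τ i (u i)) = 0 := by
        rw [h0 i his]; simp [l2sq, oscOp, kOp]
      rw [this]; exact zero_le
    · refine (l2sq_oscOp_le (hu i) hd hσ hτ hs (not_lt.1 his) (hB i)).trans ?_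
      calc 18 * decayRate ^ (4 * s) * B * ∫⁻ y, ‖u i y‖ₑ
          = 18 * (decayRate ^ (4 * s) * (B * ∫⁻ y, ‖u i y‖ₑ)) := by ring
        _ ≤ 960 * (decayRate ^ (4 * s) * (B * ∫⁻ y, ‖u i y‖ₑ)) := by gcongr; norm_num
        _ = _ := by ring
  have hdiag' : ∀ i, l2sq (oscOp d σ τ i (u i)) ≤ a i := by
    intro i
    refine (hdiag i).trans (mul_le_mul_left ?_ _)
    exact pow_le_pow_right_of_le_one' decayRate_lt_one.le (by omega)
  have hB2 : ∀ i : ℕ, ∀ x, dyAvg ((i : ℤ) + 2) (fun y => ‖u i y‖ₑ) x ≤ B := fun i =>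
    hB i _ (by omega)
  have main := lintegral_sq_iSup_partialSum_le decayRate_ne_zero decayRate_lt_one
    (antitone_oscScale (d := d) (by omega)) hφ (N := N) (a := a) (fun i _ => hdiag' i)
    (fun i _ j hj => le_pow_mul_of_two_bounds (l2sq_dyExp_oscOp_le (hu i) hd hσ hτ hj.le (hB2 i))
      ((l2sq_dyExp_le _ (hφ i)).trans (hdiag i)))
    (fun j _ i hij => ?_)
  · refine main.trans (le_of_eq ?_)
    rw [ha]
    simp_rw [← mul_assoc]
    rw [← Finset.mul_sum]
    ring
  · rcases hij.eq_or_lt with rfl | hij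
    · rw [Nat.sub_self, mul_zero, pow_zero, one_mul]
      exact (l2sq_sub_dyExp_le _ (hφ i)).trans (hdiag' i)
    · exact le_pow_mul_of_two_bounds (l2sq_oscOp_sub_dyExp_le (hu i) hd hσ hτ hij (hB2 i))
        ((l2sq_sub_dyExp_le _ (hφ i)).trans (hdiag i))

/-- The maximal partial sums of the oscillating operators, applied to functions with controlled
averages: a bound that decays geometrically in the distance `s` between the scale of the operator
and the scale from which on the averages of the function are controlled. -/
theorem lintegral_sq_iSup_oscOp_le (hd : 2 ≤ d) (hσ : |σ| = 1) (hτ : |τ| = 1)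
    {u : ℕ → ℝ → ℂ} (hu : ∀ i, TestFun (u i)) {s : ℕ} (hs : 1 ≤ s) {B : ℝ≥0∞}
    (hB : ∀ i : ℕ, ∀ n : ℤ, (i : ℤ) + 1 - s ≤ n → ∀ x, dyAvg n (fun y => ‖u i y‖ₑ) x ≤ B)
    (h0 : ∀ i, i + 1 < s → u i = fun _ => 0) (N : ℕ) :
    ∫⁻ x, (⨆ j ∈ Finset.range N, ‖∑ i ∈ Finset.Ico j N, oscOp d σ τ i (u i) x‖ₑ) ^ 2 ≤
      oscConst * (decayRate ^ (2 * s) * B * ∑ i ∈ Finset.range N, ∫⁻ y, ‖u i y‖ₑ) := by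
  have h := lintegral_sq_iSup_oscOp_head_le hd hσ hτ hu hs hB h0 N
  have hm := measurable_iSup_partialSum (fun i => (hu i).oscOp (d := d) (τ := τ) hσ i)
    (Finset.range N) (fun j => Finset.range (j + 1))
  set S : ℝ → ℝ≥0∞ := fun x =>
    ⨆ j ∈ Finset.range N, ‖∑ i ∈ Finset.range (j + 1), oscOp d σ τ i (u i) x‖ₑ with hS
  -- A final partial sum is a difference of two initial ones.
  calc _ ≤ ∫⁻ x, 4 * S x ^ 2 := by
        refine lintegral_mono fun x => ?_
        rw [show (4 : ℝ≥0∞) = 2 ^ 2 by norm_num, ← mul_pow]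
        refine pow_le_pow_left' (iSup₂_le fun j hj => ?_) 2
        have hjN := Finset.mem_range.1 hj
        have hle : ∀ m ≤ N, ‖∑ i ∈ Finset.range m, oscOp d σ τ i (u i) x‖ₑ ≤ S x := by
          intro m hm
          rcases m with _ | m
          · simp
          · exact le_iSup₂ (f := fun j _ =>
              ‖∑ i ∈ Finset.range (j + 1), oscOp d σ τ i (u i) x‖ₑ) m (Finset.mem_range.2 hm)
        rw [Finset.sum_Ico_eq_sub _ hjN.le, two_mul]
        exact enorm_sub_le.trans (add_le_add (hle N le_rfl) (hle j hjN.le))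
    _ = 4 * ∫⁻ x, S x ^ 2 := lintegral_const_mul _ (hm.pow_const 2)
    _ ≤ 4 * _ := mul_le_mul_right h _
    _ = _ := by rw [oscConst]; ring

end

/-! ### The oscillating part at the active scales -/

/-- The normalized integral over the threefold dilate of the dyadic interval around `x`. -/
noncomputable def triAvg (k : ℤ) (F : ℝ → ℝ≥0∞) (x : ℝ) : ℝ≥0∞ :=
  (ENNReal.ofReal ((2 : ℝ) ^ k))⁻¹ * ∫⁻ y in dyTriple k (dyIdx k x), F y

lemma triAvg_congr {k : ℤ} {F : ℝ → ℝ≥0∞} {x y : ℝ} (h : dyIdx k x = dyIdx k y) :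
    triAvg k F x = triAvg k F y := by rw [triAvg, triAvg, h]

lemma dyAvg_le_triAvg {k : ℤ} (F : ℝ → ℝ≥0∞) {x y : ℝ} (h : |x - y| ≤ (2 : ℝ) ^ k) :
    dyAvg k F y ≤ triAvg k F x := by
  refine mul_le_mul_right (lintegral_mono_set fun z hz => ?_) _
  have h1 := dyIdx_near h
  rw [mem_dyTriple_iff, mem_dyIv.1 hz]
  exact h1

lemma le_inv_rpow_mul_rpow {θ h : ℝ≥0∞} (hθ0 : θ ≠ 0) (hθ : θ ≠ ∞) (hle : θ ≤ h) {r : ℝ}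
    (hr : 1 ≤ r) : h ≤ (θ ^ (r - 1))⁻¹ * h ^ r := by
  have e : h ^ r = h ^ (r - 1) * h := by
    conv_rhs => rw [← ENNReal.rpow_one h, ← ENNReal.rpow_mul]
    rw [one_mul, ← ENNReal.rpow_add_of_nonneg _ _ (by linarith) (by norm_num), sub_add_cancel]
  rw [e, ← mul_assoc]
  have h2 : 1 ≤ (θ ^ (r - 1))⁻¹ * h ^ (r - 1) := by
    have h3 : θ ^ (r - 1) ≤ h ^ (r - 1) := ENNReal.rpow_le_rpow hle (by linarith)
    have h4 : θ ^ (r - 1) ≠ 0 := by simp [ENNReal.rpow_eq_zero_iff, hθ0, hθ]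
    have h5 : θ ^ (r - 1) ≠ ∞ := ENNReal.rpow_ne_top_of_nonneg (by linarith) hθ
    calc 1 = (θ ^ (r - 1))⁻¹ * θ ^ (r - 1) := (ENNReal.inv_mul_cancel h4 h5).symm
      _ ≤ _ := mul_le_mul_right h3 _
  calc h = 1 * h := (one_mul _).symm
    _ ≤ _ := mul_le_mul_left h2 _

/-- The part of `f` whose stopping scale is `s` steps below `i + 1`. -/
noncomputable def stopPart (f : ℝ → ℂ) (T : ℝ≥0∞) (K i s : ℕ) : ℝ → ℂ :=
  {y | stopScale (fun y => ‖f y‖ₑ) T 0 K y = (i : ℤ) + 1 - s}.indicator f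

section

variable {d : ℕ} {σ τ : ℝ} {f : ℝ → ℂ} {T : ℝ≥0∞} {K : ℕ}

lemma testFun_stopPart (hf : TestFun f) (T : ℝ≥0∞) (K i s : ℕ) : TestFun (stopPart f T K i s) :=
  hf.indicator (measurableSet_stopScale _)

lemma stopPart_eq_zero {i s : ℕ} (h : i + 1 < s) : stopPart f T K i s = fun _ => 0 := by
  funext y
  refine indicator_of_notMem (fun hy => ?_) _
  have h1 := left_le_stopScale (F := fun y => ‖f y‖ₑ) (t := T) (a := 0) (M := K) y
  have h2 : stopScale (fun y => ‖f y‖ₑ) T 0 K y = (i : ℤ) + 1 - s := hy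
  omega

lemma enorm_indicator (S : Set ℝ) (f : ℝ → ℂ) (y : ℝ) :
    ‖S.indicator f y‖ₑ = S.indicator (fun y => ‖f y‖ₑ) y := by
  by_cases hy : y ∈ S <;> simp [hy]

lemma dyAvg_stopPart_le (hT : ∫⁻ y, ‖f y‖ₑ ≤ T * ENNReal.ofReal ((2 : ℝ) ^ (K : ℤ))) (i s : ℕ)
    {n : ℤ} (hn : (i : ℤ) + 1 - s ≤ n) (x : ℝ) :
    dyAvg n (fun y => ‖stopPart f T K i s y‖ₑ) x ≤ 2 * T := by
  simp_rw [stopPart, enorm_indicator]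
  exact dyAvg_indicator_stopScale_le hT hn x

lemma sum_lintegral_stopPart_le (hf : TestFun f) (T : ℝ≥0∞) (K s : ℕ) :
    ∑ i ∈ Finset.range K, ∫⁻ y, ‖stopPart f T K i s y‖ₑ ≤ ∫⁻ y, ‖f y‖ₑ := by
  rw [← lintegral_finsetSum _ fun i _ => (testFun_stopPart hf T K i s).enorm_meas]
  refine lintegral_mono fun y => ?_
  by_cases h : ∃ i ∈ Finset.range K, stopScale (fun y => ‖f y‖ₑ) T 0 K y = (i : ℤ) + 1 - s
  · obtain ⟨i, hi, h⟩ := h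
    rw [Finset.sum_eq_single_of_mem i hi]
    · rw [stopPart, enorm_indicator]
      exact indicator_le_self' (fun _ _ => zero_le) y
    · intro j _ hj
      rw [stopPart, indicator_of_notMem, enorm_zero]
      intro hy
      have h2 : stopScale (fun y => ‖f y‖ₑ) T 0 K y = (j : ℤ) + 1 - s := hy
      omega
  · rw [Finset.sum_eq_zero]
    · exact zero_le
    · intro j hj
      rw [stopPart, indicator_of_notMem, enorm_zero]
      intro hy
      exact h ⟨j, hj, hy⟩

/-- At an active scale only the parts of `f` with smaller stopping scale contribute. -/
lemma oscOp_eq_sum_stopPart (hf : TestFun f) (hσ : |σ| = 1) {i : ℕ} (hi : i < K) {x : ℝ}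
    (hA : ∀ m : ℤ, (i : ℤ) + 1 ≤ m → m ≤ K → triAvg m (fun y => ‖f y‖ₑ) x ≤ T) :
    oscOp d σ τ i f x = ∑ s ∈ Finset.Icc 1 K, oscOp d σ τ i (stopPart f T K i s) x := by
  have h1 := (localKernel_oscKer (d := d) (τ := τ) hσ i).kOp_sum (s := Finset.Icc 1 K)
    (φ := fun s => stopPart f T K i s) (fun s _ => testFun_stopPart hf T K i s) x
  simp only [oscOp]
  rw [← h1, kOp, kOp]
  congr 1; funext y
  by_cases hy : (2 : ℝ) ^ (i + 1) < |x - y|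
  · rw [oscKer_of_lt hσ hy, zero_mul, zero_mul]
  congr 1
  set m := stopScale (fun y => ‖f y‖ₑ) T 0 K y with hm
  have hm0 : 0 ≤ m := left_le_stopScale y
  have hmK : m ≤ K := stopScale_le (by omega) y
  have hmi : m ≤ i := by
    by_contra! hlt
    have h2 : T < dyAvg m (fun y => ‖f y‖ₑ) y := lt_dyAvg_stopScale (by omega)
    have h3 : |x - y| ≤ (2 : ℝ) ^ m := by
      refine (not_lt.1 hy).trans ?_
      rw [← zpow_natCast]
      exact two_zpow_mono (by push_cast; omega)
    exact absurd ((dyAvg_le_triAvg _ h3).trans (hA m (by omega) hmK)) (not_le.2 h2)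
  rw [Finset.sum_eq_single_of_mem (i + 1 - m.toNat) (Finset.mem_Icc.2 (by omega))]
  · rw [stopPart, indicator_of_mem]
    show stopScale (fun y => ‖f y‖ₑ) T 0 K y = _
    omega
  · intro s _ hs
    rw [stopPart, indicator_of_notMem]
    intro hy'
    have h2 : stopScale (fun y => ‖f y‖ₑ) T 0 K y = (i : ℤ) + 1 - s := hy'
    omega

lemma enorm_oscKer_le (d : ℕ) (σ τ : ℝ) (i : ℕ) (x y : ℝ) :
    ‖oscKer d σ τ i x y‖ₑ ≤ ENNReal.ofReal ((2 : ℝ) ^ i)⁻¹ :=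
  enorm_le_ofReal (norm_oscKer_le d σ τ i x y)

/-- The trivial bound for one oscillating operator against a weight with bounded averages. -/
lemma lintegral_oscOp_mul_le (hσ : |σ| = 1) {u : ℝ → ℂ} (hu : TestFun u) (i : ℕ)
    {w : ℝ → ℝ≥0∞} (hw : Measurable w) {B : ℝ≥0∞} (hB : ∀ x, dyAvg ((i : ℤ) + 1) w x ≤ B) :
    ∫⁻ x, ‖oscOp d σ τ i u x‖ₑ * w x ≤ 6 * B * ∫⁻ y, ‖u y‖ₑ := by
  have hκ := localKernel_oscKer (d := d) (τ := τ) hσ i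
  have hm : Measurable fun p : ℝ × ℝ => ‖oscKer d σ τ i p.1 p.2‖ₑ * ‖u p.2‖ₑ * w p.1 :=
    (hκ.meas.enorm.mul (hu.enorm_meas.comp measurable_snd)).mul (hw.comp measurable_fst)
  calc ∫⁻ x, ‖oscOp d σ τ i u x‖ₑ * w x
      ≤ ∫⁻ x, ∫⁻ y, ‖oscKer d σ τ i x y‖ₑ * ‖u y‖ₑ * w x := by
        refine lintegral_mono fun x => ?_
        rw [lintegral_mul_const _ ((hκ.right x).enorm_meas.fun_mul hu.enorm_meas)]
        exact mul_le_mul_left (enorm_kOp_le _ _ _) _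
    _ = ∫⁻ y, ∫⁻ x, ‖oscKer d σ τ i x y‖ₑ * ‖u y‖ₑ * w x :=
        lintegral_lintegral_swap hm.aemeasurable
    _ = ∫⁻ y, (∫⁻ x, ‖oscKer d σ τ i x y‖ₑ * w x) * ‖u y‖ₑ := by
        refine lintegral_congr fun y => ?_
        rw [← lintegral_mul_const _ ((hκ.left y).enorm_meas.fun_mul hw)]
        refine lintegral_congr fun x => ?_
        ring
    _ ≤ ∫⁻ y, 6 * B * ‖u y‖ₑ := by
        refine lintegral_mono fun y => mul_le_mul_left ?_ _
        have h1 := two_pow_ofReal_inv_mul i 1 B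
        rw [show (3 : ℝ≥0∞) * 2 ^ 1 = 6 by norm_num] at h1
        rw [← h1]
        refine lintegral_mul_le_of_near hw (x := y)
          (fun x => enorm_oscKer_le d σ τ i x y) (fun x hx => ?_) hB
        rw [oscKer_of_lt hσ, enorm_zero]
        rw [abs_sub_comm, ← zpow_natCast]
        exact_mod_cast hx
    _ = _ := lintegral_const_mul _ hu.enorm_meas

/-- Contribution of the parts of `f` that live `s` scales below the operator. The weight `h` is
split at height `θ`: the `L²` bound handles its small values, the trivial bound the large ones. -/
lemma lintegral_stopPart_le (hd : 2 ≤ d) (hσ : |σ| = 1) (hτ : |τ| = 1) (hf : TestFun f)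
    (hT : ∫⁻ y, ‖f y‖ₑ ≤ T * ENNReal.ofReal ((2 : ℝ) ^ (K : ℤ)))
    {act : ℕ → ℝ → Prop} (hact : ∀ i i', i ≤ i' → i' < K → ∀ x, act i x → act i' x)
    (hactm : ∀ i, MeasurableSet {x | act i x})
    {h : ℝ → ℝ≥0∞} (hh : Measurable h) {r : ℝ} (hr : 1 ≤ r) (hr2 : r ≤ 2) {t : ℝ≥0∞}
    (ht : ∀ i < K, ∀ x, dyAvg ((i : ℤ) + 1) ({x | act i x}.indicator fun x => h x ^ r) x ≤ t)
    {s : ℕ} (hs : 1 ≤ s) {θ : ℝ≥0∞} (hθ0 : θ ≠ 0) (hθ : θ ≠ ∞) :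
    ∃ I₁ : ℝ≥0∞, I₁ ^ 2 ≤ oscConst * (decayRate ^ (2 * s) * (2 * T) * ∫⁻ y, ‖f y‖ₑ) *
        (θ ^ (2 - r) * ∫⁻ x, h x ^ r) ∧
      ∫⁻ x, (⨆ j ∈ Finset.range K, ⨆ _ : act j x,
        ‖∑ i ∈ Finset.Ico j K, oscOp d σ τ i (stopPart f T K i s) x‖ₑ) * h x ≤
      I₁ + 6 * t * (θ ^ (r - 1))⁻¹ * ∫⁻ y, ‖f y‖ₑ := by
  have hu : ∀ i, TestFun (stopPart f T K i s) := fun i => testFun_stopPart hf T K i s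
  -- The part of the weight below height `θ`.
  set h₁ : ℝ → ℝ≥0∞ := {x | h x ≤ θ}.indicator h with hh₁
  have hm₁ : Measurable h₁ := hh.indicator (measurableSet_le hh measurable_const)
  set U : ℝ → ℝ≥0∞ := fun x => ⨆ j ∈ Finset.range K,
    ‖∑ i ∈ Finset.Ico j K, oscOp d σ τ i (stopPart f T K i s) x‖ₑ with hU
  have hUm : Measurable U := measurable_iSup_partialSum
    (fun i => (hu i).oscOp (d := d) (τ := τ) hσ i)
    (Finset.range K) (fun j => Finset.Ico j K)
  refine ⟨∫⁻ x, U x * h₁ x, ?_, ?_⟩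
  · refine (sq_lintegral_mul_le volume hUm.aemeasurable hm₁.aemeasurable).trans ?_
    refine mul_le_mul' ?_ ?_
    · refine (lintegral_sq_iSup_oscOp_le hd hσ hτ hu hs
        (fun i n hn x => dyAvg_stopPart_le hT i s hn x)
        (fun i hi => stopPart_eq_zero hi) K).trans ?_
      exact mul_le_mul_right (mul_le_mul_right (sum_lintegral_stopPart_le hf T K s) _) _
    · rw [← lintegral_const_mul _ (hh.pow_const r)]
      refine lintegral_mono fun x => ?_
      by_cases hx : h x ≤ θ
      · rw [hh₁, indicator_of_mem (show x ∈ {x | h x ≤ θ} from hx)]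
        calc h x ^ 2 = h x ^ ((2 - r) + r) := by
              rw [sub_add_cancel]; norm_cast
          _ = h x ^ (2 - r) * h x ^ r :=
              ENNReal.rpow_add_of_nonneg _ _ (by linarith) (by linarith)
          _ ≤ _ := mul_le_mul_left (ENNReal.rpow_le_rpow hx (by linarith)) _
      · rw [hh₁, indicator_of_notMem (show x ∉ {x | h x ≤ θ} from hx)]
        simp
  · set w : ℕ → ℝ → ℝ≥0∞ := fun i => {x | act i x}.indicator fun x => h x ^ r with hw
    have hwm : ∀ i, Measurable (w i) := fun i => (hh.pow_const r).indicator (hactm i)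
    set c : ℝ≥0∞ := (θ ^ (r - 1))⁻¹ with hc
    have hom : ∀ i, Measurable fun x => ‖oscOp d σ τ i (stopPart f T K i s) x‖ₑ := fun i =>
      ((hu i).oscOp hσ i).enorm_meas
    have hpt : ∀ x, (⨆ j ∈ Finset.range K, ⨆ _ : act j x,
        ‖∑ i ∈ Finset.Ico j K, oscOp d σ τ i (stopPart f T K i s) x‖ₑ) * h x ≤
        U x * h₁ x + ∑ i ∈ Finset.range K, c * (‖oscOp d σ τ i (stopPart f T K i s) x‖ₑ * w i x) := by
      intro x
      by_cases hx : h x ≤ θ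
      · refine le_trans ?_ le_self_add
        rw [hh₁, indicator_of_mem (show x ∈ {x | h x ≤ θ} from hx)]
        refine mul_le_mul_left (iSup₂_le fun j hj => iSup_le fun _ => ?_) _
        exact le_iSup₂ (f := fun j _ =>
          ‖∑ i ∈ Finset.Ico j K, oscOp d σ τ i (stopPart f T K i s) x‖ₑ) j hj
      · refine le_trans ?_ le_add_self
        -- Above height `θ` no cancellation between the scales is needed.
        have hx1 : h x ≤ c * h x ^ r := le_inv_rpow_mul_rpow hθ0 hθ (not_le.1 hx).le hr
        refine (mul_le_mul_right hx1 _).trans ?_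
        rw [ENNReal.iSup_mul]
        refine iSup_le fun j => ?_
        rw [ENNReal.iSup_mul]
        refine iSup_le fun hj => ?_
        rw [ENNReal.iSup_mul]
        refine iSup_le fun hja => ?_
        calc _ ≤ (∑ i ∈ Finset.Ico j K, ‖oscOp d σ τ i (stopPart f T K i s) x‖ₑ) * (c * h x ^ r) :=
              mul_le_mul_left (enorm_sum_le _ _) _
          _ = ∑ i ∈ Finset.Ico j K, c * (‖oscOp d σ τ i (stopPart f T K i s) x‖ₑ * w i x) := by
              rw [Finset.sum_mul]
              refine Finset.sum_congr rfl fun i hi => ?_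
              have hi' := Finset.mem_Ico.1 hi
              have : w i x = h x ^ r :=
                indicator_of_mem (show x ∈ {x | act i x} from hact j i hi'.1 hi'.2 x hja) _
              rw [this]; ring
          _ ≤ _ := Finset.sum_le_sum_of_subset fun i hi =>
              Finset.mem_range.2 (Finset.mem_Ico.1 hi).2
    refine (lintegral_mono hpt).trans ?_
    rw [lintegral_add_left (hUm.fun_mul hm₁)]
    refine add_le_add_right ?_ _
    rw [lintegral_finsetSum _ fun i _ => ((hom i).fun_mul (hwm i)).const_mul c]
    calc ∑ i ∈ Finset.range K, ∫⁻ x, c * (‖oscOp d σ τ i (stopPart f T K i s) x‖ₑ * w i x)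
        ≤ ∑ i ∈ Finset.range K, c * (6 * t * ∫⁻ y, ‖stopPart f T K i s y‖ₑ) := by
          refine Finset.sum_le_sum fun i hi => ?_
          rw [lintegral_const_mul _ ((hom i).fun_mul (hwm i))]
          exact mul_le_mul_right
            (lintegral_oscOp_mul_le hσ (hu i) i (hwm i) (ht i (Finset.mem_range.1 hi))) _
      _ = 6 * t * c * ∑ i ∈ Finset.range K, ∫⁻ y, ‖stopPart f T K i s y‖ₑ := by
          rw [Finset.mul_sum]
          refine Finset.sum_congr rfl fun i _ => ?_
          ring
      _ ≤ _ := mul_le_mul_right (sum_lintegral_stopPart_le hf T K s) _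

end

/-- The sum of the geometric series with ratio `decayRate ^ ((r - 1) / 2)`; it is the source of the
factor `1 / (r - 1)` in the sparse bound. -/
lemma inv_one_sub_decayRate_rpow_le {r : ℝ} (hr : 1 < r) (hr2 : r ≤ 2) :
    (1 - decayRate ^ ((r - 1) / 2))⁻¹ ≤ ENNReal.ofReal (64 / (r - 1)) := by
  have hlog : 0.5 < Real.log 2 := lt_trans (by norm_num) Real.log_two_gt_d9
  have hlog1 : Real.log 2 < 1 := lt_trans Real.log_two_lt_d9 (by norm_num)
  set y : ℝ := Real.log 2 * ((r - 1) / 16) with hy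
  have hy0 : 0 < y := mul_pos (by linarith) (by linarith)
  have hy1 : y ≤ 1 := by nlinarith
  have hyr : (r - 1) / 32 ≤ y := by nlinarith
  have e1 : decayRate ^ ((r - 1) / 2) = ENNReal.ofReal (Real.exp (-y)) := by
    rw [decayRate, ← ENNReal.rpow_mul, hy, ← mul_neg, ← Real.rpow_def_of_pos (by norm_num),
      Real.rpow_neg (by norm_num), ENNReal.ofReal_inv_of_pos (by positivity),
      ← ENNReal.ofReal_rpow_of_pos (by norm_num), ENNReal.inv_rpow]
    congr 2
    · norm_num
    · ring
  have h1 : Real.exp (-y) ≤ 1 - y / 2 := by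
    rw [Real.exp_neg]
    have h2 : 1 + y ≤ Real.exp y := by linarith [Real.add_one_le_exp y]
    calc (Real.exp y)⁻¹ ≤ (1 + y)⁻¹ := inv_anti₀ (by linarith) h2
      _ ≤ 1 - y / 2 := by
        rw [inv_le_iff_one_le_mul₀ (by linarith)]
        nlinarith
  rw [e1, ← ENNReal.ofReal_one, ← ENNReal.ofReal_sub _ (Real.exp_pos _).le,
    ← ENNReal.ofReal_inv_of_pos (by linarith)]
  refine ENNReal.ofReal_le_ofReal ?_
  calc (1 - Real.exp (-y))⁻¹ ≤ ((r - 1) / 64)⁻¹ := inv_anti₀ (by linarith) (by linarith)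
    _ = 64 / (r - 1) := by rw [inv_div]

/-- The constant in `lintegral_iSup_active_oscOp_le`. -/
noncomputable def oscSumConst (c : ℝ≥0∞) (r : ℝ) : ℝ≥0∞ :=
  (oscConst * (2 * c) + 1 + 6 * c) * (1 - decayRate ^ ((r - 1) / 2))⁻¹

section

variable {d : ℕ} {σ τ : ℝ} {f : ℝ → ℂ} {K : ℕ}

/-- The maximal partial sums of the oscillating operators over the active scales, paired with a
weight `h`, when `f` and `h` have controlled averages at these scales. -/
theorem lintegral_iSup_active_oscOp_le (hd : 2 ≤ d) (hσ : |σ| = 1) (hτ : |τ| = 1)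
    (hf : TestFun f) {c V F G : ℝ≥0∞} (hG0 : G ≠ 0) (hG : G ≠ ∞)
    (hT : ∫⁻ y, ‖f y‖ₑ ≤ c * F * ENNReal.ofReal ((2 : ℝ) ^ (K : ℤ)))
    (hF : ∫⁻ y, ‖f y‖ₑ ≤ V * F)
    {act : ℕ → ℝ → Prop} (hact : ∀ i i', i ≤ i' → i' < K → ∀ x, act i x → act i' x)
    (hactm : ∀ i, MeasurableSet {x | act i x})
    (hactF : ∀ i < K, ∀ x, act i x → ∀ m : ℤ, (i : ℤ) + 1 ≤ m → m ≤ K →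
      triAvg m (fun y => ‖f y‖ₑ) x ≤ c * F)
    {h : ℝ → ℝ≥0∞} (hh : Measurable h) {r : ℝ} (hr : 1 ≤ r) (hr2 : r ≤ 2)
    (hV : ∫⁻ x, h x ^ r ≤ V * G ^ r)
    (ht : ∀ i < K, ∀ x, dyAvg ((i : ℤ) + 1) ({x | act i x}.indicator fun x => h x ^ r) x ≤
      c * G ^ r) :
    ∫⁻ x, (⨆ j ∈ Finset.range K, ⨆ _ : act j x,
      ‖∑ i ∈ Finset.Ico j K, oscOp d σ τ i f x‖ₑ) * h x ≤ oscSumConst c r * (V * F * G) := by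
  set D : ℝ≥0∞ := oscConst * (2 * c) + 1 with hD
  set ρ : ℝ≥0∞ := decayRate ^ ((r - 1) / 2) with hρ
  -- The contribution of the parts of `f` that live `s` scales below the operators.
  set W : ℕ → ℝ → ℝ≥0∞ := fun s x => ⨆ j ∈ Finset.range K, ⨆ _ : act j x,
    ‖∑ i ∈ Finset.Ico j K, oscOp d σ τ i (stopPart f (c * F) K i s) x‖ₑ with hW
  have hWm : ∀ s, Measurable (W s) := by
    intro s
    refine Measurable.iSup fun j => Measurable.iSup fun _ => ?_
    have e : (fun x => ⨆ _ : act j x,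
        ‖∑ i ∈ Finset.Ico j K, oscOp d σ τ i (stopPart f (c * F) K i s) x‖ₑ) =
        {x | act j x}.indicator fun x =>
          ‖∑ i ∈ Finset.Ico j K, oscOp d σ τ i (stopPart f (c * F) K i s) x‖ₑ := by
      funext x
      by_cases hx : act j x
      · rw [indicator_of_mem (show x ∈ {x | act j x} from hx)]; simp [hx]
      · rw [indicator_of_notMem (show x ∉ {x | act j x} from hx)]; simp [hx]
    rw [e]
    refine Measurable.indicator ?_ (hactm j)
    exact (TestFun.sum fun i _ => (testFun_stopPart hf (c * F) K i s).oscOp hσ i).enorm_meas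
  have hpt : ∀ x, (⨆ j ∈ Finset.range K, ⨆ _ : act j x,
      ‖∑ i ∈ Finset.Ico j K, oscOp d σ τ i f x‖ₑ) * h x ≤ ∑ s ∈ Finset.Icc 1 K, W s x * h x := by
    intro x
    rw [← Finset.sum_mul]
    refine mul_le_mul_left (iSup₂_le fun j hj => iSup_le fun hja => ?_) _
    have e : ∑ i ∈ Finset.Ico j K, oscOp d σ τ i f x =
        ∑ s ∈ Finset.Icc 1 K, ∑ i ∈ Finset.Ico j K,
          oscOp d σ τ i (stopPart f (c * F) K i s) x := by
      rw [Finset.sum_comm]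
      refine Finset.sum_congr rfl fun i hi => ?_
      have hi' := Finset.mem_Ico.1 hi
      exact oscOp_eq_sum_stopPart hf hσ hi'.2
        (hactF i hi'.2 x (hact j i hi'.1 hi'.2 x hja))
    rw [e]
    refine (enorm_sum_le _ _).trans (Finset.sum_le_sum fun s _ => ?_)
    refine le_trans ?_ (le_iSup₂ (f := fun j _ => ⨆ _ : act j x,
      ‖∑ i ∈ Finset.Ico j K, oscOp d σ τ i (stopPart f (c * F) K i s) x‖ₑ) j hj)
    exact le_iSup (fun _ : act j x =>
      ‖∑ i ∈ Finset.Ico j K, oscOp d σ τ i (stopPart f (c * F) K i s) x‖ₑ) hja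
  have hs : ∀ s ∈ Finset.Icc 1 K, ∫⁻ x, W s x * h x ≤ (D + 6 * c) * (V * F * G) * ρ ^ s := by
    intro s hs
    set p : ℝ≥0∞ := decayRate ^ s with hp
    have hp0 : p ≠ 0 := pow_ne_zero _ decayRate_ne_zero
    have hp1 : p ≤ 1 := pow_le_one₀ zero_le decayRate_lt_one.le
    have hpt : p ≠ ∞ := ne_top_of_le_ne_top ENNReal.one_ne_top hp1
    have hρs : ρ ^ s = p ^ ((r - 1) / 2) := by
      rw [hρ, hp, ← ENNReal.rpow_natCast, ← ENNReal.rpow_natCast, ← ENNReal.rpow_mul,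
        ← ENNReal.rpow_mul, mul_comm]
    have hr1p : p ^ (r - 1) ≤ ρ ^ s := by
      rw [hρs]
      exact ENNReal.rpow_le_rpow_of_exponent_ge hp1 (by linarith)
    have hsq : p ^ (r - 1) = (ρ ^ s) ^ 2 := by
      rw [hρs, ← ENNReal.rpow_natCast, ← ENNReal.rpow_mul]
      congr 1; push_cast; ring
    -- With the height `θ = p⁻¹ G`, where `p = decayRate ^ s`, the contribution of the values above
    -- `θ` is `O(p ^ (r - 1))` and that of the values below it is `O(p ^ (r / 2))`. Both are `O(ρ ^
    -- s)`.
    obtain ⟨I₁, hI, hle⟩ := lintegral_stopPart_le (d := d) (σ := σ) (τ := τ) hd hσ hτ hf hT hact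
      hactm hh hr hr2 ht (Finset.mem_Icc.1 hs).1 (θ := p⁻¹ * G)
      (mul_ne_zero (ENNReal.inv_ne_zero.2 hpt) hG0)
      (ENNReal.mul_ne_top (ENNReal.inv_ne_top.2 hp0) hG)
    refine hle.trans ?_
    have hA : I₁ ≤ D * (V * F * G) * ρ ^ s := by
      rw [← ENNReal.pow_le_pow_left_iff two_ne_zero]
      refine hI.trans ?_
      have e1 : decayRate ^ (2 * s) = p ^ 2 := by rw [hp, ← pow_mul, mul_comm]
      have e2 : p ^ 2 * (p⁻¹) ^ (2 - r) = p ^ r := by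
        rw [ENNReal.inv_rpow, ← ENNReal.rpow_neg, ← ENNReal.rpow_natCast,
          ← ENNReal.rpow_add _ _ hp0 hpt]
        congr 1; push_cast; ring
      have e3 : G ^ (2 - r) * G ^ r = G ^ 2 := by
        rw [← ENNReal.rpow_add _ _ hG0 hG, sub_add_cancel]; norm_cast
      have e4 : p ^ r ≤ p ^ (r - 1) := ENNReal.rpow_le_rpow_of_exponent_ge hp1 (by linarith)
      have hDD : oscConst * (2 * c) ≤ D ^ 2 := by
        calc oscConst * (2 * c) ≤ D * 1 := by rw [mul_one]; exact le_self_add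
          _ ≤ D * D := mul_le_mul_right le_add_self _
          _ = D ^ 2 := (sq D).symm
      calc oscConst * (decayRate ^ (2 * s) * (2 * (c * F)) * ∫⁻ y, ‖f y‖ₑ) *
            ((p⁻¹ * G) ^ (2 - r) * ∫⁻ x, h x ^ r)
          ≤ oscConst * (p ^ 2 * (2 * (c * F)) * (V * F)) *
            ((p⁻¹) ^ (2 - r) * G ^ (2 - r) * (V * G ^ r)) := by
            rw [e1, ENNReal.mul_rpow_of_nonneg _ _ (by linarith)]
            gcongr
        _ = oscConst * (2 * c) * (p ^ 2 * (p⁻¹) ^ (2 - r)) * (V * F) ^ 2 *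
            (G ^ (2 - r) * G ^ r) := by ring
        _ ≤ D ^ 2 * p ^ (r - 1) * (V * F) ^ 2 * G ^ 2 := by
            rw [e2, e3]; gcongr
        _ = _ := by rw [hsq]; ring
    have hB : 6 * (c * G ^ r) * ((p⁻¹ * G) ^ (r - 1))⁻¹ * ∫⁻ y, ‖f y‖ₑ ≤
        6 * c * (V * F * G) * ρ ^ s := by
      have hGr0 : G ^ (r - 1) ≠ 0 := by simp [ENNReal.rpow_eq_zero_iff, hG0, hG]
      have hGrt : G ^ (r - 1) ≠ ∞ := ENNReal.rpow_ne_top_of_nonneg (by linarith) hG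
      have e1 : ((p⁻¹ * G) ^ (r - 1))⁻¹ = p ^ (r - 1) * (G ^ (r - 1))⁻¹ := by
        rw [ENNReal.mul_rpow_of_nonneg _ _ (by linarith),
            ENNReal.mul_inv (Or.inr hGrt) (Or.inr hGr0),
          ENNReal.inv_rpow, inv_inv]
      have e2 : G ^ r = G ^ (r - 1) * G := by
        conv_rhs => rw [← ENNReal.rpow_one G, ← ENNReal.rpow_mul]
        rw [one_mul, ← ENNReal.rpow_add _ _ hG0 hG, sub_add_cancel]
      calc 6 * (c * G ^ r) * ((p⁻¹ * G) ^ (r - 1))⁻¹ * ∫⁻ y, ‖f y‖ₑ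
          = 6 * c * (G ^ (r - 1) * (G ^ (r - 1))⁻¹) * G * p ^ (r - 1) * ∫⁻ y, ‖f y‖ₑ := by
            rw [e1, e2]; ring
        _ ≤ 6 * c * 1 * G * ρ ^ s * (V * F) := by
            rw [ENNReal.mul_inv_cancel hGr0 hGrt]
            gcongr
        _ = _ := by ring
    refine (add_le_add hA hB).trans (le_of_eq ?_)
    ring
  calc _ ≤ ∫⁻ x, ∑ s ∈ Finset.Icc 1 K, W s x * h x := lintegral_mono hpt
    _ = ∑ s ∈ Finset.Icc 1 K, ∫⁻ x, W s x * h x :=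
        lintegral_finsetSum _ fun s _ => (hWm s).fun_mul hh
    _ ≤ ∑ s ∈ Finset.Icc 1 K, (D + 6 * c) * (V * F * G) * ρ ^ s := Finset.sum_le_sum hs
    _ = (D + 6 * c) * (V * F * G) * ∑ s ∈ Finset.Icc 1 K, ρ ^ s := by rw [Finset.mul_sum]
    _ ≤ (D + 6 * c) * (V * F * G) * (1 - ρ)⁻¹ := by
        rw [← ENNReal.tsum_geometric]
        exact mul_le_mul_right (ENNReal.sum_le_tsum _) _
    _ = _ := by rw [oscSumConst]; ring

end

/-! ### The local estimate outside an exceptional set -/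

/-- The truncation of the operator to the scales between `2 ^ j` and `2 ^ l`, up to averages: the
averages of `|f|`, the Hilbert transform at the scales at most `1`, and the oscillating parts on
the two half-lines at the larger scales. -/
noncomputable def truncTerm (d : ℕ) (f : ℝ → ℂ) (j l : ℤ) (x : ℝ) : ℝ≥0∞ :=
  (⨆ k ∈ Finset.Icc j l, triAvg k (fun y => ‖f y‖ₑ) x) +
  ‖∑ k ∈ Finset.Icc j (min l 0), hilOp k f x‖ₑ +
  ‖∑ i ∈ Finset.Ico (j - 1).toNat l.toNat, oscOp d 1 1 i f x‖ₑ +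
  ‖∑ i ∈ Finset.Ico (j - 1).toNat l.toNat, oscOp d (-1) ((-1) ^ d) i f x‖ₑ

lemma kOp_congr_of_ne {κ : ℝ → ℝ → ℂ} {f g : ℝ → ℂ} {x : ℝ} (h : ∀ y, κ x y ≠ 0 → f y = g y) :
    kOp κ f x = kOp κ g x := by
  rw [kOp, kOp]
  congr 1; funext y
  by_cases hy : κ x y = 0
  · rw [hy, zero_mul, zero_mul]
  · rw [h y hy]

lemma mem_dyTriple_of_hilKer_ne {k : ℤ} {x y : ℝ} (h : hilKer k x y ≠ 0) :
    y ∈ dyTriple k (dyIdx k x) := by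
  refine mem_dyTriple_of_abs_le ?_
  by_contra! hlt
  exact h (hilKer_of_le hlt.le)

lemma mem_dyTriple_of_oscKer_ne {d : ℕ} {σ τ : ℝ} (hσ : |σ| = 1) {i : ℕ} {x y : ℝ}
    (h : oscKer d σ τ i x y ≠ 0) : y ∈ dyTriple ((i : ℤ) + 1) (dyIdx ((i : ℤ) + 1) x) := by
  refine mem_dyTriple_of_abs_le ?_
  by_contra! hlt
  refine h (oscKer_of_lt hσ ?_)
  rw [← zpow_natCast]
  exact_mod_cast hlt

lemma truncTerm_congr {d : ℕ} {f g : ℝ → ℂ} {j K : ℤ} {x : ℝ}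
    (h : ∀ y ∈ dyTriple K (dyIdx K x), f y = g y) : truncTerm d f j K x = truncTerm d g j K x := by
  have h1 : ∀ k ≤ K, ∀ y ∈ dyTriple k (dyIdx k x), f y = g y := fun k hk y hy =>
    h y (dyTriple_subset_of_le hk x hy)
  have e1 : ∀ k ∈ Finset.Icc j K, triAvg k (fun y => ‖f y‖ₑ) x = triAvg k (fun y => ‖g y‖ₑ) x := by
    intro k hk
    rw [triAvg, triAvg]
    congr 1
    refine setLIntegral_congr_fun (measurableSet_dyTriple _ _) fun y hy => ?_
    simp only [h1 k (Finset.mem_Icc.1 hk).2 y hy]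
  have e2 : ∀ k ∈ Finset.Icc j (min K 0), hilOp k f x = hilOp k g x := fun k hk =>
    kOp_congr_of_ne fun y hy => h1 k ((Finset.mem_Icc.1 hk).2.trans (min_le_left _ _)) y
      (mem_dyTriple_of_hilKer_ne hy)
  have e3 : ∀ σ τ : ℝ, |σ| = 1 → ∀ i ∈ Finset.Ico (j - 1).toNat K.toNat,
      oscOp d σ τ i f x = oscOp d σ τ i g x := fun σ τ hσ i hi =>
    kOp_congr_of_ne fun y hy => h1 _ (by have := (Finset.mem_Ico.1 hi).2; omega) y
      (mem_dyTriple_of_oscKer_ne hσ hy)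
  rw [truncTerm, truncTerm, Finset.sum_congr rfl e2, Finset.sum_congr rfl (e3 1 1 (by simp)),
    Finset.sum_congr rfl (e3 (-1) ((-1) ^ d) (by simp))]
  congr 3
  exact iSup_congr fun k => iSup_congr fun hk => e1 k hk

lemma kOp_eq_zero {κ : ℝ → ℝ → ℂ} {f : ℝ → ℂ} (hf : f =ᵐ[volume] 0) (x : ℝ) : kOp κ f x = 0 := by
  rw [kOp]
  refine integral_eq_zero_of_ae ?_
  filter_upwards [hf] with y hy
  simp [hy]

lemma truncTerm_eq_zero {d : ℕ} {f : ℝ → ℂ} (hf : f =ᵐ[volume] 0) (j l : ℤ) (x : ℝ) :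
    truncTerm d f j l x = 0 := by
  have e1 : ∀ k, triAvg k (fun y => ‖f y‖ₑ) x = 0 := by
    intro k
    rw [triAvg, setLIntegral_congr_fun_ae (g := fun _ => 0) (measurableSet_dyTriple _ _)]
    · simp
    · filter_upwards [hf] with y hy _
      simp [hy]
  simp [truncTerm, e1, hilOp, oscOp, kOp_eq_zero hf]

lemma sum_Icc_two_zpow_le (j b : ℤ) :
    ∑ k ∈ Finset.Icc j b, ENNReal.ofReal ((2 : ℝ) ^ (j - k)) ≤ 2 := by
  have e : ∀ k ∈ Finset.Icc j b, ENNReal.ofReal ((2 : ℝ) ^ (j - k)) = 2⁻¹ ^ (k - j).toNat := by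
    intro k hk
    have h1 := (Finset.mem_Icc.1 hk).1
    rw [show j - k = -((k - j).toNat : ℤ) by omega, ofReal_two_zpow_neg, pow_mul,
      decayRate_pow_eight]
  rw [Finset.sum_congr rfl e]
  have hinj : Set.InjOn (fun k : ℤ => (k - j).toNat) (Finset.Icc j b) := by
    intro k hk l hl hkl
    have h1 := (Finset.mem_Icc.1 (Finset.mem_coe.1 hk)).1
    have h2 := (Finset.mem_Icc.1 (Finset.mem_coe.1 hl)).1
    have h3 : (k - j).toNat = (l - j).toNat := hkl
    omega
  rw [← Finset.sum_image (f := fun n : ℕ => (2⁻¹ : ℝ≥0∞) ^ n) hinj]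
  refine (ENNReal.sum_le_tsum _).trans (le_of_eq ?_)
  rw [ENNReal.tsum_geometric, ENNReal.one_sub_inv_two, inv_inv]

/-- The smoothness of the Hilbert kernel compares the values at two points of one interval. -/
lemma enorm_hilOp_sub_le {f : ℝ → ℂ} (hf : TestFun f) {j k : ℤ} (hjk : j ≤ k) {x x' : ℝ}
    (hx : dyIdx j x = dyIdx j x') :
    ‖hilOp k f x - hilOp k f x'‖ₑ ≤
      15 * ENNReal.ofReal ((2 : ℝ) ^ (j - k)) * triAvg k (fun y => ‖f y‖ₑ) x := by
  have hp := two_zpow_pos k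
  have e1 : hilOp k f x - hilOp k f x' = ∫ y, (hilKer k x y - hilKer k x' y) * f y := by
    rw [hilOp, kOp, kOp, ← integral_sub ((localKernel_hilKer k).integrable_mul hf x)
      ((localKernel_hilKer k).integrable_mul hf x')]
    congr 1; funext y; ring
  rw [e1]
  refine (enorm_integral_le_lintegral_enorm _).trans ?_
  set c : ℝ := 15 * ((2 : ℝ) ^ k)⁻¹ ^ 2 * 2 ^ j with hc
  have hkk : dyIdx k x = dyIdx k x' := dyIdx_eq_of_le hjk hx
  calc ∫⁻ y, ‖(hilKer k x y - hilKer k x' y) * f y‖ₑ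
      ≤ ∫⁻ y, (dyTriple k (dyIdx k x)).indicator (fun y => ENNReal.ofReal c * ‖f y‖ₑ) y := by
        refine lintegral_mono fun y => ?_
        by_cases hy : y ∈ dyTriple k (dyIdx k x)
        · rw [indicator_of_mem hy, enorm_mul]
          refine mul_le_mul_left (enorm_le_ofReal ?_) _
          refine (norm_hilKer_sub_le k x x' y).trans ?_
          rw [hc]
          gcongr
          exact (abs_sub_lt_of_dyIdx_eq hx).le
        · rw [indicator_of_notMem hy]
          have h1 : hilKer k x y = 0 := by
            by_contra h; exact hy (mem_dyTriple_of_hilKer_ne h)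
          have h2 : hilKer k x' y = 0 := by
            by_contra h; exact hy (hkk ▸ mem_dyTriple_of_hilKer_ne h)
          simp [h1, h2]
    _ = ENNReal.ofReal c * ∫⁻ y in dyTriple k (dyIdx k x), ‖f y‖ₑ := by
        rw [lintegral_indicator (measurableSet_dyTriple _ _), lintegral_const_mul _ hf.enorm_meas]
    _ = _ := by
        have e2 : c = 15 * 2 ^ (j - k) * ((2 : ℝ) ^ k)⁻¹ := by
          rw [hc, zpow_sub₀ (by norm_num)]; field_simp
        rw [e2, triAvg, ENNReal.ofReal_mul (by positivity), ENNReal.ofReal_mul (by norm_num),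
          ENNReal.ofReal_inv_of_pos hp]
        norm_num
        ring

lemma sum_range_sub_eq {M : Type*} [AddCommMonoid M] (φ : ℤ → M) (b : ℤ) (n : ℕ) :
    ∑ i ∈ Finset.range (n + 1), φ (b - i) = ∑ k ∈ Finset.Icc (b - n) b, φ k := by
  refine Finset.sum_bij' (fun i _ => b - (i : ℤ)) (fun k _ => (b - k).toNat) ?_ ?_ ?_ ?_ ?_
  · intro i hi
    have := Finset.mem_range.1 hi
    exact Finset.mem_Icc.2 (by omega)
  · intro k hk
    have := Finset.mem_Icc.1 hk
    exact Finset.mem_range.2 (by omega)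
  · intro i _; simp
  · intro k hk
    have := Finset.mem_Icc.1 hk
    show b - ((b - k).toNat : ℤ) = k
    omega
  · intro i _; rfl

lemma triAvg_le_three_mul {k : ℤ} {F : ℝ → ℝ≥0∞} {x : ℝ} {t : ℝ≥0∞}
    (h : ∀ y, |x - y| ≤ (2 : ℝ) ^ k → dyAvg k F y ≤ t) : triAvg k F x ≤ 3 * t := by
  have hp := two_zpow_pos k
  have hb := dyIdx_bounds k x
  have i1 : dyIdx k (x - 2 ^ k) = dyIdx k x - 1 := by
    rw [dyIdx_eq_iff]; push_cast; constructor <;> linarith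
  have i2 : dyIdx k (x + 2 ^ k) = dyIdx k x + 1 := by
    rw [dyIdx_eq_iff]; push_cast; constructor <;> linarith
  rw [triAvg, dyTriple_eq_union, ← i1, ← i2]
  calc _ ≤ (ENNReal.ofReal ((2 : ℝ) ^ k))⁻¹ * ((∫⁻ y in dyIv k (dyIdx k (x - 2 ^ k)), F y) +
        (∫⁻ y in dyIv k (dyIdx k x), F y) + ∫⁻ y in dyIv k (dyIdx k (x + 2 ^ k)), F y) := by
        refine mul_le_mul_right ((lintegral_union_le _ _ _).trans ?_) _
        exact add_le_add_left (lintegral_union_le _ _ _) _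
    _ = dyAvg k F (x - 2 ^ k) + dyAvg k F x + dyAvg k F (x + 2 ^ k) := by
        rw [mul_add, mul_add]; rfl
    _ ≤ t + t + t := by
        refine add_le_add (add_le_add (h _ ?_) (h _ ?_)) (h _ ?_)
        · rw [sub_sub_cancel, abs_of_pos hp]
        · rw [sub_self, abs_zero]; exact hp.le
        · rw [sub_add_cancel_left, abs_neg, abs_of_pos hp]
    _ = 3 * t := by ring

lemma volume_dyAvg_near_le {F : ℝ → ℝ≥0∞} (hF : Measurable F) {t : ℝ≥0∞} (ht : t ≠ 0)
    (htt : t ≠ ∞) (a K : ℤ) (h : 192 * ∫⁻ x, F x ≤ t * ENNReal.ofReal ((2 : ℝ) ^ K)) :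
    volume {x : ℝ | ∃ m ∈ Icc a K, ∃ y, |x - y| ≤ (2 : ℝ) ^ m ∧ t < dyAvg m F y} ≤
      ENNReal.ofReal ((2 : ℝ) ^ K) / 64 := by
  have h1 := mul_volume_dyAvg_near_le (a := a) (M := K) (t := t) hF
  rw [ENNReal.le_div_iff_mul_le (by simp) (by simp), ← ENNReal.mul_le_mul_iff_right ht htt]
  refine le_trans ?_ h
  calc _ = 64 * (t * volume {x : ℝ | ∃ m ∈ Icc a K, ∃ y, |x - y| ≤ (2 : ℝ) ^ m ∧
      t < dyAvg m F y}) := by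
        ring
    _ ≤ 64 * (3 * ∫⁻ x, F x) := mul_le_mul_right h1 _
    _ = _ := by ring

/-- The part of `locConst` that comes from the averages and from the Hilbert transform. -/
noncomputable def locHilConst : ℝ≥0∞ := 1728 + 96 * (hilWeakConst + 1) + 51840

/-- The constant in the local estimate `exists_exceptional_set`. -/
noncomputable def locConst (r : ℝ) : ℝ≥0∞ := 2 * locHilConst + 2 * oscSumConst 1728 r

lemma lintegral_le_two_mul {h : ℝ → ℝ≥0∞} {S : Set ℝ} (hS : MeasurableSet S)
    (hh : Measurable h) (hhS : ∀ x, x ∉ S → h x = 0) {r : ℝ} (hr : 1 ≤ r) {G : ℝ≥0∞}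
    (hG0 : G ≠ 0) (hG : G ≠ ∞) (hV : ∫⁻ x, h x ^ r ≤ volume S * G ^ r) :
    ∫⁻ x, h x ≤ 2 * (volume S * G) := by
  have hGr0 : G ^ (r - 1) ≠ 0 := by simp [ENNReal.rpow_eq_zero_iff, hG0, hG]
  have hGrt : G ^ (r - 1) ≠ ∞ := ENNReal.rpow_ne_top_of_nonneg (by linarith) hG
  have hpt : ∀ x, h x ≤ S.indicator (fun _ => G) x + (G ^ (r - 1))⁻¹ * h x ^ r := by
    intro x
    by_cases hx : x ∈ S
    · rw [indicator_of_mem hx]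
      rcases le_total (h x) G with hle | hle
      · exact hle.trans le_self_add
      · exact (le_inv_rpow_mul_rpow hG0 hG hle hr).trans le_add_self
    · rw [hhS x hx]; exact zero_le
  have e2 : G ^ r = G ^ (r - 1) * G := by
    conv_rhs => rw [← ENNReal.rpow_one G, ← ENNReal.rpow_mul]
    rw [one_mul, ← ENNReal.rpow_add _ _ hG0 hG, sub_add_cancel]
  calc ∫⁻ x, h x ≤ ∫⁻ x, (S.indicator (fun _ => G) x + (G ^ (r - 1))⁻¹ * h x ^ r) :=
        lintegral_mono hpt
    _ = G * volume S + (G ^ (r - 1))⁻¹ * ∫⁻ x, h x ^ r := by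
        rw [lintegral_add_left (measurable_const.indicator hS), lintegral_indicator hS,
          setLIntegral_const, lintegral_const_mul _ (hh.pow_const r)]
    _ ≤ G * volume S + (G ^ (r - 1))⁻¹ * (volume S * (G ^ (r - 1) * G)) := by
        rw [← e2]; gcongr
    _ = G * volume S + ((G ^ (r - 1))⁻¹ * G ^ (r - 1)) * (volume S * G) := by ring
    _ = _ := by rw [ENNReal.inv_mul_cancel hGr0 hGrt]; ring

lemma measurableSet_not_dyIv_subset (j : ℤ) (E : Set ℝ) :
    MeasurableSet {x | ¬ dyIv j (dyIdx j x) ⊆ E} := by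
  have : Measurable fun x : ℝ => (¬ dyIv j (dyIdx j x) ⊆ E : Prop) :=
    measurable_of_dyIdx (k := j) fun x y hxy => by simp only [hxy]
  exact measurableSet_setOfPred.2 this

lemma exists_mem_of_not_dyIv_subset {j : ℤ} {E : Set ℝ} {x : ℝ}
    (h : ¬ dyIv j (dyIdx j x) ⊆ E) : ∃ x', dyIdx j x = dyIdx j x' ∧ x' ∉ E := by
  obtain ⟨x', h1, h2⟩ := not_subset.1 h
  exact ⟨x', (mem_dyIv.1 h1).symm, h2⟩

/-- The local estimate: outside a small exceptional set, all terms of the operator at the scales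
of a dyadic interval are controlled by the averages over its threefold dilate. -/
theorem exists_exceptional_set {d : ℕ} (hd : 2 ≤ d) {f g : ℝ → ℂ} (hf : TestFun f)
    (hg : TestFun g) {r : ℝ} (hr : 1 ≤ r) (hr2 : r ≤ 2) (a K i₀ : ℤ) :
    ∃ E : Set ℝ, volume E ≤ ENNReal.ofReal ((2 : ℝ) ^ K) / 16 ∧
      ∫⁻ x in dyIv K i₀, (⨆ j ∈ Finset.Icc a K, ⨆ _ : ¬ dyIv j (dyIdx j x) ⊆ E,
        truncTerm d f j K x) * ‖g x‖ₑ ≤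
      locConst r * (volume (dyTriple K i₀) * avg f (dyTriple K i₀) 1 * avg g (dyTriple K i₀) r) := by
  set S : Set ℝ := dyTriple K i₀ with hS
  have hSm : MeasurableSet S := measurableSet_dyTriple _ _
  set f₁ : ℝ → ℂ := S.indicator f with hf₁
  have hf₁t : TestFun f₁ := hf.indicator hSm
  set h : ℝ → ℝ≥0∞ := (dyIv K i₀).indicator fun x => ‖g x‖ₑ with hh
  have hhm : Measurable h := hg.enorm_meas.indicator (measurableSet_dyIv _ _)
  set V : ℝ≥0∞ := volume S with hV
  have hVeq : V = 3 * ENNReal.ofReal ((2 : ℝ) ^ K) := by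
    rw [hV, hS, volume_dyTriple, ENNReal.ofReal_mul (by norm_num)]; norm_num
  have hV0 : V ≠ 0 := by rw [hVeq]; exact mul_ne_zero (by norm_num) (ofReal_two_zpow_ne_zero K)
  have hVt : V ≠ ∞ := by rw [hVeq]; exact ENNReal.mul_ne_top (by norm_num) ENNReal.ofReal_ne_top
  set F : ℝ≥0∞ := avg f S 1 with hF
  set G : ℝ≥0∞ := avg g S r with hG
  set F₂ : ℝ → ℝ≥0∞ := S.indicator fun x => ‖g x‖ₑ ^ r with hF₂
  have hF₂m : Measurable F₂ := (hg.enorm_meas.pow_const r).indicator hSm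
  have hfF : ∫⁻ y, ‖f₁ y‖ₑ = V * F := by
    simp_rw [hf₁, enorm_indicator]
    rw [lintegral_indicator hSm, hF, avg]
    simp only [ENNReal.rpow_one, div_one]
    rw [← mul_assoc, ENNReal.mul_inv_cancel hV0 hVt, one_mul]
  have hgG : ∫⁻ y, F₂ y = V * G ^ r := by
    rw [hF₂, lintegral_indicator hSm, hG, avg, ← ENNReal.rpow_mul, one_div,
      inv_mul_cancel₀ (by linarith), ENNReal.rpow_one, ← mul_assoc, ENNReal.mul_inv_cancel hV0 hVt,
      one_mul]
  have hhF₂ : ∀ x, h x ^ r ≤ F₂ x := by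
    intro x
    by_cases hx : x ∈ dyIv K i₀
    · rw [hh, hF₂, indicator_of_mem hx, indicator_of_mem (dyIv_subset_dyTriple K i₀ hx)]
    · rw [hh, indicator_of_notMem hx, ENNReal.zero_rpow_of_pos (by linarith)]; exact zero_le
  have hhr : ∫⁻ x, h x ^ r ≤ V * G ^ r := (lintegral_mono hhF₂).trans hgG.le
  have hFt : F ≠ ∞ := fun hFt => by
    have := hf₁t.lintegral_lt_top
    rw [hfF, hFt, ENNReal.mul_top hV0] at this
    exact lt_irrefl _ this
  have hGt : G ≠ ∞ := fun hGt => by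
    obtain ⟨C, hC⟩ := hg.bdd
    have h1 : ∫⁻ y, F₂ y ≤ ENNReal.ofReal C ^ r * V := by
      rw [hF₂, lintegral_indicator hSm, ← setLIntegral_const]
      exact setLIntegral_mono measurable_const fun x _ =>
        ENNReal.rpow_le_rpow (enorm_le_ofReal (hC x)) (by linarith)
    rw [hgG, hGt, ENNReal.top_rpow_of_pos (by linarith), ENNReal.mul_top hV0, top_le_iff] at h1
    exact ENNReal.mul_ne_top (ENNReal.rpow_ne_top_of_nonneg (by linarith) ENNReal.ofReal_ne_top)
      hVt h1
  -- On the interval itself only the restriction of `f` to the threefold dilate matters.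
  have hcongr : ∀ x ∈ dyIv K i₀, ∀ j, truncTerm d f j K x = truncTerm d f₁ j K x := by
    intro x hx j
    refine truncTerm_congr fun y hy => ?_
    rw [mem_dyIv.1 hx] at hy
    rw [hf₁, indicator_of_mem hy]
  have hint : ∀ Φ : ℝ → ℝ≥0∞, ∫⁻ x in dyIv K i₀, Φ x * ‖g x‖ₑ = ∫⁻ x, Φ x * h x := by
    intro Φ
    rw [← lintegral_indicator (measurableSet_dyIv _ _)]
    refine lintegral_congr fun x => ?_
    by_cases hx : x ∈ dyIv K i₀
    · rw [hh, indicator_of_mem hx, indicator_of_mem hx]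
    · rw [hh, indicator_of_notMem hx, indicator_of_notMem hx, mul_zero]
  by_cases hF0 : F = 0
  · refine ⟨∅, by simp, ?_⟩
    have hz : f₁ =ᵐ[volume] 0 := by
      rw [hF0, mul_zero, lintegral_eq_zero_iff hf₁t.enorm_meas] at hfF
      filter_upwards [hfF] with y hy
      simpa using hy
    rw [setLIntegral_congr_fun (g := fun _ => 0) (measurableSet_dyIv _ _)]
    · simp
    · intro x hx
      simp [hcongr x hx, truncTerm_eq_zero hz]
  by_cases hG0 : G = 0
  · refine ⟨∅, by simp, ?_⟩
    have hz : ∀ᵐ x, h x = 0 := by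
      rw [hG0, ENNReal.zero_rpow_of_pos (by linarith), mul_zero, nonpos_iff_eq_zero,
        lintegral_eq_zero_iff (hhm.pow_const r)] at hhr
      filter_upwards [hhr] with y hy
      exact (ENNReal.rpow_eq_zero_iff_of_pos (by linarith)).1 hy
    rw [hint, lintegral_congr_ae (g := fun _ => 0)]
    · simp
    · filter_upwards [hz] with x hx
      rw [hx, mul_zero]
  have hGr0 : G ^ r ≠ 0 := by simp [ENNReal.rpow_eq_zero_iff, hG0, hGt]
  have hGrt : G ^ r ≠ ∞ := ENNReal.rpow_ne_top_of_nonneg (by linarith) hGt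
  -- The exceptional set: large averages of `f` or of `|g| ^ r`, or a large Hilbert transform.
  set b : ℤ := min K 0 with hb
  set M : ℕ := (b - a).toNat with hM
  set F₁ : ℝ → ℝ≥0∞ := fun y => ‖f₁ y‖ₑ with hF₁
  set t₃ : ℝ≥0∞ := 96 * (hilWeakConst + 1) * F with ht₃
  set S₁ : Set ℝ := {x | ∃ m ∈ Icc a K, ∃ y, |x - y| ≤ (2 : ℝ) ^ m ∧
      576 * F < dyAvg m F₁ y} with hS₁
  set S₂ : Set ℝ := {x | ∃ m ∈ Icc a K, ∃ y, |x - y| ≤ (2 : ℝ) ^ m ∧ 576 * G ^ r < dyAvg m F₂ y}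
    with hS₂
  set S₃ : Set ℝ := {x | t₃ < ⨆ j ∈ Finset.range (M + 1),
    ‖∑ i ∈ Finset.range (j + 1), hilOp (b - i) f₁ x‖ₑ} with hS₃
  have v₁ : volume S₁ ≤ ENNReal.ofReal ((2 : ℝ) ^ K) / 64 := by
    refine volume_dyAvg_near_le hf₁t.enorm_meas (mul_ne_zero (by norm_num) hF0)
      (ENNReal.mul_ne_top (by norm_num) hFt) a K ?_
    rw [hfF, hVeq]
    exact le_of_eq (by ring)
  have v₂ : volume S₂ ≤ ENNReal.ofReal ((2 : ℝ) ^ K) / 64 := by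
    refine volume_dyAvg_near_le hF₂m (mul_ne_zero (by norm_num) hGr0)
      (ENNReal.mul_ne_top (by norm_num) hGrt) a K ?_
    rw [hgG, hVeq]
    exact le_of_eq (by ring)
  have v₃ : volume S₃ ≤ ENNReal.ofReal ((2 : ℝ) ^ K) / 32 := by
    have h1 := mul_volume_iSup_hilOp_le b M hf₁t t₃
    rw [ENNReal.le_div_iff_mul_le (by simp) (by simp)]
    have hc0 : hilWeakConst + 1 ≠ 0 := by simp
    have hct : hilWeakConst + 1 ≠ ∞ := ENNReal.add_ne_top.2 ⟨hilWeakConst_ne_top, by simp⟩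
    have h3 : (hilWeakConst + 1) * F ≠ 0 := mul_ne_zero hc0 hF0
    have h4 : (hilWeakConst + 1) * F ≠ ∞ := ENNReal.mul_ne_top hct hFt
    rw [← ENNReal.mul_le_mul_iff_right (mul_ne_zero (by norm_num : (96 : ℝ≥0∞) ≠ 0) h3)
      (ENNReal.mul_ne_top (by norm_num) h4)]
    calc 96 * ((hilWeakConst + 1) * F) * (volume S₃ * 32) = 32 * (t₃ * volume S₃) := by
          rw [ht₃]; ring
      _ ≤ 32 * (hilWeakConst * (V * F)) := by
          rw [← hfF]; exact mul_le_mul_right h1 _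
      _ ≤ 32 * ((hilWeakConst + 1) * (V * F)) := by gcongr; exact le_self_add
      _ = _ := by rw [hVeq]; ring
  set E : Set ℝ := S₁ ∪ S₂ ∪ S₃ with hE
  refine ⟨E, ?_, ?_⟩
  · refine (measure_union_le _ _).trans ((add_le_add ((measure_union_le _ _).trans
      (add_le_add v₁ v₂)) v₃).trans (le_of_eq ?_))
    simp only [div_eq_mul_inv]
    rw [← mul_add, ← mul_add]
    congr 1
    have e64 : (64 : ℝ≥0∞)⁻¹ = 2⁻¹ ^ 6 := by rw [← ENNReal.inv_pow]; norm_num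
    have e32 : (32 : ℝ≥0∞)⁻¹ = 2⁻¹ ^ 5 := by rw [← ENNReal.inv_pow]; norm_num
    have e16 : (16 : ℝ≥0∞)⁻¹ = 2⁻¹ ^ 4 := by rw [← ENNReal.inv_pow]; norm_num
    rw [e64, e32, e16]
    have h2 : (2 : ℝ≥0∞)⁻¹ + 2⁻¹ = 1 := ENNReal.inv_two_add_inv_two
    calc (2⁻¹ : ℝ≥0∞) ^ 6 + 2⁻¹ ^ 6 + 2⁻¹ ^ 5 = 2⁻¹ ^ 4 * (2⁻¹ * (2⁻¹ + 2⁻¹) + 2⁻¹) := by ring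
      _ = _ := by rw [h2, mul_one, h2, mul_one]
  -- An interval that is not contained in `E` has a point outside `E`, and this point controls the
  -- averages on that interval and on all larger ones.
  have A₁ : ∀ j x, a ≤ j → ¬ dyIv j (dyIdx j x) ⊆ E → ∀ m, j ≤ m → m ≤ K →
      triAvg m F₁ x ≤ 1728 * F := by
    intro j x haj hx m hjm hmK
    obtain ⟨x', e, hx'⟩ := exists_mem_of_not_dyIv_subset hx
    rw [triAvg_congr (dyIdx_eq_of_le hjm e), show (1728 : ℝ≥0∞) * F = 3 * (576 * F) by ring]
    refine triAvg_le_three_mul fun y hy => ?_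
    by_contra! hlt
    exact hx' (Or.inl (Or.inl ⟨m, ⟨haj.trans hjm, hmK⟩, y, hy, hlt⟩))
  have A₂ : ∀ j x, a ≤ j → j ≤ K → ¬ dyIv j (dyIdx j x) ⊆ E → dyAvg j F₂ x ≤ 1728 * G ^ r := by
    intro j x haj hjK hx
    obtain ⟨x', e, hx'⟩ := exists_mem_of_not_dyIv_subset hx
    rw [dyAvg_congr e]
    refine le_trans ?_ (mul_le_mul_left (by norm_num : (576 : ℝ≥0∞) ≤ 1728) _)
    by_contra! hlt
    refine hx' (Or.inl (Or.inr ⟨j, ⟨haj, hjK⟩, x', ?_, hlt⟩))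
    rw [sub_self, abs_zero]; exact (two_zpow_pos j).le
  -- The bound for the Hilbert transform holds at a point outside `E` and is transferred to the
  -- other points of the interval by the smoothness of the kernel.
  have A₃ : ∀ j x, a ≤ j → ¬ dyIv j (dyIdx j x) ⊆ E →
      ‖∑ k ∈ Finset.Icc j b, hilOp k f₁ x‖ₑ ≤ t₃ + 51840 * F := by
    intro j x haj hx
    rcases lt_or_ge b j with hbj | hjb
    · rw [Finset.Icc_eq_empty (not_le.2 hbj)]; simp
    obtain ⟨x', e, hx'⟩ := exists_mem_of_not_dyIv_subset hx
    have h1 : ‖∑ k ∈ Finset.Icc j b, hilOp k f₁ x'‖ₑ ≤ t₃ := by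
      have h2 : ¬ t₃ < ⨆ j ∈ Finset.range (M + 1),
          ‖∑ i ∈ Finset.range (j + 1), hilOp (b - i) f₁ x'‖ₑ := fun hlt => hx' (Or.inr hlt)
      rw [not_lt] at h2
      refine le_trans (le_of_eq ?_) ((le_iSup₂ (f := fun j _ =>
        ‖∑ i ∈ Finset.range (j + 1), hilOp (b - i) f₁ x'‖ₑ) (b - j).toNat
        (Finset.mem_range.2 (by omega))).trans h2)
      rw [sum_range_sub_eq (fun k => hilOp k f₁ x')]
      congr 3; omega
    have h3 : ‖∑ k ∈ Finset.Icc j b, hilOp k f₁ x - ∑ k ∈ Finset.Icc j b, hilOp k f₁ x'‖ₑ ≤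
        51840 * F := by
      rw [← Finset.sum_sub_distrib]
      calc _ ≤ ∑ k ∈ Finset.Icc j b, ‖hilOp k f₁ x - hilOp k f₁ x'‖ₑ := enorm_sum_le _ _
        _ ≤ ∑ k ∈ Finset.Icc j b, ENNReal.ofReal ((2 : ℝ) ^ (j - k)) * (15 * (1728 * F)) := by
            refine Finset.sum_le_sum fun k hk => ?_
            have hk' := Finset.mem_Icc.1 hk
            refine (enorm_hilOp_sub_le hf₁t hk'.1 e).trans ?_
            rw [mul_comm (15 : ℝ≥0∞), mul_assoc]
            have := A₁ j x haj hx k hk'.1 (hk'.2.trans (min_le_left _ _))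
            gcongr
        _ ≤ 2 * (15 * (1728 * F)) := by
            rw [← Finset.sum_mul]; exact mul_le_mul_left (sum_Icc_two_zpow_le j b) _
        _ = _ := by ring
    calc _ = ‖∑ k ∈ Finset.Icc j b, hilOp k f₁ x' + (∑ k ∈ Finset.Icc j b, hilOp k f₁ x -
          ∑ k ∈ Finset.Icc j b, hilOp k f₁ x')‖ₑ := by rw [add_sub_cancel]
      _ ≤ _ := (enorm_add_le _ _).trans (add_le_add h1 h3)
  set N : ℕ := K.toNat with hN
  -- The oscillating operator of index `n` reaches the distance `2 ^ (n + 1)`, so that it is active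
  -- at a point if the dyadic interval of length `2 ^ (n + 1)` is not contained in `E`.
  set act : ℕ → ℝ → Prop := fun n x => a ≤ (n : ℤ) + 1 ∧ (n : ℤ) + 1 ≤ K ∧
    ¬ dyIv ((n : ℤ) + 1) (dyIdx ((n : ℤ) + 1) x) ⊆ E with hact
  have actm : ∀ n, MeasurableSet {x | act n x} := by
    intro n
    by_cases hn : a ≤ (n : ℤ) + 1 ∧ (n : ℤ) + 1 ≤ K
    · have : {x | act n x} = {x | ¬ dyIv ((n : ℤ) + 1) (dyIdx ((n : ℤ) + 1) x) ⊆ E} := by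
        ext x; exact ⟨fun hx => hx.2.2, fun hx => ⟨hn.1, hn.2, hx⟩⟩
      rw [this]; exact measurableSet_not_dyIv_subset _ _
    · have : {x | act n x} = ∅ := by
        ext x; exact ⟨fun hx => hn ⟨hx.1, hx.2.1⟩, fun hx => hx.elim⟩
      rw [this]; exact MeasurableSet.empty
  set O : ℝ → ℝ → ℝ → ℝ≥0∞ := fun σ τ x => ⨆ n ∈ Finset.range N, ⨆ _ : act n x,
    ‖∑ i ∈ Finset.Ico n N, oscOp d σ τ i f₁ x‖ₑ with hO
  have Ole : ∀ σ τ : ℝ, |σ| = 1 → |τ| = 1 →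
      ∫⁻ x, O σ τ x * h x ≤ oscSumConst 1728 r * (V * F * G) := by
    intro σ τ hσ hτ
    by_cases hK : 0 ≤ K
    · have hNK : (N : ℤ) = K := by omega
      refine lintegral_iSup_active_oscOp_le hd hσ hτ hf₁t hG0 hGt ?_ hfF.le ?_ actm ?_ hhm hr hr2
        hhr ?_
      · rw [hfF, hVeq, hNK]
        calc 3 * ENNReal.ofReal ((2 : ℝ) ^ K) * F = 3 * F * ENNReal.ofReal ((2 : ℝ) ^ K) := by ring
          _ ≤ _ := by gcongr; norm_num
      · intro n n' hnn hn' x hx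
        refine ⟨by have := hx.1; omega, by omega, fun hsub => hx.2.2 ?_⟩
        exact (dyIv_subset_of_le (by omega) x).trans hsub
      · intro n _ x hx m hm hmN
        exact A₁ _ x hx.1 hx.2.2 m hm (by omega)
      · intro n hn x
        by_cases hx : act n x
        · have hmono : ({x | act n x}.indicator fun x => h x ^ r) ≤ F₂ := fun y =>
            (indicator_le_self' (fun _ _ => zero_le) y).trans (hhF₂ y)
          exact (dyAvg_mono hmono x).trans (A₂ _ x hx.1 hx.2.1 hx.2.2)
        · rw [dyAvg, setLIntegral_congr_fun (g := fun _ => 0) (measurableSet_dyIv _ _)]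
          · simp
          · intro y hy
            refine indicator_of_notMem (s := {x | act n x}) (fun hy' => hx ?_) _
            refine ⟨hy'.1, hy'.2.1, ?_⟩
            have := hy'.2.2
            rwa [mem_dyIv.1 hy] at this
    · have hN0 : N = 0 := by omega
      simp [hO, hN0]
  have hpt : ∀ x ∈ dyIv K i₀, (⨆ j ∈ Finset.Icc a K, ⨆ _ : ¬ dyIv j (dyIdx j x) ⊆ E,
      truncTerm d f j K x) ≤ locHilConst * F + O 1 1 x + O (-1) ((-1) ^ d) x := by
    intro x hx
    refine iSup₂_le fun j hj => iSup_le fun hjE => ?_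
    have hj' := Finset.mem_Icc.1 hj
    rw [hcongr x hx, truncTerm]
    have hosc : ∀ σ τ : ℝ, ‖∑ i ∈ Finset.Ico (j - 1).toNat N, oscOp d σ τ i f₁ x‖ₑ ≤ O σ τ x := by
      intro σ τ
      rcases lt_or_ge (j - 1).toNat N with hlt | hge
      · have hact' : act (j - 1).toNat x := by
          refine ⟨by omega, by omega, fun hsub => hjE ?_⟩
          exact (dyIv_subset_of_le (by omega) x).trans hsub
        refine le_trans ?_ (le_iSup₂ (f := fun n _ => ⨆ _ : act n x,
          ‖∑ i ∈ Finset.Ico n N, oscOp d σ τ i f₁ x‖ₑ) (j - 1).toNat (Finset.mem_range.2 hlt))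
        exact le_iSup (fun _ : act (j - 1).toNat x =>
          ‖∑ i ∈ Finset.Ico (j - 1).toNat N, oscOp d σ τ i f₁ x‖ₑ) hact'
      · rw [Finset.Ico_eq_empty (not_lt.2 hge)]; simp
    refine add_le_add (add_le_add ?_ (hosc _ _)) (hosc _ _)
    refine le_trans (add_le_add (iSup₂_le fun k hk => A₁ j x hj'.1 hjE k (Finset.mem_Icc.1 hk).1
      (Finset.mem_Icc.1 hk).2) (A₃ j x hj'.1 hjE)) (le_of_eq ?_)
    rw [ht₃, locHilConst]; ring
  have hhint : ∫⁻ x, h x ≤ 2 * (V * G) := by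
    refine lintegral_le_two_mul hSm hhm (fun x hx => ?_) hr hG0 hGt hhr
    exact indicator_of_notMem (fun hx' => hx (dyIv_subset_dyTriple K i₀ hx')) _
  have hOm : ∀ σ τ : ℝ, |σ| = 1 → Measurable (O σ τ) := by
    intro σ τ hσ
    refine Measurable.iSup fun n => Measurable.iSup fun _ => ?_
    have e : (fun x => ⨆ _ : act n x, ‖∑ i ∈ Finset.Ico n N, oscOp d σ τ i f₁ x‖ₑ) =
        {x | act n x}.indicator fun x => ‖∑ i ∈ Finset.Ico n N, oscOp d σ τ i f₁ x‖ₑ := by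
      funext x
      by_cases hx : act n x
      · rw [indicator_of_mem (show x ∈ {x | act n x} from hx)]; simp [hx]
      · rw [indicator_of_notMem (show x ∉ {x | act n x} from hx)]; simp [hx]
    rw [e]
    exact Measurable.indicator (TestFun.sum fun i _ => hf₁t.oscOp hσ i).enorm_meas (actm n)
  have hn1 : |(-1 : ℝ)| = 1 := by simp
  have hnd : |(-1 : ℝ) ^ d| = 1 := by simp
  calc _ ≤ ∫⁻ x in dyIv K i₀, (locHilConst * F + O 1 1 x + O (-1) ((-1) ^ d) x) * ‖g x‖ₑ :=
        setLIntegral_mono' (measurableSet_dyIv _ _) fun x hx => mul_le_mul_left (hpt x hx) _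
    _ = ∫⁻ x, (locHilConst * F * h x + O 1 1 x * h x + O (-1) ((-1) ^ d) x * h x) := by
        rw [hint]
        refine lintegral_congr fun x => ?_
        ring
    _ = locHilConst * F * (∫⁻ x, h x) + (∫⁻ x, O 1 1 x * h x) +
        ∫⁻ x, O (-1) ((-1) ^ d) x * h x := by
        rw [lintegral_add_right _ ((hOm _ _ hn1).fun_mul hhm),
          lintegral_add_right _ ((hOm 1 1 (by simp)).fun_mul hhm), lintegral_const_mul _ hhm]
    _ ≤ locHilConst * F * (2 * (V * G)) + oscSumConst 1728 r * (V * F * G) +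
        oscSumConst 1728 r * (V * F * G) := by
        have := Ole 1 1 (by simp) (by simp)
        have := Ole (-1) ((-1) ^ d) hn1 hnd
        gcongr
    _ = _ := by rw [locConst]; ring

/-! ### The recursion over stopping intervals -/

lemma dyIv_nonempty (k i : ℤ) : (dyIv k i).Nonempty :=
  ⟨i * (2 : ℝ) ^ k, dyIdx_mul_zpow k i⟩

lemma dyIv_add_one (k i : ℤ) : dyIv (k + 1) i = dyIv k (2 * i) ∪ dyIv k (2 * i + 1) := by
  have hp := two_zpow_pos k
  rw [dyIv_eq_Ico, dyIv_eq_Ico, dyIv_eq_Ico]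
  push_cast
  rw [Ico_union_Ico_eq_Ico (by nlinarith) (by nlinarith), zpow_add_one₀ (by norm_num)]
  congr 1 <;> ring

lemma disjoint_dyIv {k i i' : ℤ} (h : i ≠ i') : Disjoint (dyIv k i) (dyIv k i') := by
  rw [Set.disjoint_left]
  intro x h1 h2
  exact h ((mem_dyIv.1 h1).symm.trans (mem_dyIv.1 h2))

/-- A finite family of dyadic subintervals `dyIv p.1 p.2` of a set `I`, in which the smaller
members contained in a given one cover at most a sixteenth of it. -/
structure DyFamily (I : Set ℝ) (P : Finset (ℤ × ℤ)) : Prop where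
  sub : ∀ p ∈ P, dyIv p.1 p.2 ⊆ I
  small : ∀ p ∈ P, volume (⋃ q ∈ P, ⋃ _ : q.1 < p.1 ∧ dyIv q.1 q.2 ⊆ dyIv p.1 p.2, dyIv q.1 q.2) ≤
    volume (dyIv p.1 p.2) / 16

namespace DyFamily

lemma empty (I : Set ℝ) : DyFamily I ∅ := ⟨by simp, by simp⟩

lemma disjoint {I J : Set ℝ} {P R : Finset (ℤ × ℤ)} (hP : DyFamily I P) (hR : DyFamily J R)
    (h : Disjoint I J) : Disjoint P R := by
  rw [Finset.disjoint_left]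
  intro p h1 h2
  obtain ⟨x, hx⟩ := dyIv_nonempty p.1 p.2
  exact Set.disjoint_left.1 h (hP.sub p h1 hx) (hR.sub p h2 hx)

lemma small_union {I J : Set ℝ} {P R : Finset (ℤ × ℤ)} (hP : DyFamily I P) (hR : DyFamily J R)
    (h : Disjoint I J) {p : ℤ × ℤ} (hp : p ∈ P) :
    volume (⋃ q ∈ P ∪ R, ⋃ _ : q.1 < p.1 ∧ dyIv q.1 q.2 ⊆ dyIv p.1 p.2, dyIv q.1 q.2) ≤
      volume (dyIv p.1 p.2) / 16 := by
  refine le_trans (measure_mono ?_) (hP.small p hp)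
  refine iUnion₂_subset fun q hq => iUnion_subset fun hqp => ?_
  rcases Finset.mem_union.1 hq with hq | hq
  · exact subset_iUnion₂_of_subset q hq (subset_iUnion_of_subset hqp le_rfl)
  · obtain ⟨x, hx⟩ := dyIv_nonempty q.1 q.2
    exact (Set.disjoint_left.1 h (hP.sub p hp (hqp.2 hx)) (hR.sub q hq hx)).elim

lemma union {I J : Set ℝ} {P R : Finset (ℤ × ℤ)} (hP : DyFamily I P) (hR : DyFamily J R)
    (h : Disjoint I J) : DyFamily (I ∪ J) (P ∪ R) := by
  refine ⟨fun p hp => ?_, fun p hp => ?_⟩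
  · rcases Finset.mem_union.1 hp with hp | hp
    · exact (hP.sub p hp).trans subset_union_left
    · exact (hR.sub p hp).trans subset_union_right
  · rcases Finset.mem_union.1 hp with hp | hp
    · exact hP.small_union hR h hp
    · rw [Finset.union_comm]
      exact hR.small_union hP h.symm hp

lemma insert_top {K i : ℤ} {P : Finset (ℤ × ℤ)} (hP : DyFamily (dyIv K i) P)
    (hK : ∀ p ∈ P, p.1 < K) {E : Set ℝ} (hE : ∀ p ∈ P, dyIv p.1 p.2 ⊆ E)
    (hv : volume E ≤ volume (dyIv K i) / 16) : DyFamily (dyIv K i) (insert (K, i) P) := by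
  refine ⟨fun p hp => ?_, fun p hp => ?_⟩
  · rcases Finset.mem_insert.1 hp with rfl | hp
    · exact le_rfl
    · exact hP.sub p hp
  · rcases Finset.mem_insert.1 hp with rfl | hp
    · refine le_trans (measure_mono ?_) hv
      refine iUnion₂_subset fun q hq => iUnion_subset fun hqp => ?_
      rcases Finset.mem_insert.1 hq with rfl | hq
      · exact (lt_irrefl _ hqp.1).elim
      · exact hE q hq
    · refine le_trans (measure_mono ?_) (hP.small p hp)
      refine iUnion₂_subset fun q hq => iUnion_subset fun hqp => ?_
      rcases Finset.mem_insert.1 hq with rfl | hq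
      · exact absurd (hqp.1.trans (hK p hp)) (lt_irrefl _)
      · exact subset_iUnion₂_of_subset q hq (subset_iUnion_of_subset hqp le_rfl)

end DyFamily

section

variable {Φ : ℤ → ℤ → ℝ → ℝ≥0∞} {w : ℝ → ℝ≥0∞} {X : ℤ × ℤ → ℝ≥0∞} {C : ℝ≥0∞} {a : ℤ}

lemma measurable_iSup_active (hΦ : ∀ j l, Measurable (Φ j l)) (a K : ℤ) (E : Set ℝ) :
    Measurable fun x => ⨆ j ∈ Finset.Icc a K, ⨆ _ : ¬ dyIv j (dyIdx j x) ⊆ E, Φ j K x := by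
  refine Measurable.iSup fun j => Measurable.iSup fun _ => ?_
  have e : (fun x => ⨆ _ : ¬ dyIv j (dyIdx j x) ⊆ E, Φ j K x) =
      {x | ¬ dyIv j (dyIdx j x) ⊆ E}.indicator (Φ j K) := by
    funext x
    by_cases hx : ¬ dyIv j (dyIdx j x) ⊆ E
    · rw [indicator_of_mem (show x ∈ {x | ¬ dyIv j (dyIdx j x) ⊆ E} from hx)]; simp [hx]
    · rw [indicator_of_notMem (show x ∉ {x | ¬ dyIv j (dyIdx j x) ⊆ E} from hx)]; simp [hx]
  rw [e]
  exact (hΦ j K).indicator (measurableSet_not_dyIv_subset j E)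

/-- Inside an interval of the top scale `K`, the supremum over all scales is controlled by the
supremum over the active scales and by the suprema that start at the maximal dyadic intervals
contained in the exceptional set `E`. -/
lemma exists_dyFamily_active (hΦ : ∀ j l, Measurable (Φ j l)) (hw : Measurable w)
    (hsub : ∀ j i l : ℤ, j ≤ i → i < l → ∀ x, Φ j l x ≤ Φ j i x + Φ (i + 1) l x) {K : ℤ}
    {E : Set ℝ} (hE : ∀ i, ¬ dyIv K i ⊆ E)
    (ih : ∀ k, a ≤ k → k < K → ∀ i, ∃ P, DyFamily (dyIv k i) P ∧ (∀ p ∈ P, p.1 ≤ k) ∧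
      ∫⁻ x in dyIv k i, (⨆ j ∈ Finset.Icc a k, Φ j k x) * w x ≤ C * ∑ p ∈ P, X p) (m : ℕ) :
    ∀ k, k = a + m → k ≤ K → ∀ i,
      (∀ x ∈ dyIv k i, ∀ j, k < j → j ≤ K → ¬ dyIv j (dyIdx j x) ⊆ E) →
      ∃ P, DyFamily (dyIv k i) P ∧ (∀ p ∈ P, p.1 < K) ∧ (∀ p ∈ P, dyIv p.1 p.2 ⊆ E) ∧
        ∫⁻ x in dyIv k i, (⨆ j ∈ Finset.Icc a K, Φ j K x) * w x ≤
          (∫⁻ x in dyIv k i, (⨆ j ∈ Finset.Icc a K, ⨆ _ : ¬ dyIv j (dyIdx j x) ⊆ E,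
            Φ j K x) * w x) + C * ∑ p ∈ P, X p := by
  have hactm := measurable_iSup_active hΦ a K E
  have le_act : ∀ x j, j ∈ Finset.Icc a K → ¬ dyIv j (dyIdx j x) ⊆ E → Φ j K x ≤
      ⨆ j ∈ Finset.Icc a K, ⨆ _ : ¬ dyIv j (dyIdx j x) ⊆ E, Φ j K x := by
    intro x j hj hjE
    refine le_trans ?_ (le_iSup₂ (f := fun j _ => ⨆ _ : ¬ dyIv j (dyIdx j x) ⊆ E, Φ j K x) j hj)
    exact le_iSup (fun _ : ¬ dyIv j (dyIdx j x) ⊆ E => Φ j K x) hjE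
  -- An interval contained in `E`, all of whose ancestors are active: the sum over the scales is
  -- split at the scale of the interval, and the smaller scales are left to the induction on the top
  -- scale.
  have stopSum : ∀ k, a ≤ k → k ≤ K → ∀ i,
      (∀ x ∈ dyIv k i, ∀ j, k < j → j ≤ K → ¬ dyIv j (dyIdx j x) ⊆ E) → dyIv k i ⊆ E →
      ∃ P, DyFamily (dyIv k i) P ∧ (∀ p ∈ P, p.1 < K) ∧ (∀ p ∈ P, dyIv p.1 p.2 ⊆ E) ∧
        ∫⁻ x in dyIv k i, (⨆ j ∈ Finset.Icc a K, Φ j K x) * w x ≤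
          (∫⁻ x in dyIv k i, (⨆ j ∈ Finset.Icc a K, ⨆ _ : ¬ dyIv j (dyIdx j x) ⊆ E,
            Φ j K x) * w x) + C * ∑ p ∈ P, X p := by
    intro k hak hkK i hact hin
    have hlt : k < K := by
      refine lt_of_le_of_ne hkK fun h => ?_
      subst h
      exact hE i hin
    obtain ⟨P, hP, hPk, hPle⟩ := ih k hak hlt i
    refine ⟨P, hP, fun p hp => (hPk p hp).trans_lt hlt, fun p hp => (hP.sub p hp).trans hin, ?_⟩
    refine le_trans ?_ (add_le_add_right hPle _)
    rw [← lintegral_add_left (hactm.fun_mul hw)]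
    refine setLIntegral_mono' (measurableSet_dyIv _ _) fun x hx => ?_
    rw [← add_mul]
    refine mul_le_mul_left (iSup₂_le fun j hj => ?_) _
    have hj' := Finset.mem_Icc.1 hj
    rcases le_or_gt j k with hjk | hkj
    · rw [add_comm]
      refine (hsub j k K hjk hlt x).trans (add_le_add ?_ ?_)
      · exact le_iSup₂ (f := fun j _ => Φ j k x) j (Finset.mem_Icc.2 ⟨hj'.1, hjk⟩)
      · exact le_act x (k + 1) (Finset.mem_Icc.2 (by omega))
          (hact x hx (k + 1) (by omega) (by omega))
    · exact (le_act x j hj (hact x hx j hkj hj'.2)).trans le_self_add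
  induction m with
  | zero =>
    intro k hk hkK i hact
    by_cases hin : dyIv k i ⊆ E
    · exact stopSum k (by omega) hkK i hact hin
    · refine ⟨∅, DyFamily.empty _, by simp, by simp, le_trans ?_ le_self_add⟩
      refine setLIntegral_mono' (measurableSet_dyIv _ _) fun x hx => ?_
      refine mul_le_mul_left (iSup₂_le fun j hj => le_act x j hj ?_) _
      have hj' := Finset.mem_Icc.1 hj
      rcases eq_or_lt_of_le (show k ≤ j by push_cast at hk; omega) with rfl | hlt
      · rwa [mem_dyIv.1 hx]
      · exact hact x hx j hlt hj'.2
  | succ m ihm =>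
    intro k hk hkK i hact
    by_cases hin : dyIv k i ⊆ E
    · exact stopSum k (by push_cast at hk; omega) hkK i hact hin
    -- The interval is itself active and is replaced by its two halves.
    · have hk1 : k = (k - 1) + 1 := by ring
      have hsplit := dyIv_add_one (k - 1) i
      rw [← hk1] at hsplit
      have child : ∀ i', dyIv (k - 1) i' ⊆ dyIv k i → ∀ x ∈ dyIv (k - 1) i', ∀ j,
          k - 1 < j → j ≤ K →
          ¬ dyIv j (dyIdx j x) ⊆ E := by
        intro i' hi' x hx j hj hjK
        rcases eq_or_lt_of_le (show k ≤ j by omega) with rfl | hlt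
        · rwa [mem_dyIv.1 (hi' hx)]
        · exact hact x (hi' hx) j hlt hjK
      have hk2 : k - 1 = a + m := by push_cast at hk; omega
      obtain ⟨P, hP, hPK, hPE, hPle⟩ := ihm (k - 1) hk2 (by omega) (2 * i)
        (child _ (hsplit ▸ subset_union_left))
      obtain ⟨R, hR, hRK, hRE, hRle⟩ := ihm (k - 1) hk2 (by omega) (2 * i + 1)
        (child _ (hsplit ▸ subset_union_right))
      have hdisj : Disjoint (dyIv (k - 1) (2 * i)) (dyIv (k - 1) (2 * i + 1)) :=
        disjoint_dyIv (by omega)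
      refine ⟨P ∪ R, hsplit ▸ hP.union hR hdisj, fun p hp => ?_, fun p hp => ?_, ?_⟩
      · exact (Finset.mem_union.1 hp).elim (hPK p) (hRK p)
      · exact (Finset.mem_union.1 hp).elim (hPE p) (hRE p)
      · rw [hsplit, lintegral_union (measurableSet_dyIv _ _) hdisj,
          lintegral_union (measurableSet_dyIv _ _) hdisj, Finset.sum_union (hP.disjoint hR hdisj)]
        refine (add_le_add hPle hRle).trans (le_of_eq ?_)
        ring

/-- The supremum over all scales, on a dyadic interval, is dominated by a sum over a family with
small overlap, if the local estimate holds on every dyadic interval. -/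
theorem exists_dyFamily_le (hΦ : ∀ j l, Measurable (Φ j l)) (hw : Measurable w)
    (hsub : ∀ j i l : ℤ, j ≤ i → i < l → ∀ x, Φ j l x ≤ Φ j i x + Φ (i + 1) l x)
    (hloc : ∀ K i : ℤ, ∃ E : Set ℝ, volume E ≤ ENNReal.ofReal ((2 : ℝ) ^ K) / 16 ∧
      ∫⁻ x in dyIv K i, (⨆ j ∈ Finset.Icc a K, ⨆ _ : ¬ dyIv j (dyIdx j x) ⊆ E, Φ j K x) * w x ≤
        C * X (K, i)) (n : ℕ) :
    ∀ K, K = a + n → ∀ i, ∃ P, DyFamily (dyIv K i) P ∧ (∀ p ∈ P, p.1 ≤ K) ∧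
      ∫⁻ x in dyIv K i, (⨆ j ∈ Finset.Icc a K, Φ j K x) * w x ≤ C * ∑ p ∈ P, X p := by
  induction n using Nat.strong_induction_on with
  | _ n ih =>
    intro K hK i
    obtain ⟨E, hEv, hEle⟩ := hloc K i
    have hE : ∀ i, ¬ dyIv K i ⊆ E := by
      intro i hi
      have h1 := (measure_mono hi).trans hEv
      rw [volume_dyIv] at h1
      have h2 : ENNReal.ofReal ((2 : ℝ) ^ K) / 16 < ENNReal.ofReal ((2 : ℝ) ^ K) := by
        rw [div_eq_mul_inv]
        conv_rhs => rw [← mul_one (ENNReal.ofReal ((2 : ℝ) ^ K))]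
        rw [ENNReal.mul_lt_mul_iff_right (ofReal_two_zpow_ne_zero K) ENNReal.ofReal_ne_top]
        exact ENNReal.inv_lt_one.2 (by norm_num)
      exact absurd h1 (not_le.2 h2)
    obtain ⟨P, hP, hPK, hPE, hPle⟩ := exists_dyFamily_active (a := a) (X := X) (C := C) hΦ hw hsub
      hE (fun k hak hkK i => ih (k - a).toNat (by omega) k (by omega) i) n K hK le_rfl i
      (fun x _ j h1 h2 => absurd h1 (not_lt.2 h2))
    have hnot : (K, i) ∉ P := fun h => lt_irrefl _ (hPK _ h)
    refine ⟨insert (K, i) P, hP.insert_top hPK hPE (by rwa [volume_dyIv]), fun p hp => ?_, ?_⟩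
    · rcases Finset.mem_insert.1 hp with rfl | hp
      · exact le_rfl
      · exact (hPK p hp).le
    · rw [Finset.sum_insert hnot, mul_add]
      exact hPle.trans (add_le_add_left hEle _)

end

/-! ### Sparse families of triples -/

lemma dyTriple_injective : Function.Injective fun p : ℤ × ℤ => dyTriple p.1 p.2 := by
  rintro ⟨k, i⟩ ⟨k', i'⟩ h
  have h' : dyTriple k i = dyTriple k' i' := h
  have hk : k = k' := by
    have h1 := congrArg volume h'
    rw [volume_dyTriple, volume_dyTriple, ENNReal.ofReal_eq_ofReal_iff
      (by have := two_zpow_pos k; positivity) (by have := two_zpow_pos k'; positivity)] at h1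
    exact zpow_right_injective₀ (by norm_num : (0 : ℝ) < 2) (by norm_num)
      (mul_left_cancel₀ (by norm_num) h1)
  subst hk
  have key : ∀ i i' : ℤ, dyTriple k i = dyTriple k i' → i' ≤ i := by
    intro i i' h
    obtain ⟨y, hy⟩ := dyIv_nonempty k (i - 1)
    have h1 : y ∈ dyTriple k i := by
      rw [mem_dyTriple_iff, mem_dyIv.1 hy]; omega
    rw [h, mem_dyTriple_iff, mem_dyIv.1 hy] at h1
    omega
  rw [le_antisymm (key _ _ h'.symm) (key _ _ h')]

namespace DyFamily

/-- What remains of a member of the family after removal of the smaller members inside it. -/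
def core (P : Finset (ℤ × ℤ)) (p : ℤ × ℤ) : Set ℝ :=
  dyIv p.1 p.2 \ ⋃ q ∈ P, ⋃ _ : q.1 < p.1 ∧ dyIv q.1 q.2 ⊆ dyIv p.1 p.2, dyIv q.1 q.2

lemma measurableSet_core (P : Finset (ℤ × ℤ)) (p : ℤ × ℤ) : MeasurableSet (core P p) :=
  (measurableSet_dyIv _ _).diff (Finset.measurableSet_biUnion _ fun _ _ =>
    MeasurableSet.iUnion fun _ => measurableSet_dyIv _ _)

lemma disjoint_core {P : Finset (ℤ × ℤ)} {p q : ℤ × ℤ} (hp : p ∈ P) (hq : q ∈ P) (h : p ≠ q) :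
    Disjoint (core P p) (core P q) := by
  have key : ∀ p ∈ P, ∀ q ∈ P, p.1 < q.1 → Disjoint (core P p) (core P q) := by
    intro p hp q hq hlt
    rw [Set.disjoint_left]
    intro x hxp hxq
    have h1 : dyIv p.1 p.2 ⊆ dyIv q.1 q.2 := by
      have := dyIv_subset_of_le hlt.le x
      rwa [mem_dyIv.1 hxp.1, mem_dyIv.1 hxq.1] at this
    exact hxq.2 (mem_iUnion₂.2 ⟨p, hp, mem_iUnion.2 ⟨⟨hlt, h1⟩, hxp.1⟩⟩)
  rcases lt_trichotomy p.1 q.1 with hlt | heq | hgt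
  · exact key p hp q hq hlt
  · have h2 : p.2 ≠ q.2 := fun h2 => h (Prod.ext heq h2)
    have := disjoint_dyIv (k := q.1) h2
    refine this.mono ?_ sdiff_subset
    rw [← heq]; exact sdiff_subset
  · exact (key q hq p hp hgt).symm

variable {I : Set ℝ} {P : Finset (ℤ × ℤ)}

lemma volume_dyTriple_div_lt (hP : DyFamily I P) {p : ℤ × ℤ} (hp : p ∈ P) :
    volume (dyTriple p.1 p.2) / 4 < volume (core P p) := by
  set v : ℝ≥0∞ := ENNReal.ofReal ((2 : ℝ) ^ p.1) with hv
  have hv0 : v ≠ 0 := ofReal_two_zpow_ne_zero _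
  have hvt : v ≠ ∞ := ENNReal.ofReal_ne_top
  have h1 : v ≤ volume (core P p) + v / 16 := by
    have h2 := hP.small p hp
    rw [volume_dyIv] at h2
    calc v = volume (dyIv p.1 p.2) := (volume_dyIv _ _).symm
      _ ≤ volume (core P p ∪ ⋃ q ∈ P, ⋃ _ : q.1 < p.1 ∧ dyIv q.1 q.2 ⊆ dyIv p.1 p.2,
          dyIv q.1 q.2) := measure_mono (by rw [core, sdiff_union_self]; exact subset_union_left)
      _ ≤ _ := (measure_union_le _ _).trans (add_le_add_right h2 _)
  rw [volume_dyTriple, ENNReal.ofReal_mul (by norm_num), ← hv]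
  by_contra! hle
  have h3 : v ≤ ENNReal.ofReal 3 * v / 4 + v / 16 := h1.trans (add_le_add_left hle _)
  have h4 : ENNReal.ofReal 3 * v / 4 + v / 16 = ENNReal.ofReal (13 / 16) * v := by
    rw [show (13 / 16 : ℝ) = 3 / 4 + 1 / 16 by norm_num, ENNReal.ofReal_add (by norm_num)
      (by norm_num), ENNReal.ofReal_div_of_pos (by norm_num),
          ENNReal.ofReal_div_of_pos (by norm_num),
      add_mul]
    simp only [div_eq_mul_inv]
    norm_num
    ring
  rw [h4] at h3
  have h5 : ENNReal.ofReal (13 / 16) * v < 1 * v := by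
    rw [ENNReal.mul_lt_mul_iff_left hv0 hvt]
    rw [← ENNReal.ofReal_one]
    exact (ENNReal.ofReal_lt_ofReal_iff (by norm_num)).2 (by norm_num)
  rw [one_mul] at h5
  exact absurd h3 (not_le.2 h5)

lemma isSparse (hP : DyFamily I P) : IsSparse ((fun p : ℤ × ℤ => dyTriple p.1 p.2) '' P) := by
  refine ⟨?_, fun J => ⋃ p ∈ P, ⋃ _ : dyTriple p.1 p.2 = J, core P p, ?_, ?_⟩
  · rintro _ ⟨p, _, rfl⟩
    refine ⟨_, _, ?_, rfl⟩
    have := two_zpow_pos p.1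
    nlinarith
  all_goals
    have e : ∀ p ∈ P, (⋃ q ∈ P, ⋃ _ : dyTriple q.1 q.2 = dyTriple p.1 p.2, core P q) = core P p := by
      intro p hp
      apply subset_antisymm
      · refine iUnion₂_subset fun q _ => iUnion_subset fun hqp => ?_
        rw [dyTriple_injective hqp]
      · exact subset_iUnion₂_of_subset p hp (subset_iUnion_of_subset rfl le_rfl)
  · rintro _ ⟨p, hp, rfl⟩
    simp only [e p hp]
    exact ⟨measurableSet_core P p, sdiff_subset.trans (dyIv_subset_dyTriple _ _),
      hP.volume_dyTriple_div_lt hp⟩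
  · rintro _ ⟨p, hp, rfl⟩ _ ⟨q, hq, rfl⟩ hne
    simp only [Function.onFun, e p hp, e q hq]
    exact disjoint_core hp hq fun h => hne (by rw [h])

lemma sparseForm_eq (P : Finset (ℤ × ℤ)) (r s : ℝ) (f g : ℝ → ℂ) :
    sparseForm ((fun p : ℤ × ℤ => dyTriple p.1 p.2) '' P) r s f g =
      ∑ p ∈ P, volume (dyTriple p.1 p.2) * avg f (dyTriple p.1 p.2) r *
        avg g (dyTriple p.1 p.2) s := by
  rw [sparseForm, tsum_image (fun I : Set ℝ => volume I * avg f I r * avg g I s)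
    dyTriple_injective.injOn]
  exact Finset.tsum_subtype' P fun p : ℤ × ℤ => volume (dyTriple p.1 p.2) *
    avg f (dyTriple p.1 p.2) r * avg g (dyTriple p.1 p.2) s

lemma sum_volume_dyTriple_le (hP : DyFamily I P) :
    ∑ p ∈ P, volume (dyTriple p.1 p.2) ≤ 4 * volume I := by
  calc ∑ p ∈ P, volume (dyTriple p.1 p.2) ≤ ∑ p ∈ P, 4 * volume (core P p) := by
        refine Finset.sum_le_sum fun p hp => ?_
        have := (hP.volume_dyTriple_div_lt hp).le
        rwa [ENNReal.div_le_iff (by norm_num) (by norm_num), mul_comm] at this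
    _ = 4 * volume (⋃ p ∈ P, core P p) := by
        rw [← Finset.mul_sum, measure_biUnion_finset
          (fun p hp q hq h => disjoint_core hp hq h) fun p _ => measurableSet_core P p]
    _ ≤ 4 * volume I := mul_le_mul_right (measure_mono (iUnion₂_subset fun p hp =>
        sdiff_subset.trans (hP.sub p hp))) _

end DyFamily

lemma avg_le_of_bound {f : ℝ → ℂ} {C : ℝ≥0∞} (hC : ∀ x, ‖f x‖ₑ ≤ C) {I : Set ℝ}
    (hI0 : volume I ≠ 0) (hI : volume I ≠ ∞) {r : ℝ} (hr : 0 < r) : avg f I r ≤ C := by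
  rw [avg]
  calc ((volume I)⁻¹ * ∫⁻ x in I, ‖f x‖ₑ ^ r) ^ (1 / r)
      ≤ ((volume I)⁻¹ * (C ^ r * volume I)) ^ (1 / r) := by
        refine ENNReal.rpow_le_rpow (mul_le_mul_right ?_ _) (by positivity)
        rw [← setLIntegral_const]
        exact setLIntegral_mono measurable_const fun x _ => ENNReal.rpow_le_rpow (hC x) hr.le
    _ = C := by
        rw [mul_left_comm, ENNReal.inv_mul_cancel hI0 hI, mul_one, one_div,
            ENNReal.rpow_rpow_inv hr.ne']

lemma measurable_triAvg (k : ℤ) (F : ℝ → ℝ≥0∞) : Measurable (triAvg k F) :=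
  measurable_of_dyIdx (k := k) fun _ _ h => triAvg_congr h

lemma measurable_truncTerm (d : ℕ) {f : ℝ → ℂ} (hf : TestFun f) (j l : ℤ) :
    Measurable (truncTerm d f j l) := by
  refine Measurable.add (Measurable.add (Measurable.add ?_ ?_) ?_) ?_
  · exact Measurable.iSup fun k => Measurable.iSup fun _ => measurable_triAvg k _
  · exact (TestFun.sum fun k _ => hf.hilOp k).enorm_meas
  · exact (TestFun.sum fun i _ => hf.oscOp (by simp) i).enorm_meas
  · exact (TestFun.sum fun i _ => hf.oscOp (by simp) i).enorm_meas

lemma truncTerm_le_add (d : ℕ) (f : ℝ → ℂ) {j i l : ℤ} (hji : j ≤ i) (hil : i < l) (x : ℝ) :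
    truncTerm d f j l x ≤ truncTerm d f j i x + truncTerm d f (i + 1) l x := by
  have h1 : (⨆ k ∈ Finset.Icc j l, triAvg k (fun y => ‖f y‖ₑ) x) ≤
      (⨆ k ∈ Finset.Icc j i, triAvg k (fun y => ‖f y‖ₑ) x) +
        ⨆ k ∈ Finset.Icc (i + 1) l, triAvg k (fun y => ‖f y‖ₑ) x := by
    refine iSup₂_le fun k hk => ?_
    have hk' := Finset.mem_Icc.1 hk
    rcases le_or_gt k i with h | h
    · exact (le_iSup₂ (f := fun k _ => triAvg k (fun y => ‖f y‖ₑ) x) k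
        (Finset.mem_Icc.2 ⟨hk'.1, h⟩)).trans le_self_add
    · exact (le_iSup₂ (f := fun k _ => triAvg k (fun y => ‖f y‖ₑ) x) k
        (Finset.mem_Icc.2 ⟨h, hk'.2⟩)).trans le_add_self
  have h2 : ‖∑ k ∈ Finset.Icc j (min l 0), hilOp k f x‖ₑ ≤
      ‖∑ k ∈ Finset.Icc j (min i 0), hilOp k f x‖ₑ +
        ‖∑ k ∈ Finset.Icc (i + 1) (min l 0), hilOp k f x‖ₑ := by
    have hd : Disjoint (Finset.Icc j (min i 0)) (Finset.Icc (i + 1) (min l 0)) := by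
      rw [Finset.disjoint_left]
      intro k h1 h2
      rw [Finset.mem_Icc] at h1 h2
      omega
    have e : Finset.Icc j (min l 0) = Finset.Icc j (min i 0) ∪ Finset.Icc (i + 1) (min l 0) := by
      ext k
      rw [Finset.mem_union, Finset.mem_Icc, Finset.mem_Icc, Finset.mem_Icc]
      omega
    rw [e, Finset.sum_union hd]
    exact enorm_add_le _ _
  have h3 : ∀ σ τ : ℝ, ‖∑ n ∈ Finset.Ico (j - 1).toNat l.toNat, oscOp d σ τ n f x‖ₑ ≤
      ‖∑ n ∈ Finset.Ico (j - 1).toNat i.toNat, oscOp d σ τ n f x‖ₑ +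
        ‖∑ n ∈ Finset.Ico (i + 1 - 1).toNat l.toNat, oscOp d σ τ n f x‖ₑ := by
    intro σ τ
    rw [add_sub_cancel_right, ← Finset.sum_Ico_consecutive _ (by omega : (j - 1).toNat ≤ i.toNat)
      (by omega : i.toNat ≤ l.toNat)]
    exact enorm_add_le _ _
  simp only [truncTerm]
  refine (add_le_add (add_le_add (add_le_add h1 h2) (h3 _ _)) (h3 _ _)).trans (le_of_eq ?_)
  ring

/-- The supremum of the truncations over all smallest scales below `2 ^ K`. -/
noncomputable def truncSup (d : ℕ) (f : ℝ → ℂ) (K : ℤ) (x : ℝ) : ℝ≥0∞ :=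
  ⨆ n : ℕ, ⨆ j ∈ Finset.Icc (K - n) K, truncTerm d f j K x

lemma truncTerm_le_truncSup (d : ℕ) (f : ℝ → ℂ) {j K : ℤ} (h : j ≤ K) (x : ℝ) :
    truncTerm d f j K x ≤ truncSup d f K x := by
  refine le_iSup_of_le (K - j).toNat ?_
  exact le_iSup₂ (f := fun j _ => truncTerm d f j K x) j (Finset.mem_Icc.2 (by omega))

lemma lintegral_truncSup_mul (d : ℕ) {f g : ℝ → ℂ} (hf : TestFun f) (hg : TestFun g) (K i : ℤ) :
    ∫⁻ x in dyIv K i, truncSup d f K x * ‖g x‖ₑ =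
      ⨆ n : ℕ, ∫⁻ x in dyIv K i, (⨆ j ∈ Finset.Icc (K - n) K, truncTerm d f j K x) * ‖g x‖ₑ := by
  rw [← lintegral_iSup]
  · simp_rw [truncSup, ENNReal.iSup_mul]
  · intro n
    exact (Measurable.iSup fun j => Measurable.iSup fun _ => measurable_truncTerm d hf j K).mul
      hg.enorm_meas
  · intro n m hnm x
    refine mul_le_mul_left (iSup₂_le fun j hj => ?_) _
    have hj' := Finset.mem_Icc.1 hj
    exact le_iSup₂ (f := fun j _ => truncTerm d f j K x) j (Finset.mem_Icc.2 (by omega))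

lemma exists_dyFamily_truncTerm_le {d : ℕ} (hd : 2 ≤ d) {f g : ℝ → ℂ} (hf : TestFun f)
    (hg : TestFun g) {r : ℝ} (hr : 1 ≤ r) (hr2 : r ≤ 2) (K i : ℤ) (n : ℕ) :
    ∃ P, DyFamily (dyIv K i) P ∧
      ∫⁻ x in dyIv K i, (⨆ j ∈ Finset.Icc (K - n) K, truncTerm d f j K x) * ‖g x‖ₑ ≤
        locConst r * ∑ p ∈ P, volume (dyTriple p.1 p.2) * avg f (dyTriple p.1 p.2) 1 *
          avg g (dyTriple p.1 p.2) r := by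
  obtain ⟨P, hP, _, h⟩ := exists_dyFamily_le (Φ := truncTerm d f) (w := fun x => ‖g x‖ₑ)
    (X := fun p => volume (dyTriple p.1 p.2) * avg f (dyTriple p.1 p.2) 1 *
      avg g (dyTriple p.1 p.2) r) (C := locConst r) (a := K - n)
    (measurable_truncTerm d hf) hg.enorm_meas (fun j i l h1 h2 x => truncTerm_le_add d f h1 h2 x)
    (fun K' i => exists_exceptional_set hd hf hg hr hr2 (K - n) K' i) n K (by ring) i
  exact ⟨P, hP, h⟩

/-- The sparse bound for the supremum of the truncations on a dyadic interval. -/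
theorem lintegral_truncSup_le_sparse {d : ℕ} (hd : 2 ≤ d) {f g : ℝ → ℂ} (hf : TestFun f)
    (hg : TestFun g) {r : ℝ} (hr : 1 ≤ r) (hr2 : r ≤ 2) (K i : ℤ) :
    ∫⁻ x in dyIv K i, truncSup d f K x * ‖g x‖ₑ ≤
      locConst r * ⨆ (S : Set (Set ℝ)) (_ : IsSparse S), sparseForm S 1 r f g := by
  rw [lintegral_truncSup_mul d hf hg]
  refine iSup_le fun n => ?_
  obtain ⟨P, hP, h⟩ := exists_dyFamily_truncTerm_le hd hf hg hr hr2 K i n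
  refine h.trans (mul_le_mul_right ?_ _)
  rw [← DyFamily.sparseForm_eq]
  exact le_iSup₂ (f := fun (S : Set (Set ℝ)) (_ : IsSparse S) => sparseForm S 1 r f g) _ hP.isSparse

lemma lintegral_truncSup_lt_top {d : ℕ} (hd : 2 ≤ d) {f g : ℝ → ℂ} (hf : TestFun f)
    (hg : TestFun g) {r : ℝ} (hr : 1 ≤ r) (hr2 : r ≤ 2) (hC : locConst r ≠ ∞) (K i : ℤ) :
    ∫⁻ x in dyIv K i, truncSup d f K x * ‖g x‖ₑ < ∞ := by
  obtain ⟨A, hA⟩ := hf.bdd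
  obtain ⟨B, hB⟩ := hg.bdd
  rw [lintegral_truncSup_mul d hf hg]
  refine lt_of_le_of_lt (b := locConst r * (4 * volume (dyIv K i) * ENNReal.ofReal A *
    ENNReal.ofReal B)) (iSup_le fun n => ?_) ?_
  · obtain ⟨P, hP, h⟩ := exists_dyFamily_truncTerm_le hd hf hg hr hr2 K i n
    refine h.trans (mul_le_mul_right ?_ _)
    calc _ ≤ ∑ p ∈ P, volume (dyTriple p.1 p.2) * ENNReal.ofReal A * ENNReal.ofReal B := by
          refine Finset.sum_le_sum fun p _ => ?_
          have h0 : volume (dyTriple p.1 p.2) ≠ 0 := by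
            rw [volume_dyTriple, ne_eq, ENNReal.ofReal_eq_zero, not_le]
            have := two_zpow_pos p.1
            positivity
          have ht : volume (dyTriple p.1 p.2) ≠ ∞ := by
            rw [volume_dyTriple]; exact ENNReal.ofReal_ne_top
          exact mul_le_mul' (mul_le_mul_right (avg_le_of_bound (fun x => enorm_le_ofReal (hA x)) h0
            ht one_pos) _) (avg_le_of_bound (fun x => enorm_le_ofReal (hB x)) h0 ht (by linarith))
      _ = (∑ p ∈ P, volume (dyTriple p.1 p.2)) * ENNReal.ofReal A * ENNReal.ofReal B := by
          rw [Finset.sum_mul, Finset.sum_mul]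
      _ ≤ _ := mul_le_mul_left (mul_le_mul_left hP.sum_volume_dyTriple_le _) _
  · rw [volume_dyIv]
    exact ENNReal.mul_lt_top hC.lt_top (ENNReal.mul_lt_top (ENNReal.mul_lt_top (ENNReal.mul_lt_top
      (by norm_num) ENNReal.ofReal_lt_top) ENNReal.ofReal_lt_top) ENNReal.ofReal_lt_top)

/-! ### The pointwise bound for the maximal operator -/

/-- The kernel `e ^ (2 π i u ^ d) / u` of the untruncated operator. -/
noncomputable def oscHilKer (d : ℕ) (u : ℝ) : ℂ :=
  Complex.exp (2 * (Real.pi : ℂ) * Complex.I * (u : ℂ) ^ d) / (u : ℂ)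

lemma measurable_oscHilKer (d : ℕ) : Measurable (oscHilKer d) := by
  refine Measurable.div ?_ Complex.measurable_ofReal
  fun_prop

lemma norm_exp_two_pi_I_mul (d : ℕ) (u : ℝ) :
    ‖Complex.exp (2 * (Real.pi : ℂ) * Complex.I * (u : ℂ) ^ d)‖ = 1 := by
  have : 2 * (Real.pi : ℂ) * Complex.I * (u : ℂ) ^ d =
      ((2 * Real.pi * u ^ d : ℝ) : ℂ) * Complex.I := by
    push_cast; ring
  rw [this, Complex.norm_exp_ofReal_mul_I]

lemma norm_oscHilKer (d : ℕ) (u : ℝ) : ‖oscHilKer d u‖ = |u|⁻¹ := by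
  rw [oscHilKer, norm_div, norm_exp_two_pi_I_mul, Complex.norm_real, Real.norm_eq_abs, one_div]

lemma norm_oscHilKer_sub_le {d : ℕ} (hd : 1 ≤ d) {u : ℝ} (hu : |u| ≤ 1) (hu0 : u ≠ 0) :
    ‖oscHilKer d u - ((1 / u : ℝ) : ℂ)‖ ≤ 7 := by
  have e1 : oscHilKer d u - ((1 / u : ℝ) : ℂ) =
      (Complex.exp (Complex.I * ((2 * Real.pi * u ^ d : ℝ) : ℂ)) - 1) / u := by
    rw [oscHilKer]; push_cast; rw [sub_div]
    congr 3; ring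
  have hu' : 0 < |u| := abs_pos.2 hu0
  have hpi : Real.pi < 3.15 := Real.pi_lt_d2
  rw [e1, norm_div, Complex.norm_real, Real.norm_eq_abs, div_le_iff₀ hu']
  refine (Real.norm_exp_I_mul_ofReal_sub_one_le (x := 2 * Real.pi * u ^ d)).trans ?_
  rw [Real.norm_eq_abs, abs_mul, abs_pow, abs_of_pos (by positivity : 0 < 2 * Real.pi)]
  have h1 : |u| ^ d ≤ |u| := pow_le_of_le_one hu'.le hu (by omega)
  calc 2 * Real.pi * |u| ^ d ≤ 2 * Real.pi * |u| := by gcongr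
    _ ≤ 7 * |u| := by gcongr; linarith

lemma oscPiece_sub_eq (d i : ℕ) (u : ℝ) :
    oscPiece d 1 (2 ^ i) u - oscPiece d ((-1) ^ d) (2 ^ i) (-u) =
      if (2 : ℝ) ^ i < |u| ∧ |u| ≤ 2 ^ (i + 1) then oscHilKer d u else 0 := by
  have hp : (0 : ℝ) < 2 ^ i := by positivity
  rcases le_total 0 u with h0 | h0
  · have h1 : -u ∉ Ioc ((2 : ℝ) ^ i) (2 * 2 ^ i) := fun h => by linarith [h.1]
    rw [oscPiece_of_notMem h1, sub_zero, abs_of_nonneg h0, pow_succ']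
    split_ifs with h
    · rw [oscPiece_of_mem h, oscHilKer]
      congr 2; push_cast; ring
    · exact oscPiece_of_notMem h
  · have h1 : u ∉ Ioc ((2 : ℝ) ^ i) (2 * 2 ^ i) := fun h => by linarith [h.1]
    rw [oscPiece_of_notMem h1, zero_sub, abs_of_nonpos h0, pow_succ']
    split_ifs with h
    · rw [oscPiece_of_mem h, oscHilKer]
      have e : Complex.I * (((-1 : ℝ) ^ d : ℝ) : ℂ) * ((2 * Real.pi * (-u) ^ d : ℝ) : ℂ) =
          2 * (Real.pi : ℂ) * Complex.I * (u : ℂ) ^ d := by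
        have : ((-1 : ℂ)) ^ d * (-(u : ℂ)) ^ d = (u : ℂ) ^ d := by
          rw [← mul_pow]; congr 1; ring
        push_cast
        rw [← this]; ring
      rw [e]; push_cast; rw [div_neg, neg_neg]
    · rw [oscPiece_of_notMem h, neg_zero]

lemma sum_oscPiece_sub_eq (d : ℕ) {n N : ℕ} (h : n ≤ N) (u : ℝ) :
    ∑ i ∈ Finset.Ico n N, (oscPiece d 1 (2 ^ i) u - oscPiece d ((-1) ^ d) (2 ^ i) (-u)) =
      if (2 : ℝ) ^ n < |u| ∧ |u| ≤ 2 ^ N then oscHilKer d u else 0 := by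
  induction N, h using Nat.le_induction with
  | base => rw [Finset.Ico_self, Finset.sum_empty, if_neg]; rintro ⟨h1, h2⟩; linarith
  | succ N hN ih =>
    rw [Finset.sum_Ico_succ_top hN, ih, oscPiece_sub_eq]
    have h1 : (2 : ℝ) ^ n ≤ 2 ^ N := pow_le_pow_right₀ (by norm_num) hN
    have h2 : (2 : ℝ) ^ N ≤ 2 ^ (N + 1) := pow_le_pow_right₀ (by norm_num) (by omega)
    by_cases c1 : (2 : ℝ) ^ n < |u|
    · by_cases c2 : |u| ≤ 2 ^ N
      · rw [if_pos ⟨c1, c2⟩, if_neg (fun h => by linarith [h.1]), if_pos ⟨c1, c2.trans h2⟩,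
            add_zero]
      · rw [if_neg (fun h => c2 h.2), zero_add]
        push Not at c2
        by_cases c3 : |u| ≤ 2 ^ (N + 1)
        · rw [if_pos ⟨c2, c3⟩, if_pos ⟨c1, c3⟩]
        · rw [if_neg (fun h => c3 h.2), if_neg (fun h => c3 h.2)]
    · rw [if_neg (fun h => c1 h.1), if_neg (fun h => c1 (h1.trans_lt h.1)),
          if_neg (fun h => c1 h.1),
        add_zero]

lemma sum_invPiece {j : ℤ} (hj : j ≤ 0) (u : ℝ) :
    ∑ k ∈ Finset.Icc (j + 1) 0, invPiece k u = regInv j u - regInv 0 u := by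
  obtain ⟨n, rfl⟩ : ∃ n : ℕ, j = -(n : ℤ) := ⟨(-j).toNat, by omega⟩
  clear hj
  induction n with
  | zero => simp
  | succ n ih =>
    have e : Finset.Icc (-((n + 1 : ℕ) : ℤ) + 1) 0 =
        insert (-(n : ℤ)) (Finset.Icc (-(n : ℤ) + 1) 0) := by
      ext k
      rw [Finset.mem_insert, Finset.mem_Icc, Finset.mem_Icc]
      push_cast
      omega
    rw [e, Finset.sum_insert (by simp), ih, invPiece]
    have : -(n : ℤ) - 1 = -((n + 1 : ℕ) : ℤ) := by push_cast; ring
    rw [this]; ring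

/-- The combination of the pieces of the kernel between the scales `2 ^ j` and `2 ^ K` that
approximates the truncation of the kernel to `|u| > ε`, for `ε` comparable to `2 ^ j`. -/
noncomputable def pieceKer (d : ℕ) (j K : ℤ) (u : ℝ) : ℂ :=
  ∑ i ∈ Finset.Ico j.toNat K.toNat, (oscPiece d 1 (2 ^ i) u - oscPiece d ((-1) ^ d) (2 ^ i) (-u)) +
    ∑ k ∈ Finset.Icc (j + 1) 0, (invPiece k u : ℂ)

/-- The difference between the truncated kernel and its approximation has three parts: at the scale
of the truncation neither is larger than a multiple of `1 / ε`, on `|u| ≤ 1` the kernel differs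
from `1 / u` by a bounded amount, and beyond `2 ^ K` the approximation vanishes. Between `1` and
`2 ^ K` the oscillating pieces add up to the kernel exactly. -/
lemma norm_trunc_sub_pieceKer_le {d : ℕ} (hd : 1 ≤ d) {j K : ℤ} (hjK : j ≤ K) (hK : 0 ≤ K) {ε : ℝ}
    (h1 : (2 : ℝ) ^ (j - 1) ≤ ε) (h2 : ε < 2 ^ j) (u : ℝ) :
    ‖{u : ℝ | ε < |u|}.indicator (oscHilKer d) u - pieceKer d j K u‖ ≤
      {u : ℝ | |u| ≤ 2 ^ j}.indicator (fun _ => 4 * ((2 : ℝ) ^ j)⁻¹) u +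
      {u : ℝ | j ≤ 0 ∧ |u| ≤ 2 ^ (0 : ℤ)}.indicator (fun _ => (8 : ℝ)) u +
      {u : ℝ | (2 : ℝ) ^ K < |u|}.indicator (fun _ => ((2 : ℝ) ^ K)⁻¹) u := by
  have hpj := two_zpow_pos j
  have hpK := two_zpow_pos K
  have hjK' := two_zpow_mono hjK
  have hε0 : 0 < ε := (two_zpow_pos (j - 1)).trans_le h1
  have hKN : (2 : ℝ) ^ K.toNat = 2 ^ K := by
    rw [← zpow_natCast]; congr 1; omega
  have n1 : 0 ≤ {u : ℝ | |u| ≤ 2 ^ j}.indicator (fun _ => 4 * ((2 : ℝ) ^ j)⁻¹) u :=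
    indicator_nonneg (fun _ _ => by positivity) _
  have n2 : 0 ≤ {u : ℝ | j ≤ 0 ∧ |u| ≤ 2 ^ (0 : ℤ)}.indicator (fun _ => (8 : ℝ)) u :=
    indicator_nonneg (fun _ _ => by positivity) _
  have n3 : 0 ≤ {u : ℝ | (2 : ℝ) ^ K < |u|}.indicator (fun _ => ((2 : ℝ) ^ K)⁻¹) u :=
    indicator_nonneg (fun _ _ => by positivity) _
  -- The truncated kernel itself is at most `1 / ε`.
  have htr : ‖{u : ℝ | ε < |u|}.indicator (oscHilKer d) u‖ ≤ 2 * ((2 : ℝ) ^ j)⁻¹ := by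
    by_cases hu : ε < |u|
    · rw [indicator_of_mem (show u ∈ {u : ℝ | ε < |u|} from hu), norm_oscHilKer]
      calc |u|⁻¹ ≤ ((2 : ℝ) ^ (j - 1))⁻¹ := inv_anti₀ (two_zpow_pos _) (h1.trans hu.le)
        _ = _ := inv_two_zpow_sub_one j
    · rw [indicator_of_notMem (show u ∉ {u : ℝ | ε < |u|} from hu), norm_zero]; positivity
  have hmem : ε < |u| → {u : ℝ | ε < |u|}.indicator (oscHilKer d) u = oscHilKer d u := fun hu =>
    indicator_of_mem (show u ∈ {u : ℝ | ε < |u|} from hu) _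
  -- The contribution of the Hilbert pieces.
  have hhil : ∑ k ∈ Finset.Icc (j + 1) 0, (invPiece k u : ℂ) =
      if j ≤ 0 then ((regInv j u - regInv 0 u : ℝ) : ℂ) else 0 := by
    split_ifs with hj
    · rw [← sum_invPiece hj]; push_cast; rfl
    · rw [Finset.Icc_eq_empty (by omega), Finset.sum_empty]
  rw [pieceKer, sum_oscPiece_sub_eq d (by omega), hKN, hhil]
  have hr0 : |regInv 0 u| ≤ 1 := by simpa using abs_regInv_le 0 u
  set T := {u : ℝ | ε < |u|}.indicator (oscHilKer d) u with hT
  set b1 := {u : ℝ | |u| ≤ 2 ^ j}.indicator (fun _ => 4 * ((2 : ℝ) ^ j)⁻¹) u with hb1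
  set b2 := {u : ℝ | j ≤ 0 ∧ |u| ≤ 2 ^ (0 : ℤ)}.indicator (fun _ => (8 : ℝ)) u with hb2
  set b3 := {u : ℝ | (2 : ℝ) ^ K < |u|}.indicator (fun _ => ((2 : ℝ) ^ K)⁻¹) u with hb3
  have hE : |u| ≤ 2 ^ j → b1 = 4 * ((2 : ℝ) ^ j)⁻¹ := fun h =>
    indicator_of_mem (show u ∈ {u : ℝ | |u| ≤ 2 ^ j} from h) _
  have hE2 : j ≤ 0 → |u| ≤ 1 → b2 = 8 := fun h h' =>
    indicator_of_mem (show u ∈ {u : ℝ | j ≤ 0 ∧ |u| ≤ 2 ^ (0 : ℤ)} from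
      ⟨h, h'.trans_eq (zpow_zero 2).symm⟩) _
  have hE3 : (2 : ℝ) ^ K < |u| → b3 = ((2 : ℝ) ^ K)⁻¹ ∧ ‖oscHilKer d u‖ ≤ ((2 : ℝ) ^ K)⁻¹ := by
    intro h
    refine ⟨indicator_of_mem (show u ∈ {u : ℝ | (2 : ℝ) ^ K < |u|} from h) _, ?_⟩
    rw [norm_oscHilKer]
    exact inv_anti₀ hpK h.le
  by_cases hj : j ≤ 0
  · have hjn : (2 : ℝ) ^ j.toNat = 1 := by
      rw [show j.toNat = 0 by omega, pow_zero]
    have hj1 : (2 : ℝ) ^ j ≤ 1 := by simpa using two_zpow_mono hj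
    have hK1 : (1 : ℝ) ≤ 2 ^ K := by simpa using two_zpow_mono hK
    rw [if_pos hj, hjn]
    have hin : (1 : ℝ) ≤ ((2 : ℝ) ^ j)⁻¹ := (one_le_inv₀ hpj).2 hj1
    by_cases c1 : |u| ≤ 2 ^ j
    · rw [if_neg (fun h : 1 < |u| ∧ |u| ≤ 2 ^ K => by linarith [h.1]), zero_add]
      have hE' := hE c1
      have hrj := abs_regInv_le j u
      have h3 : ‖((regInv j u - regInv 0 u : ℝ) : ℂ)‖ ≤ ((2 : ℝ) ^ j)⁻¹ + 1 := by
        rw [Complex.norm_real, Real.norm_eq_abs]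
        exact (abs_sub _ _).trans (add_le_add hrj hr0)
      have := norm_sub_le T ((regInv j u - regInv 0 u : ℝ) : ℂ)
      linarith
    · push Not at c1
      have hTu : T = oscHilKer d u := hmem (h2.trans c1)
      rw [hTu, regInv_of_le c1.le]
      by_cases c2 : |u| ≤ 1
      · rw [if_neg (fun h : 1 < |u| ∧ |u| ≤ 2 ^ K => by linarith [h.1]), zero_add]
        have hE' := hE2 hj c2
        have e : oscHilKer d u - ((1 / u - regInv 0 u : ℝ) : ℂ) =
            (oscHilKer d u - ((1 / u : ℝ) : ℂ)) + (regInv 0 u : ℂ) := by push_cast; ring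
        have h3 := norm_oscHilKer_sub_le hd c2 (fun h => by rw [h, abs_zero] at c1; linarith)
        have h4 : ‖(regInv 0 u : ℂ)‖ ≤ 1 := by rwa [Complex.norm_real, Real.norm_eq_abs]
        have := norm_add_le (oscHilKer d u - ((1 / u : ℝ) : ℂ)) (regInv 0 u : ℂ)
        rw [e]
        linarith
      · push Not at c2
        rw [regInv_of_le (j := 0) (by simpa using c2.le), sub_self, Complex.ofReal_zero, add_zero]
        by_cases c3 : |u| ≤ 2 ^ K
        · rw [if_pos ⟨c2, c3⟩, sub_self, norm_zero]
          positivity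
        · rw [if_neg (fun h : 1 < |u| ∧ |u| ≤ 2 ^ K => c3 h.2), sub_zero]
          obtain ⟨h3, h4⟩ := hE3 (not_le.1 c3)
          linarith
  · have hjn : (2 : ℝ) ^ j.toNat = 2 ^ j := by
      rw [← zpow_natCast]; congr 1; omega
    rw [if_neg hj, add_zero, hjn]
    by_cases c1 : |u| ≤ 2 ^ j
    · rw [if_neg (fun h : (2 : ℝ) ^ j < |u| ∧ |u| ≤ 2 ^ K => by linarith [h.1]), sub_zero]
      have hE' := hE c1
      have : 0 ≤ ((2 : ℝ) ^ j)⁻¹ := by positivity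
      linarith
    · push Not at c1
      have hTu : T = oscHilKer d u := hmem (h2.trans c1)
      rw [hTu]
      by_cases c3 : |u| ≤ 2 ^ K
      · rw [if_pos ⟨c1, c3⟩, sub_self, norm_zero]
        positivity
      · rw [if_neg (fun h : (2 : ℝ) ^ j < |u| ∧ |u| ≤ 2 ^ K => c3 h.2), sub_zero]
        obtain ⟨h3, h4⟩ := hE3 (not_le.1 c3)
        linarith

/-! ### The maximal operator and the dyadic truncations -/

/-- The truncated integral defining the maximal operator, as a convolution with the truncated
kernel. -/
noncomputable def truncInt (d : ℕ) (f : ℝ → ℂ) (ε x : ℝ) : ℂ :=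
  ∫ y, {u : ℝ | ε < |u|}.indicator (oscHilKer d) (x - y) * f y

lemma measurableSet_lt_abs (ε : ℝ) : MeasurableSet {u : ℝ | ε < |u|} :=
  measurableSet_lt measurable_const measurable_id.abs

lemma maxOscHilbert_eq (d : ℕ) (f : ℝ → ℂ) (x : ℝ) :
    maxOscHilbert d f x = ⨆ (ε : ℝ) (_ : 0 < ε), ‖truncInt d f ε x‖ₑ := by
  rw [maxOscHilbert]
  refine iSup_congr fun ε => iSup_congr fun hε => ?_
  rw [← integral_indicator (measurableSet_lt_abs ε), ← integral_sub_left_eq_self _ _ x, truncInt]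
  congr 2; funext y
  by_cases h : ε < |x - y|
  · rw [indicator_of_mem (s := {u : ℝ | ε < |u|}) h, indicator_of_mem (s := {u : ℝ | ε < |u|}) h,
      sub_sub_cancel, mul_comm]
    rfl
  · rw [indicator_of_notMem (s := {u : ℝ | ε < |u|}) h,
      indicator_of_notMem (s := {u : ℝ | ε < |u|}) h, zero_mul]

lemma lintegral_mul_le_triAvg {k : ℤ} {x : ℝ} {c : ℝ≥0∞} {G F : ℝ → ℝ≥0∞}
    (h : ∀ y, G y ≤ c * (ENNReal.ofReal ((2 : ℝ) ^ k))⁻¹)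
    (h0 : ∀ y, y ∉ dyTriple k (dyIdx k x) → G y * F y = 0) (hc : c ≠ ∞) :
    ∫⁻ y, G y * F y ≤ c * triAvg k F x := by
  have hk := ofReal_two_zpow_ne_zero k
  calc ∫⁻ y, G y * F y = ∫⁻ y in dyTriple k (dyIdx k x), G y * F y := by
        rw [← lintegral_indicator (measurableSet_dyTriple _ _)]
        congr 1; funext y
        by_cases hy : y ∈ dyTriple k (dyIdx k x)
        · rw [indicator_of_mem hy]
        · rw [indicator_of_notMem hy, h0 y hy]
    _ ≤ ∫⁻ y in dyTriple k (dyIdx k x), c * (ENNReal.ofReal ((2 : ℝ) ^ k))⁻¹ * F y :=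
        lintegral_mono fun y => mul_le_mul_left (h y) _
    _ = c * triAvg k F x := by
        rw [lintegral_const_mul' _ _ (ENNReal.mul_ne_top hc (ENNReal.inv_ne_top.2 hk)), triAvg,
          mul_assoc]

lemma triAvg_le_truncSup (d : ℕ) (f : ℝ → ℂ) {k K : ℤ} (h : k ≤ K) (x : ℝ) :
    triAvg k (fun y => ‖f y‖ₑ) x ≤ truncSup d f K x := by
  refine le_trans ?_ (truncTerm_le_truncSup d f h x)
  rw [truncTerm, add_assoc, add_assoc]
  refine le_trans ?_ le_self_add
  exact le_iSup₂_of_le (f := fun k' (_ : k' ∈ Finset.Icc k K) => triAvg k' (fun y => ‖f y‖ₑ) x) k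
    (Finset.mem_Icc.2 ⟨le_rfl, h⟩) le_rfl

lemma integrable_pieceKer_mul_and_integral_eq (d : ℕ) (j K : ℤ) (x : ℝ)
    {f : ℝ → ℂ} (hf : TestFun f) :
    Integrable (fun y => pieceKer d j K (x - y) * f y) ∧
    ∫ y, pieceKer d j K (x - y) * f y =
      ∑ i ∈ Finset.Ico j.toNat K.toNat, oscOp d 1 1 i f x -
      ∑ i ∈ Finset.Ico j.toNat K.toNat, oscOp d (-1) ((-1) ^ d) i f x +
      ∑ k ∈ Finset.Icc (j + 1) 0, hilOp k f x := by
  have e : (fun y => pieceKer d j K (x - y) * f y) = fun y =>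
      (∑ i ∈ Finset.Ico j.toNat K.toNat, oscKer d 1 1 i x y * f y -
      ∑ i ∈ Finset.Ico j.toNat K.toNat, oscKer d (-1) ((-1) ^ d) i x y * f y) +
      ∑ k ∈ Finset.Icc (j + 1) 0, hilKer k x y * f y := by
    funext y
    rw [pieceKer, add_mul, Finset.sum_sub_distrib, sub_mul, Finset.sum_mul, Finset.sum_mul,
      Finset.sum_mul]
    simp only [oscKer, hilKer, one_mul, neg_one_mul]
  have h1 : ∀ i ∈ Finset.Ico j.toNat K.toNat, Integrable fun y => oscKer d 1 1 i x y * f y :=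
    fun i _ => (localKernel_oscKer (by simp) i).integrable_mul hf x
  have h2 : ∀ i ∈ Finset.Ico j.toNat K.toNat,
      Integrable fun y => oscKer d (-1) ((-1) ^ d) i x y * f y :=
    fun i _ => (localKernel_oscKer (by simp) i).integrable_mul hf x
  have h3 : ∀ k ∈ Finset.Icc (j + 1) 0, Integrable fun y => hilKer k x y * f y :=
    fun k _ => (localKernel_hilKer k).integrable_mul hf x
  have i1 := integrable_finsetSum _ h1
  have i2 := integrable_finsetSum _ h2
  have i3 := integrable_finsetSum _ h3
  rw [e]
  refine ⟨(i1.sub i2).add i3, ?_⟩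
  have e1 := integral_add (i1.sub i2) i3
  have e2 := integral_sub i1 i2
  rw [integral_finsetSum _ h1, integral_finsetSum _ h2] at e2
  rw [integral_finsetSum _ h3] at e1
  simp only [Pi.sub_apply] at e1
  rw [e1, e2]
  rfl

lemma enorm_integral_pieceKer_le (d : ℕ) {j K : ℤ} (hjK : j ≤ K) (hK : 0 ≤ K) (x : ℝ) {f : ℝ → ℂ}
    (hf : TestFun f) : ‖∫ y, pieceKer d j K (x - y) * f y‖ₑ ≤ truncSup d f K x := by
  rw [(integrable_pieceKer_mul_and_integral_eq d j K x hf).2]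
  rcases hjK.lt_or_eq with h | rfl
  · refine le_trans ?_ (truncTerm_le_truncSup d f (show j + 1 ≤ K by omega) x)
    rw [truncTerm, min_eq_right hK, add_sub_cancel_right]
    refine (enorm_add_le _ _).trans ?_
    refine (add_le_add (enorm_sub_le) le_rfl).trans ?_
    generalize (⨆ k ∈ Finset.Icc (j + 1) K, triAvg k (fun y => ‖f y‖ₑ) x) = t
    rw [add_comm, ← add_assoc]
    gcongr
    exact le_add_self
  · rw [Finset.Ico_self, Finset.Icc_eq_empty (by omega)]
    simp

lemma measurable_truncKer (d : ℕ) (ε : ℝ) :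
    Measurable ({u : ℝ | ε < |u|}.indicator (oscHilKer d)) :=
  (measurable_oscHilKer d).indicator (measurableSet_lt_abs ε)

lemma norm_truncKer_le (d : ℕ) {ε : ℝ} (hε : 0 < ε) (u : ℝ) :
    ‖{u : ℝ | ε < |u|}.indicator (oscHilKer d) u‖ ≤ ε⁻¹ := by
  by_cases hu : ε < |u|
  · rw [indicator_of_mem (s := {u : ℝ | ε < |u|}) hu, norm_oscHilKer]
    exact inv_anti₀ hε hu.le
  · rw [indicator_of_notMem (s := {u : ℝ | ε < |u|}) hu, norm_zero]; positivity

lemma integrable_truncKer_mul (d : ℕ) {ε : ℝ} (hε : 0 < ε) {f : ℝ → ℂ} (hf : TestFun f) (x : ℝ) :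
    Integrable fun y => {u : ℝ | ε < |u|}.indicator (oscHilKer d) (x - y) * f y :=
  (hf.mul_bdd ((measurable_truncKer d ε).comp (measurable_const.sub measurable_id))
    fun y => norm_truncKer_le d hε (x - y)).integrable

/-- The truncated integrals at a point are controlled by the truncations to dyadic scales up to
`2 ^ K`, provided that `f` lives near the dyadic interval of that scale containing the point. -/
lemma enorm_truncInt_le {d : ℕ} (hd : 1 ≤ d) {f : ℝ → ℂ} (hf : TestFun f) {K : ℤ} (hK : 0 ≤ K)
    {x : ℝ} (hfx : ∀ y, y ∉ dyTriple K (dyIdx K x) → f y = 0) {ε : ℝ} (hε : 0 < ε) :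
    ‖truncInt d f ε x‖ₑ ≤ 14 * truncSup d f K x := by
  obtain ⟨n, hn1, hn2⟩ := exists_mem_Ico_zpow hε (one_lt_two)
  obtain ⟨j, rfl⟩ : ∃ j, n = j - 1 := ⟨n + 1, by ring⟩
  rw [sub_add_cancel] at hn2
  set F : ℝ → ℝ≥0∞ := fun y => ‖f y‖ₑ with hF
  have hFx : ∀ (G : ℝ → ℝ≥0∞) y, y ∉ dyTriple K (dyIdx K x) → G y * F y = 0 := by
    intro G y hy
    simp only [hF, hfx y hy, enorm_zero, mul_zero]
  have hofinv : ∀ k : ℤ, ENNReal.ofReal ((2 : ℝ) ^ k)⁻¹ = (ENNReal.ofReal ((2 : ℝ) ^ k))⁻¹ :=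
    fun k => ENNReal.ofReal_inv_of_pos (two_zpow_pos k)
  rcases lt_or_ge K j with hjK | hjK
  · calc ‖truncInt d f ε x‖ₑ
        ≤ ∫⁻ y, ‖{u : ℝ | ε < |u|}.indicator (oscHilKer d) (x - y)‖ₑ * F y := by
          refine (enorm_integral_le_lintegral_enorm _).trans (lintegral_mono fun y => ?_)
          rw [enorm_mul]
      _ ≤ 1 * triAvg K F x := by
          refine lintegral_mul_le_triAvg (fun y => ?_) (hFx _) ENNReal.one_ne_top
          rw [one_mul, ← hofinv]
          refine enorm_le_ofReal ((norm_truncKer_le d hε _).trans ?_)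
          exact inv_anti₀ (two_zpow_pos K) ((two_zpow_mono (by omega)).trans hn1)
      _ ≤ 14 * truncSup d f K x := by
          refine mul_le_mul' (by norm_num) (triAvg_le_truncSup d f le_rfl x)
  · set T : ℝ → ℂ := fun y => {u : ℝ | ε < |u|}.indicator (oscHilKer d) (x - y) with hT
    set B : ℝ → ℂ := fun y => pieceKer d j K (x - y) with hB
    obtain ⟨iB, -⟩ := integrable_pieceKer_mul_and_integral_eq d j K x hf
    have iT := integrable_truncKer_mul d hε hf x
    set G1 : ℝ → ℝ≥0∞ := {y : ℝ | |x - y| ≤ 2 ^ j}.indicator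
      (fun _ => 4 * (ENNReal.ofReal ((2 : ℝ) ^ j))⁻¹) with hG1
    set G2 : ℝ → ℝ≥0∞ := {y : ℝ | j ≤ 0 ∧ |x - y| ≤ 2 ^ (0 : ℤ)}.indicator
      (fun _ => 8 * (ENNReal.ofReal ((2 : ℝ) ^ (0 : ℤ)))⁻¹) with hG2
    set G3 : ℝ → ℝ≥0∞ := fun _ => 1 * (ENNReal.ofReal ((2 : ℝ) ^ K))⁻¹ with hG3
    have habs : Measurable fun y : ℝ => |x - y| := (measurable_const.sub measurable_id).abs
    have mG1 : Measurable G1 :=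
      measurable_const.indicator (measurableSet_le habs measurable_const)
    have mG2 : Measurable G2 := by
      refine measurable_const.indicator ?_
      exact (MeasurableSet.const (j ≤ 0)).inter (measurableSet_le habs measurable_const)
    have hTB : ∀ y, ‖T y - B y‖ₑ ≤ G1 y + G2 y + G3 y := by
      intro y
      refine (enorm_le_ofReal (norm_trunc_sub_pieceKer_le hd hjK hK hn1 hn2 (x - y))).trans ?_
      refine (ENNReal.ofReal_add_le).trans (add_le_add ((ENNReal.ofReal_add_le).trans
        (add_le_add ?_ ?_)) ?_)
      · by_cases h : |x - y| ≤ 2 ^ j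
        · rw [indicator_of_mem (s := {u : ℝ | |u| ≤ 2 ^ j}) h, hG1,
            indicator_of_mem (s := {y : ℝ | |x - y| ≤ 2 ^ j}) h, ENNReal.ofReal_mul (by norm_num),
            hofinv]
          simp
        · rw [indicator_of_notMem (s := {u : ℝ | |u| ≤ 2 ^ j}) h]; simp
      · by_cases h : j ≤ 0 ∧ |x - y| ≤ 2 ^ (0 : ℤ)
        · rw [indicator_of_mem (s := {u : ℝ | j ≤ 0 ∧ |u| ≤ 2 ^ (0 : ℤ)}) h, hG2,
            indicator_of_mem (s := {y : ℝ | j ≤ 0 ∧ |x - y| ≤ 2 ^ (0 : ℤ)}) h]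
          simp
        · rw [indicator_of_notMem (s := {u : ℝ | j ≤ 0 ∧ |u| ≤ 2 ^ (0 : ℤ)}) h]; simp
      · rw [hG3, one_mul, ← hofinv]
        refine ENNReal.ofReal_le_ofReal ?_
        exact indicator_le_self' (fun _ _ => (inv_pos.2 (two_zpow_pos K)).le) _
    have b1 : ∫⁻ y, G1 y * F y ≤ 4 * triAvg j F x := by
      refine lintegral_mul_le_triAvg (fun y => indicator_le_self' (fun _ _ => zero_le) _)
        (fun y hy => ?_) (by norm_num)
      rw [hG1, indicator_of_notMem (s := {y : ℝ | |x - y| ≤ 2 ^ j})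
        (fun h => hy (mem_dyTriple_of_abs_le h)), zero_mul]
    have b2 : ∫⁻ y, G2 y * F y ≤ 8 * triAvg 0 F x := by
      refine lintegral_mul_le_triAvg (fun y => indicator_le_self' (fun _ _ => zero_le) _)
        (fun y hy => ?_) (by norm_num)
      rw [hG2, indicator_of_notMem (s := {y : ℝ | j ≤ 0 ∧ |x - y| ≤ 2 ^ (0 : ℤ)})
        (fun h => hy (mem_dyTriple_of_abs_le h.2)), zero_mul]
    have b3 : ∫⁻ y, G3 y * F y ≤ 1 * triAvg K F x :=
      lintegral_mul_le_triAvg (fun y => le_rfl) (hFx _) ENNReal.one_ne_top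
    have hFm : Measurable F := hf.enorm_meas
    have hsplit : truncInt d f ε x = (∫ y, B y * f y) + ∫ y, (T y - B y) * f y := by
      have := integral_sub iT iB
      simp only [← sub_mul] at this
      rw [this, truncInt]
      ring
    calc ‖truncInt d f ε x‖ₑ ≤ ‖∫ y, B y * f y‖ₑ + ‖∫ y, (T y - B y) * f y‖ₑ := by
          rw [hsplit]; exact enorm_add_le _ _
      _ ≤ truncSup d f K x + ∫⁻ y, (G1 y * F y + G2 y * F y + G3 y * F y) := by
          refine add_le_add (enorm_integral_pieceKer_le d hjK hK x hf)
            ((enorm_integral_le_lintegral_enorm _).trans (lintegral_mono fun y => ?_))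
          rw [enorm_mul, ← add_mul, ← add_mul]
          exact mul_le_mul_left (hTB y) _
      _ = truncSup d f K x + ((∫⁻ y, G1 y * F y) + (∫⁻ y, G2 y * F y) + ∫⁻ y, G3 y * F y) := by
          rw [lintegral_add_left ((mG1.fun_mul hFm).fun_add (mG2.fun_mul hFm)),
            lintegral_add_left (mG1.fun_mul hFm)]
      _ ≤ truncSup d f K x + (4 * truncSup d f K x + 8 * truncSup d f K x +
            1 * truncSup d f K x) := by
          gcongr
          · exact b1.trans (mul_le_mul_right (triAvg_le_truncSup d f hjK x) _)
          · exact b2.trans (mul_le_mul_right (triAvg_le_truncSup d f hK x) _)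
          · exact b3.trans (mul_le_mul_right (triAvg_le_truncSup d f le_rfl x) _)
      _ = 14 * truncSup d f K x := by ring

/-! ### Reduction to everywhere bounded functions, and measurability -/

lemma BddCompactlySupported.exists_testFun {f : ℝ → ℂ} (hf : BddCompactlySupported f) :
    ∃ f', TestFun f' ∧ f =ᵐ[volume] f' := by
  obtain ⟨hm, hc⟩ := hf
  obtain ⟨R, hR⟩ := hc.isCompact.isBounded.subset_closedBall 0
  have hb : ∀ᵐ x, ‖f x‖ₑ ≤ eLpNorm f ∞ volume := by
    rw [eLpNorm_exponent_top]; exact ae_le_eLpNormEssSup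
  have hfin : eLpNorm f ∞ volume ≠ ∞ := hm.2.ne
  set h := hm.1.mk f with hh
  have hhm : Measurable h := hm.1.stronglyMeasurable_mk.measurable
  set S : Set ℝ := {x | |x| ≤ R} ∩ {x | ‖h x‖ ≤ (eLpNorm f ∞ volume).toReal} with hS
  have hSm : MeasurableSet S := (measurableSet_le measurable_id.abs measurable_const).inter
    (measurableSet_le hhm.norm measurable_const)
  refine ⟨S.indicator h, ⟨hhm.indicator hSm, ⟨(eLpNorm f ∞ volume).toReal, fun x => ?_⟩, ⟨R, ?_⟩⟩,
      ?_⟩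
  · by_cases hx : x ∈ S
    · rw [indicator_of_mem hx]; exact hx.2
    · rw [indicator_of_notMem hx, norm_zero]; exact ENNReal.toReal_nonneg
  · intro x hx
    exact indicator_of_notMem (fun h' : x ∈ S => hx.not_ge h'.1) _
  · filter_upwards [hb, hm.1.ae_eq_mk] with x h1 h2
    by_cases hx : x ∈ S
    · rw [indicator_of_mem hx, h2]
    · rw [indicator_of_notMem hx]
      by_contra h0
      refine hx ⟨?_, ?_⟩
      · have := hR (subset_tsupport f (show x ∈ Function.support f from h0))
        rwa [mem_closedBall_zero_iff, Real.norm_eq_abs] at this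
      · change ‖h x‖ ≤ _
        rw [hh, ← h2, ← toReal_enorm]
        exact ENNReal.toReal_mono hfin h1

lemma avg_congr_ae {f f' : ℝ → ℂ} (h : f =ᵐ[volume] f') (I : Set ℝ) (r : ℝ) :
    avg f I r = avg f' I r := by
  rw [avg, avg]
  congr 2
  refine lintegral_congr_ae (ae_restrict_of_ae ?_)
  filter_upwards [h] with x hx
  rw [hx]

lemma sparseForm_congr_ae {f f' g g' : ℝ → ℂ} (hf : f =ᵐ[volume] f') (hg : g =ᵐ[volume] g')
    (S : Set (Set ℝ)) (r s : ℝ) : sparseForm S r s f g = sparseForm S r s f' g' := by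
  simp only [sparseForm, avg_congr_ae hf, avg_congr_ae hg]

lemma maxOscHilbert_congr_ae (d : ℕ) {f f' : ℝ → ℂ} (h : f =ᵐ[volume] f') (x : ℝ) :
    maxOscHilbert d f x = maxOscHilbert d f' x := by
  rw [maxOscHilbert_eq, maxOscHilbert_eq]
  refine iSup_congr fun ε => iSup_congr fun _ => ?_
  rw [truncInt, truncInt]
  congr 1
  refine integral_congr_ae ?_
  filter_upwards [h] with y hy
  rw [hy]

lemma measurable_truncInt (d : ℕ) {f : ℝ → ℂ} (hf : TestFun f) (ε : ℝ) :
    Measurable (truncInt d f ε) := by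
  have : Measurable fun p : ℝ × ℝ => {u : ℝ | ε < |u|}.indicator (oscHilKer d) (p.1 - p.2) * f p.2 :=
    ((measurable_truncKer d ε).comp (measurable_fst.sub measurable_snd)).mul
      (hf.meas.comp measurable_snd)
  exact (this.stronglyMeasurable.integral_prod_right (ν := volume)).measurable

/-- By right continuity in the truncation parameter, rational truncations suffice. -/
lemma maxOscHilbert_eq_iSup_rat (d : ℕ) {f : ℝ → ℂ} (hf : TestFun f) (x : ℝ) :
    maxOscHilbert d f x = ⨆ (q : ℚ) (_ : 0 < q), ‖truncInt d f q x‖ₑ := by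
  rw [maxOscHilbert_eq]
  refine le_antisymm (iSup₂_le fun ε hε => ?_)
    (iSup₂_le fun q hq => le_iSup₂_of_le (q : ℝ) (by exact_mod_cast hq) le_rfl)
  obtain ⟨q, -, hq, hlim⟩ := Rat.isDenseEmbedding_coe_real.dense.exists_seq_strictAnti_tendsto
    Rat.cast_mono ε
  have hT : Filter.Tendsto (fun n => truncInt d f (q n) x) Filter.atTop
      (nhds (truncInt d f ε x)) := by
    refine tendsto_integral_of_dominated_convergence (fun y => ε⁻¹ * ‖f y‖) (fun n => ?_)
      (hf.integrable.norm.const_mul _) (fun n => ?_) ?_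
    · exact (integrable_truncKer_mul d (hε.trans (hq n)) hf x).aestronglyMeasurable
    · refine Filter.Eventually.of_forall fun y => ?_
      rw [norm_mul]
      gcongr
      exact (norm_truncKer_le d (hε.trans (hq n)) _).trans (inv_anti₀ hε (hq n).le)
    · refine Filter.Eventually.of_forall fun y => ?_
      refine Filter.Tendsto.mul_const _ ?_
      by_cases h : ε < |x - y|
      · refine tendsto_const_nhds.congr' ?_
        filter_upwards [hlim.eventually (eventually_lt_nhds h)] with n hn
        rw [indicator_of_mem (s := {u : ℝ | ε < |u|}) h,
          indicator_of_mem (s := {u : ℝ | (q n : ℝ) < |u|}) hn]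
      · refine tendsto_const_nhds.congr fun n => ?_
        rw [indicator_of_notMem (s := {u : ℝ | ε < |u|}) h,
          indicator_of_notMem (s := {u : ℝ | (q n : ℝ) < |u|}) fun h' => h ((hq n).trans h')]
  refine le_of_tendsto' hT.enorm fun n => ?_
  exact le_iSup₂_of_le (f := fun (p : ℚ) (_ : 0 < p) => ‖truncInt d f p x‖ₑ) (q n)
    (by exact_mod_cast hε.trans (hq n)) le_rfl

lemma measurable_maxOscHilbert (d : ℕ) {f : ℝ → ℂ} (hf : TestFun f) :
    Measurable (maxOscHilbert d f) := by
  rw [funext (maxOscHilbert_eq_iSup_rat d hf)]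
  exact Measurable.iSup fun q => Measurable.iSup fun _ => (measurable_truncInt d hf q).enorm

/-! ### The sparse bound -/

/-- Two adjacent dyadic intervals of a large scale cover the supports of both functions, and on each
of them the maximal operator is controlled by the dyadic truncations. -/
lemma lintegral_maxOscHilbert_mul_le {d : ℕ} (hd : 2 ≤ d) {f g : ℝ → ℂ} (hf : TestFun f)
    (hg : TestFun g) : ∃ K : ℤ, ∫⁻ x, maxOscHilbert d f x * ‖g x‖ₑ ≤
      14 * ((∫⁻ x in dyIv K 0, truncSup d f K x * ‖g x‖ₑ) +
        ∫⁻ x in dyIv K (-1), truncSup d f K x * ‖g x‖ₑ) := by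
  obtain ⟨R, hR⟩ := hf.supp
  obtain ⟨R', hR'⟩ := hg.supp
  obtain ⟨n, hn⟩ := pow_unbounded_of_one_lt (max R R') (one_lt_two (α := ℝ))
  have hidx : ∀ x : ℝ, |x| ≤ max R R' → dyIdx n x = 0 ∨ dyIdx n x = -1 := by
    intro x hx
    have hx' : |x| < (2 : ℝ) ^ (n : ℤ) := by rw [zpow_natCast]; exact hx.trans_lt hn
    rw [abs_lt] at hx'
    rcases le_or_gt 0 x with h | h
    · left; rw [dyIdx_eq_iff]; push_cast; constructor <;> linarith
    · right; rw [dyIdx_eq_iff]; push_cast; constructor <;> linarith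
  have hfz : ∀ y : ℝ, dyIdx n y ≠ 0 → dyIdx n y ≠ -1 → f y = 0 := fun y h1 h2 =>
    hR y ((le_max_left _ _).trans_lt (not_le.1 fun h => (hidx y h).elim h1 h2))
  have hgz : ∀ y : ℝ, dyIdx n y ≠ 0 → dyIdx n y ≠ -1 → g y = 0 := fun y h1 h2 =>
    hR' y ((le_max_right _ _).trans_lt (not_le.1 fun h => (hidx y h).elim h1 h2))
  have hpt : ∀ x : ℝ, maxOscHilbert d f x * ‖g x‖ₑ ≤
      14 * (truncSup d f n x * ‖g x‖ₑ) := by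
    intro x
    by_cases hx : dyIdx n x = 0 ∨ dyIdx n x = -1
    · rw [← mul_assoc]
      refine mul_le_mul_left ?_ _
      rw [maxOscHilbert_eq]
      refine iSup₂_le fun ε hε => enorm_truncInt_le (by omega) hf (by omega) (fun y hy => ?_) hε
      rw [mem_dyTriple_iff] at hy
      exact hfz y (by omega) (by omega)
    · push Not at hx
      rw [hgz x hx.1 hx.2]; simp
  refine ⟨n, ?_⟩
  calc ∫⁻ x, maxOscHilbert d f x * ‖g x‖ₑ
      ≤ ∫⁻ x, 14 * (truncSup d f n x * ‖g x‖ₑ) := lintegral_mono hpt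
    _ = 14 * ∫⁻ x, truncSup d f n x * ‖g x‖ₑ :=
        lintegral_const_mul' _ _ (by norm_num)
    _ = 14 * ∫⁻ x in dyIv n 0 ∪ dyIv n (-1), truncSup d f n x * ‖g x‖ₑ := by
        rw [← lintegral_indicator ((measurableSet_dyIv _ _).union (measurableSet_dyIv _ _))]
        congr 2; funext x
        by_cases hx : x ∈ dyIv n 0 ∪ dyIv n (-1)
        · rw [indicator_of_mem hx]
        · rw [indicator_of_notMem hx]
          rw [mem_union, mem_dyIv, mem_dyIv] at hx
          push Not at hx
          rw [hgz x hx.1 hx.2]; simp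
    _ ≤ _ := mul_le_mul_right (lintegral_union_le _ _ _) _

lemma enorm_ofReal_toReal_le (t : ℝ≥0∞) : ‖(t.toReal : ℂ)‖ₑ ≤ t := by
  rw [← ofReal_norm, Complex.norm_real, Real.norm_of_nonneg ENNReal.toReal_nonneg]
  exact ENNReal.ofReal_toReal_le

theorem sparseBoundWith_maxOscHilbert {d : ℕ} (hd : 2 ≤ d) {r : ℝ} (hr : 1 ≤ r) (hr2 : r ≤ 2)
    (hC : locConst r ≠ ∞) {C : ℝ≥0} (hCC : 28 * locConst r ≤ C) :
    SparseBoundWith (maxOscHilbert d) 1 r C := by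
  intro f₀ g₀ hf₀ hg₀
  obtain ⟨f, hf, hff⟩ := hf₀.exists_testFun
  obtain ⟨g, hg, hgg⟩ := hg₀.exists_testFun
  have hH : maxOscHilbert d f₀ = maxOscHilbert d f := funext (maxOscHilbert_congr_ae d hff)
  have hHm := measurable_maxOscHilbert d hf
  have hfin : ∀ h : ℝ → ℂ, TestFun h → ∫⁻ x, maxOscHilbert d f x * ‖h x‖ₑ < ∞ := by
    intro h hh
    obtain ⟨K, hK⟩ := lintegral_maxOscHilbert_mul_le hd hf hh
    refine hK.trans_lt (ENNReal.mul_lt_top (by norm_num) (ENNReal.add_lt_top.2 ⟨?_, ?_⟩))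
    · exact lintegral_truncSup_lt_top hd hf hh hr hr2 hC K 0
    · exact lintegral_truncSup_lt_top hd hf hh hr hr2 hC K (-1)
  have hle : ∀ x, ‖((maxOscHilbert d f x).toReal : ℂ) * conj (g x)‖ₑ ≤
      maxOscHilbert d f x * ‖g x‖ₑ := by
    intro x
    rw [enorm_mul]
    refine mul_le_mul' (enorm_ofReal_toReal_le _) ?_
    rw [← ofReal_norm, RCLike.norm_conj, ofReal_norm]
  have hae : (fun x => ((maxOscHilbert d f₀ x).toReal : ℂ) * conj (g₀ x)) =ᵐ[volume]
      fun x => ((maxOscHilbert d f x).toReal : ℂ) * conj (g x) := by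
    filter_upwards [hgg] with x hx
    rw [hH, hx]
  refine ⟨?_, ?_, ?_⟩
  · rw [hH]
    have hN : ∀ N : ℕ, ∀ᵐ x : ℝ, |x| ≤ N → maxOscHilbert d f x < ∞ := by
      intro N
      have hS : MeasurableSet {x : ℝ | |x| ≤ N} :=
        measurableSet_le measurable_id.abs measurable_const
      set h : ℝ → ℂ := {x : ℝ | |x| ≤ N}.indicator fun _ => 1 with hh
      have hT : TestFun h := by
        refine ⟨measurable_const.indicator hS, ⟨1, fun x => ?_⟩, ⟨N, fun x hx => ?_⟩⟩
        · exact (norm_indicator_le_norm_self _ _).trans (by simp)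
        · exact indicator_of_notMem (s := {x : ℝ | |x| ≤ N}) hx.not_ge _
      have := ae_lt_top (hHm.fun_mul hT.enorm_meas) (hfin h hT).ne
      filter_upwards [this] with x hx hxN
      simpa [hh, indicator_of_mem (s := {x : ℝ | |x| ≤ N}) hxN] using hx
    filter_upwards [ae_all_iff.2 hN] with x hx
    obtain ⟨N, hN⟩ := exists_nat_ge |x|
    exact hx N hN
  · refine (integrable_congr hae).2 ⟨?_, ?_⟩
    · exact ((Complex.measurable_ofReal.comp hHm.ennreal_toReal).mul
        (Complex.continuous_conj.measurable.comp hg.meas)).aestronglyMeasurable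
    · exact (lintegral_mono hle).trans_lt (hfin g hg)
  · rw [integral_congr_ae hae]
    obtain ⟨K, hK⟩ := lintegral_maxOscHilbert_mul_le hd hf hg
    have hb := fun i => lintegral_truncSup_le_sparse hd hf hg hr hr2 K i
    simp only [sparseForm_congr_ae hff hgg]
    calc _ ≤ ∫⁻ x, maxOscHilbert d f x * ‖g x‖ₑ :=
          (enorm_integral_le_lintegral_enorm _).trans (lintegral_mono hle)
      _ ≤ _ := hK
      _ ≤ 14 * ((locConst r * ⨆ (S : Set (Set ℝ)) (_ : IsSparse S), sparseForm S 1 r f g) +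
          locConst r * ⨆ (S : Set (Set ℝ)) (_ : IsSparse S), sparseForm S 1 r f g) := by
          gcongr
          · exact hb 0
          · exact hb (-1)
      _ = 28 * locConst r * ⨆ (S : Set (Set ℝ)) (_ : IsSparse S), sparseForm S 1 r f g := by ring
      _ ≤ _ := mul_le_mul_left hCC _

/-- The part of the constant that does not depend on the exponent. -/
noncomputable def sparseConst : ℝ≥0∞ :=
  28 * (2 * locHilConst + 2 * ((oscConst * (2 * 1728) + 1 + 6 * 1728) * 64))

lemma sparseConst_ne_top : sparseConst ≠ ∞ := by
  have h1 := hilWeakConst_ne_top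
  have h2 := oscConst_ne_top
  rw [sparseConst, locHilConst]
  finiteness

lemma locConst_le {r : ℝ} (hr : 1 < r) (hr2 : r ≤ 2) :
    28 * locConst r ≤ sparseConst * ENNReal.ofReal (1 / (r - 1)) := by
  have h1 : 1 ≤ ENNReal.ofReal (1 / (r - 1)) := by
    rw [ENNReal.one_le_ofReal, le_div_iff₀ (by linarith)]; linarith
  have h2 := inv_one_sub_decayRate_rpow_le hr hr2
  have h3 : ENNReal.ofReal (64 / (r - 1)) = 64 * ENNReal.ofReal (1 / (r - 1)) := by
    rw [← ENNReal.ofReal_ofNat 64, ← ENNReal.ofReal_mul (by norm_num)]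
    congr 1; ring
  rw [h3] at h2
  rw [locConst, oscSumConst, sparseConst]
  generalize oscConst * (2 * 1728) + 1 + 6 * 1728 = M
  calc 28 * (2 * locHilConst + 2 * (M * (1 - decayRate ^ ((r - 1) / 2))⁻¹))
      ≤ 28 * (2 * (locHilConst * ENNReal.ofReal (1 / (r - 1))) +
          2 * (M * (64 * ENNReal.ofReal (1 / (r - 1))))) := by
        gcongr
        exact le_mul_of_one_le_right' h1
    _ = _ := by ring

theorem theorem1p4 :
    ∃ C : ℝ, 0 < C ∧ ∀ d : ℕ, 2 ≤ d → ∀ r : ℝ, 1 < r → r ≤ 2 →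
      sparseNorm (maxOscHilbert d) 1 r ≤ ENNReal.ofReal (C / (r - 1)) := by
  have hM := sparseConst_ne_top
  refine ⟨sparseConst.toReal + 1, by positivity, fun d hd r hr hr2 => ?_⟩
  set C : ℝ≥0 := ((sparseConst.toReal + 1) / (r - 1)).toNNReal with hC
  have hr0 : 0 < r - 1 := by linarith
  have hle : 28 * locConst r ≤ C := by
    refine (locConst_le hr hr2).trans ?_
    calc sparseConst * ENNReal.ofReal (1 / (r - 1))
        = ENNReal.ofReal (sparseConst.toReal * (1 / (r - 1))) := by
          rw [ENNReal.ofReal_mul ENNReal.toReal_nonneg, ENNReal.ofReal_toReal hM]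
      _ ≤ ENNReal.ofReal ((sparseConst.toReal + 1) / (r - 1)) := by
          refine ENNReal.ofReal_le_ofReal ?_
          rw [mul_one_div]
          gcongr
          linarith
  have hfin : locConst r ≠ ∞ := by
    intro h
    rw [h, ENNReal.mul_top (by norm_num)] at hle
    exact absurd (top_le_iff.1 hle) ENNReal.coe_ne_top
  exact iInf₂_le_of_le C (sparseBoundWith_maxOscHilbert hd hr.le hr2 hfin hle) le_rfl
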